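/- **Proposition 4.4.** *Model.* Let $\alpha>0$ and let $(\psi_{kl})_{k,l\in\mathbb Z}$ be non-negative numbers with $\max_{k,l}\psi_{kl}=1$ and $\sum_{k,l}\psi_{kl}<\infty$. Let $(\eta_{it})_{i,t\in\mathbb Z}$ be an iid field of real random variables with generic element $\eta$ such that $\mathbb P(e^{\eta}>x)=x^{-\alpha}L(x)$, $x>0$, for a slowly varying function $L$, and such that $\sum_{k,l}\psi_{kl}|\eta_{i-k,t-l}|<\infty$ a.s. for all $i,t$. Put $$\sigma_{it}=\exp\Big(\sum_{k,l\in\mathbb Z}\psi_{kl}\,\eta_{i-k,t-l}\Big),\qquad X_{it}=\sigma_{it}Z_{it},\qquad i,t\in\mathbb Z,$$ where $(Z_{it})$ is an iid field, independent of $(\sigma_{it})$, whose generic element $Z$ satisfies $\mathbb P(Z\ne0)>0$ and $\mathbb E|Z|^{\alpha+\delta}<\infty$ for some $\delta>0$. Assume that at least one of the following holds: * (A) $\mathbb E[e^{\alpha\eta}]=\infty$; * (B) (convolution equivalence) $\lim_{x\to\infty}\mathbb P(\eta_1+\eta_2>x)/\mathbb P(\eta_1>x)=c$ for some $c\in(0,\infty)$,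 where $\eta_1,\eta_2$ are independent copies of $\eta$. *Definitions.* A sequence $(\mathbf Y_t)_{t\in\mathbb Z}$ in $\mathbb R^d$ is regularly varying with index $\gamma>0$ if it is strictly stationary and for each $h\ge0$ there is a non-null Radon measure $\mu_h$ on $[-\infty,\infty]^{d(h+1)}\setminus\{\mathbf 0\}$, homogeneous of order $-\gamma$, such that $\mathbb P(x^{-1}(\mathbf Y_0,\dots,\mathbf Y_h)\in\cdot)/\mathbb P(\|\mathbf Y_0\|>x)\to\mu_h$ vaguely as $x\to\infty$. The spectral tail process of a real sequence $(Y_t)$ that is regularly varying with index $\gamma$ is the (in law unique) process $(\Theta_t)_{t\ge0}$ such that, for $R$ independent of it with $\mathbb P(R>y)=y^{-\gamma}$, $y\geq 1$, and every $k\ge0$, the conditional law of $x^{-1}(Y_0,\dots,Y_k)$ given $|Y_0|>x$ converges weakly to the law of $R(\Theta_0,\dots,\Theta_k)$ as $x\to\infty$. For $i,j,t\in\mathbb Z$ and $\mathbf i,\mathbf j\in\mathbb Z^d$ put $$\psi^{ij}=\max_{k,l}(\psi_{kl}+\psi_{k+i-j,l}),\qquad \psi^{\mathbf i,\mathbf j}=\max_{1\le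 l\le d}\psi^{i_l,j_l},$$ $$\Lambda_i^{(t)}=\{(u,v)\in\mathbb Z^2:\psi_{i-u,t-v}=1\},\qquad \Lambda_{i,j}^{(t)}=\{(u,v)\in\mathbb Z^2:\psi_{i-u,t-v}+\psi_{j-u,t-v}=\psi^{ij}\},$$ and $x_\pm=\max(\pm x,0)$. *Claims.* 1. For each $i\in\mathbb Z$, $(X_{it})_{t\in\mathbb Z}$ is regularly varying with index $\alpha$ and has a spectral tail process $(\Theta^i_t)_{t\ge0}$. If (A) holds, then $\Theta^i_t=0$ a.s. for $t\ge1$ and $\mathbb P(\Theta^i_0=\pm1)=\mathbb E[Z_\pm^\alpha]/\mathbb E[|Z|^\alpha]$. If (B) holds, then for all $n\ge 0$ and Borel sets $B=B_0\times\cdots\times B_n\subset\mathbb R^{n+1}$, $$\mathbb P\big((\Theta^i_t)_{0\le t\le n}\in B\big)=\sum_{(u,v)\in\Lambda_i^{(0)}}\frac1{|\Lambda_i^{(0)}|}\,\frac{\mathbb E\Big[\mathbf 1\Big(\big(\mathbf 1((u,v)\in\Lambda_i^{(t)})\tfrac{X_{it}}{|X_{i0}|}\big)_{0\le t\le n}\in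 B\Big)|X_{i0}|^\alpha\Big]}{\mathbb E[|X_{i0}|^\alpha]}.$$ 2. For all $i,j\in\mathbb Z$, $(X_{it}X_{jt})_{t\in\mathbb Z}$ is regularly varying with index $\alpha/\psi^{ij}$ and has a spectral tail process $(\Theta^{ij}_t)_{t\ge0}$. If (A) holds, then $\Theta^{ij}_t=0$ a.s. for $t\ge1$ and $\mathbb P(\Theta^{ij}_0=\pm1)=\mathbb E[(Z_{i0}Z_{j0})_\pm^{\alpha/\psi^{ij}}]/\mathbb E[|Z_{i0}Z_{j0}|^{\alpha/\psi^{ij}}]$. If (B) holds, then for all $n\ge 0$ and Borel sets $B=B_0\times\cdots\times B_n\subset\mathbb R^{n+1}$, $$\mathbb P\big((\Theta^{ij}_t)_{0\le t\le n}\in B\big)=\sum_{(u,v)\in\Lambda_{i,j}^{(0)}}\frac1{|\Lambda_{i,j}^{(0)}|}\,\frac{\mathbb E\Big[\mathbf 1\Big(\big(\mathbf 1((u,v)\in\Lambda_{i,j}^{(t)})\tfrac{X_{it}X_{jt}}{|X_{i0}X_{j0}|}\big)_{0\le t\le n}\in B\Big)|X_{i0}X_{j0}|^{\alpha/\psi^{ij}}\Big]}{\mathbb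 E[|X_{i0}X_{j0}|^{\alpha/\psi^{ij}}]}.$$ 3. For all $d\ge1$ and $\mathbf i,\mathbf j\in\mathbb Z^d$, the $\mathbb R^d$-valued sequence $\big((X_{i_kt}X_{j_kt})_{1\le k\le d}\big)_{t\in\mathbb Z}$ is regularly varying with index $\alpha/\psi^{\mathbf i,\mathbf j}$. -/

import Mathlib

open MeasureTheory ProbabilityTheory Filter Topology

/-- Slow variation at infinity. -/
def SlowlyVarying (L : ℝ → ℝ) : Prop :=
  (∀ᶠ x in atTop, 0 < L x) ∧
    ∀ c : ℝ, 0 < c → Tendsto (fun x => L (c * x) / L x) atTop (𝓝 1)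

/-- `E[e^{αξ}] = ∞`. -/
def InfiniteExpMoment {Ω : Type*} [MeasurableSpace Ω] (P : Measure Ω) (α : ℝ)
    (ξ : Ω → ℝ) : Prop :=
  ∫⁻ ω, ENNReal.ofReal (Real.exp (α * ξ ω)) ∂P = ⊤

/-- `lim_{x → ∞} P (ξ₁ + ξ₂ > x) / P (ξ₁ > x) = c` for some `c ∈ (0, ∞)`; for independent copies
`ξ₁, ξ₂` with `e^{ξ₁}` regularly varying this is convolution equivalence of their law. -/
def ConvolutionRatio {Ω : Type*} [MeasurableSpace Ω] (P : Measure Ω) (ξ₁ ξ₂ : Ω → ℝ) : Prop :=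
  ∃ c : ℝ, 0 < c ∧
    Tendsto (fun x : ℝ => P.real {ω | x < ξ₁ ω + ξ₂ ω} / P.real {ω | x < ξ₁ ω}) atTop (𝓝 c)

/-- The volatility field `σ_{it} = exp (∑_{k,l} ψ_{kl} η_{i-k,t-l})`. -/
noncomputable def volatility {Ω : Type*} (ψ : ℤ × ℤ → ℝ) (η : ℤ × ℤ → Ω → ℝ)
    (i t : ℤ) (ω : Ω) : ℝ :=
  Real.exp (∑' p : ℤ × ℤ, ψ p * η (i - p.1, t - p.2) ω)

/-- The stochastic volatility model `X_{it} = σ_{it} Z_{it}`. -/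
noncomputable def svProcess {Ω : Type*} (ψ : ℤ × ℤ → ℝ) (η Z : ℤ × ℤ → Ω → ℝ)
    (i t : ℤ) (ω : Ω) : ℝ :=
  volatility ψ η i t ω * Z (i, t) ω

/-- `ψ^{ij} = max_{k,l} (ψ_{kl} + ψ_{k+i-j,l})`. -/
noncomputable def psiPair (ψ : ℤ × ℤ → ℝ) (i j : ℤ) : ℝ :=
  ⨆ p : ℤ × ℤ, (ψ (p.1, p.2) + ψ (p.1 + i - j, p.2))

/-- `ψ^{𝐢,𝐣} = max_l ψ^{i_l j_l}`. -/
noncomputable def psiMulti (ψ : ℤ × ℤ → ℝ) {d : ℕ} (i j : Fin d → ℤ) : ℝ :=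
  ⨆ l : Fin d, psiPair ψ (i l) (j l)

/-- `Λ_i^{(t)} = {(u,v) : ψ_{i-u,t-v} = 1}`. -/
def maxSet (ψ : ℤ × ℤ → ℝ) (i t : ℤ) : Set (ℤ × ℤ) :=
  {p | ψ (i - p.1, t - p.2) = 1}

/-- `Λ_{i,j}^{(t)} = {(u,v) : ψ_{i-u,t-v} + ψ_{j-u,t-v} = ψ^{ij}}`. -/
def maxSetPair (ψ : ℤ × ℤ → ℝ) (i j t : ℤ) : Set (ℤ × ℤ) :=
  {p | ψ (i - p.1, t - p.2) + ψ (j - p.1, t - p.2) = psiPair ψ i j}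

/-- Strict stationarity: all time shifts of the process have the same law. -/
def StrictlyStationary {Ω E : Type*} [MeasurableSpace Ω] [MeasurableSpace E]
    (P : Measure Ω) (Y : ℤ → Ω → E) : Prop :=
  ∀ s : ℤ, IdentDistrib (fun ω (t : ℤ) => Y (t + s) ω) (fun ω (t : ℤ) => Y t ω) P P

/-- Regular variation with index `γ` of a random vector `V` with coordinates in `ι`, in the sense
of vague convergence of `P (x⁻¹ V ∈ ·) / r x` on `[-∞, ∞]^ι \ {0}`, as `x → ∞`, to a non-null Radon
measure that is homogeneous of order `-γ`.

Measures on the punctured space are represented by measures on `[-∞, ∞]^ι` that do not charge `0`;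
since `[-∞, ∞]^ι` is compact, the compact subsets of the punctured space are the closed sets that
miss a neighbourhood of `0`, and the continuous functions with compact support there are the
continuous functions on `[-∞, ∞]^ι` that vanish near `0`. -/
def VagueRegVar {Ω ι : Type*} [MeasurableSpace Ω]
    (P : Measure Ω) (γ : ℝ) (V : Ω → ι → ℝ) (r : ℝ → ℝ) : Prop :=
  ∃ μ : Measure (ι → EReal),
    μ ≠ 0 ∧ μ {0} = 0 ∧ (∀ U ∈ 𝓝 (0 : ι → EReal), μ Uᶜ < ⊤) ∧
    (∀ c : ℝ, 0 < c → ∀ B : Set (ι → EReal), MeasurableSet B →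
      μ ((fun y q => (c : EReal) * y q) '' B) = ENNReal.ofReal (c ^ (-γ)) * μ B) ∧
    ∀ f : C(ι → EReal, ℝ), (∀ᶠ y in 𝓝 (0 : ι → EReal), f y = 0) →
      Tendsto (fun x : ℝ => (∫ ω, f (fun q => ((x⁻¹ * V ω q : ℝ) : EReal)) ∂P) / r x)
        atTop (𝓝 (∫ y, f y ∂μ))

/-- An `ℝ^d`-valued sequence `(Y_t)` is regularly varying with index `γ`: it is strictly
stationary, and every vector `(Y_0, …, Y_h)` is regularly varying with index `γ`, with
normalization `P (‖Y_0‖ > x)`. -/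
structure IsRegVarSeq {Ω : Type*} [MeasurableSpace Ω] (P : Measure Ω) (γ : ℝ) {d : ℕ}
    (Y : ℤ → Ω → Fin d → ℝ) : Prop where
  index_pos : 0 < γ
  stationary : StrictlyStationary P Y
  regVar : ∀ h : ℕ,
    VagueRegVar P γ (fun ω (q : Fin (h + 1) × Fin d) => Y ((q.1 : ℕ) : ℤ) ω q.2)
      (fun x => P.real {ω | x < ‖Y 0 ω‖})

/-- Regular variation of a real-valued sequence: the case `d = 1`. -/
def IsRegVarSeqReal {Ω : Type*} [MeasurableSpace Ω] (P : Measure Ω) (γ : ℝ)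
    (Y : ℤ → Ω → ℝ) : Prop :=
  IsRegVarSeq P γ (fun t ω (_ : Fin 1) => Y t ω)

/-- `ν` is the law on `ℝ^ℕ` of the spectral tail process `(Θ_h)_{h ≥ 0}` of `(Y_t)` (index `γ`):
conditionally on `|Y_0| > x`, the vector `x⁻¹ (Y_0, …, Y_k)` converges weakly, as `x → ∞`, to
`R (Θ_0, …, Θ_k)`, where `R` is Pareto(`γ`) and independent of `(Θ_h) ∼ ν`. -/
structure IsSpectralTailLaw {Ω : Type*} [MeasurableSpace Ω] (P : Measure Ω) (γ : ℝ)
    (Y : ℤ → Ω → ℝ) (ν : Measure (ℕ → ℝ)) : Prop where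
  isProbabilityMeasure : IsProbabilityMeasure ν
  tendsto : ∀ (k : ℕ) (f : BoundedContinuousFunction (Fin (k + 1) → ℝ) ℝ),
    Tendsto
      (fun x : ℝ => ∫ ω, f (fun t => x⁻¹ * Y ((t : ℕ) : ℤ) ω) ∂(P[|{ω | x < |Y 0 ω|}]))
      atTop
      (𝓝 (∫ z : ℝ × (ℕ → ℝ), f (fun t => z.1 * z.2 t) ∂((paretoMeasure 1 γ).prod ν)))

/-- The mixture attached to a process `Y`, an exponent `κ` and sets `Λ t` of indices:
`∑_{p ∈ Λ 0} |Λ 0|⁻¹ E[1((1(p ∈ Λ t) Y_t / |Y_0|)_{t ≤ n} ∈ B_0 × ⋯ × B_n) |Y_0|^κ] / E[|Y_0|^κ]`. -/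
noncomputable def spectralMixture {Ω : Type*} [MeasurableSpace Ω] (P : Measure Ω) (κ : ℝ)
    (Λ : ℤ → Set (ℤ × ℤ)) (Y : ℤ → Ω → ℝ) (n : ℕ) (B : ℕ → Set ℝ) : ℝ :=
  ∑ᶠ (p : ℤ × ℤ) (_ : p ∈ Λ 0),
    1 / ((Λ 0).ncard : ℝ) *
      ((∫ ω in {ω | ∀ t : ℕ, t ≤ n →
            (Λ (t : ℤ)).indicator (fun _ => Y (t : ℤ) ω / |Y 0 ω|) p ∈ B t},
          |Y 0 ω| ^ κ ∂P) /
        ∫ ω, |Y 0 ω| ^ κ ∂P)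

/-!
The proof is a "single big jump" argument, carried out for an abstract class of random vectors and
then applied to the stochastic volatility model.

In `BigSource`, a vector `V` has finitely many positive sources `R s` with a common regularly varying
tail. A source acts on some of the coordinates, where `V q = R s * U s q` with `U s` independent of
`R s`. A large coordinate of `V` requires a large source acting on it, and two sources are rarely
large together. Hence `V / x`, on the event that `V` is large, behaves like `R s * U s / x` for one
source at a time (`BigSource.tendsto_integral`), and the tail measure of `V` is the sum of the images
of `γ r^{-γ-1} dr ⊗ P` under `(r, ω) ↦ r U s ω`. This gives vague regular variation
(`BigSource.vagueRegVar`) and a spectral tail process, namely the mixture of the laws of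
`U s / |U s 0|` under `|U s 0|^γ P` (`isSpectralTailLaw_spectralLaw`). Any spectral tail law of the
process has the same finite-dimensional laws (`IsSpectralTailLaw.real_setOf_eq_spectralLaw`).

A value of the volatility model, or a product of two values at the same time, is the exponential of a
series in the noise with nonnegative summable weights, times a multiplier. After division by the
largest weight, finitely many weights are equal to one (`LinearModel`). The two alternatives for the
noise lead to different sources.

* If `E e^{γ ξ} = ∞`, the product of `n + 1` factors `e^{ξ p}` has a regularly varying tail that
  dominates the tail of the product of `n` factors (`RegVarTail.mul`,
  `SourceField.eventually_tail_expSum_le`). The sources are the products over the largest sets of full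
  weights (`LinearModel.bigSource_of_infinite_moment`). The sets that belong to distinct times are
  shifts of each other, hence distinct, so the source at time zero does not act at other times and the
  spectral tail process vanishes there.
* Under convolution equivalence `E e^{γ ξ}` is finite, and a large product of factors `e^{ξ p}`
  contains exactly one large factor. The sources are the single factors of full weight
  (`LinearModel.bigSource_of_convolutionRatio`), which gives the mixture over the maximal sets. The
  point is that the limit `c` of the convolution ratio equals `2 E e^{γ ξ}`; the inequality
  `c ≤ 2 E e^{γ ξ}` is the Foss-Korshunov bound `not_eventually_tail_add_ge`, the other one is Fatou's
  lemma (`convolutionRatio_consequences`).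

The multipliers are assumed to be independent of the volatility field only, not of the noise field.
All claims depend on the law of the process alone, so they may be proved for copies in which the
multipliers are independent of the noise (`SVModel.exists_linearModel`).
-/

/-! ### Regularly varying tails -/

/-- The tail function `G` of a positive random variable, regularly varying with index `γ`. -/
structure RegVarTail (γ : ℝ) (G : ℝ → ℝ) : Prop where
  anti : Antitone G
  pos : ∀ x, 0 < G x
  le_one : ∀ x, G x ≤ 1
  ratio : ∀ c : ℝ, 0 < c → Tendsto (fun x => G (c * x) / G x) atTop (𝓝 (c ^ (-γ)))

namespace RegVarTail

variable {γ : ℝ} {G : ℝ → ℝ}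

theorem eventually_le (h : RegVarTail γ G) {c C : ℝ} (hc : 0 < c) (hC : c ^ (-γ) < C) :
    ∀ᶠ x in atTop, G (c * x) ≤ C * G x := by
  filter_upwards [(h.ratio c hc).eventually_lt_const hC] with x hx
  rw [div_lt_iff₀ (h.pos x)] at hx
  exact hx.le

theorem exists_eventually_le (h : RegVarTail γ G) {c : ℝ} (hc : 0 < c) :
    ∃ C, 0 < C ∧ ∀ᶠ x in atTop, G (c * x) ≤ C * G x :=
  ⟨c ^ (-γ) + 1, by positivity, h.eventually_le hc (by linarith)⟩

/-- Potter's bound, obtained by iterating the ratio bound for `c = 1 / 2`. -/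
theorem potter (h : RegVarTail γ G) {β : ℝ} (hβ : γ < β) (hβ0 : 0 < β) :
    ∃ C x₀ : ℝ, 0 < C ∧ 0 < x₀ ∧ ∀ x, x₀ ≤ x → ∀ u, 1 ≤ u → G (x / u) ≤ C * u ^ β * G x := by
  have h2 : ((1 / 2 : ℝ)) ^ (-γ) < 2 ^ β := by
    rw [one_div, Real.inv_rpow (by norm_num), Real.rpow_neg (by norm_num), inv_inv]
    exact Real.rpow_lt_rpow_of_exponent_lt (by norm_num) hβ
  obtain ⟨x₁, hx₁⟩ := eventually_atTop.1 (h.eventually_le (by norm_num) h2)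
  set x₀ := max x₁ 1
  have hx₀ : 0 < x₀ := lt_of_lt_of_le one_pos (le_max_right _ _)
  set C₀ := 1 / G (2 * x₀)
  have hC₀ : 0 < C₀ := one_div_pos.2 (h.pos _)
  have hC₀1 : 1 ≤ C₀ := by rw [le_div_iff₀ (h.pos _), one_mul]; exact h.le_one _
  have key : ∀ k : ℕ, ∀ x, x₀ ≤ x → G (x / 2 ^ k) ≤ C₀ * ((2 : ℝ) ^ β) ^ k * G x := by
    intro k
    induction k with
    | zero =>
      intro x _
      simpa using le_mul_of_one_le_left (h.pos x).le hC₀1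
    | succ k ih =>
      intro x hx
      rcases le_or_gt (2 * x₀) x with h2x | h2x
      · have := ih (x / 2) (by linarith)
        rw [div_div, ← pow_succ'] at this
        refine this.trans ?_
        have h3 := hx₁ x ((le_max_left _ _).trans hx)
        rw [one_div, inv_mul_eq_div] at h3
        calc C₀ * (2 ^ β) ^ k * G (x / 2) ≤ C₀ * (2 ^ β) ^ k * (2 ^ β * G x) := by gcongr
          _ = _ := by ring
      · -- below `2 x₀` the constant `C₀ = 1 / G (2 x₀)` makes the bound trivial
        have h1 : 1 ≤ C₀ * G x := by
          rw [div_mul_eq_mul_div, one_mul, le_div_iff₀ (h.pos _), one_mul]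
          exact h.anti h2x.le
        have h4 : (1 : ℝ) ≤ ((2 : ℝ) ^ β) ^ (k + 1) :=
          one_le_pow₀ (Real.one_le_rpow (by norm_num) hβ0.le)
        calc G (x / 2 ^ (k + 1)) ≤ 1 := h.le_one _
          _ ≤ (C₀ * G x) * (2 ^ β) ^ (k + 1) := one_le_mul_of_one_le_of_one_le h1 h4
          _ = _ := by ring
  refine ⟨C₀ * 2 ^ β, x₀, by positivity, hx₀, fun x hx u hu => ?_⟩
  obtain ⟨k, hk1, hk2⟩ : ∃ k : ℕ, (2 : ℝ) ^ k ≤ u ∧ u < 2 ^ (k + 1) :=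
    exists_nat_pow_near hu (by norm_num)
  have hx0 : 0 ≤ x := hx₀.le.trans hx
  calc G (x / u) ≤ G (x / 2 ^ (k + 1)) := h.anti (by gcongr)
    _ ≤ C₀ * ((2 : ℝ) ^ β) ^ (k + 1) * G x := key _ _ hx
    _ = C₀ * 2 ^ β * (((2 : ℝ) ^ k) ^ β) * G x := by
      rw [pow_succ, ← Real.rpow_natCast, ← Real.rpow_mul (by norm_num), mul_comm β,
        Real.rpow_mul (by norm_num), Real.rpow_natCast]; ring
    _ ≤ _ := by
      have := h.pos x
      gcongr

theorem exists_rpow_neg_le (h : RegVarTail γ G) {β : ℝ} (hβ : γ < β) (hβ0 : 0 < β) :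
    ∃ C x₀ : ℝ, 0 < C ∧ 0 < x₀ ∧ ∀ x, x₀ ≤ x → x ^ (-β) ≤ C * G x := by
  obtain ⟨C, x₀, hC, hx₀, H⟩ := h.potter hβ hβ0
  refine ⟨C * x₀ ^ (-β) / G x₀, x₀, by have := h.pos x₀; positivity, hx₀, fun x hx => ?_⟩
  have hxpos : 0 < x := hx₀.trans_le hx
  have h1 := H x hx (x / x₀) (by rwa [one_le_div hx₀])
  rw [div_div_cancel₀ hxpos.ne', Real.div_rpow hxpos.le hx₀.le] at h1
  rw [div_mul_eq_mul_div, le_div_iff₀ (h.pos _)]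
  calc x ^ (-β) * G x₀ ≤ x ^ (-β) * (C * (x ^ β / x₀ ^ β) * G x) := by gcongr
    _ = (x ^ (-β) * x ^ β) * (C * (x₀ ^ β)⁻¹ * G x) := by ring
    _ = _ := by
      rw [← Real.rpow_add hxpos, Real.rpow_neg hx₀.le]; simp

/-- A power with exponent below the index bounds the tail. -/
theorem exists_le_rpow_neg (h : RegVarTail γ G) {θ : ℝ} (hθ : θ < γ) (hθ0 : 0 < θ) :
    ∃ C : ℝ, 0 < C ∧ ∀ x, 0 < x → G x ≤ C * x ^ (-θ) := by
  have h2 : (2 : ℝ) ^ (-γ) < 2 ^ (-θ) :=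
    Real.rpow_lt_rpow_of_exponent_lt (by norm_num) (by linarith)
  obtain ⟨x₁, hx₁⟩ := eventually_atTop.1 (h.eventually_le (by norm_num) h2)
  set x₀ := max x₁ 1
  have hx₀ : 0 < x₀ := lt_of_lt_of_le one_pos (le_max_right _ _)
  have key : ∀ k : ℕ, G (2 ^ k * x₀) ≤ ((2 : ℝ) ^ (-θ)) ^ k := by
    intro k
    induction k with
    | zero => simpa using h.le_one _
    | succ k ih =>
      have h3 : x₁ ≤ 2 ^ k * x₀ :=
        (le_max_left x₁ 1).trans (le_mul_of_one_le_left hx₀.le (one_le_pow₀ (by norm_num)))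
      calc G (2 ^ (k + 1) * x₀) = G (2 * (2 ^ k * x₀)) := by ring_nf
        _ ≤ 2 ^ (-θ) * G (2 ^ k * x₀) := hx₁ _ h3
        _ ≤ 2 ^ (-θ) * (2 ^ (-θ)) ^ k := by gcongr
        _ = _ := by ring
  refine ⟨(2 * x₀) ^ θ, by positivity, fun x hx => ?_⟩
  rcases le_or_gt x₀ x with hxx | hxx
  · obtain ⟨k, hk1, hk2⟩ : ∃ k : ℕ, (2 : ℝ) ^ k ≤ x / x₀ ∧ x / x₀ < 2 ^ (k + 1) :=
      exists_nat_pow_near (by rwa [one_le_div hx₀]) (by norm_num)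
    rw [le_div_iff₀ hx₀] at hk1
    rw [div_lt_iff₀ hx₀] at hk2
    calc G x ≤ G (2 ^ k * x₀) := h.anti hk1
      _ ≤ ((2 : ℝ) ^ (-θ)) ^ k := key k
      _ = ((2 : ℝ) ^ k) ^ (-θ) := by
        rw [← Real.rpow_natCast, ← Real.rpow_mul (by norm_num), mul_comm,
          Real.rpow_mul (by norm_num), Real.rpow_natCast]
      _ ≤ (x / (2 * x₀)) ^ (-θ) := by
        refine Real.rpow_le_rpow_of_nonpos (by positivity) ?_ (by linarith)
        rw [div_le_iff₀ (by positivity)]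
        rw [pow_succ] at hk2; linarith
      _ = _ := by
        rw [Real.div_rpow hx.le (by positivity), Real.rpow_neg (by positivity : 0 ≤ 2 * x₀),
          div_inv_eq_mul, mul_comm]
  · have h4 : (1 : ℝ) ≤ (2 * x₀) ^ θ * x ^ (-θ) := by
      rw [Real.rpow_neg hx.le, ← div_eq_mul_inv, ← Real.div_rpow (by positivity) hx.le]
      exact Real.one_le_rpow (by rw [one_le_div hx]; linarith) hθ0.le
    exact (h.le_one x).trans h4

theorem tendsto_zero (h : RegVarTail γ G) (hγ : 0 < γ) : Tendsto G atTop (𝓝 0) := by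
  obtain ⟨C, -, hC⟩ := h.exists_le_rpow_neg (half_lt_self hγ) (half_pos hγ)
  refine squeeze_zero' (Eventually.of_forall fun x => (h.pos x).le)
    ((eventually_gt_atTop 0).mono hC) ?_
  simpa using (tendsto_rpow_neg_atTop (half_pos hγ)).const_mul C

/-- Powers with exponent above the index are negligible against the tail. -/
theorem eventually_rpow_neg_le (h : RegVarTail γ G) (hγ : 0 < γ) {β : ℝ} (hβ : γ < β) {η : ℝ}
    (hη : 0 < η) : ∀ᶠ x in atTop, x ^ (-β) ≤ η * G x := by
  obtain ⟨C, x₀, hC, hx₀, H⟩ := h.exists_rpow_neg_le (β := (γ + β) / 2) (by linarith) (by linarith)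
  have h1 : Tendsto (fun x : ℝ => C * x ^ (-((β - γ) / 2))) atTop (𝓝 0) := by
    simpa using (tendsto_rpow_neg_atTop (by linarith : 0 < (β - γ) / 2)).const_mul C
  filter_upwards [eventually_ge_atTop x₀, h1.eventually_le_const hη] with x hx hx2
  have hxpos : 0 < x := hx₀.trans_le hx
  calc x ^ (-β) = x ^ (-((γ + β) / 2)) * x ^ (-((β - γ) / 2)) := by
        rw [← Real.rpow_add hxpos]; ring_nf
    _ ≤ (C * G x) * x ^ (-((β - γ) / 2)) := by gcongr; exact H x hx
    _ = (C * x ^ (-((β - γ) / 2))) * G x := by ring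
    _ ≤ _ := by have := h.pos x; gcongr

end RegVarTail

/-- Moments below the tail index are finite. -/
theorem lintegral_rpow_lt_top_of_tail {Ω : Type*} [MeasurableSpace Ω] {P : Measure Ω}
    [IsProbabilityMeasure P] {Y : Ω → ℝ} (hY : Measurable Y) (hY0 : ∀ ω, 0 ≤ Y ω) {θ θ' C : ℝ}
    (hθ : 0 < θ) (hθ' : θ < θ') (hC : 0 ≤ C)
    (h : ∀ x, 0 < x → P.real {ω | x < Y ω} ≤ C * x ^ (-θ')) :
    ∫⁻ ω, ENNReal.ofReal (Y ω ^ θ) ∂P < ⊤ := by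
  rw [lintegral_rpow_eq_lintegral_meas_lt_mul P (Eventually.of_forall hY0) hY.aemeasurable hθ]
  refine ENNReal.mul_lt_top ENNReal.ofReal_lt_top ?_
  rw [← Set.Ioc_union_Ioi_eq_Ioi (zero_le_one' ℝ),
    lintegral_union measurableSet_Ioi Set.Ioc_disjoint_Ioi_same]
  refine ENNReal.add_lt_top.2 ⟨?_, ?_⟩
  · calc _ ≤ ∫⁻ t in Set.Ioc (0 : ℝ) 1, ENNReal.ofReal (t ^ (θ - 1)) := by
          refine lintegral_mono fun t => ?_
          exact mul_le_of_le_one_left' prob_le_one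
      _ < ⊤ := by
        have : IntegrableOn (fun t : ℝ => t ^ (θ - 1)) (Set.Ioc 0 1) := by
          rw [← intervalIntegrable_iff_integrableOn_Ioc_of_le zero_le_one]
          exact intervalIntegral.intervalIntegrable_rpow' (by linarith)
        exact this.lintegral_lt_top
  · calc _ ≤ ∫⁻ t in Set.Ioi (1 : ℝ), ENNReal.ofReal (C * t ^ (-θ' + (θ - 1))) := by
          refine setLIntegral_mono (by fun_prop) fun t ht => ?_
          have ht0 : (0 : ℝ) < t := one_pos.trans ht
          rw [Real.rpow_add ht0, ← mul_assoc, ENNReal.ofReal_mul (by positivity)]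
          gcongr
          rw [← ofReal_measureReal]
          exact ENNReal.ofReal_le_ofReal (h t ht0)
      _ < ⊤ := by
        have : IntegrableOn (fun t : ℝ => C * t ^ (-θ' + (θ - 1))) (Set.Ioi 1) :=
          (integrableOn_Ioi_rpow_of_lt (by linarith) one_pos).const_mul C
        exact this.lintegral_lt_top

/-! ### Conditioning on an independent variable -/

section Conditioning

variable {Ω E F : Type*} [MeasurableSpace Ω] [MeasurableSpace E] [MeasurableSpace F]
  {P : Measure Ω} [IsProbabilityMeasure P] {X : Ω → E} {Y : Ω → F}

/-- Independent variables may be integrated one after the other. -/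
theorem integral_comp_of_indepFun (h : IndepFun X Y P) (hX : Measurable X) (hY : Measurable Y)
    {f : E × F → ℝ} (hf : Measurable f) {C : ℝ} (hC : ∀ p, |f p| ≤ C) :
    ∫ ω, f (X ω, Y ω) ∂P = ∫ ω, ∫ ω', f (X ω', Y ω) ∂P ∂P := by
  have h1 := (indepFun_iff_map_prod_eq_prod_map_map hX.aemeasurable hY.aemeasurable).1 h
  have := Measure.isProbabilityMeasure_map hX.aemeasurable (μ := P)
  have := Measure.isProbabilityMeasure_map hY.aemeasurable (μ := P)
  have hint : Integrable f ((P.map X).prod (P.map Y)) :=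
    Integrable.of_bound hf.aestronglyMeasurable C (Eventually.of_forall hC)
  calc ∫ ω, f (X ω, Y ω) ∂P = ∫ p, f p ∂(P.map fun ω => (X ω, Y ω)) := by
        rw [integral_map (hX.prodMk hY).aemeasurable hf.aestronglyMeasurable]
    _ = ∫ y, ∫ x, f (x, y) ∂(P.map X) ∂(P.map Y) := by
        rw [h1, integral_prod_symm _ hint]
    _ = ∫ ω, ∫ x, f (x, Y ω) ∂(P.map X) ∂P := by
        rw [integral_map hY.aemeasurable hint.integral_prod_right.aestronglyMeasurable]
    _ = _ := by
        refine integral_congr_ae (Eventually.of_forall fun ω => ?_)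
        simp only
        rw [integral_map hX.aemeasurable]
        exact (hf.comp (by fun_prop : Measurable fun x => (x, Y ω))).aestronglyMeasurable

theorem measureReal_of_indepFun (h : IndepFun X Y P) (hX : Measurable X) (hY : Measurable Y)
    {D : Set (E × F)} (hD : MeasurableSet D) :
    P.real {ω | (X ω, Y ω) ∈ D} = ∫ ω, P.real {ω' | (X ω', Y ω) ∈ D} ∂P := by
  have h1 := integral_comp_of_indepFun h hX hY (f := D.indicator 1)
    (measurable_one.indicator hD) (C := 1) (fun p => by
      by_cases hp : p ∈ D <;> simp [hp])
  have h2 : ∀ y, ∫ ω, D.indicator (1 : E × F → ℝ) (X ω, y) ∂P = P.real {ω | (X ω, y) ∈ D} := by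
    intro y
    exact integral_indicator_one
      ((hX.prodMk measurable_const : Measurable fun ω => (X ω, y)) hD)
  have h3 : ∫ ω, D.indicator (1 : E × F → ℝ) (X ω, Y ω) ∂P = P.real {ω | (X ω, Y ω) ∈ D} := by
    exact integral_indicator_one ((hX.prodMk hY) hD)
  simp_rw [h2] at h1
  rw [← h3, h1]

theorem integrable_measureReal_of_indepFun (hX : Measurable X) (hY : Measurable Y)
    {D : Set (E × F)} (hD : MeasurableSet D) :
    Integrable (fun ω => P.real {ω' | (X ω', Y ω) ∈ D}) P := by
  have hm : Measurable fun ω => P.real {ω' | (X ω', Y ω) ∈ D} :=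
    (measurable_measure_prodMk_left (ν := P)
      (s := {p : Ω × Ω | (X p.2, Y p.1) ∈ D}) (by
        exact ((hX.comp measurable_snd).prodMk (hY.comp measurable_fst)) hD)).ennreal_toReal
  refine Integrable.of_bound hm.aestronglyMeasurable 1 (Eventually.of_forall fun ω => ?_)
  rw [Real.norm_of_nonneg measureReal_nonneg]
  exact measureReal_le_one

theorem measureReal_le_of_indepFun (h : IndepFun X Y P) (hX : Measurable X) (hY : Measurable Y)
    {D : Set (E × F)} (hD : MeasurableSet D) {b : Ω → ℝ} (hb : Integrable b P)
    (hle : ∀ ω, P.real {ω' | (X ω', Y ω) ∈ D} ≤ b ω) :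
    P.real {ω | (X ω, Y ω) ∈ D} ≤ ∫ ω, b ω ∂P := by
  rw [measureReal_of_indepFun h hX hY hD]
  exact integral_mono (integrable_measureReal_of_indepFun hX hY hD) hb hle

theorem measureReal_le_measureReal_of_indepFun {E' : Type*} [MeasurableSpace E'] {X' : Ω → E'}
    (h : IndepFun X Y P) (h' : IndepFun X' Y P)
    (hX : Measurable X) (hX' : Measurable X') (hY : Measurable Y)
    {D : Set (E × F)} (hD : MeasurableSet D) {D' : Set (E' × F)} (hD' : MeasurableSet D') {c : ℝ}
    (hle : ∀ ω, P.real {ω' | (X ω', Y ω) ∈ D} ≤ c * P.real {ω' | (X' ω', Y ω) ∈ D'}) :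
    P.real {ω | (X ω, Y ω) ∈ D} ≤ c * P.real {ω | (X' ω, Y ω) ∈ D'} := by
  rw [measureReal_of_indepFun h' hX' hY hD', ← integral_const_mul]
  exact measureReal_le_of_indepFun h hX hY hD
    ((integrable_measureReal_of_indepFun hX' hY hD').const_mul c) hle

end Conditioning

/-! ### Products with an independent factor of higher moment -/

section Breiman

variable {Ω : Type*} [MeasurableSpace Ω] {P : Measure Ω} [IsProbabilityMeasure P]
  {γ β C₀ : ℝ} {G : ℝ → ℝ} {T U : Ω → ℝ}

/-- Potter's bound, integrated over an independent factor `U`. -/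
theorem breiman_bound (hG : RegVarTail γ G) (hβ : γ < β) (hβ0 : 0 < β)
    (hTm : Measurable T) (hUm : Measurable U) (hind : IndepFun T U P)
    (hT : ∀ x, P.real {ω | x < T ω} ≤ C₀ * G x) (hC₀ : 0 ≤ C₀)
    (hU : Integrable (fun ω => |U ω| ^ β) P) :
    ∃ C x₀ : ℝ, 0 ≤ C ∧ ∀ x, x₀ ≤ x → ∀ K, 1 ≤ K →
      P.real {ω | x < T ω * U ω ∧ K < U ω} ≤
        C * (∫ ω in {ω | K < U ω}, |U ω| ^ β ∂P) * G x := by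
  obtain ⟨C, x₀, hC, hx₀, H⟩ := hG.potter hβ hβ0
  refine ⟨C₀ * C, x₀, by positivity, fun x hx K hK => ?_⟩
  have hKm : MeasurableSet {ω | K < U ω} := measurableSet_lt measurable_const hUm
  have hD : MeasurableSet {p : ℝ × ℝ | x < p.1 * p.2 ∧ K < p.2} := by
    measurability
  have := measureReal_le_of_indepFun hind hTm hUm hD
    (b := fun ω => {ω | K < U ω}.indicator (fun ω => C₀ * C * G x * |U ω| ^ β) ω)
    ((hU.const_mul _).indicator hKm) (fun ω => by
      by_cases hω : K < U ω
      · have hpos : 0 < U ω := by linarith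
        simp only [Set.mem_ofPred_eq, hω, and_true, Set.indicator_of_mem]
        calc P.real {ω' | x < T ω' * U ω} = P.real {ω' | x / U ω < T ω'} := by
              congr 1; ext ω'; simp [div_lt_iff₀ hpos]
          _ ≤ C₀ * G (x / U ω) := hT _
          _ ≤ C₀ * (C * U ω ^ β * G x) := by gcongr; exact H x hx _ (by linarith)
          _ = _ := by rw [abs_of_pos hpos]; ring
      · simp [hω])
  refine this.trans_eq ?_
  rw [integral_indicator hKm, integral_const_mul]
  ring

/-- Large values of the factor `U` contribute negligibly to the tail of the product `T * U`. -/
theorem breiman_trunc (hG : RegVarTail γ G) (hβ : γ < β) (hβ0 : 0 < β)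
    (hTm : Measurable T) (hUm : Measurable U) (hind : IndepFun T U P)
    (hT : ∀ x, P.real {ω | x < T ω} ≤ C₀ * G x) (hC₀ : 0 ≤ C₀)
    (hU : Integrable (fun ω => |U ω| ^ β) P) {η : ℝ} (hη : 0 < η) :
    ∃ K : ℝ, 1 ≤ K ∧ ∀ᶠ x in atTop, P.real {ω | x < T ω * U ω ∧ K < U ω} ≤ η * G x := by
  obtain ⟨C, x₀, hC, H⟩ := breiman_bound hG hβ hβ0 hTm hUm hind hT hC₀ hU
  have hlim : Tendsto (fun n : ℕ => ∫ ω in {ω | (n : ℝ) < U ω}, |U ω| ^ β ∂P) atTop (𝓝 0) := by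
    have h0 : (⋂ n : ℕ, {ω | (n : ℝ) < U ω}) = ∅ := by
      ext ω
      simp only [Set.mem_iInter, Set.mem_ofPred_eq, Set.mem_empty_iff_false, iff_false, not_forall,
        not_lt]
      exact exists_nat_ge _
    have := Antitone.tendsto_setIntegral (μ := P) (s := fun n : ℕ => {ω | (n : ℝ) < U ω})
      (f := fun ω => |U ω| ^ β)
      (fun n => measurableSet_lt measurable_const hUm)
      (fun m n hmn ω (hω : (n : ℝ) < U ω) => lt_of_le_of_lt (by exact_mod_cast hmn) hω)
      hU.integrableOn
    simpa [h0] using this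
  obtain ⟨n, hn1, hn⟩ := ((hlim.const_mul C).eventually_le_const
    (by simpa using hη : C * 0 < η) |>.and (eventually_ge_atTop 1)).exists
  refine ⟨n, by exact_mod_cast hn, ?_⟩
  filter_upwards [eventually_ge_atTop x₀] with x hx
  refine (H x hx n (by exact_mod_cast hn)).trans ?_
  have := hG.pos x
  gcongr

/-- The tail of a product is at most of the order of the tail of the factor without higher
moment. -/
theorem breiman_le (hG : RegVarTail γ G) (hβ : γ < β) (hβ0 : 0 < β)
    (hTm : Measurable T) (hUm : Measurable U) (hT0 : ∀ ω, 0 ≤ T ω) (hind : IndepFun T U P)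
    (hT : ∀ x, P.real {ω | x < T ω} ≤ C₀ * G x) (hC₀ : 0 ≤ C₀)
    (hU : Integrable (fun ω => |U ω| ^ β) P) :
    ∃ C : ℝ, 0 < C ∧ ∀ᶠ x in atTop, P.real {ω | x < T ω * U ω} ≤ C * G x := by
  obtain ⟨K, hK, H⟩ := breiman_trunc hG hβ hβ0 hTm hUm hind hT hC₀ hU one_pos
  obtain ⟨C, hC, HC⟩ := hG.exists_eventually_le (inv_pos.2 (one_pos.trans_le hK))
  refine ⟨C₀ * C + 1, by positivity, ?_⟩
  filter_upwards [H, HC] with x hx hxC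
  have hK0 : 0 < K := by linarith
  have hsub : {ω | x < T ω * U ω} ⊆
      {ω | K⁻¹ * x < T ω} ∪ {ω | x < T ω * U ω ∧ K < U ω} := by
    intro ω hω
    by_cases hu : K < U ω
    · exact Or.inr ⟨hω, hu⟩
    · left
      simp only [Set.mem_ofPred_eq] at hω ⊢
      rw [inv_mul_lt_iff₀ hK0]
      push Not at hu
      nlinarith [hT0 ω]
  calc P.real {ω | x < T ω * U ω} ≤ _ := measureReal_mono hsub
    _ ≤ _ := measureReal_union_le _ _
    _ ≤ C₀ * (C * G x) + 1 * G x := add_le_add ((hT _).trans (by gcongr)) hx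
    _ = _ := by ring

end Breiman

/-! ### The tail measure of a single source -/

/-- The measure `γ r^{-γ-1} dr` on `(0, ∞)`. -/
noncomputable def powMeasure (γ : ℝ) : Measure ℝ :=
  (volume.restrict (Set.Ioi 0)).withDensity fun r => ENNReal.ofReal (γ * r ^ (-(γ + 1)))

section PowMeasure

variable {γ : ℝ}

theorem powMeasure_apply (γ : ℝ) {B : Set ℝ} (hB : MeasurableSet B) (h0 : B ⊆ Set.Ioi 0) :
    powMeasure γ B = ∫⁻ r in B, ENNReal.ofReal (γ * r ^ (-(γ + 1))) := by
  rw [powMeasure, withDensity_apply _ hB, Measure.restrict_restrict hB,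
    Set.inter_eq_left.2 h0]

instance : SFinite (powMeasure γ) := by unfold powMeasure; infer_instance

theorem powMeasure_Ioi (hγ : 0 < γ) {a : ℝ} (ha : 0 < a) :
    powMeasure γ (Set.Ioi a) = ENNReal.ofReal (a ^ (-γ)) := by
  rw [powMeasure_apply γ measurableSet_Ioi (Set.Ioi_subset_Ioi ha.le),
    ← ofReal_integral_eq_lintegral_ofReal]
  · rw [integral_const_mul, integral_Ioi_rpow_of_lt (by linarith) ha]
    congr 1
    have : -(γ + 1) + 1 = -γ := by ring
    rw [this]; field_simp
  · exact (integrableOn_Ioi_rpow_of_lt (by linarith) ha).const_mul _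
  · refine (ae_restrict_iff' measurableSet_Ioi).2 (Eventually.of_forall fun r hr => ?_)
    have : 0 < r := ha.trans hr
    positivity

theorem powMeasure_Iic_zero (γ : ℝ) : powMeasure γ (Set.Iic 0) = 0 := by
  rw [powMeasure, withDensity_apply _ measurableSet_Iic,
    Measure.restrict_restrict measurableSet_Iic, Set.Iic_inter_Ioi]
  simp

theorem ae_powMeasure_pos (γ : ℝ) : ∀ᵐ r ∂(powMeasure γ), 0 < r := by
  rw [ae_iff]
  simp only [not_lt]
  exact powMeasure_Iic_zero γ

/-- The Pareto law is the normalized restriction of `γ r^{-γ-1} dr` to `(1, ∞)`, where this measure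
has mass one. -/
theorem paretoMeasure_one_eq (γ : ℝ) :
    paretoMeasure 1 γ = (powMeasure γ).restrict (Set.Ioi 1) := by
  rw [paretoMeasure, powMeasure, restrict_withDensity measurableSet_Ioi,
    Measure.restrict_restrict measurableSet_Ioi,
    Set.inter_eq_left.2 (Set.Ioi_subset_Ioi zero_le_one), restrict_Ioi_eq_restrict_Ici,
    ← withDensity_indicator measurableSet_Ici]
  congr 1
  ext r
  by_cases hr : 1 ≤ r
  · rw [Set.indicator_of_mem (Set.mem_Ici.2 hr), paretoPDF_of_le hr]; simp
  · rw [Set.indicator_of_notMem (by simpa using hr), paretoPDF_of_lt (not_le.1 hr)]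

theorem lintegral_powMeasure_comp_mul {g : ℝ → ENNReal} (hg : Measurable g) {c : ℝ} (hc : 0 < c) :
    ∫⁻ r, g (c * r) ∂(powMeasure γ) = ENNReal.ofReal (c ^ γ) * ∫⁻ r, g r ∂(powMeasure γ) := by
  have hd : Measurable fun r : ℝ => ENNReal.ofReal (γ * r ^ (-(γ + 1))) := by fun_prop
  have hgc : Measurable fun r => g (c * r) := hg.comp (measurable_const_mul c)
  rw [powMeasure, lintegral_withDensity_eq_lintegral_mul _ hd hgc,
    lintegral_withDensity_eq_lintegral_mul _ hd hg, ← lintegral_indicator measurableSet_Ioi,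
    ← lintegral_indicator measurableSet_Ioi]
  have h1 : ∀ F : ℝ → ENNReal, Measurable F →
      ∫⁻ r, F (c * r) = ENNReal.ofReal c⁻¹ * ∫⁻ r, F r := by
    intro F hF
    rw [← lintegral_map hF (measurable_const_mul c), Real.map_volume_mul_left hc.ne',
      lintegral_smul_measure, abs_of_pos (inv_pos.2 hc), smul_eq_mul]
  set F : ℝ → ENNReal := (Set.Ioi (0 : ℝ)).indicator fun r =>
    ENNReal.ofReal (γ * r ^ (-(γ + 1))) * g r
  have hF : Measurable F := (hd.mul hg).indicator measurableSet_Ioi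
  have h2 : ∀ r, (Set.Ioi (0 : ℝ)).indicator
      ((fun r : ℝ => ENNReal.ofReal (γ * r ^ (-(γ + 1)))) * fun r => g (c * r)) r
      = ENNReal.ofReal (c ^ (γ + 1)) * F (c * r) := by
    intro r
    by_cases hr : 0 < r
    · rw [Set.indicator_of_mem (Set.mem_Ioi.2 hr)]
      simp only [F]
      rw [Set.indicator_of_mem (Set.mem_Ioi.2 (mul_pos hc hr))]
      simp only [Pi.mul_apply]
      rw [← mul_assoc, ← ENNReal.ofReal_mul (by positivity)]
      congr 2
      rw [Real.mul_rpow hc.le hr.le, Real.rpow_neg hc.le]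
      have : c ^ (γ + 1) ≠ 0 := (Real.rpow_pos_of_pos hc _).ne'
      field_simp
    · rw [Set.indicator_of_notMem (by simpa using hr)]
      simp only [F]
      rw [Set.indicator_of_notMem]
      · simp
      · simp only [Set.mem_Ioi, not_lt] at hr ⊢
        exact mul_nonpos_of_nonneg_of_nonpos hc.le hr
  calc _ = ∫⁻ r, ENNReal.ofReal (c ^ (γ + 1)) * F (c * r) := lintegral_congr h2
    _ = ENNReal.ofReal (c ^ (γ + 1)) * (ENNReal.ofReal c⁻¹ * ∫⁻ r, F r) := by
      have hFc : Measurable fun r => F (c * r) := hF.comp (measurable_const_mul c)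
      rw [lintegral_const_mul _ hFc, h1 F hF]
    _ = _ := by
      rw [← mul_assoc, ← ENNReal.ofReal_mul (by positivity), Real.rpow_add hc, Real.rpow_one,
        mul_assoc, mul_inv_cancel₀ hc.ne', mul_one]
      rfl

/-- The measure `γ r^{-γ-1} dr` is homogeneous of order `-γ`. -/
theorem map_mul_powMeasure (γ : ℝ) {c : ℝ} (hc : 0 < c) :
    (powMeasure γ).map (fun r => c * r) = ENNReal.ofReal (c ^ γ) • powMeasure γ := by
  ext B hB
  rw [← lintegral_indicator_one hB, lintegral_map (measurable_one.indicator hB)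
    (measurable_const_mul c), lintegral_powMeasure_comp_mul (measurable_one.indicator hB) hc,
    lintegral_indicator_one hB]
  simp

end PowMeasure

section OneSource

variable {Ω : Type*} [MeasurableSpace Ω] {P : Measure Ω} [IsProbabilityMeasure P]
  {γ : ℝ} {G : ℝ → ℝ} {R : Ω → ℝ}

/-- A regularly varying variable, rescaled by `x` and restricted to `(y, ∞)`, converges to
`γ r^{-γ-1} dr`: after normalization this is weak convergence of probability measures, which is
checked on intervals. -/
theorem tendsto_setIntegral_source (hG : RegVarTail γ G) (hγ : 0 < γ) (hR : Measurable R)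
    (hRG : ∀ x, P.real {ω | x < R ω} = G x) {y : ℝ} (hy : 0 < y)
    (φ : BoundedContinuousFunction ℝ ℝ) :
    Tendsto (fun x => (∫ ω in {ω | y * x < R ω}, φ (x⁻¹ * R ω) ∂P) / G x) atTop
      (𝓝 (∫ r in Set.Ioi y, φ r ∂(powMeasure γ))) := by
  have hms : ∀ z, MeasurableSet {ω | z < R ω} := fun z => measurableSet_lt measurable_const hR
  have hP0 : ∀ z, P {ω | z < R ω} ≠ 0 := fun z h0 => by
    have := hG.pos z
    rw [← hRG, measureReal_def, h0] at this
    simp at this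
  have hprob : ∀ x, IsProbabilityMeasure ((P[|{ω | y * x < R ω}]).map fun ω => x⁻¹ * R ω) := by
    intro x
    have := cond_isProbabilityMeasure (hP0 (y * x))
    exact Measure.isProbabilityMeasure_map (by fun_prop)
  set μs : ℝ → ProbabilityMeasure ℝ := fun x => ⟨_, hprob x⟩ with hμs
  have hlprob : IsProbabilityMeasure
      (ENNReal.ofReal (y ^ γ) • (powMeasure γ).restrict (Set.Ioi y)) := by
    constructor
    rw [Measure.smul_apply, Measure.restrict_apply_univ, powMeasure_Ioi hγ hy, smul_eq_mul,
      ← ENNReal.ofReal_mul (by positivity), ← Real.rpow_add hy]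
    simp
  set μ : ProbabilityMeasure ℝ := ⟨_, hlprob⟩ with hμ
  have hy' : (0 : ℝ) < y ^ γ := by positivity
  have hconv : Tendsto μs atTop (𝓝 μ) := by
    refine IsPiSystem.tendsto_probabilityMeasure_of_tendsto_of_mem
      (isPiSystem_Ioc (id : ℝ → ℝ) id) ?_ ?_ ?_
    · rintro _ ⟨a, b, -, rfl⟩
      exact measurableSet_Ioc
    · intro u hu x hx
      obtain ⟨ε, hε, hball⟩ := Metric.isOpen_iff.1 hu x hx
      refine ⟨Set.Ioc (x - ε / 2) (x + ε / 2), ⟨_, _, by simp only [id]; linarith, rfl⟩,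
        Ioc_mem_nhds (by linarith) (by linarith), fun z hz => hball ?_⟩
      rw [Real.ball_eq_Ioo]
      exact ⟨by linarith [hz.1], by linarith [hz.2]⟩
    · rintro _ ⟨a, b, hab, rfl⟩
      simp only [id] at hab ⊢
      -- the limit law lives on `(y, ∞)`, which cuts the interval `(a, b]` down to `(a', b']`
      set a' := max a y
      set b' := max b a'
      have ha' : 0 < a' := hy.trans_le (le_max_right _ _)
      have hb' : 0 < b' := ha'.trans_le (le_max_right _ _)
      have hab' : a' ≤ b' := le_max_right _ _
      rw [← NNReal.tendsto_coe]
      have hlim : Tendsto (fun x => (G (a' * x) / G x - G (b' * x) / G x) / (G (y * x) / G x))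
          atTop (𝓝 ((a' ^ (-γ) - b' ^ (-γ)) / y ^ (-γ))) :=
        ((hG.ratio a' ha').sub (hG.ratio b' hb')).div (hG.ratio y hy)
          (Real.rpow_pos_of_pos hy _).ne'
      have hl : ((μ (Set.Ioc a b) : NNReal) : ℝ) = (a' ^ (-γ) - b' ^ (-γ)) / y ^ (-γ) := by
        change (μ : Measure ℝ).real (Set.Ioc a b) = _
        simp only [hμ, ProbabilityMeasure.coe_mk]
        have hset : Set.Ioc a b ∩ Set.Ioi y = Set.Ioi a' \ Set.Ioi b' := by
          ext r
          simp only [Set.mem_inter_iff, Set.mem_Ioc, Set.mem_Ioi, Set.mem_sdiff, a', b',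
            max_lt_iff]
          grind
        rw [measureReal_def, Measure.smul_apply, Measure.restrict_apply measurableSet_Ioc, hset,
          measure_sdiff (Set.Ioi_subset_Ioi hab') measurableSet_Ioi.nullMeasurableSet
            (by rw [powMeasure_Ioi hγ hb']; exact ENNReal.ofReal_ne_top),
          powMeasure_Ioi hγ ha', powMeasure_Ioi hγ hb', smul_eq_mul, ENNReal.toReal_mul,
          ENNReal.toReal_ofReal hy'.le, ← ENNReal.ofReal_sub _ (by positivity),
          ENNReal.toReal_ofReal, Real.rpow_neg hy.le, div_inv_eq_mul, mul_comm]
        exact sub_nonneg.2 (Real.rpow_le_rpow_of_nonpos ha' hab' (by linarith))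
      rw [hl]
      refine hlim.congr' ?_
      filter_upwards [eventually_gt_atTop 0] with x hx
      rw [← sub_div, div_div_div_cancel_right₀ (hG.pos x).ne']
      symm
      change (μs x : Measure ℝ).real (Set.Ioc a b) = _
      simp only [hμs, ProbabilityMeasure.coe_mk]
      have hset : {ω | y * x < R ω} ∩ (fun ω => x⁻¹ * R ω) ⁻¹' Set.Ioc a b =
          {ω | a' * x < R ω} \ {ω | b' * x < R ω} := by
        ext ω
        simp only [Set.mem_inter_iff, Set.mem_ofPred_eq, Set.mem_preimage, Set.mem_Ioc,
          Set.mem_sdiff, ← div_eq_inv_mul, lt_div_iff₀ hx, div_le_iff₀ hx, a', b',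
          max_mul_of_nonneg _ _ hx.le, max_lt_iff]
        grind
      rw [measureReal_def, Measure.map_apply (by fun_prop) measurableSet_Ioc,
        cond_apply (hms _), hset, ENNReal.toReal_mul, ENNReal.toReal_inv, ← measureReal_def,
        ← measureReal_def, measureReal_sdiff _ (hms _), hRG, hRG, hRG, inv_mul_eq_div]
      intro ω hω
      exact (mul_le_mul_of_nonneg_right hab' hx.le).trans_lt hω
  have h1 := (ProbabilityMeasure.tendsto_iff_forall_integral_tendsto.1 hconv) φ
  have h2 : ∀ x, ∫ r, φ r ∂(μs x : Measure ℝ) =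
      (∫ ω in {ω | y * x < R ω}, φ (x⁻¹ * R ω) ∂P) / G (y * x) := by
    intro x
    simp only [hμs, ProbabilityMeasure.coe_mk]
    rw [integral_map (by fun_prop) (by fun_prop), ProbabilityTheory.cond, integral_smul_measure,
      ← hRG, measureReal_def, ENNReal.toReal_inv, smul_eq_mul, inv_mul_eq_div]
  have h3 : ∫ r, φ r ∂(μ : Measure ℝ) = y ^ γ * ∫ r in Set.Ioi y, φ r ∂(powMeasure γ) := by
    simp only [hμ, ProbabilityMeasure.coe_mk]
    rw [integral_smul_measure, ENNReal.toReal_ofReal hy'.le, smul_eq_mul]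
  rw [h3] at h1
  simp_rw [h2] at h1
  have h4 := h1.mul (hG.ratio y hy)
  rw [mul_right_comm, ← Real.rpow_add hy, add_neg_cancel, Real.rpow_zero, one_mul] at h4
  refine h4.congr fun x => ?_
  have := hG.pos (y * x)
  field_simp

end OneSource

section VectorSource

variable {Ω ι : Type*} [MeasurableSpace Ω] [Fintype ι] {P : Measure Ω} [IsProbabilityMeasure P]
  {γ : ℝ} {G : ℝ → ℝ} {R : Ω → ℝ} {U : Ω → ι → ℝ}

/-- The limit for one variable, integrated over an independent vector of directions. -/
theorem tendsto_setIntegral_vector_source (hG : RegVarTail γ G) (hγ : 0 < γ) (hR : Measurable R)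
    (hU : Measurable U) (hind : IndepFun R U P)
    (hRG : ∀ x, P.real {ω | x < R ω} = G x) {y : ℝ} (hy : 0 < y)
    {f : (ι → ℝ) → ℝ} (hf : Continuous f) {C : ℝ} (hC : ∀ v, |f v| ≤ C) :
    Tendsto (fun x => (∫ ω in {ω | y * x < R ω}, f (fun q => x⁻¹ * (R ω * U ω q)) ∂P) / G x) atTop
      (𝓝 (∫ ω, ∫ r in Set.Ioi y, f (fun q => r * U ω q) ∂(powMeasure γ) ∂P)) := by
  have hms : ∀ z, MeasurableSet {ω | z < R ω} := fun z => measurableSet_lt measurable_const hR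
  have hC0 : 0 ≤ C := (abs_nonneg _).trans (hC 0)
  set h : ℝ → Ω → ℝ := fun x ω =>
    ∫ ω' in {ω' | y * x < R ω'}, f (fun q => x⁻¹ * (R ω' * U ω q)) ∂P with hh
  have h1 : ∀ x, ∫ ω in {ω | y * x < R ω}, f (fun q => x⁻¹ * (R ω * U ω q)) ∂P = ∫ ω, h x ω ∂P := by
    intro x
    have := integral_comp_of_indepFun hind hR hU
      (f := {p : ℝ × (ι → ℝ) | y * x < p.1}.indicator fun p => f fun q => x⁻¹ * (p.1 * p.2 q))
      (Measurable.indicator (hf.measurable.comp (by fun_prop)) (by measurability)) (C := C)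
      (fun p => by
        by_cases hp : y * x < p.1
        · rw [Set.indicator_of_mem (by exact hp)]; exact hC _
        · rw [Set.indicator_of_notMem (by exact hp)]; simpa using hC0)
    rw [← integral_indicator (hms _)]
    simp only [hh]
    simp_rw [← integral_indicator (hms _)]
    exact this
  have hbound : ∀ x ω, ‖h x ω‖ ≤ C * G (y * x) := by
    intro x ω
    have := norm_setIntegral_le_of_norm_le_const (μ := P) (s := {ω' | y * x < R ω'})
      (f := fun ω' => f (fun q => x⁻¹ * (R ω' * U ω q))) (C := C) (measure_lt_top _ _)
      (fun ω' _ => hC _)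
    rwa [hRG] at this
  have hmeas : ∀ x, Measurable (h x) := by
    intro x
    have hm : Measurable fun p : Ω × Ω => f (fun q => x⁻¹ * (R p.2 * U p.1 q)) :=
      hf.measurable.comp (by fun_prop)
    exact (hm.stronglyMeasurable.integral_prod_right
      (ν := P.restrict {ω' | y * x < R ω'})).measurable
  obtain ⟨C', -, hC'⟩ := hG.exists_eventually_le hy
  have key : Tendsto (fun x => ∫ ω, h x ω / G x ∂P) atTop
      (𝓝 (∫ ω, ∫ r in Set.Ioi y, f (fun q => r * U ω q) ∂(powMeasure γ) ∂P)) := by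
    refine tendsto_integral_filter_of_dominated_convergence (fun _ => C * C')
      (Eventually.of_forall fun x => ((hmeas x).div_const _).aestronglyMeasurable) ?_
      (integrable_const _)
      (Eventually.of_forall fun ω => ?_)
    · filter_upwards [hC'] with x hx
      refine Eventually.of_forall fun ω => ?_
      rw [norm_div, Real.norm_of_nonneg (hG.pos x).le, div_le_iff₀ (hG.pos x)]
      refine (hbound x ω).trans ?_
      rw [mul_assoc]
      gcongr
    · set φ : BoundedContinuousFunction ℝ ℝ := BoundedContinuousFunction.ofNormedAddCommGroup
        (fun r => f (fun q => r * U ω q)) (hf.comp (by fun_prop)) C (fun r => hC _)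
      refine (tendsto_setIntegral_source hG hγ hR hRG hy φ).congr fun x => ?_
      simp only [hh, φ, BoundedContinuousFunction.coe_ofNormedAddCommGroup, mul_assoc]
  refine key.congr fun x => ?_
  rw [h1, integral_div]

/-- The image of `γ r^{-γ-1} dr ⊗ P` under `(r, ω) ↦ r U(ω)`: the tail measure of the product of a
regularly varying variable with an independent vector `U`. -/
noncomputable def sourceMeasure (γ : ℝ) (P : Measure Ω) (U : Ω → ι → ℝ) : Measure (ι → ℝ) :=
  ((powMeasure γ).prod P).map fun p q => p.1 * U p.2 q

omit [Fintype ι] in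
theorem measurable_source (hU : Measurable U) :
    Measurable fun (p : ℝ × Ω) (q : ι) => p.1 * U p.2 q := by
  fun_prop

theorem prod_powMeasure_setOf_lt (hγ : 0 < γ) {N : Ω → ℝ} (hN : Measurable N) (hN0 : ∀ ω, 0 ≤ N ω)
    {a : ℝ} (ha : 0 < a) :
    ((powMeasure γ).prod P) {p | 0 < p.1 ∧ a < p.1 * N p.2} =
      ENNReal.ofReal (a ^ (-γ)) * ∫⁻ ω, ENNReal.ofReal (N ω ^ γ) ∂P := by
  rw [Measure.prod_apply_symm (by measurability), ← lintegral_const_mul _ (by fun_prop)]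
  refine lintegral_congr fun ω => ?_
  rcases (hN0 ω).eq_or_lt with h | h
  · rw [← h, Real.zero_rpow hγ.ne']
    simp [← h, ha.not_gt]
  · have : (fun r => (r, ω)) ⁻¹' {p : ℝ × Ω | 0 < p.1 ∧ a < p.1 * N p.2} = Set.Ioi (a / N ω) := by
      ext r
      simp only [Set.mem_preimage, Set.mem_ofPred_eq, Set.mem_Ioi, div_lt_iff₀ h,
        and_iff_right_iff_imp]
      intro hr
      by_contra hneg
      nlinarith
    rw [this, powMeasure_Ioi hγ (by positivity), ← ENNReal.ofReal_mul (by positivity),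
      Real.div_rpow ha.le h.le, Real.rpow_neg h.le, div_inv_eq_mul]

theorem ae_prod_powMeasure_pos : ∀ᵐ p ∂((powMeasure γ).prod P), 0 < p.1 := by
  rw [ae_iff]
  have : {p : ℝ × Ω | ¬ 0 < p.1} = Set.Iic 0 ×ˢ Set.univ := by
    ext p; simp
  rw [this, Measure.prod_prod, powMeasure_Iic_zero, zero_mul]

theorem prod_powMeasure_setOf_lt' (hγ : 0 < γ) {N : Ω → ℝ} (hN : Measurable N)
    (hN0 : ∀ ω, 0 ≤ N ω) {a : ℝ} (ha : 0 < a) :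
    ((powMeasure γ).prod P) {p | a < p.1 * N p.2} =
      ENNReal.ofReal (a ^ (-γ)) * ∫⁻ ω, ENNReal.ofReal (N ω ^ γ) ∂P := by
  rw [← prod_powMeasure_setOf_lt hγ hN hN0 ha]
  refine measure_congr ?_
  filter_upwards [ae_prod_powMeasure_pos (γ := γ) (P := P)] with p hp
  simp only [eq_iff_iff]
  exact ⟨fun h => ⟨hp, h⟩, fun h => h.2⟩

variable {f : (ι → ℝ) → ℝ} {C ε : ℝ}

theorem integrable_source (hγ : 0 < γ) (hU : Measurable U)
    (hmom : Integrable (fun ω => ‖U ω‖ ^ γ) P) (hf : Measurable f) (hC : ∀ v, |f v| ≤ C)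
    (hε : 0 < ε) (h0 : ∀ v, ‖v‖ ≤ ε → f v = 0) :
    Integrable (fun p : ℝ × Ω => f fun q => p.1 * U p.2 q) ((powMeasure γ).prod P) := by
  have hA : ((powMeasure γ).prod P) {p | ε < p.1 * ‖U p.2‖} < ⊤ := by
    rw [prod_powMeasure_setOf_lt' hγ hU.norm (fun _ => norm_nonneg _) hε]
    exact ENNReal.mul_lt_top ENNReal.ofReal_lt_top hmom.lintegral_lt_top
  have hAm : MeasurableSet {p : ℝ × Ω | ε < p.1 * ‖U p.2‖} := by measurability
  refine ((integrable_indicator_iff hAm).2 (integrableOn_const (C := C) hA.ne)).mono'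
    (hf.comp (measurable_source hU)).aestronglyMeasurable ?_
  filter_upwards [ae_prod_powMeasure_pos (γ := γ) (P := P)] with p hp
  by_cases h : ε < p.1 * ‖U p.2‖
  · rw [Set.indicator_of_mem (by exact h)]
    exact hC _
  · rw [Set.indicator_of_notMem (by exact h), h0, norm_zero]
    have : (fun q => p.1 * U p.2 q) = p.1 • U p.2 := by ext; simp
    rw [this, norm_smul, Real.norm_of_nonneg hp.le]
    exact not_lt.1 h

theorem integrable_sourceMeasure (hγ : 0 < γ) (hU : Measurable U)
    (hmom : Integrable (fun ω => ‖U ω‖ ^ γ) P) (hf : Measurable f) (hC : ∀ v, |f v| ≤ C)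
    (hε : 0 < ε) (h0 : ∀ v, ‖v‖ ≤ ε → f v = 0) :
    Integrable f (sourceMeasure γ P U) := by
  rw [sourceMeasure, integrable_map_measure hf.aestronglyMeasurable
    (measurable_source hU).aemeasurable]
  exact integrable_source hγ hU hmom hf hC hε h0

theorem tendsto_setIntegral_sourceMeasure (hγ : 0 < γ) (hU : Measurable U)
    (hmom : Integrable (fun ω => ‖U ω‖ ^ γ) P) (hf : Measurable f) (hC : ∀ v, |f v| ≤ C)
    (hε : 0 < ε) (h0 : ∀ v, ‖v‖ ≤ ε → f v = 0) :
    Tendsto (fun y => ∫ ω, ∫ r in Set.Ioi y, f (fun q => r * U ω q) ∂(powMeasure γ) ∂P) (𝓝[>] 0)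
      (𝓝 (∫ v, f v ∂(sourceMeasure γ P U))) := by
  have hi := integrable_source hγ hU hmom hf hC hε h0
  rw [sourceMeasure, integral_map (measurable_source hU).aemeasurable hf.aestronglyMeasurable]
  set F : ℝ × Ω → ℝ := fun p => f fun q => p.1 * U p.2 q
  have h1 : ∀ y, ∫ ω, ∫ r in Set.Ioi y, f (fun q => r * U ω q) ∂(powMeasure γ) ∂P
      = ∫ p, {p : ℝ × Ω | y < p.1}.indicator F p ∂((powMeasure γ).prod P) := by
    intro y
    have hm : MeasurableSet {p : ℝ × Ω | y < p.1} := by measurability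
    rw [integral_prod_symm _ (hi.indicator hm)]
    refine integral_congr_ae (Eventually.of_forall fun ω => ?_)
    simp only
    rw [← integral_indicator measurableSet_Ioi]
    rfl
  simp_rw [h1]
  refine tendsto_integral_filter_of_dominated_convergence (fun p => ‖F p‖)
    (Eventually.of_forall fun y => ?_) (Eventually.of_forall fun y => Eventually.of_forall fun p =>
      norm_indicator_le_norm_self _ _) hi.norm ?_
  · exact hi.aestronglyMeasurable.indicator (by measurability)
  · filter_upwards [ae_prod_powMeasure_pos (γ := γ) (P := P)] with p hp
    refine tendsto_const_nhds.congr' ?_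
    filter_upwards [nhdsWithin_le_nhds (eventually_lt_nhds hp)] with y hy
    rw [Set.indicator_of_mem (by exact hy)]

end VectorSource

/-! ### Vectors with finitely many large sources -/

/-- A random vector `V` whose large values are caused by one of finitely many large sources `R s`:
if `s` acts on the coordinate `q`, that is `I q s`, then `V q = R s * U s q` with `U s` independent
of `R s`. A large `|V q|` comes from a large source that acts on `q`, and two sources are not large
together. All sources have the same regularly varying tail `G`. -/
structure BigSource {Ω ι σ : Type*} [MeasurableSpace Ω] [Fintype ι] (P : Measure Ω) (γ : ℝ)
    (G : ℝ → ℝ) (V : Ω → ι → ℝ) (S : Finset σ) (I : ι → σ → Prop) (R : σ → Ω → ℝ)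
    (U : σ → Ω → ι → ℝ) : Prop where
  tail : RegVarTail γ G
  index_pos : 0 < γ
  measurable_V : Measurable V
  measurable_R : ∀ s, Measurable (R s)
  measurable_U : ∀ s, Measurable (U s)
  source_tail : ∀ s ∈ S, ∀ x, P.real {ω | x < R s ω} = G x
  indep : ∀ s ∈ S, IndepFun (R s) (U s) P
  factor : ∀ s ∈ S, ∀ q, I q s → ∀ᵐ ω ∂P, V ω q = R s ω * U s ω q
  zero : ∀ s ∈ S, ∀ q, ¬ I q s → ∀ ω, U s ω q = 0
  big : ∀ q, ∀ η : ℝ, 0 < η → ∃ y : ℝ, 0 < y ∧ ∀ᶠ x in atTop,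
    P.real {ω | x < |V ω q| ∧ ∀ s ∈ S, I q s → R s ω ≤ y * x} ≤ η * G x
  pair : ∀ s ∈ S, ∀ s' ∈ S, s ≠ s' → ∀ η : ℝ, 0 < η → ∀ᶠ x in atTop,
    P.real {ω | x < R s ω ∧ x < R s' ω} ≤ η * G x
  moment : ∀ s ∈ S, Integrable (fun ω => ‖U s ω‖ ^ γ) P

namespace BigSource

variable {Ω ι σ : Type*} [MeasurableSpace Ω] [Fintype ι] {P : Measure Ω} [IsProbabilityMeasure P]
  {γ : ℝ} {G : ℝ → ℝ} {V : Ω → ι → ℝ} {S : Finset σ} {I : ι → σ → Prop} {R : σ → Ω → ℝ}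
  {U : σ → Ω → ι → ℝ}

/-- A large value of `V` without a large source is improbable, once the level `y` that counts as large
for a source is small enough. -/
theorem eventually_unexplained (h : BigSource P γ G V S I R U) {ε η : ℝ} (hε : 0 < ε)
    (hη : 0 < η) : ∀ᶠ y in 𝓝[>] (0 : ℝ), ∀ᶠ x in atTop,
      P.real {ω | ∃ q, ε * x < |V ω q| ∧ ∀ s ∈ S, I q s → R s ω ≤ y * x} ≤ η * G x := by
  obtain ⟨C, hC, hCG⟩ := h.tail.exists_eventually_le hε
  set n : ℝ := Fintype.card ι + 1 with hn
  have hn0 : 0 < n := by positivity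
  have h1 : ∀ q, ∀ᶠ y in 𝓝[>] (0 : ℝ), ∀ᶠ x in atTop,
      P.real {ω | ε * x < |V ω q| ∧ ∀ s ∈ S, I q s → R s ω ≤ y * x} ≤ η / n * G x := by
    intro q
    obtain ⟨y₀, hy₀, hy⟩ := h.big q (η / (n * C)) (by positivity)
    filter_upwards [Ioo_mem_nhdsGT (mul_pos hy₀ hε)] with y hyy
    have := (tendsto_id.const_mul_atTop hε).eventually hy
    filter_upwards [this, hCG, eventually_gt_atTop 0] with x hx hxC hx0
    calc _ ≤ P.real {ω | ε * x < |V ω q| ∧ ∀ s ∈ S, I q s → R s ω ≤ y₀ * (ε * x)} := by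
          refine measureReal_mono ?_
          rintro ω ⟨h1, h2⟩
          refine ⟨h1, fun s hs hq => (h2 s hs hq).trans ?_⟩
          rw [← mul_assoc]
          exact mul_le_mul_of_nonneg_right hyy.2.le hx0.le
      _ ≤ η / (n * C) * G (ε * x) := hx
      _ ≤ η / (n * C) * (C * G x) := by gcongr
      _ = _ := by field_simp
  filter_upwards [eventually_all.2 h1] with y hy
  filter_upwards [eventually_all.2 hy] with x hx
  have hset : {ω | ∃ q, ε * x < |V ω q| ∧ ∀ s ∈ S, I q s → R s ω ≤ y * x} =
      ⋃ q, {ω | ε * x < |V ω q| ∧ ∀ s ∈ S, I q s → R s ω ≤ y * x} := by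
    ext ω; simp
  rw [hset]
  calc _ ≤ ∑ q, P.real {ω | ε * x < |V ω q| ∧ ∀ s ∈ S, I q s → R s ω ≤ y * x} :=
        measureReal_iUnion_fintype_le _
    _ ≤ ∑ _q : ι, η / n * G x := Finset.sum_le_sum fun q _ => hx q
    _ = (Fintype.card ι / n) * (η * G x) := by
        rw [Finset.sum_const, Finset.card_univ, nsmul_eq_mul]; ring
    _ ≤ 1 * (η * G x) := by
        have := h.tail.pos x
        gcongr
        rw [div_le_one hn0]; linarith
    _ = _ := one_mul _

theorem eventually_two_sources (h : BigSource P γ G V S I R U) {y η : ℝ} (hy : 0 < y)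
    (hη : 0 < η) : ∀ᶠ x in atTop,
      P.real {ω | ∃ s ∈ S, ∃ s' ∈ S, s ≠ s' ∧ y * x < R s ω ∧ y * x < R s' ω} ≤ η * G x := by
  classical
  obtain ⟨C, hC, hCG⟩ := h.tail.exists_eventually_le hy
  set T := (S ×ˢ S).filter fun p => p.1 ≠ p.2
  set n : ℝ := T.card + 1 with hn
  have hn0 : 0 < n := by positivity
  have h1 : ∀ p ∈ T, ∀ᶠ x in atTop,
      P.real {ω | y * x < R p.1 ω ∧ y * x < R p.2 ω} ≤ η / n * G x := by
    intro p hp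
    simp only [T, Finset.mem_filter, Finset.mem_product] at hp
    have := (tendsto_id.const_mul_atTop hy).eventually
      (h.pair p.1 hp.1.1 p.2 hp.1.2 hp.2 (η / (n * C)) (by positivity))
    filter_upwards [this, hCG] with x hx hxC
    calc _ ≤ η / (n * C) * G (y * x) := hx
      _ ≤ η / (n * C) * (C * G x) := by gcongr
      _ = _ := by field_simp
  filter_upwards [(Finset.eventually_all T).2 h1] with x hx
  have hset : {ω | ∃ s ∈ S, ∃ s' ∈ S, s ≠ s' ∧ y * x < R s ω ∧ y * x < R s' ω} ⊆
      ⋃ p ∈ T, {ω | y * x < R p.1 ω ∧ y * x < R p.2 ω} := by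
    rintro ω ⟨s, hs, s', hs', hne, h1, h2⟩
    simp only [Set.mem_iUnion]
    exact ⟨(s, s'), by simp [T, hs, hs', hne], h1, h2⟩
  calc _ ≤ _ := measureReal_mono hset (measure_ne_top _ _)
    _ ≤ ∑ p ∈ T, P.real {ω | y * x < R p.1 ω ∧ y * x < R p.2 ω} :=
        measureReal_biUnion_finset_le _ _
    _ ≤ ∑ _p ∈ T, η / n * G x := Finset.sum_le_sum fun p hp => hx p hp
    _ = (T.card / n) * (η * G x) := by
        rw [Finset.sum_const, nsmul_eq_mul]; ring
    _ ≤ 1 * (η * G x) := by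
        have := h.tail.pos x
        gcongr
        rw [div_le_one hn0]; linarith
    _ = _ := one_mul _

/-- The comparison of `f (V / x)` with the contributions of the single sources. Outside three bad
events, either no source exceeds `y x` and `f (V / x) = 0`, or exactly one source does, and then
`V` is close to the product of this source with its direction: the coordinates on which it does not
act are small, as all sources that act on them are below `y' x`. -/
theorem pointwise_bound {f : (ι → ℝ) → ℝ} {C ε η ρ x y y' : ℝ} (hC : ∀ v, |f v| ≤ C)
    (h0 : ∀ v, ‖v‖ ≤ ε → f v = 0) (hρ : ∀ v w, dist v w ≤ ρ → |f v - f w| ≤ η)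
    (hρ0 : 0 ≤ ρ) (hε0 : 0 ≤ ε) (hη : 0 ≤ η)
    (hx : 0 < x) (hy : y' ≤ y) {v : ι → ℝ} {R : σ → ℝ} {u : σ → ι → ℝ}
    (hfac : ∀ s ∈ S, ∀ q, I q s → v q = R s * u s q) (hzero : ∀ s ∈ S, ∀ q, ¬ I q s → u s q = 0) :
    |f (fun q => x⁻¹ * v q) -
        ∑ s ∈ S, {s | y * x < R s}.indicator (fun s => f fun q => x⁻¹ * (R s * u s q)) s| ≤
      η * ∑ s ∈ S, {s | y * x < R s}.indicator 1 s + C * (1 + S.card) *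
        ({R : σ → ℝ | ∃ q, ε * x < |v q| ∧ ∀ s ∈ S, I q s → R s ≤ y * x}.indicator 1 R +
          {R : σ → ℝ | ∃ q, ρ * x < |v q| ∧ ∀ s ∈ S, I q s → R s ≤ y' * x}.indicator 1 R +
          {R : σ → ℝ | ∃ s ∈ S, ∃ s' ∈ S, s ≠ s' ∧ y' * x < R s ∧ y' * x < R s'}.indicator 1 R) :=
        by
  classical
  have hC0 : 0 ≤ C := (abs_nonneg _).trans (hC 0)
  have hsum0 : 0 ≤ η * ∑ s ∈ S, {s | y * x < R s}.indicator (1 : σ → ℝ) s :=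
    mul_nonneg hη (Finset.sum_nonneg fun s _ => Set.indicator_nonneg (fun _ _ => zero_le_one) _)
  have hind : ∀ A : Set (σ → ℝ), 0 ≤ A.indicator (1 : (σ → ℝ) → ℝ) R := fun A =>
    Set.indicator_nonneg (fun _ _ => zero_le_one) _
  set B₁ := {R : σ → ℝ | ∃ q, ε * x < |v q| ∧ ∀ s ∈ S, I q s → R s ≤ y * x}
  set B₂ := {R : σ → ℝ | ∃ q, ρ * x < |v q| ∧ ∀ s ∈ S, I q s → R s ≤ y' * x}
  set B₃ := {R : σ → ℝ | ∃ s ∈ S, ∃ s' ∈ S, s ≠ s' ∧ y' * x < R s ∧ y' * x < R s'}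
  by_cases hbad : R ∈ B₁ ∨ R ∈ B₂ ∨ R ∈ B₃
  · have h1 : (1 : ℝ) ≤ B₁.indicator 1 R + B₂.indicator 1 R + B₃.indicator 1 R := by
      have e1 := hind B₁
      have e2 := hind B₂
      have e3 := hind B₃
      rcases hbad with hb | hb | hb
      all_goals
        have := Set.indicator_of_mem hb (1 : (σ → ℝ) → ℝ)
        simp only [Pi.one_apply] at this
        linarith
    have h2 : |f (fun q => x⁻¹ * v q) -
        ∑ s ∈ S, {s | y * x < R s}.indicator (fun s => f fun q => x⁻¹ * (R s * u s q)) s| ≤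
        C * (1 + S.card) := by
      refine (abs_sub _ _).trans ?_
      rw [mul_add, mul_one]
      refine add_le_add (hC _) ((Finset.abs_sum_le_sum_abs _ _).trans ?_)
      rw [mul_comm C, ← nsmul_eq_mul]
      refine Finset.sum_le_card_nsmul _ _ _ fun s _ => ?_
      by_cases hs : y * x < R s
      · rw [Set.indicator_of_mem (by exact hs)]; exact hC _
      · rw [Set.indicator_of_notMem (by exact hs)]; simpa using hC0
    have h3 : 0 ≤ C * (1 + (S.card : ℝ)) := by positivity
    nlinarith
  · push Not at hbad
    obtain ⟨hb1, hb2, hb3⟩ := hbad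
    rw [Set.indicator_of_notMem hb1, Set.indicator_of_notMem hb2, Set.indicator_of_notMem hb3]
    simp only [add_zero, mul_zero]
    by_cases hex : ∃ s₀ ∈ S, y * x < R s₀
    · obtain ⟨s₀, hs₀, hR₀⟩ := hex
      have hyx : y' * x ≤ y * x := mul_le_mul_of_nonneg_right hy hx.le
      have huniq : ∀ s ∈ S, s ≠ s₀ → R s ≤ y' * x := by
        intro s hs hne
        by_contra hlt
        exact hb3 ⟨s, hs, s₀, hs₀, hne, not_le.1 hlt, hyx.trans_lt hR₀⟩
      rw [Finset.sum_eq_single_of_mem s₀ hs₀ fun s hs hne => Set.indicator_of_notMem (by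
          simpa using (huniq s hs hne).trans hyx) _,
        Finset.sum_eq_single_of_mem s₀ hs₀ fun s hs hne => Set.indicator_of_notMem (by
          simpa using (huniq s hs hne).trans hyx) _,
        Set.indicator_of_mem (by exact hR₀), Set.indicator_of_mem (by exact hR₀), Pi.one_apply,
        mul_one]
      refine hρ _ _ ((dist_pi_le_iff hρ0).2 fun q => ?_)
      by_cases hq : I q s₀
      · rw [hfac s₀ hs₀ q hq, dist_self]; exact hρ0
      · rw [hzero s₀ hs₀ q hq, mul_zero, mul_zero, dist_zero_right, Real.norm_eq_abs, abs_mul,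
          abs_of_pos (inv_pos.2 hx), inv_mul_le_iff₀ hx, mul_comm]
        by_contra hlt
        refine hb2 ⟨q, not_le.1 hlt, fun s hs hqs => huniq s hs ?_⟩
        rintro rfl
        exact hq hqs
    · push Not at hex
      rw [Finset.sum_eq_zero fun s hs => Set.indicator_of_notMem (by simpa using hex s hs) _,
        sub_zero, h0, abs_zero]
      · exact hsum0
      · refine (pi_norm_le_iff_of_nonneg hε0).2 fun q => ?_
        rw [Real.norm_eq_abs, abs_mul, abs_of_pos (inv_pos.2 hx), inv_mul_le_iff₀ hx, mul_comm]
        by_contra hlt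
        exact hb1 ⟨q, not_le.1 hlt, fun s hs _ => hex s hs⟩

end BigSource

namespace BigSource

variable {Ω ι σ : Type*} [MeasurableSpace Ω] [Fintype ι] {P : Measure Ω} [IsProbabilityMeasure P]
  {γ : ℝ} {G : ℝ → ℝ} {V : Ω → ι → ℝ} {S : Finset σ} {I : ι → σ → Prop} {R : σ → Ω → ℝ}
  {U : σ → Ω → ι → ℝ}

theorem abs_integral_sub_le [Countable σ] (h : BigSource P γ G V S I R U) {f : (ι → ℝ) → ℝ}
    {C ε η ρ x y y' : ℝ} (hf : Continuous f) (hC : ∀ v, |f v| ≤ C)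
    (h0 : ∀ v, ‖v‖ ≤ ε → f v = 0) (hρ : ∀ v w, dist v w ≤ ρ → |f v - f w| ≤ η)
    (hρ0 : 0 ≤ ρ) (hε0 : 0 ≤ ε) (hη : 0 ≤ η) (hx : 0 < x) (hy : y' ≤ y) :
    |∫ ω, f (fun q => x⁻¹ * V ω q) ∂P -
        ∑ s ∈ S, ∫ ω in {ω | y * x < R s ω}, f (fun q => x⁻¹ * (R s ω * U s ω q)) ∂P| ≤
      η * (S.card * G (y * x)) + C * (1 + S.card) *
        (P.real {ω | ∃ q, ε * x < |V ω q| ∧ ∀ s ∈ S, I q s → R s ω ≤ y * x} +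
          P.real {ω | ∃ q, ρ * x < |V ω q| ∧ ∀ s ∈ S, I q s → R s ω ≤ y' * x} +
          P.real {ω | ∃ s ∈ S, ∃ s' ∈ S, s ≠ s' ∧ y' * x < R s ω ∧ y' * x < R s' ω}) := by
  have hV := h.measurable_V
  have hR := h.measurable_R
  have hU := h.measurable_U
  have hA : ∀ s, MeasurableSet {ω | y * x < R s ω} := fun s =>
    measurableSet_lt measurable_const (hR s)
  have hB : ∀ a b : ℝ, MeasurableSet
      {ω | ∃ q, a * x < |V ω q| ∧ ∀ s ∈ S, I q s → R s ω ≤ b * x} := by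
    intro a b
    measurability
  have hB₃ : MeasurableSet
      {ω | ∃ s ∈ S, ∃ s' ∈ S, s ≠ s' ∧ y' * x < R s ω ∧ y' * x < R s' ω} := by
    measurability
  have hi1 : Integrable (fun ω => f (fun q => x⁻¹ * V ω q)) P :=
    Integrable.of_bound (hf.measurable.comp (by fun_prop)).aestronglyMeasurable C
      (Eventually.of_forall fun ω => hC _)
  have hi2 : ∀ s ∈ S, Integrable ({ω | y * x < R s ω}.indicator
      fun ω => f (fun q => x⁻¹ * (R s ω * U s ω q))) P := fun s _ =>
    (Integrable.of_bound (hf.measurable.comp (by fun_prop)).aestronglyMeasurable C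
      (Eventually.of_forall fun ω => hC _)).indicator (hA s)
  have hi3 : ∀ {A : Set Ω}, MeasurableSet A → Integrable (A.indicator (1 : Ω → ℝ)) P :=
    fun hA => (integrable_const (1 : ℝ)).indicator hA
  simp_rw [← fun s => integral_indicator (μ := P)
    (f := fun ω => f (fun q => x⁻¹ * (R s ω * U s ω q))) (hA s)]
  rw [← integral_finsetSum _ hi2, ← integral_sub hi1 (integrable_finsetSum _ hi2)]
  have hle : ∀ᵐ ω ∂P, |f (fun q => x⁻¹ * V ω q) - ∑ s ∈ S, {ω | y * x < R s ω}.indicator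
      (fun ω => f (fun q => x⁻¹ * (R s ω * U s ω q))) ω| ≤
      η * ∑ s ∈ S, {ω | y * x < R s ω}.indicator 1 ω + C * (1 + S.card) *
        ({ω | ∃ q, ε * x < |V ω q| ∧ ∀ s ∈ S, I q s → R s ω ≤ y * x}.indicator 1 ω +
          {ω | ∃ q, ρ * x < |V ω q| ∧ ∀ s ∈ S, I q s → R s ω ≤ y' * x}.indicator 1 ω +
          {ω | ∃ s ∈ S, ∃ s' ∈ S, s ≠ s' ∧ y' * x < R s ω ∧ y' * x < R s' ω}.indicator 1 ω) := by
    have hfac : ∀ᵐ ω ∂P, ∀ s ∈ S, ∀ q, I q s → V ω q = R s ω * U s ω q :=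
      (ae_ball_iff S.countable_toSet).2 fun s hs => ae_all_iff.2 fun q => by
        by_cases hq : I q s
        · filter_upwards [h.factor s hs q hq] with ω hω _ using hω
        · exact Eventually.of_forall fun ω hq' => absurd hq' hq
    filter_upwards [hfac] with ω hω
    have := pointwise_bound (S := S) (I := I) (R := fun s => R s ω) (u := fun s => U s ω)
      (v := V ω) hC h0 hρ hρ0 hε0 hη hx hy hω (fun s hs q hq => h.zero s hs q hq ω)
    exact this
  have hj1 : Integrable (fun ω => η * ∑ s ∈ S, {ω | y * x < R s ω}.indicator 1 ω) P :=
    (integrable_finsetSum _ fun s _ => hi3 (hA s)).const_mul _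
  have hj3 : Integrable (fun ω =>
      {ω | ∃ q, ε * x < |V ω q| ∧ ∀ s ∈ S, I q s → R s ω ≤ y * x}.indicator (1 : Ω → ℝ) ω +
        {ω | ∃ q, ρ * x < |V ω q| ∧ ∀ s ∈ S, I q s → R s ω ≤ y' * x}.indicator 1 ω) P :=
    (hi3 (hB _ _)).add (hi3 (hB _ _))
  have hj2 : Integrable (fun ω => C * (1 + S.card) *
        ({ω | ∃ q, ε * x < |V ω q| ∧ ∀ s ∈ S, I q s → R s ω ≤ y * x}.indicator 1 ω +
          {ω | ∃ q, ρ * x < |V ω q| ∧ ∀ s ∈ S, I q s → R s ω ≤ y' * x}.indicator 1 ω +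
          {ω | ∃ s ∈ S, ∃ s' ∈ S, s ≠ s' ∧ y' * x < R s ω ∧ y' * x < R s' ω}.indicator 1 ω)) P :=
    (hj3.add (hi3 hB₃)).const_mul _
  refine (abs_integral_le_integral_abs).trans ((integral_mono_ae
    (hi1.sub (integrable_finsetSum _ hi2)).abs ?_ hle).trans_eq ?_)
  · exact hj1.add hj2
  · rw [integral_add hj1 hj2, integral_const_mul, integral_const_mul,
      integral_finsetSum _ (fun s _ => hi3 (hA s)), integral_add hj3 (hi3 hB₃),
      integral_add (hi3 (hB _ _)) (hi3 (hB _ _)), integral_indicator_one (hB _ _),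
      integral_indicator_one (hB _ _), integral_indicator_one hB₃]
    congr 2
    rw [← nsmul_eq_mul, ← Finset.sum_const]
    refine Finset.sum_congr rfl fun s hs => ?_
    rw [integral_indicator_one (hA s), h.source_tail s hs]

/-- The tail measure of a vector with big sources: the sum of the tail measures of the products
`R s * U s`. -/
noncomputable def _root_.limitMeasure (γ : ℝ) (P : Measure Ω) (S : Finset σ) (U : σ → Ω → ι → ℝ) :
    Measure (ι → ℝ) :=
  ∑ s ∈ S, sourceMeasure γ P (U s)

theorem integrable_limitMeasure (h : BigSource P γ G V S I R U) {f : (ι → ℝ) → ℝ} {C ε : ℝ}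
    (hf : Measurable f) (hC : ∀ v, |f v| ≤ C) (hε : 0 < ε) (h0 : ∀ v, ‖v‖ ≤ ε → f v = 0) :
    Integrable f (limitMeasure γ P S U) :=
  integrable_finsetSum_measure.2 fun s hs =>
    integrable_sourceMeasure h.index_pos (h.measurable_U s) (h.moment s hs) hf hC hε h0

/-- Rescaled expectations of a vector with big sources converge to the integral over the sum of the
tail measures of the sources. -/
theorem tendsto_integral [Countable σ] (h : BigSource P γ G V S I R U) {f : (ι → ℝ) → ℝ} {C ε : ℝ}
    (hf : UniformContinuous f) (hC : ∀ v, |f v| ≤ C) (hε : 0 < ε) (h0 : ∀ v, ‖v‖ ≤ ε → f v = 0) :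
    Tendsto (fun x => (∫ ω, f (fun q => x⁻¹ * V ω q) ∂P) / G x) atTop
      (𝓝 (∫ v, f v ∂(limitMeasure γ P S U))) := by
  have hC0 : 0 ≤ C := (abs_nonneg _).trans (hC 0)
  rw [limitMeasure, integral_finsetSum_measure fun s hs =>
    integrable_sourceMeasure h.index_pos (h.measurable_U s) (h.moment s hs)
      hf.continuous.measurable hC hε h0]
  set L : σ → ℝ := fun s => ∫ v, f v ∂(sourceMeasure γ P (U s))
  set n : ℝ := (S.card : ℝ) with hn
  set K : ℝ := n + C * (1 + n) * 3 + 2 * n + 1 with hK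
  have hK0 : 0 < K := by positivity
  suffices H : ∀ η : ℝ, 0 < η → ∀ᶠ x in atTop,
      |(∫ ω, f (fun q => x⁻¹ * V ω q) ∂P) / G x - ∑ s ∈ S, L s| ≤ (K - 1) * η by
    rw [Metric.tendsto_nhds]
    intro δ hδ
    filter_upwards [H (δ / K) (by positivity)] with x hx
    rw [Real.dist_eq]
    refine hx.trans_lt ?_
    rw [mul_div_assoc', div_lt_iff₀ hK0]
    nlinarith
  intro η hη
  -- The cut-off `y` below which a source is ignored is fixed first, then the modulus `ρ`.
  obtain ⟨y, ⟨hy1, hy2⟩, hy0⟩ := ((h.eventually_unexplained hε hη).and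
    ((Finset.eventually_all S).2 fun s hs => (Metric.tendsto_nhds.1
      (tendsto_setIntegral_sourceMeasure h.index_pos (h.measurable_U s) (h.moment s hs)
        hf.continuous.measurable hC hε h0) η hη)) |>.and self_mem_nhdsWithin).exists
  have hy0 : 0 < y := hy0
  obtain ⟨Cy, hCy, hCyG⟩ := h.tail.exists_eventually_le hy0
  obtain ⟨ρ₀, hρ₀, hρ⟩ := Metric.uniformContinuous_iff.1 hf (η / Cy) (by positivity)
  obtain ⟨y', ⟨hy'1, hy'2⟩, hy'0⟩ := ((h.eventually_unexplained (half_pos hρ₀) hη).and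
    (nhdsWithin_le_nhds (eventually_lt_nhds hy0)) |>.and self_mem_nhdsWithin).exists
  have hy'0 : 0 < y' := hy'0
  have hsrc : ∀ s ∈ S, ∀ᶠ x in atTop,
      dist ((∫ ω in {ω | y * x < R s ω}, f (fun q => x⁻¹ * (R s ω * U s ω q)) ∂P) / G x)
        (∫ ω, ∫ r in Set.Ioi y, f (fun q => r * U s ω q) ∂(powMeasure γ) ∂P) < η := fun s hs =>
    Metric.tendsto_nhds.1 (tendsto_setIntegral_vector_source h.tail h.index_pos (h.measurable_R s)
      (h.measurable_U s) (h.indep s hs) (h.source_tail s hs) hy0 hf.continuous hC) η hη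
  filter_upwards [eventually_gt_atTop 0, hy1, hCyG, hy'1, h.eventually_two_sources hy'0 hη,
    (Finset.eventually_all S).2 hsrc] with x hx h1 hCx h2 h3 h4
  have hGx := h.tail.pos x
  have hD := h.abs_integral_sub_le (x := x) (y := y) (y' := y') (η := η / Cy) (ρ := ρ₀ / 2)
    hf.continuous hC h0
    (fun v w hvw => (hρ (lt_of_le_of_lt hvw (half_lt_self hρ₀))).le) (by positivity) hε.le
    (by positivity) hx hy'2.le
  set E := ∫ ω, f (fun q => x⁻¹ * V ω q) ∂P
  set A : σ → ℝ := fun s =>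
    ∫ ω in {ω | y * x < R s ω}, f (fun q => x⁻¹ * (R s ω * U s ω q)) ∂P
  set Ly : σ → ℝ := fun s =>
    ∫ ω, ∫ r in Set.Ioi y, f (fun q => r * U s ω q) ∂(powMeasure γ) ∂P
  have hD' : |E - ∑ s ∈ S, A s| ≤ (n + C * (1 + n) * 3) * η * G x := by
    refine hD.trans ?_
    calc _ ≤ η / Cy * (n * (Cy * G x)) + C * (1 + n) * (η * G x + η * G x + η * G x) := by
          gcongr
      _ = _ := by field_simp; ring
  have e1 : |E / G x - ∑ s ∈ S, A s / G x| ≤ (n + C * (1 + n) * 3) * η := by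
    rw [← Finset.sum_div, ← sub_div, abs_div, abs_of_pos hGx, div_le_iff₀ hGx]
    exact hD'
  have e2 : |∑ s ∈ S, A s / G x - ∑ s ∈ S, L s| ≤ 2 * n * η := by
    rw [← Finset.sum_sub_distrib]
    refine (Finset.abs_sum_le_sum_abs _ _).trans ?_
    have : ∀ s ∈ S, |A s / G x - L s| ≤ 2 * η := by
      intro s hs
      have a1 := h4 s hs
      have a2 := hy2 s hs
      rw [Real.dist_eq] at a1 a2
      have : |A s / G x - L s| ≤ |A s / G x - Ly s| + |Ly s - L s| := abs_sub_le _ _ _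
      linarith
    refine (Finset.sum_le_card_nsmul _ _ _ this).trans_eq ?_
    rw [nsmul_eq_mul]; ring
  have e3 := abs_sub_le (E / G x) (∑ s ∈ S, A s / G x) (∑ s ∈ S, L s)
  rw [hK]
  linarith

end BigSource

/-! ### Gauges -/

/-- The continuous, piecewise linear function that is `0` up to `a` and `1` from `b` on. -/
noncomputable def ramp (a b t : ℝ) : ℝ := max 0 (min 1 ((t - a) / (b - a)))

section Ramp

variable {a b t : ℝ}

theorem ramp_nonneg : 0 ≤ ramp a b t := le_max_left _ _

theorem ramp_le_one : ramp a b t ≤ 1 := max_le zero_le_one (min_le_left _ _)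

theorem abs_ramp_le_one : |ramp a b t| ≤ 1 := by
  rw [abs_of_nonneg ramp_nonneg]; exact ramp_le_one

theorem ramp_of_le (hab : a < b) (h : t ≤ a) : ramp a b t = 0 :=
  max_eq_left ((min_le_right _ _).trans (div_nonpos_of_nonpos_of_nonneg (by linarith)
    (by linarith)))

theorem ramp_of_ge (hab : a < b) (h : b ≤ t) : ramp a b t = 1 := by
  rw [ramp, min_eq_left, max_eq_right zero_le_one]
  rw [one_le_div (by linarith)]; linarith

theorem uniformContinuous_ramp (a b : ℝ) : UniformContinuous (ramp a b) := by
  have h1 : UniformContinuous fun t : ℝ => (t - a) / (b - a) := by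
    have : LipschitzWith (Real.toNNReal |(b - a)⁻¹|) fun t : ℝ => (t - a) / (b - a) := by
      refine LipschitzWith.of_dist_le_mul fun s t => ?_
      rw [Real.coe_toNNReal _ (abs_nonneg _), Real.dist_eq, Real.dist_eq, ← sub_div,
        sub_sub_sub_cancel_right, div_eq_inv_mul, abs_mul]
    exact this.uniformContinuous
  have h2 : LipschitzWith 1 fun t : ℝ => max 0 (min 1 t) :=
    (LipschitzWith.id.const_min 1).const_max 0
  exact h2.uniformContinuous.comp h1

end Ramp

theorem UniformContinuous.mul_of_bounded' {E : Type*} [PseudoMetricSpace E] {f g : E → ℝ}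
    (hf : UniformContinuous f) (hg : UniformContinuous g) {C D : ℝ} (hC : ∀ v, |f v| ≤ C)
    (hD : ∀ v, |g v| ≤ D) : UniformContinuous fun v => f v * g v := by
  rw [Metric.uniformContinuous_iff] at hf hg ⊢
  intro ε hε
  rcases isEmpty_or_nonempty E with hE | ⟨⟨v₀⟩⟩
  · exact ⟨1, one_pos, fun {a} => hE.elim a⟩
  have hC0 : 0 ≤ C := (abs_nonneg _).trans (hC v₀)
  have hD0 : 0 ≤ D := (abs_nonneg _).trans (hD v₀)
  obtain ⟨δ₁, h1, H1⟩ := hf (ε / (C + D + 1)) (by positivity)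
  obtain ⟨δ₂, h2, H2⟩ := hg (ε / (C + D + 1)) (by positivity)
  refine ⟨min δ₁ δ₂, lt_min h1 h2, fun {v w} hvw => ?_⟩
  have e1 := H1 (hvw.trans_le (min_le_left _ _))
  have e2 := H2 (hvw.trans_le (min_le_right _ _))
  rw [Real.dist_eq] at e1 e2 ⊢
  have : f v * g v - f w * g w = (f v - f w) * g v + f w * (g v - g w) := by ring
  rw [this]
  calc |(f v - f w) * g v + f w * (g v - g w)| ≤ |f v - f w| * |g v| + |f w| * |g v - g w| := by
        rw [← abs_mul, ← abs_mul]; exact abs_add_le _ _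
    _ ≤ ε / (C + D + 1) * D + C * (ε / (C + D + 1)) := by
        gcongr
        · exact hD v
        · exact hC w
    _ = ε * ((C + D) / (C + D + 1)) := by ring
    _ < ε * 1 := by
        gcongr
        rw [div_lt_one (by positivity)]; linarith
    _ = ε := mul_one _

/-- A nonnegative, positively homogeneous function with Lipschitz constant one for the maximum
norm. -/
structure IsGauge {ι : Type*} [Fintype ι] (N : (ι → ℝ) → ℝ) : Prop where
  nonneg : ∀ v, 0 ≤ N v
  lipschitz : LipschitzWith 1 N
  homogeneous : ∀ r : ℝ, 0 ≤ r → ∀ v, N (fun q => r * v q) = r * N v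

namespace IsGauge

variable {ι : Type*} [Fintype ι] {N : (ι → ℝ) → ℝ}

theorem zero (hN : IsGauge N) : N 0 = 0 := by
  have := hN.homogeneous 0 le_rfl 0
  simp only [zero_mul] at this
  exact this

theorem le_norm (hN : IsGauge N) (v : ι → ℝ) : N v ≤ ‖v‖ := by
  have := hN.lipschitz.dist_le_mul v 0
  rw [hN.zero, dist_zero_right, dist_zero_right, Real.norm_of_nonneg (hN.nonneg v)] at this
  simpa using this

theorem measurable (hN : IsGauge N) : Measurable N := hN.lipschitz.continuous.measurable

end IsGauge

theorem isGauge_norm {ι : Type*} [Fintype ι] : IsGauge (fun v : ι → ℝ => ‖v‖) where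
  nonneg _ := norm_nonneg _
  lipschitz := lipschitzWith_one_norm
  homogeneous r hr v := by
    have : (fun q => r * v q) = r • v := rfl
    rw [this, norm_smul, Real.norm_of_nonneg hr]

theorem measurable_toEReal {ι : Type*} : Measurable fun (v : ι → ℝ) (q : ι) => (v q : EReal) := by
  fun_prop

theorem continuous_toEReal {ι : Type*} : Continuous fun (v : ι → ℝ) (q : ι) => (v q : EReal) :=
  continuous_pi fun q => continuous_coe_real_ereal.comp (continuous_apply q)

/-- A continuous function on the compact space `[-∞, ∞]^ι` is uniformly continuous on `ℝ^ι`: points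
of `ℝ^ι` that get close to each other have the same limit points in `[-∞, ∞]^ι`. -/
theorem uniformContinuous_comp_toEReal {ι : Type*} [Fintype ι] (f : C(ι → EReal, ℝ)) :
    UniformContinuous fun v : ι → ℝ => f fun q => (v q : EReal) := by
  rw [Metric.uniformContinuous_iff]
  by_contra hcon
  push Not at hcon
  obtain ⟨ε, hε, H⟩ := hcon
  choose v w hvw hf using fun n : ℕ => H (1 / ((n : ℝ) + 1)) (by positivity)
  obtain ⟨z, -, φ, hφ, hz⟩ := (isCompact_univ (X := ι → EReal)).tendsto_subseq
    (x := fun n q => (v n q : EReal)) (fun _ => Set.mem_univ _)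
  have hw : Tendsto (fun n q => (w (φ n) q : EReal)) atTop (𝓝 z) := by
    rw [tendsto_pi_nhds] at hz ⊢
    intro q
    have hd : Tendsto (fun n => w (φ n) q - v (φ n) q) atTop (𝓝 0) := by
      refine squeeze_zero_norm (fun n => ?_)
        (tendsto_one_div_add_atTop_nhds_zero_nat.comp hφ.tendsto_atTop)
      have := (dist_le_pi_dist (v (φ n)) (w (φ n)) q).trans (hvw (φ n)).le
      rw [dist_comm, Real.dist_eq] at this
      exact this
    have hd' : Tendsto (fun n => ((w (φ n) q - v (φ n) q : ℝ) : EReal)) atTop (𝓝 (0 : ℝ)) :=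
      (continuous_coe_real_ereal.tendsto _).comp hd
    have hadd := (EReal.continuousAt_add (p := (z q, ((0 : ℝ) : EReal)))
      (by simp) (by simp)).tendsto.comp ((hz q).prodMk_nhds hd')
    simp only [EReal.coe_zero, add_zero] at hadd
    refine hadd.congr fun n => ?_
    simp only [Function.comp_apply]
    rw [← EReal.coe_add, add_sub_cancel]
  have h1 := ((f.continuous.tendsto z).comp hz).dist ((f.continuous.tendsto z).comp hw)
  rw [dist_self] at h1
  obtain ⟨n, hn⟩ := (h1.eventually_lt_const hε).exists
  exact absurd hn (not_lt.2 (hf (φ n)))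

/-! ### The tail measure on the sets where a gauge is large -/

section

variable {Ω ι : Type*} [MeasurableSpace Ω] [Fintype ι] {P : Measure Ω} [IsProbabilityMeasure P]
  {γ : ℝ} {U : Ω → ι → ℝ} {N : (ι → ℝ) → ℝ}

omit [IsProbabilityMeasure P] in
theorem IsGauge.integrable_rpow (hN : IsGauge N) (hγ : 0 < γ) (hU : Measurable U)
    (hmom : Integrable (fun ω => ‖U ω‖ ^ γ) P) : Integrable (fun ω => N (U ω) ^ γ) P := by
  refine hmom.mono' ((hN.measurable.comp hU).pow_const γ).aestronglyMeasurable
    (Eventually.of_forall fun ω => ?_)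
  rw [Real.norm_of_nonneg (Real.rpow_nonneg (hN.nonneg _) _)]
  exact Real.rpow_le_rpow (hN.nonneg _) (hN.le_norm _) hγ.le

theorem sourceMeasure_gauge_lt (hN : IsGauge N) (hγ : 0 < γ) (hU : Measurable U)
    (hmom : Integrable (fun ω => ‖U ω‖ ^ γ) P) {a : ℝ} (ha : 0 < a) :
    sourceMeasure γ P U {v | a < N v} = ENNReal.ofReal (a ^ (-γ) * ∫ ω, N (U ω) ^ γ ∂P) := by
  rw [sourceMeasure, Measure.map_apply (measurable_source hU)
    (measurableSet_lt measurable_const hN.measurable), ENNReal.ofReal_mul (by positivity),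
    ofReal_integral_eq_lintegral_ofReal (hN.integrable_rpow hγ hU hmom)
      (Eventually.of_forall fun ω => Real.rpow_nonneg (hN.nonneg _) _),
    ← prod_powMeasure_setOf_lt (N := fun ω => N (U ω)) hγ (hN.measurable.comp hU)
      (fun ω => hN.nonneg _) ha]
  refine measure_congr (eventuallyEq_set.2 ?_)
  filter_upwards [ae_prod_powMeasure_pos (γ := γ) (P := P)] with p hp
  simp only [Set.mem_preimage, Set.mem_ofPred_eq, hN.homogeneous _ hp.le, hp, true_and]

omit [Fintype ι] in
theorem sourceMeasure_smul (hU : Measurable U) {c : ℝ} (hc : 0 < c) {D : Set (ι → ℝ)}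
    (hD : MeasurableSet D) :
    sourceMeasure γ P U {v | (fun q => c⁻¹ * v q) ∈ D} =
      ENNReal.ofReal (c ^ (-γ)) * sourceMeasure γ P U D := by
  have hm : Measurable fun (v : ι → ℝ) q => c⁻¹ * v q := by fun_prop
  have hD' : MeasurableSet {v : ι → ℝ | (fun q => c⁻¹ * v q) ∈ D} := hm hD
  rw [sourceMeasure, Measure.map_apply (measurable_source hU) hD',
    Measure.map_apply (measurable_source hU) hD]
  have h1 : ((powMeasure γ).prod P).map (Prod.map (fun r => c⁻¹ * r) id) =
      ENNReal.ofReal (c ^ (-γ)) • (powMeasure γ).prod P := by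
    rw [← Measure.map_prod_map _ _ (by fun_prop) measurable_id, Measure.map_id,
      map_mul_powMeasure γ (inv_pos.2 hc), Measure.prod_smul_left, Real.inv_rpow hc.le,
      Real.rpow_neg hc.le]
  rw [← smul_eq_mul, ← Measure.smul_apply, ← h1,
    Measure.map_apply (by fun_prop) (measurable_source hU hD)]
  congr 1
  ext p
  simp only [Set.mem_preimage, Set.mem_ofPred_eq, Prod.map_fst, Prod.map_snd, id, mul_assoc]

end

namespace BigSource

variable {Ω ι σ : Type*} [MeasurableSpace Ω] [Fintype ι] {P : Measure Ω} [IsProbabilityMeasure P]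
  {γ : ℝ} {G : ℝ → ℝ} {V : Ω → ι → ℝ} {S : Finset σ} {I : ι → σ → Prop} {R : σ → Ω → ℝ}
  {U : σ → Ω → ι → ℝ} {N : (ι → ℝ) → ℝ}

/-- The constant `lim P (N V > x) / G x`. -/
noncomputable def _root_.tailConst (γ : ℝ) (P : Measure Ω) (S : Finset σ) (U : σ → Ω → ι → ℝ)
    (N : (ι → ℝ) → ℝ) : ℝ :=
  ∑ s ∈ S, ∫ ω, N (U s ω) ^ γ ∂P

omit [IsProbabilityMeasure P] in
theorem tailConst_nonneg (hN : IsGauge N) : 0 ≤ tailConst γ P S U N :=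
  Finset.sum_nonneg fun _ _ => integral_nonneg fun _ => Real.rpow_nonneg (hN.nonneg _) _

theorem limitMeasure_gauge_lt (h : BigSource P γ G V S I R U) (hN : IsGauge N) {a : ℝ}
    (ha : 0 < a) :
    limitMeasure γ P S U {v | a < N v} = ENNReal.ofReal (a ^ (-γ) * tailConst γ P S U N) := by
  rw [limitMeasure, Measure.finsetSum_apply, tailConst, Finset.mul_sum,
    ENNReal.ofReal_sum_of_nonneg]
  · exact Finset.sum_congr rfl fun s hs =>
      sourceMeasure_gauge_lt hN h.index_pos (h.measurable_U s) (h.moment s hs) ha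
  · intro s _
    have : 0 ≤ ∫ ω, N (U s ω) ^ γ ∂P :=
      integral_nonneg fun _ => Real.rpow_nonneg (hN.nonneg _) _
    positivity

theorem limitMeasure_real_gauge_lt (h : BigSource P γ G V S I R U) (hN : IsGauge N) {a : ℝ}
    (ha : 0 < a) :
    (limitMeasure γ P S U).real {v | a < N v} = a ^ (-γ) * tailConst γ P S U N := by
  rw [measureReal_def, h.limitMeasure_gauge_lt hN ha, ENNReal.toReal_ofReal]
  have := tailConst_nonneg (γ := γ) (P := P) (S := S) (U := U) hN
  positivity

theorem limitMeasure_smul (h : BigSource P γ G V S I R U) {c : ℝ} (hc : 0 < c)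
    {D : Set (ι → ℝ)} (hD : MeasurableSet D) :
    limitMeasure γ P S U {v | (fun q => c⁻¹ * v q) ∈ D} =
      ENNReal.ofReal (c ^ (-γ)) * limitMeasure γ P S U D := by
  rw [limitMeasure, Measure.finsetSum_apply, Measure.finsetSum_apply, Finset.mul_sum]
  exact Finset.sum_congr rfl fun s _ => sourceMeasure_smul (h.measurable_U s) hc hD

/-- Convergence of rescaled expectations on the event `N V > x`. The indicator of this event is
sandwiched between continuous ramps; by homogeneity the tail measure of `{a < N}` is `c a ^ (-γ)`, so
that the error is small with the width of the ramps. -/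
theorem tendsto_setIntegral_gauge [Countable σ] (h : BigSource P γ G V S I R U) (hN : IsGauge N)
    {g : (ι → ℝ) → ℝ} {C : ℝ} (hg : UniformContinuous g) (hC : ∀ v, |g v| ≤ C) :
    Tendsto (fun x => (∫ ω in {ω | x < N (V ω)}, g (fun q => x⁻¹ * V ω q) ∂P) / G x) atTop
      (𝓝 (∫ v in {v | 1 < N v}, g v ∂(limitMeasure γ P S U))) := by
  have hC0 : 0 ≤ C := (abs_nonneg _).trans (hC 0)
  have hV := h.measurable_V
  set M := limitMeasure γ P S U
  set c := tailConst γ P S U N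
  have hc0 : 0 ≤ c := tailConst_nonneg hN
  have hmN : ∀ a, MeasurableSet {v | a < N v} := fun a =>
    measurableSet_lt measurable_const hN.measurable
  have hrampu : ∀ a b, UniformContinuous fun v => ramp a b (N v) := fun a b =>
    (uniformContinuous_ramp a b).comp hN.lipschitz.uniformContinuous
  have hramp0 : ∀ a b, 1 / 2 ≤ a → a < b → ∀ v, ‖v‖ ≤ 1 / 2 → ramp a b (N v) = 0 :=
    fun a b ha hab v hv => ramp_of_le hab ((hN.le_norm v).trans (hv.trans ha))
  have hi : ∀ a b, 1 / 2 ≤ a → a < b → Integrable (fun v => ramp a b (N v)) M := fun a b ha hab =>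
    h.integrable_limitMeasure (hrampu a b).continuous.measurable (fun v => abs_ramp_le_one)
      one_half_pos (hramp0 a b ha hab)
  have hfin : ∀ a, 0 < a → M {v | a < N v} ≠ ⊤ := fun a ha => by
    rw [h.limitMeasure_gauge_lt hN ha]; exact ENNReal.ofReal_ne_top
  -- `ρ a` bounds the distance between the indicator of `(1, ∞)` and the ramp on `[1 - a, 1]`
  set ρ : ℝ → ℝ → ℝ := fun a t => ramp (1 - 2 * a) (1 - a) t - ramp 1 (1 + a) t
  have hρ0 : ∀ a, 0 < a → ∀ t, 0 ≤ ρ a t := by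
    intro a ha t
    rcases le_or_gt t 1 with ht | ht
    · simp only [ρ, ramp_of_le (by linarith : (1 : ℝ) < 1 + a) ht, sub_zero]
      exact ramp_nonneg
    · simp only [ρ, ramp_of_ge (by linarith : 1 - 2 * a < 1 - a) (by linarith : 1 - a ≤ t)]
      exact sub_nonneg.2 ramp_le_one
  have hρ1 : ∀ a, 0 < a → ∀ t,
      |(Set.Ioi (1 : ℝ)).indicator 1 t - ramp (1 - a) 1 t| ≤ ρ a t := by
    intro a ha t
    rcases le_or_gt t 1 with ht | ht
    · rw [Set.indicator_of_notMem (by simpa using ht), zero_sub, abs_neg, abs_of_nonneg ramp_nonneg]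
      simp only [ρ, ramp_of_le (by linarith : (1 : ℝ) < 1 + a) ht, sub_zero]
      rcases le_or_gt t (1 - a) with h2 | h2
      · rw [ramp_of_le (by linarith) h2]; exact ramp_nonneg
      · rw [ramp_of_ge (by linarith : 1 - 2 * a < 1 - a) h2.le]; exact ramp_le_one
    · rw [Set.indicator_of_mem (by simpa using ht), ramp_of_ge (by linarith) ht.le]
      simpa using hρ0 a ha t
  have hρM : ∀ a, 0 < a → a ≤ 1 / 4 →
      ∫ v, ρ a (N v) ∂M ≤ ((1 - 2 * a) ^ (-γ) - (1 + a) ^ (-γ)) * c := by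
    intro a ha ha4
    simp only [ρ]
    rw [integral_sub (hi _ _ (by linarith) (by linarith)) (hi _ _ (by norm_num) (by linarith)),
      sub_mul]
    refine sub_le_sub ?_ ?_
    · rw [← h.limitMeasure_real_gauge_lt hN (by linarith), ← integral_indicator_one (hmN _)]
      refine integral_mono (hi _ _ (by linarith) (by linarith))
        ((integrable_indicator_iff (hmN _)).2 (integrableOn_const (C := (1 : ℝ))
          (hfin _ (by linarith)))) fun v => ?_
      by_cases hv : 1 - 2 * a < N v
      · rw [Set.indicator_of_mem (by exact hv)]; exact ramp_le_one
      · simp only [ramp_of_le (by linarith : 1 - 2 * a < 1 - a) (not_lt.1 hv)]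
        exact Set.indicator_nonneg (fun _ _ => zero_le_one) _
    · rw [← h.limitMeasure_real_gauge_lt hN (by linarith), ← integral_indicator_one (hmN _)]
      refine integral_mono ((integrable_indicator_iff (hmN _)).2 (integrableOn_const (C := (1 : ℝ))
          (hfin _ (by linarith)))) (hi _ _ (by norm_num) (by linarith)) fun v => ?_
      by_cases hv : 1 + a < N v
      · rw [Set.indicator_of_mem (by exact hv), ramp_of_ge (by linarith) hv.le]; rfl
      · rw [Set.indicator_of_notMem (by exact hv)]; exact ramp_nonneg
  have hNx : ∀ x : ℝ, 0 < x → ∀ ω, N (fun q => x⁻¹ * V ω q) = x⁻¹ * N (V ω) := fun x hx ω =>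
    hN.homogeneous _ (inv_pos.2 hx).le _
  have hsmall : Tendsto (fun a : ℝ => 2 * C * (((1 - 2 * a) ^ (-γ) - (1 + a) ^ (-γ)) * c))
      (𝓝[>] 0) (𝓝 0) := by
    have h1 : Tendsto (fun a : ℝ => (1 - 2 * a) ^ (-γ)) (𝓝 0) (𝓝 ((1 - 2 * 0) ^ (-γ))) := by
      refine ContinuousAt.tendsto ?_
      exact (by fun_prop : ContinuousAt (fun a : ℝ => 1 - 2 * a) 0).rpow_const (by norm_num)
    have h2 : Tendsto (fun a : ℝ => (1 + a) ^ (-γ)) (𝓝 0) (𝓝 ((1 + 0) ^ (-γ))) := by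
      refine ContinuousAt.tendsto ?_
      exact (by fun_prop : ContinuousAt (fun a : ℝ => 1 + a) 0).rpow_const (by norm_num)
    have h3 := ((h1.sub h2).mul_const c).const_mul (2 * C)
    simp only [mul_zero, sub_zero, Real.one_rpow, add_zero, sub_self, zero_mul] at h3
    exact h3.mono_left nhdsWithin_le_nhds
  rw [Metric.tendsto_nhds]
  intro η hη
  obtain ⟨a, ⟨ha1, ha4⟩, ha0⟩ := ((hsmall.eventually_lt_const (half_pos hη)).and
    (nhdsWithin_le_nhds (eventually_lt_nhds (by norm_num : (0 : ℝ) < 1 / 4))) |>.and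
      self_mem_nhdsWithin).exists
  have ha0 : 0 < a := ha0
  have hfu : UniformContinuous fun v => g v * ramp (1 - a) 1 (N v) :=
    hg.mul_of_bounded' (hrampu _ _) hC fun _ => abs_ramp_le_one
  have hfb : ∀ v, |g v * ramp (1 - a) 1 (N v)| ≤ C := fun v => by
    rw [abs_mul]
    exact (mul_le_of_le_one_right (abs_nonneg _) abs_ramp_le_one).trans (hC v)
  have hf0 : ∀ v, ‖v‖ ≤ 1 / 2 → g v * ramp (1 - a) 1 (N v) = 0 := fun v hv => by
    rw [hramp0 _ _ (by linarith) (by linarith) v hv, mul_zero]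
  have hρu : UniformContinuous fun v => ρ a (N v) := (hrampu _ _).sub (hrampu _ _)
  have hρb : ∀ v, |ρ a (N v)| ≤ 1 := fun v => by
    rw [abs_of_nonneg (hρ0 a ha0 _)]
    simp only [ρ]
    linarith [ramp_le_one (a := 1 - 2 * a) (b := 1 - a) (t := N v),
      ramp_nonneg (a := 1) (b := 1 + a) (t := N v)]
  have hρz : ∀ v, ‖v‖ ≤ 1 / 2 → ρ a (N v) = 0 := fun v hv => by
    simp only [ρ]
    rw [hramp0 _ _ (by linarith) (by linarith) v hv, hramp0 _ _ (by norm_num) (by linarith) v hv,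
      sub_zero]
  have T1 := h.tendsto_integral hfu hfb one_half_pos hf0
  have T2 := (h.tendsto_integral hρu hρb one_half_pos hρz).const_mul C
  have T3 := (((T1.sub_const (∫ v, g v * ramp (1 - a) 1 (N v) ∂M)).abs).add T2)
  rw [sub_self, abs_zero, zero_add] at T3
  have hρM' := hρM a ha0 ha4.le
  have hlt : C * ∫ v, ρ a (N v) ∂M < η - C * ∫ v, ρ a (N v) ∂M := by nlinarith
  have hpw : ∀ v, |{v | 1 < N v}.indicator g v - g v * ramp (1 - a) 1 (N v)| ≤ C * ρ a (N v) := by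
    intro v
    have : {v | 1 < N v}.indicator g v = g v * (Set.Ioi (1 : ℝ)).indicator 1 (N v) := by
      by_cases hv : 1 < N v
      · rw [Set.indicator_of_mem (by exact hv), Set.indicator_of_mem (by exact hv)]; simp
      · rw [Set.indicator_of_notMem (by exact hv), Set.indicator_of_notMem (by exact hv)]; simp
    rw [this, ← mul_sub, abs_mul]
    have := hρ1 a ha0 (N v)
    gcongr
    exact hC v
  have hgi : Integrable ({v | 1 < N v}.indicator g) M := by
    refine h.integrable_limitMeasure (hg.continuous.measurable.indicator (hmN 1))
      (C := C) (fun v => ?_) one_half_pos fun v hv => ?_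
    · by_cases hv : 1 < N v
      · rw [Set.indicator_of_mem (by exact hv)]; exact hC _
      · rw [Set.indicator_of_notMem (by exact hv)]; simpa using hC0
    · refine Set.indicator_of_notMem ?_ _
      simp only [Set.mem_ofPred_eq, not_lt]
      linarith [hN.le_norm v]
  have hfi := h.integrable_limitMeasure hfu.continuous.measurable hfb one_half_pos hf0
  have hρi := h.integrable_limitMeasure hρu.continuous.measurable hρb one_half_pos hρz
  have hM1 : |∫ v in {v | 1 < N v}, g v ∂M - ∫ v, g v * ramp (1 - a) 1 (N v) ∂M| ≤
      C * ∫ v, ρ a (N v) ∂M := by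
    rw [← integral_indicator (hmN 1), ← integral_sub hgi hfi, ← integral_const_mul]
    exact (abs_integral_le_integral_abs).trans
      (integral_mono (hgi.sub hfi).abs (hρi.const_mul C) hpw)
  filter_upwards [T3.eventually_lt_const hlt, eventually_gt_atTop 0] with x hx hx0
  have hGx := h.tail.pos x
  have hmx : Measurable fun ω (q : ι) => x⁻¹ * V ω q := by fun_prop
  have hPi : ∀ {f : (ι → ℝ) → ℝ} {B : ℝ}, Measurable f → (∀ v, |f v| ≤ B) →
      Integrable (fun ω => f (fun q => x⁻¹ * V ω q)) P := fun hf hB =>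
    Integrable.of_bound (hf.comp hmx).aestronglyMeasurable _ (Eventually.of_forall fun ω => hB _)
  have hset : ∫ ω in {ω | x < N (V ω)}, g (fun q => x⁻¹ * V ω q) ∂P =
      ∫ ω, {v | 1 < N v}.indicator g (fun q => x⁻¹ * V ω q) ∂P := by
    have hm : MeasurableSet {ω | x < N (V ω)} :=
      measurableSet_lt measurable_const (hN.measurable.comp hV)
    rw [← integral_indicator hm]
    refine integral_congr_ae (Eventually.of_forall fun ω => ?_)
    simp only [Set.indicator_apply, Set.mem_ofPred_eq, hNx x hx0]
    have : 1 < x⁻¹ * N (V ω) ↔ x < N (V ω) := by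
      rw [← div_eq_inv_mul, one_lt_div hx0]
    simp only [this]
  have hgi' : Integrable (fun ω => {v | 1 < N v}.indicator g (fun q => x⁻¹ * V ω q)) P := by
    refine hPi (B := C) (hg.continuous.measurable.indicator (hmN 1)) fun v => ?_
    by_cases hv : 1 < N v
    · rw [Set.indicator_of_mem (by exact hv)]; exact hC _
    · rw [Set.indicator_of_notMem (by exact hv)]; simpa using hC0
  have hP1 : |∫ ω in {ω | x < N (V ω)}, g (fun q => x⁻¹ * V ω q) ∂P -
      ∫ ω, g (fun q => x⁻¹ * V ω q) * ramp (1 - a) 1 (N fun q => x⁻¹ * V ω q) ∂P| ≤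
      C * ∫ ω, ρ a (N fun q => x⁻¹ * V ω q) ∂P := by
    have i1 := hPi hfu.continuous.measurable hfb
    have i2 := hPi hρu.continuous.measurable hρb
    rw [hset, ← integral_sub hgi' i1, ← integral_const_mul]
    exact (abs_integral_le_integral_abs).trans
      (integral_mono (hgi'.sub i1).abs (i2.const_mul C) fun ω => hpw _)
  set A := ∫ ω in {ω | x < N (V ω)}, g (fun q => x⁻¹ * V ω q) ∂P
  set B := ∫ ω, g (fun q => x⁻¹ * V ω q) * ramp (1 - a) 1 (N fun q => x⁻¹ * V ω q) ∂P
  have e1 : |A / G x - B / G x| ≤ C * ((∫ ω, ρ a (N fun q => x⁻¹ * V ω q) ∂P) / G x) := by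
    rw [← sub_div, abs_div, abs_of_pos hGx, ← mul_div_assoc]
    gcongr
  rw [Real.dist_eq]
  have e2 := abs_sub_le (A / G x) (B / G x) (∫ v in {v | 1 < N v}, g v ∂M)
  have e3 := abs_sub_le (B / G x) (∫ v, g v * ramp (1 - a) 1 (N v) ∂M)
    (∫ v in {v | 1 < N v}, g v ∂M)
  rw [abs_sub_comm] at hM1
  linarith

/-- The tail of a gauge of `V` is asymptotically a multiple of the common tail of the sources. -/
theorem tendsto_tail [Countable σ] (h : BigSource P γ G V S I R U) (hN : IsGauge N) :
    Tendsto (fun x => P.real {ω | x < N (V ω)} / G x) atTop (𝓝 (tailConst γ P S U N)) := by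
  have h1 := h.tendsto_setIntegral_gauge hN (g := fun _ => 1) (C := 1) uniformContinuous_const
    (by simp)
  simp only [integral_const, smul_eq_mul, mul_one, measureReal_restrict_apply_univ,
    h.limitMeasure_real_gauge_lt hN one_pos, Real.one_rpow, one_mul] at h1
  exact h1

end BigSource

/-! ### Vague convergence -/

namespace BigSource

variable {Ω ι σ : Type*} [MeasurableSpace Ω] [Fintype ι] {P : Measure Ω} [IsProbabilityMeasure P]
  {γ : ℝ} {G : ℝ → ℝ} {V : Ω → ι → ℝ} {S : Finset σ} {I : ι → σ → Prop} {R : σ → Ω → ℝ}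
  {U : σ → Ω → ι → ℝ} {N : (ι → ℝ) → ℝ} [Countable σ]

/-- The limit measure is the normalized image of the tail measure under the embedding of `ℝ^ι` into
`[-∞, ∞]^ι`, without its mass at `0`. A test function on the compactification is uniformly
continuous on `ℝ^ι`. -/
theorem vagueRegVar (h : BigSource P γ G V S I R U) (hN : IsGauge N)
    (hc : 0 < tailConst γ P S U N) {r : ℝ → ℝ} (hr : ∀ x, r x = P.real {ω | x < N (V ω)}) :
    VagueRegVar P γ V r := by
  set c := tailConst γ P S U N
  set M := limitMeasure γ P S U
  set T : (ι → ℝ) → ι → EReal := fun v q => (v q : EReal)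
  have hT : Measurable T := measurable_toEReal
  have hT0 : ∀ v, T v = 0 ↔ v = 0 := fun v => by
    simp [T, funext_iff]
  have hm0 : MeasurableSet ({0}ᶜ : Set (ι → EReal)) := (measurableSet_singleton _).compl
  have hnear : ∀ {p : (ι → EReal) → Prop}, (∀ᶠ y in 𝓝 0, p y) →
      ∃ ε : ℝ, 0 < ε ∧ ∀ v, ‖v‖ ≤ ε → p (T v) := by
    intro p hp
    have h1 : ∀ᶠ v in 𝓝 (0 : ι → ℝ), p (T v) := by
      refine (continuous_toEReal.tendsto (0 : ι → ℝ)).eventually ?_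
      have : (fun q => (((0 : ι → ℝ) q : ℝ) : EReal)) = (0 : ι → EReal) := by ext; simp
      rwa [this]
    obtain ⟨ε, hε, H⟩ := Metric.nhds_basis_closedBall.eventually_iff.1 h1
    exact ⟨ε, hε, fun v hv => H (by simpa using hv)⟩
  refine ⟨(ENNReal.ofReal c)⁻¹ • (M.map T).restrict {0}ᶜ, ?_, ?_, ?_, ?_, ?_⟩
  · intro h0
    have h1 : M {v | 1 < N v} ≤ (M.map T).restrict {0}ᶜ Set.univ := by
      rw [Measure.restrict_apply_univ, Measure.map_apply hT hm0]
      refine measure_mono fun v hv => ?_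
      simp only [Set.mem_preimage, Set.mem_compl_iff, Set.mem_singleton_iff, hT0]
      rintro rfl
      simp only [Set.mem_ofPred_eq, hN.zero] at hv
      linarith
    rw [h.limitMeasure_gauge_lt hN one_pos, Real.one_rpow, one_mul] at h1
    have h2 : ((ENNReal.ofReal c)⁻¹ • (M.map T).restrict {0}ᶜ) Set.univ = 0 := by
      rw [h0]; simp
    rw [Measure.smul_apply, smul_eq_mul, mul_eq_zero] at h2
    rcases h2 with h2 | h2
    · simp at h2
    · rw [h2] at h1
      exact absurd h1 (by simpa using hc)
  · simp
  · intro O hO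
    obtain ⟨ε, hε, H⟩ := hnear (p := fun y => y ∈ O) hO
    obtain ⟨O', hO'O, hO'o, hO'0⟩ := mem_nhds_iff.1 hO
    obtain ⟨ε', hε', H'⟩ := hnear (p := fun y => y ∈ O') (hO'o.mem_nhds hO'0)
    have h1 : (M.map T).restrict {0}ᶜ Oᶜ < ⊤ := by
      calc _ ≤ (M.map T) Oᶜ := Measure.restrict_apply_le _ _
        _ ≤ (M.map T) O'ᶜ := measure_mono (Set.compl_subset_compl.2 hO'O)
        _ = M (T ⁻¹' O'ᶜ) := Measure.map_apply hT hO'o.measurableSet.compl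
        _ ≤ M {v | ε' < ‖v‖} := by
          refine measure_mono fun v hv => ?_
          by_contra hlt
          exact hv (H' v (not_lt.1 hlt))
        _ < ⊤ := by
          rw [h.limitMeasure_gauge_lt isGauge_norm hε']
          exact ENNReal.ofReal_lt_top
    rw [Measure.smul_apply, smul_eq_mul]
    exact ENNReal.mul_lt_top (ENNReal.inv_lt_top.2 (ENNReal.ofReal_pos.2 hc)) h1
  · intro a ha B hB
    have hinv : ∀ y : EReal, ((a⁻¹ : ℝ) : EReal) * ((a : EReal) * y) = y := fun y => by
      rw [← mul_assoc, ← EReal.coe_mul, inv_mul_cancel₀ ha.ne', EReal.coe_one, one_mul]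
    have hinv' : ∀ y : EReal, (a : EReal) * (((a⁻¹ : ℝ) : EReal) * y) = y := fun y => by
      rw [← mul_assoc, ← EReal.coe_mul, mul_inv_cancel₀ ha.ne', EReal.coe_one, one_mul]
    have himg : (fun (y : ι → EReal) q => (a : EReal) * y q) '' B =
        (fun (y : ι → EReal) q => ((a⁻¹ : ℝ) : EReal) * y q) ⁻¹' B := by
      ext y
      constructor
      · rintro ⟨z, hz, rfl⟩
        simpa only [Set.mem_preimage, hinv] using hz
      · intro hy
        exact ⟨_, hy, by simp only [hinv']⟩
    have hmB : MeasurableSet ((fun (y : ι → EReal) q => ((a⁻¹ : ℝ) : EReal) * y q) ⁻¹' B) :=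
      (by fun_prop : Measurable fun (y : ι → EReal) q => ((a⁻¹ : ℝ) : EReal) * y q) hB
    rw [himg, Measure.smul_apply, Measure.smul_apply, smul_eq_mul, smul_eq_mul,
      Measure.restrict_apply hmB, Measure.restrict_apply hB,
      Measure.map_apply hT (hmB.inter hm0), Measure.map_apply hT (hB.inter hm0),
      mul_left_comm, ← h.limitMeasure_smul ha (hT (hB.inter hm0))]
    congr 2
    ext v
    simp only [Set.mem_preimage, Set.mem_inter_iff, Set.mem_ofPred_eq, Set.mem_compl_iff,
      Set.mem_singleton_iff, hT0]
    have e1 : T (fun q => a⁻¹ * v q) = fun q => ((a⁻¹ : ℝ) : EReal) * T v q := by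
      ext q
      simp only [T, EReal.coe_mul]
    have e2 : (fun q => a⁻¹ * v q) = 0 ↔ v = 0 := by
      simp [funext_iff, ha.ne']
    rw [e1, e2]
  · intro f hf
    obtain ⟨ε, hε, H⟩ := hnear hf
    obtain ⟨C, hC⟩ := isCompact_univ.exists_bound_of_continuousOn (f := f) f.continuous.continuousOn
    have hu := uniformContinuous_comp_toEReal f
    have h1 := h.tendsto_integral hu (fun v => hC _ (Set.mem_univ _)) hε H
    have h2 := h1.div (h.tendsto_tail hN) hc.ne'
    have h3 : ∫ y, f y ∂((ENNReal.ofReal c)⁻¹ • (M.map T).restrict {0}ᶜ) =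
        (∫ v, f (T v) ∂M) / c := by
      rw [integral_smul_measure, setIntegral_eq_integral_of_forall_compl_eq_zero,
        integral_map hT.aemeasurable f.continuous.aestronglyMeasurable, ENNReal.toReal_inv,
        ENNReal.toReal_ofReal hc.le, smul_eq_mul, inv_mul_eq_div]
      intro y hy
      have : y = 0 := by simpa using hy
      rw [this]
      exact hf.self_of_nhds
    rw [h3]
    refine h2.congr fun x => ?_
    simp only [Pi.div_apply]
    rw [hr, div_div_div_cancel_right₀ (h.tail.pos x).ne']

end BigSource

/-! ### The spectral tail law of the sources -/

theorem restrict_finsetSum {E σ : Type*} [MeasurableSpace E] (S : Finset σ) (m : σ → Measure E)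
    (A : Set E) : (∑ s ∈ S, m s).restrict A = ∑ s ∈ S, (m s).restrict A := by
  classical
  induction S using Finset.induction_on with
  | empty => simp
  | insert a S ha ih => rw [Finset.sum_insert ha, Finset.sum_insert ha, Measure.restrict_add, ih]

section PowIntegral

variable {γ : ℝ}

theorem integral_powMeasure_comp_mul {φ : ℝ → ℝ} (hφ : Measurable φ) {c : ℝ} (hc : 0 < c) :
    ∫ r, φ (c * r) ∂(powMeasure γ) = c ^ γ * ∫ r, φ r ∂(powMeasure γ) := by
  rw [← integral_map (measurable_const_mul c).aemeasurable hφ.aestronglyMeasurable,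
    map_mul_powMeasure γ hc, integral_smul_measure, ENNReal.toReal_ofReal (by positivity),
    smul_eq_mul]

theorem paretoMeasure_Ioi (hγ : 0 < γ) {b : ℝ} (hb : 0 < b) :
    (paretoMeasure 1 γ).real (Set.Ioi b) = min 1 (b ^ (-γ)) := by
  rw [paretoMeasure_one_eq, measureReal_def, Measure.restrict_apply measurableSet_Ioi,
    Set.Ioi_inter_Ioi, powMeasure_Ioi hγ (lt_of_lt_of_le hb le_sup_left),
    ENNReal.toReal_ofReal (by positivity)]
  rcases le_total b 1 with h | h
  · rw [sup_eq_right.2 h, Real.one_rpow, min_eq_left]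
    exact Real.one_le_rpow_of_pos_of_le_one_of_nonpos hb h (by linarith)
  · rw [sup_eq_left.2 h, min_eq_right]
    exact Real.rpow_le_one_of_one_le_of_nonpos h (by linarith)

end PowIntegral

/-- The spectral tail law that belongs to the sources in `S`: the mixture of the laws of
`U s / |U s 0|` under the measures with density `|U s 0|^γ`. -/
noncomputable def spectralLaw {Ω σ : Type*} [MeasurableSpace Ω] (γ : ℝ) (P : Measure Ω)
    (S : Finset σ) (U : σ → Ω → ℕ → ℝ) : Measure (ℕ → ℝ) :=
  (ENNReal.ofReal (∑ s ∈ S, ∫ ω, |U s ω 0| ^ γ ∂P))⁻¹ • ∑ s ∈ S,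
    (P.withDensity fun ω => ENNReal.ofReal (|U s ω 0| ^ γ)).map fun ω t => U s ω t / |U s ω 0|

section SpectralLaw

variable {Ω σ : Type*} [MeasurableSpace Ω] {γ : ℝ} {P : Measure Ω} [IsProbabilityMeasure P]
  {S : Finset σ} {U : σ → Ω → ℕ → ℝ}

omit [IsProbabilityMeasure P] in
theorem spectralLaw_apply (hU : ∀ s, Measurable (U s)) {D : Set (ℕ → ℝ)} (hD : MeasurableSet D) :
    spectralLaw γ P S U D = (ENNReal.ofReal (∑ s ∈ S, ∫ ω, |U s ω 0| ^ γ ∂P))⁻¹ *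
      ∑ s ∈ S, ∫⁻ ω in {ω | (fun t => U s ω t / |U s ω 0|) ∈ D},
        ENNReal.ofReal (|U s ω 0| ^ γ) ∂P := by
  rw [spectralLaw, Measure.smul_apply, Measure.finsetSum_apply, smul_eq_mul]
  congr 1
  refine Finset.sum_congr rfl fun s _ => ?_
  have := hU s
  have hm : Measurable fun ω t => U s ω t / |U s ω 0| := by fun_prop
  rw [Measure.map_apply hm hD, withDensity_apply _ (hm hD)]
  rfl

omit [IsProbabilityMeasure P] in
theorem spectralLaw_real (hU : ∀ s, Measurable (U s))
    (hmom : ∀ s ∈ S, Integrable (fun ω => |U s ω 0| ^ γ) P) {D : Set (ℕ → ℝ)}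
    (hD : MeasurableSet D) :
    (spectralLaw γ P S U).real D = (∑ s ∈ S, ∫ ω, |U s ω 0| ^ γ ∂P)⁻¹ *
      ∑ s ∈ S, ∫ ω in {ω | (fun t => U s ω t / |U s ω 0|) ∈ D}, |U s ω 0| ^ γ ∂P := by
  have h0 : ∀ s ω, 0 ≤ |U s ω 0| ^ γ := fun s ω => Real.rpow_nonneg (abs_nonneg _) _
  rw [measureReal_def, spectralLaw_apply hU hD, ENNReal.toReal_mul, ENNReal.toReal_inv,
    ENNReal.toReal_ofReal (Finset.sum_nonneg fun s _ => integral_nonneg (h0 s)),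
    ENNReal.toReal_sum]
  · congr 1
    refine Finset.sum_congr rfl fun s _ => ?_
    have := hU s
    rw [integral_eq_lintegral_of_nonneg_ae (Eventually.of_forall (h0 s))]
    exact (by fun_prop : Measurable fun ω => |U s ω 0| ^ γ).aestronglyMeasurable
  · intro s hs
    exact ((hmom s hs).integrableOn.lintegral_lt_top).ne

omit [IsProbabilityMeasure P] in
theorem isProbabilityMeasure_spectralLaw (hU : ∀ s, Measurable (U s))
    (hmom : ∀ s ∈ S, Integrable (fun ω => |U s ω 0| ^ γ) P)
    (hc : 0 < ∑ s ∈ S, ∫ ω, |U s ω 0| ^ γ ∂P) : IsProbabilityMeasure (spectralLaw γ P S U) := by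
  have h0 : ∀ s ω, 0 ≤ |U s ω 0| ^ γ := fun s ω => Real.rpow_nonneg (abs_nonneg _) _
  constructor
  rw [spectralLaw_apply hU MeasurableSet.univ]
  simp only [Set.mem_univ, Set.ofPred_true, Measure.restrict_univ]
  rw [ENNReal.ofReal_sum_of_nonneg fun s _ => integral_nonneg (h0 s)]
  rw [Finset.sum_congr rfl fun s hs => (ofReal_integral_eq_lintegral_ofReal (hmom s hs)
    (Eventually.of_forall (h0 s))).symm]
  rw [← ENNReal.ofReal_sum_of_nonneg fun s _ => integral_nonneg (h0 s)]
  exact ENNReal.inv_mul_cancel (by simpa using hc) ENNReal.ofReal_ne_top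

omit [IsProbabilityMeasure P] in
theorem integral_spectralLaw (hU : ∀ s, Measurable (U s)) {φ : (ℕ → ℝ) → ℝ} (hφ : Measurable φ)
    {C : ℝ} (hC : ∀ θ, |φ θ| ≤ C) (hmom : ∀ s ∈ S, Integrable (fun ω => |U s ω 0| ^ γ) P) :
    ∫ θ, φ θ ∂(spectralLaw γ P S U) = (∑ s ∈ S, ∫ ω, |U s ω 0| ^ γ ∂P)⁻¹ *
      ∑ s ∈ S, ∫ ω, |U s ω 0| ^ γ * φ (fun t => U s ω t / |U s ω 0|) ∂P := by
  have h0 : ∀ s ω, 0 ≤ |U s ω 0| ^ γ := fun s ω => Real.rpow_nonneg (abs_nonneg _) _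
  have hm : ∀ s, Measurable fun ω t => U s ω t / |U s ω 0| := fun s => by
    have := hU s
    fun_prop
  have hfin : ∀ s ∈ S, IsFiniteMeasure
      ((P.withDensity fun ω => ENNReal.ofReal (|U s ω 0| ^ γ)).map
        fun ω t => U s ω t / |U s ω 0|) := by
    intro s hs
    have : IsFiniteMeasure (P.withDensity fun ω => ENNReal.ofReal (|U s ω 0| ^ γ)) :=
      isFiniteMeasure_withDensity_ofReal (hmom s hs).2
    infer_instance
  rw [spectralLaw, integral_smul_measure, ENNReal.toReal_inv,
    ENNReal.toReal_ofReal (Finset.sum_nonneg fun s _ => integral_nonneg (h0 s)), smul_eq_mul,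
    integral_finsetSum_measure]
  · congr 1
    refine Finset.sum_congr rfl fun s hs => ?_
    have hUs := hU s
    rw [integral_map (hm s).aemeasurable hφ.aestronglyMeasurable,
      integral_withDensity_eq_integral_toReal_smul (by fun_prop)
        (Eventually.of_forall fun _ => ENNReal.ofReal_lt_top)]
    refine integral_congr_ae (Eventually.of_forall fun ω => ?_)
    simp only [ENNReal.toReal_ofReal (h0 s ω), smul_eq_mul]
  · intro s hs
    have := hfin s hs
    exact Integrable.of_bound hφ.aestronglyMeasurable C (Eventually.of_forall hC)

end SpectralLaw

section Convergence

variable {Ω ι : Type*} [MeasurableSpace Ω] [Fintype ι] {P : Measure Ω} [IsProbabilityMeasure P]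
  {γ : ℝ} {U : Ω → ι → ℝ}

/-- Polar coordinates for the tail measure of a single source. -/
theorem setIntegral_sourceMeasure_abs (hγ : 0 < γ) (hU : Measurable U)
    (hmom : Integrable (fun ω => ‖U ω‖ ^ γ) P) {f : (ι → ℝ) → ℝ} (hf : Measurable f) {C : ℝ}
    (hC : ∀ v, |f v| ≤ C) (q₀ : ι) :
    ∫ v in {v | 1 < |v q₀|}, f v ∂(sourceMeasure γ P U) =
      ∫ ω, |U ω q₀| ^ γ * ∫ z, f (fun q => z * (U ω q / |U ω q₀|)) ∂(paretoMeasure 1 γ) ∂P := by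
  have hC0 : 0 ≤ C := (abs_nonneg _).trans (hC 0)
  have hm : MeasurableSet {v : ι → ℝ | 1 < |v q₀|} := by measurability
  have hfm : Measurable ({v : ι → ℝ | 1 < |v q₀|}.indicator f) := hf.indicator hm
  have hi := integrable_source (f := {v : ι → ℝ | 1 < |v q₀|}.indicator f) hγ hU hmom hfm
    (C := C) (fun v => by
      by_cases hv : 1 < |v q₀|
      · rw [Set.indicator_of_mem (by exact hv)]; exact hC _
      · rw [Set.indicator_of_notMem (by exact hv)]; simpa using hC0) one_pos (fun v hv => by
      refine Set.indicator_of_notMem ?_ _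
      simp only [Set.mem_ofPred_eq, not_lt]
      exact (norm_le_pi_norm v q₀).trans hv)
  rw [← integral_indicator hm, sourceMeasure, integral_map (measurable_source hU).aemeasurable
    hfm.aestronglyMeasurable, integral_prod_symm _ hi]
  refine integral_congr_ae (Eventually.of_forall fun ω => ?_)
  simp only
  rcases eq_or_ne (U ω q₀) 0 with h0 | h0
  · rw [h0, abs_zero, Real.zero_rpow hγ.ne', zero_mul]
    refine integral_eq_zero_of_ae (Eventually.of_forall fun r => ?_)
    refine Set.indicator_of_notMem ?_ _
    simp [h0]
  · have hu : 0 < |U ω q₀| := abs_pos.2 h0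
    have hφ : Measurable fun z : ℝ => f (fun q => z * (U ω q / |U ω q₀|)) :=
      hf.comp (by fun_prop)
    rw [paretoMeasure_one_eq, ← integral_indicator measurableSet_Ioi,
      ← integral_powMeasure_comp_mul (hφ.indicator measurableSet_Ioi) hu]
    refine integral_congr_ae ?_
    filter_upwards [ae_powMeasure_pos γ] with r hr
    have e1 : (1 < |r * U ω q₀|) ↔ 1 < |U ω q₀| * r := by
      rw [abs_mul, abs_of_pos hr, mul_comm]
    have e2 : (fun q => |U ω q₀| * r * (U ω q / |U ω q₀|)) = fun q => r * U ω q := by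
      ext q
      field_simp
    simp only [Set.indicator_apply, Set.mem_ofPred_eq, Set.mem_Ioi, e1, e2]

theorem isGauge_abs_apply (q₀ : ι) : IsGauge (fun v : ι → ℝ => |v q₀|) where
  nonneg _ := abs_nonneg _
  lipschitz := LipschitzWith.of_dist_le_mul fun v w => by
    rw [NNReal.coe_one, one_mul, Real.dist_eq]
    exact (abs_abs_sub_abs_le _ _).trans (dist_le_pi_dist v w q₀)
  homogeneous r hr v := by rw [abs_mul, abs_of_nonneg hr]

end Convergence

section Existence

variable {Ω σ : Type*} [MeasurableSpace Ω] {γ : ℝ} {P : Measure Ω} [IsProbabilityMeasure P]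
  {G : ℝ → ℝ} {S₀ : Finset σ} {S : ℕ → Finset σ} {I : ℕ → σ → Prop} {R : σ → Ω → ℝ}
  {U : σ → Ω → ℕ → ℝ} {Y : ℤ → Ω → ℝ} [Countable σ]

/-- A process with big sources has a spectral tail process, given by the sources that act on the
coordinate `0`. -/
theorem isSpectralTailLaw_spectralLaw
    (h : ∀ k : ℕ, BigSource P γ G (fun ω (t : Fin (k + 1)) => Y ((t : ℕ) : ℤ) ω) (S k)
      (fun t s => I t s) R (fun s ω t => U s ω t))
    (hU : ∀ s, Measurable (U s))
    (hS : ∀ k s, s ∈ S₀ ↔ s ∈ S k ∧ I 0 s)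
    (hc : 0 < ∑ s ∈ S₀, ∫ ω, |U s ω 0| ^ γ ∂P) :
    IsSpectralTailLaw P γ Y (spectralLaw γ P S₀ U) := by
  have hγ := (h 0).index_pos
  have hG := (h 0).tail
  have hmom : ∀ s ∈ S₀, Integrable (fun ω => |U s ω 0| ^ γ) P := fun s hs =>
    (isGauge_abs_apply (0 : Fin 1)).integrable_rpow hγ ((h 0).measurable_U s)
      ((h 0).moment s ((hS 0 s).1 hs).1)
  have hprob := isProbabilityMeasure_spectralLaw hU hmom hc
  have hpar : IsProbabilityMeasure (paretoMeasure 1 γ) :=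
    isProbabilityMeasure_paretoMeasure one_pos hγ
  refine ⟨hprob, fun k f => ?_⟩
  have hk := h k
  have hN := isGauge_abs_apply (0 : Fin (k + 1))
  set c := ∑ s ∈ S₀, ∫ ω, |U s ω 0| ^ γ ∂P
  have hsub : S₀ ⊆ S k := fun s hs => ((hS k s).1 hs).1
  have hz : ∀ s ∈ S k, s ∉ S₀ → ∀ ω, U s ω 0 = 0 := fun s hs hs0 ω =>
    hk.zero s hs 0 (fun hI => hs0 ((hS k s).2 ⟨hs, hI⟩)) ω
  have hcT : tailConst γ P (S k) (fun s ω (t : Fin (k + 1)) => U s ω t) (fun v => |v 0|) = c := by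
    rw [tailConst]
    refine (Finset.sum_subset hsub fun s hs hs0 => ?_).symm
    simp [hz s hs hs0, hγ.ne']
  have hYm : Measurable (Y 0) :=
    (measurable_pi_apply (0 : Fin (k + 1))).comp hk.measurable_V
  have hms : ∀ x, MeasurableSet {ω | x < |Y 0 ω|} := fun x =>
    measurableSet_lt measurable_const hYm.abs
  have htail : Tendsto (fun x => P.real {ω | x < |Y 0 ω|} / G x) atTop (𝓝 c) := by
    rw [← hcT]; exact hk.tendsto_tail hN
  have hpos : ∀ x, P {ω | x < |Y 0 ω|} ≠ 0 := by
    intro x h0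
    obtain ⟨x', hx', hxx'⟩ := ((htail.eventually_const_lt hc).and (eventually_ge_atTop x)).exists
    have hle : P {ω | x' < |Y 0 ω|} ≤ P {ω | x < |Y 0 ω|} :=
      measure_mono fun ω hω => lt_of_le_of_lt hxx' hω
    rw [h0, nonpos_iff_eq_zero] at hle
    rw [measureReal_def, hle] at hx'
    simp at hx'
  have hVm : ∀ x : ℝ, Measurable fun ω (t : Fin (k + 1)) => x⁻¹ * Y ((t : ℕ) : ℤ) ω := fun x =>
    measurable_pi_lambda _ fun t => ((measurable_pi_apply t).comp hk.measurable_V).const_mul _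
  have hprobx : ∀ x, IsProbabilityMeasure ((P[|{ω | x < |Y 0 ω|}]).map
      fun ω (t : Fin (k + 1)) => x⁻¹ * Y ((t : ℕ) : ℤ) ω) := fun x => by
    have := cond_isProbabilityMeasure (hpos x)
    exact Measure.isProbabilityMeasure_map (hVm x).aemeasurable
  have hlm : Measurable fun (z : ℝ × (ℕ → ℝ)) (t : Fin (k + 1)) => z.1 * z.2 t := by fun_prop
  have hlprob : IsProbabilityMeasure (((paretoMeasure 1 γ).prod (spectralLaw γ P S₀ U)).map
      fun (z : ℝ × (ℕ → ℝ)) (t : Fin (k + 1)) => z.1 * z.2 t) :=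
    Measure.isProbabilityMeasure_map hlm.aemeasurable
  set μs : ℝ → ProbabilityMeasure (Fin (k + 1) → ℝ) := fun x => ⟨_, hprobx x⟩ with hμs
  set μ : ProbabilityMeasure (Fin (k + 1) → ℝ) := ⟨_, hlprob⟩ with hμ
  have hcond : ∀ (g : (Fin (k + 1) → ℝ) → ℝ) x,
      ∫ ω, g (fun t => x⁻¹ * Y ((t : ℕ) : ℤ) ω) ∂(P[|{ω | x < |Y 0 ω|}]) =
      (∫ ω in {ω | x < |Y 0 ω|}, g (fun t => x⁻¹ * Y ((t : ℕ) : ℤ) ω) ∂P) /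
        P.real {ω | x < |Y 0 ω|} := fun g x => by
    rw [ProbabilityTheory.cond, integral_smul_measure, measureReal_def, ENNReal.toReal_inv,
      smul_eq_mul, inv_mul_eq_div]
  have hconv : Tendsto μs atTop (𝓝 μ) := by
    rw [tendsto_iff_forall_lipschitz_integral_tendsto]
    rintro g ⟨D, hD⟩ ⟨L, hL⟩
    set C := |g 0| + D
    have hC : ∀ v, |g v| ≤ C := fun v => by
      have h1 := hD v 0
      rw [Real.dist_eq] at h1
      have h2 := abs_sub_abs_le_abs_sub (g v) (g 0)
      simp only [C]
      linarith
    have hgm : Measurable g := hL.continuous.measurable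
    have hlim := (hk.tendsto_setIntegral_gauge hN hL.uniformContinuous hC).div htail hc.ne'
    have hval : ∫ v, g v ∂(μ : Measure (Fin (k + 1) → ℝ)) =
        (∫ v in {v : Fin (k + 1) → ℝ | 1 < |v 0|}, g v
          ∂(limitMeasure γ P (S k) fun s ω (t : Fin (k + 1)) => U s ω t)) / c := by
      have hGint : Integrable (fun z : ℝ × (ℕ → ℝ) => g fun t : Fin (k + 1) => z.1 * z.2 t)
          ((paretoMeasure 1 γ).prod (spectralLaw γ P S₀ U)) :=
        Integrable.of_bound (hgm.comp hlm).aestronglyMeasurable C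
          (Eventually.of_forall fun z => hC _)
      have hpm : Measurable fun θ : ℕ → ℝ =>
          ∫ z, g (fun t : Fin (k + 1) => z * θ t) ∂(paretoMeasure 1 γ) :=
        ((hgm.comp hlm).stronglyMeasurable.integral_prod_left'
          (μ := paretoMeasure 1 γ)).measurable
      have hpb : ∀ θ : ℕ → ℝ,
          |∫ z, g (fun t : Fin (k + 1) => z * θ t) ∂(paretoMeasure 1 γ)| ≤ C := fun θ => by
        have := norm_integral_le_of_norm_le_const (μ := paretoMeasure 1 γ)
          (f := fun z => g (fun t : Fin (k + 1) => z * θ t)) (Eventually.of_forall fun z => hC _)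
        simpa using this
      simp only [hμ, ProbabilityMeasure.coe_mk]
      rw [integral_map hlm.aemeasurable hgm.aestronglyMeasurable, integral_prod_symm _ hGint,
        integral_spectralLaw hU hpm hpb hmom, inv_mul_eq_div, limitMeasure,
        restrict_finsetSum, integral_finsetSum_measure]
      · congr 1
        rw [Finset.sum_congr rfl fun s hs => setIntegral_sourceMeasure_abs hγ (hk.measurable_U s)
          (hk.moment s hs) hgm hC (0 : Fin (k + 1))]
        refine Finset.sum_subset hsub fun s hs hs0 => ?_
        simp [hz s hs hs0, hγ.ne']
      · intro s hs
        have hm : MeasurableSet {v : Fin (k + 1) → ℝ | 1 < |v 0|} := by measurability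
        refine (integrable_indicator_iff hm).1 (integrable_sourceMeasure hγ (hk.measurable_U s)
          (hk.moment s hs) (hgm.indicator hm) (C := C) (fun v => ?_) one_pos fun v hv => ?_)
        · by_cases hv : 1 < |v 0|
          · rw [Set.indicator_of_mem (by exact hv)]; exact hC _
          · rw [Set.indicator_of_notMem (by exact hv)]
            simpa using (abs_nonneg _).trans (hC 0)
        · refine Set.indicator_of_notMem ?_ _
          simp only [Set.mem_ofPred_eq, not_lt]
          exact (norm_le_pi_norm v 0).trans hv
    rw [hval]
    refine hlim.congr fun x => ?_
    simp only [hμs, ProbabilityMeasure.coe_mk, Pi.div_apply]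
    rw [integral_map (hVm x).aemeasurable hgm.aestronglyMeasurable, hcond]
    simp only [Fin.val_zero, Nat.cast_zero]
    rw [div_div_div_cancel_right₀ (hG.pos x).ne']
  have h1 := (ProbabilityMeasure.tendsto_iff_forall_integral_tendsto.1 hconv) f
  simp only [hμs, hμ, ProbabilityMeasure.coe_mk] at h1
  rw [integral_map hlm.aemeasurable f.continuous.aestronglyMeasurable] at h1
  refine h1.congr fun x => ?_
  rw [integral_map (hVm x).aemeasurable f.continuous.aestronglyMeasurable]

end Existence

/-! ### Uniqueness of the spectral tail law -/

section Uniqueness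

variable {Ω : Type*} [MeasurableSpace Ω] {γ : ℝ} {P : Measure Ω} {Y : ℤ → Ω → ℝ}
  {ν ν' : Measure (ℕ → ℝ)}

/-- The law of `R (θ_0, …, θ_k)` for a Pareto variable `R` independent of `θ`. -/
noncomputable def paretoScaled (γ : ℝ) (ν : Measure (ℕ → ℝ)) (k : ℕ) : Measure (Fin (k + 1) → ℝ) :=
  ((paretoMeasure 1 γ).prod ν).map fun z t => z.1 * z.2 t

theorem measurable_paretoScaled (k : ℕ) :
    Measurable fun (z : ℝ × (ℕ → ℝ)) (t : Fin (k + 1)) => z.1 * z.2 t := by fun_prop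

theorem IsSpectralTailLaw.paretoScaled_eq (hγ : 0 < γ) (h : IsSpectralTailLaw P γ Y ν)
    (h' : IsSpectralTailLaw P γ Y ν') (k : ℕ) : paretoScaled γ ν k = paretoScaled γ ν' k := by
  have := h.isProbabilityMeasure
  have := h'.isProbabilityMeasure
  have := isProbabilityMeasure_paretoMeasure one_pos hγ
  have : IsProbabilityMeasure (paretoScaled γ ν k) :=
    Measure.isProbabilityMeasure_map (measurable_paretoScaled k).aemeasurable
  have : IsProbabilityMeasure (paretoScaled γ ν' k) :=
    Measure.isProbabilityMeasure_map (measurable_paretoScaled k).aemeasurable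
  refine ext_of_forall_integral_eq_of_IsFiniteMeasure fun f => ?_
  rw [paretoScaled, paretoScaled, integral_map (measurable_paretoScaled k).aemeasurable
    f.continuous.aestronglyMeasurable, integral_map (measurable_paretoScaled k).aemeasurable
    f.continuous.aestronglyMeasurable]
  exact tendsto_nhds_unique (h.tendsto k f) (h'.tendsto k f)

/-- The tail of `R |θ_0|` integrates the Pareto tail, which is `1` below the level one; this is where
the minimum comes from. -/
theorem paretoScaled_real_abs_lt [IsProbabilityMeasure ν] (hγ : 0 < γ) {a : ℝ} (ha : 0 < a)
    (k : ℕ) : (paretoScaled γ ν k).real {v | a < |v 0|} =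
      ∫ θ, min 1 ((|θ 0| / a) ^ γ) ∂ν := by
  have := isProbabilityMeasure_paretoMeasure one_pos hγ
  have hm : MeasurableSet {v : Fin (k + 1) → ℝ | a < |v 0|} := by measurability
  have hm' := measurable_paretoScaled k hm
  rw [paretoScaled, measureReal_def, Measure.map_apply (measurable_paretoScaled k) hm,
    ← measureReal_def, ← integral_indicator_one hm', integral_prod_symm]
  · refine integral_congr_ae (Eventually.of_forall fun θ => ?_)
    simp only
    have hpos : ∀ᵐ z ∂(paretoMeasure 1 γ), 0 < z := by
      rw [paretoMeasure_one_eq]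
      exact ae_restrict_of_ae (ae_powMeasure_pos γ)
    rcases eq_or_ne (θ 0) 0 with h0 | h0
    · simp [h0, hγ.ne', ha.not_gt]
    · have hθ : 0 < |θ 0| := abs_pos.2 h0
      have e1 : (|θ 0| / a) ^ γ = (a / |θ 0|) ^ (-γ) := by
        rw [Real.rpow_neg (by positivity), ← Real.inv_rpow (by positivity), inv_div]
      rw [e1, ← paretoMeasure_Ioi hγ (by positivity), ← integral_indicator_one measurableSet_Ioi]
      refine integral_congr_ae ?_
      filter_upwards [hpos] with z hz
      by_cases hlt : a < z * |θ 0|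
      · rw [Set.indicator_of_mem, Set.indicator_of_mem]
        · rfl
        · exact (div_lt_iff₀ hθ).2 hlt
        · simpa [abs_mul, abs_of_pos hz] using hlt
      · rw [Set.indicator_of_notMem, Set.indicator_of_notMem]
        · simpa [div_lt_iff₀ hθ] using hlt
        · simpa [abs_mul, abs_of_pos hz] using hlt
  · exact (integrable_const (1 : ℝ)).indicator hm'

/-- The restriction to `U s 0 ≠ 0` is built into the densities `|U s 0| ^ γ`. -/
theorem ae_abs_eq_one_spectralLaw {σ : Type*} {S : Finset σ} {U : σ → Ω → ℕ → ℝ} (hγ : 0 < γ)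
    (hU : ∀ s, Measurable (U s)) : ∀ᵐ θ ∂(spectralLaw γ P S U), |θ 0| = 1 := by
  have hm : MeasurableSet {θ : ℕ → ℝ | ¬ |θ 0| = 1} := by measurability
  rw [ae_iff, spectralLaw_apply hU hm]
  refine mul_eq_zero_of_right _ (Finset.sum_eq_zero fun s _ => ?_)
  rw [setLIntegral_eq_zero_iff]
  · refine Eventually.of_forall fun ω hω => ?_
    by_contra hne
    have h0 : U s ω 0 ≠ 0 := fun h0 => hne (by simp [h0, hγ.ne'])
    refine hω ?_
    simp only [abs_div, abs_abs]
    exact div_self (abs_ne_zero.2 h0)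
  · have := hU s
    exact (by fun_prop : Measurable fun ω t => U s ω t / |U s ω 0|) hm
  · have := hU s
    fun_prop

/-- A Pareto variable `R` with `R |θ_0|` distributed like `R` forces `|θ_0| = 1`: the tail at the
level `1` gives `|θ_0| ≥ 1`, the tail at the level `2` then gives `|θ_0| ≤ 1`. -/
theorem ae_abs_eq_one_of_paretoScaled_eq [IsProbabilityMeasure ν] [IsProbabilityMeasure ν']
    (hγ : 0 < γ) (hν' : ∀ᵐ θ ∂ν', |θ 0| = 1) (h : paretoScaled γ ν 0 = paretoScaled γ ν' 0) :
    ∀ᵐ θ ∂ν, |θ 0| = 1 := by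
  have key : ∀ a : ℝ, 1 ≤ a → ∫ θ, min 1 ((|θ 0| / a) ^ γ) ∂ν = a ^ (-γ) := by
    intro a ha
    have ha0 : 0 < a := by linarith
    rw [← paretoScaled_real_abs_lt hγ ha0 0, h, paretoScaled_real_abs_lt hγ ha0 0]
    have : ∀ᵐ θ ∂ν', min 1 ((|θ 0| / a) ^ γ) = a ^ (-γ) := by
      filter_upwards [hν'] with θ hθ
      rw [hθ, one_div, Real.inv_rpow ha0.le, ← Real.rpow_neg ha0.le, min_eq_right]
      exact Real.rpow_le_one_of_one_le_of_nonpos ha (by linarith)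
    rw [integral_congr_ae this]
    simp
  have hint : ∀ a : ℝ, 0 < a → Integrable (fun θ : ℕ → ℝ => min 1 ((|θ 0| / a) ^ γ)) ν := by
    intro a ha
    refine Integrable.of_bound (by fun_prop : Measurable fun θ : ℕ → ℝ =>
      min 1 ((|θ 0| / a) ^ γ)).aestronglyMeasurable 1 (Eventually.of_forall fun θ => ?_)
    rw [Real.norm_of_nonneg (le_min zero_le_one (by positivity))]
    exact min_le_left _ _
  have h1 : ∀ᵐ θ ∂ν, 1 ≤ |θ 0| := by
    have e : ∫ θ, (1 - min 1 ((|θ 0| / 1) ^ γ)) ∂ν = 0 := by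
      rw [integral_sub (integrable_const _) (hint 1 one_pos), key 1 le_rfl]
      simp
    rw [integral_eq_zero_iff_of_nonneg (fun θ => sub_nonneg.2 (min_le_left _ _))
      ((integrable_const _).sub (hint 1 one_pos))] at e
    filter_upwards [e] with θ hθ
    by_contra hlt
    have hlt' : |θ 0| ^ γ < 1 := Real.rpow_lt_one (abs_nonneg _) (not_le.1 hlt) hγ
    simp only [div_one, Pi.zero_apply, min_eq_right hlt'.le] at hθ
    linarith
  have e : ∫ θ, (min 1 ((|θ 0| / 2) ^ γ) - 2 ^ (-γ)) ∂ν = 0 := by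
    rw [integral_sub (hint 2 two_pos) (integrable_const _), key 2 one_le_two]
    simp
  have h2 : ∀ t : ℝ, (1 / 2 : ℝ) ^ γ = 2 ^ (-γ) := fun _ => by
    rw [one_div, Real.inv_rpow (by norm_num), ← Real.rpow_neg (by norm_num)]
  have hlt1 : (2 : ℝ) ^ (-γ) < 1 := Real.rpow_lt_one_of_one_lt_of_neg one_lt_two (by linarith)
  have hint2 : Integrable (fun θ : ℕ → ℝ => min 1 ((|θ 0| / 2) ^ γ) - 2 ^ (-γ)) ν :=
    (hint 2 two_pos).sub (integrable_const _)
  rw [integral_eq_zero_iff_of_nonneg_ae ?_ hint2] at e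
  · filter_upwards [e, h1] with θ hθ hθ1
    simp only [Pi.zero_apply] at hθ
    have hθ' : min 1 ((|θ 0| / 2) ^ γ) = 2 ^ (-γ) := by linarith
    rcases min_cases 1 ((|θ 0| / 2) ^ γ) with ⟨h3, -⟩ | ⟨h3, -⟩
    · rw [h3] at hθ'; linarith
    · rw [h3, ← h2 0] at hθ'
      have := (Real.rpow_left_inj (by positivity) (by norm_num) hγ.ne').1 hθ'
      linarith
  · filter_upwards [h1] with θ hθ1
    simp only [Pi.zero_apply]
    refine sub_nonneg.2 (le_min hlt1.le ?_)
    rw [← h2 0]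
    exact Real.rpow_le_rpow (by norm_num) (by linarith) hγ.le

/-- If `|θ_0| = 1`, then `θ` is recovered from `R θ` by division by `|R θ_0|`. -/
theorem map_restrict_eq_of_paretoScaled_eq [IsProbabilityMeasure ν] [IsProbabilityMeasure ν']
    (hγ : 0 < γ) (hν : ∀ᵐ θ ∂ν, |θ 0| = 1) (hν' : ∀ᵐ θ ∂ν', |θ 0| = 1) {k : ℕ}
    (h : paretoScaled γ ν k = paretoScaled γ ν' k) :
    ν.map (fun θ (t : Fin (k + 1)) => θ t) = ν'.map (fun θ (t : Fin (k + 1)) => θ t) := by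
  have := isProbabilityMeasure_paretoMeasure one_pos hγ
  have key : ∀ (ρ : Measure (ℕ → ℝ)) [IsProbabilityMeasure ρ], (∀ᵐ θ ∂ρ, |θ 0| = 1) →
      ρ.map (fun θ (t : Fin (k + 1)) => θ t) =
        (paretoScaled γ ρ k).map fun v t => v t / |v 0| := by
    intro ρ _ hρ
    rw [paretoScaled, Measure.map_map (by fun_prop) (measurable_paretoScaled k)]
    have h1 : ρ = ((paretoMeasure 1 γ).prod ρ).map Prod.snd := by
      rw [Measure.map_snd_prod, measure_univ, one_smul]
    conv_lhs => rw [h1]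
    rw [Measure.map_map (by fun_prop) measurable_snd]
    refine Measure.map_congr ?_
    have hpos : ∀ᵐ z ∂(paretoMeasure 1 γ), 0 < z := by
      rw [paretoMeasure_one_eq]
      exact ae_restrict_of_ae (ae_powMeasure_pos γ)
    have e1 : ∀ᵐ p ∂((paretoMeasure 1 γ).prod ρ), 0 < p.1 :=
      Measure.quasiMeasurePreserving_fst.ae hpos
    have e2 : ∀ᵐ p ∂((paretoMeasure 1 γ).prod ρ), |p.2 0| = 1 :=
      Measure.quasiMeasurePreserving_snd.ae hρ
    filter_upwards [e1, e2] with p h1 h2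
    ext t
    simp only [Function.comp_apply, Fin.val_zero, abs_mul, h2, abs_of_pos h1, mul_one]
    field_simp
  rw [key ν hν, key ν' hν', h]

/-- The finite-dimensional laws of a spectral tail process are determined by the process. -/
theorem IsSpectralTailLaw.real_setOf_eq_spectralLaw {σ : Type*} {S : Finset σ}
    {U : σ → Ω → ℕ → ℝ} (hγ : 0 < γ) (hU : ∀ s, Measurable (U s))
    (h' : IsSpectralTailLaw P γ Y (spectralLaw γ P S U)) (h : IsSpectralTailLaw P γ Y ν)
    (n : ℕ) {B : ℕ → Set ℝ} (hB : ∀ t, MeasurableSet (B t)) :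
    ν.real {θ | ∀ t : ℕ, t ≤ n → θ t ∈ B t} =
      (spectralLaw γ P S U).real {θ | ∀ t : ℕ, t ≤ n → θ t ∈ B t} := by
  have := h.isProbabilityMeasure
  have := h'.isProbabilityMeasure
  have h1 := ae_abs_eq_one_spectralLaw (P := P) (S := S) hγ hU
  have h2 := ae_abs_eq_one_of_paretoScaled_eq hγ h1 (h.paretoScaled_eq hγ h' 0)
  have h3 := map_restrict_eq_of_paretoScaled_eq hγ h2 h1 (h.paretoScaled_eq hγ h' n)
  have hm : Measurable fun (θ : ℕ → ℝ) (t : Fin (n + 1)) => θ t := by fun_prop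
  have hD : MeasurableSet {v : Fin (n + 1) → ℝ | ∀ t : Fin (n + 1), v t ∈ B t} := by
    have : {v : Fin (n + 1) → ℝ | ∀ t : Fin (n + 1), v t ∈ B t} =
        ⋂ t : Fin (n + 1), (fun v => v t) ⁻¹' (B t) := by ext; simp
    rw [this]
    exact MeasurableSet.iInter fun t => measurable_pi_apply t (hB t)
  have hset : {θ : ℕ → ℝ | ∀ t : ℕ, t ≤ n → θ t ∈ B t} =
      (fun (θ : ℕ → ℝ) (t : Fin (n + 1)) => θ t) ⁻¹'
        {v : Fin (n + 1) → ℝ | ∀ t : Fin (n + 1), v t ∈ B t} := by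
    ext θ
    simp only [Set.mem_ofPred_eq, Set.mem_preimage]
    exact ⟨fun H t => H t (Nat.lt_succ_iff.1 t.2),
      fun H t ht => H ⟨t, Nat.lt_succ_iff.2 ht⟩⟩
  rw [hset, measureReal_def, measureReal_def, ← Measure.map_apply hm hD, h3,
    Measure.map_apply hm hD]

end Uniqueness

/-! ### The lower limit of the tail of a sum of two independent copies -/

section Domination

variable {Ω : Type*} [MeasurableSpace Ω] {P : Measure Ω} [IsProbabilityMeasure P]

/-- The superlevel sets of an increasing continuous function are open half-lines. -/
theorem setOf_lt_eq_Ioi_or_empty {φ : ℝ → ℝ} (hφ : Continuous φ) (hmono : Monotone φ) {x₀ t : ℝ}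
    (h0 : ∀ x, x ≤ x₀ → φ x = 0) (ht : 0 < t) :
    {x | t < φ x} = ∅ ∨ ∃ y, x₀ ≤ y ∧ {x | t < φ x} = Set.Ioi y := by
  rcases Set.eq_empty_or_nonempty {x | t < φ x} with he | hne
  · exact Or.inl he
  right
  have hlb : ∀ x ∈ {x | t < φ x}, x₀ ≤ x := by
    intro x hx
    by_contra hlt
    simp only [Set.mem_ofPred_eq, h0 x (not_le.1 hlt).le] at hx
    linarith
  have hbdd : BddBelow {x | t < φ x} := ⟨x₀, hlb⟩
  have hopen : IsOpen {x | t < φ x} := isOpen_lt continuous_const hφ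
  refine ⟨sInf {x | t < φ x}, le_csInf hne hlb, ?_⟩
  ext x
  constructor
  · intro hx
    obtain ⟨ε, hε, hball⟩ := Metric.isOpen_iff.1 hopen x hx
    have : x - ε / 2 ∈ {x | t < φ x} := hball (by
      rw [Real.ball_eq_Ioo]; constructor <;> linarith)
    exact lt_of_le_of_lt (csInf_le hbdd this) (by linarith)
  · intro hx
    obtain ⟨z, hz, hzx⟩ := exists_lt_of_csInf_lt hne hx
    exact lt_of_lt_of_le hz (hmono hzx.le)

/-- An inequality between tails beyond `x₀` integrates to increasing functions that vanish up to
`x₀`. -/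
theorem integral_comp_le_of_tail_le {X X' : Ω → ℝ} (hX : Measurable X) (hX' : Measurable X')
    {c x₀ : ℝ} (hc : 0 ≤ c)
    (h : ∀ x, x₀ ≤ x → c * P.real {ω | x < X ω} ≤ P.real {ω | x < X' ω}) {φ : ℝ → ℝ}
    (hφ : Continuous φ) (hmono : Monotone φ) (h0 : ∀ x, x ≤ x₀ → φ x = 0)
    (hi : Integrable (fun ω => φ (X ω)) P) (hi' : Integrable (fun ω => φ (X' ω)) P) :
    c * ∫ ω, φ (X ω) ∂P ≤ ∫ ω, φ (X' ω) ∂P := by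
  have hnn : ∀ x, 0 ≤ φ x := fun x => by
    rw [← h0 (min x x₀) (min_le_right _ _)]
    exact hmono (min_le_left _ _)
  have key : ENNReal.ofReal c * ∫⁻ ω, ENNReal.ofReal (φ (X ω)) ∂P ≤
      ∫⁻ ω, ENNReal.ofReal (φ (X' ω)) ∂P := by
    rw [lintegral_eq_lintegral_meas_lt P (Eventually.of_forall fun ω => hnn _)
        (hφ.measurable.comp hX).aemeasurable,
      lintegral_eq_lintegral_meas_lt P (Eventually.of_forall fun ω => hnn _)
        (hφ.measurable.comp hX').aemeasurable, ← lintegral_const_mul' _ _ ENNReal.ofReal_ne_top]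
    refine setLIntegral_mono' measurableSet_Ioi fun t ht => ?_
    have e1 : {ω | t < φ (X ω)} = X ⁻¹' {x | t < φ x} := rfl
    have e2 : {ω | t < φ (X' ω)} = X' ⁻¹' {x | t < φ x} := rfl
    rw [e1, e2]
    rcases setOf_lt_eq_Ioi_or_empty hφ hmono h0 ht with he | ⟨y, hy, he⟩
    · simp [he]
    · rw [he, ← ofReal_measureReal, ← ofReal_measureReal, ← ENNReal.ofReal_mul hc]
      exact ENNReal.ofReal_le_ofReal (h y hy)
  rw [← ofReal_integral_eq_lintegral_ofReal hi (Eventually.of_forall fun ω => hnn _),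
    ← ofReal_integral_eq_lintegral_ofReal hi' (Eventually.of_forall fun ω => hnn _),
    ← ENNReal.ofReal_mul hc] at key
  exact (ENNReal.ofReal_le_ofReal_iff (integral_nonneg fun ω => hnn _)).1 key

end Domination

section FossKorshunov

variable {Ω : Type*} [MeasurableSpace Ω] {P : Measure Ω} [IsProbabilityMeasure P] {X Y : Ω → ℝ}
  {γ : ℝ}

/-- The positive part of `x`, truncated at `T`. -/
noncomputable def truncPos (T x : ℝ) : ℝ := min (max x 0) T

theorem truncPos_nonneg {T : ℝ} (hT : 0 ≤ T) (x : ℝ) : 0 ≤ truncPos T x :=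
  le_min (le_max_right _ _) hT

theorem truncPos_le (T x : ℝ) : truncPos T x ≤ T := min_le_right _ _

theorem truncPos_mono (T : ℝ) : Monotone (truncPos T) := fun x y h => by
  unfold truncPos; gcongr

theorem continuous_truncPos (T : ℝ) : Continuous (truncPos T) := by
  unfold truncPos; fun_prop

theorem truncPos_add_le {T : ℝ} (hT : 0 ≤ T) (x y : ℝ) :
    truncPos T (x + y) ≤ truncPos T x + truncPos T y := by
  unfold truncPos
  rcases le_total x 0 with hx | hx <;> rcases le_total y 0 with hy | hy <;>
    grind

theorem truncPos_succ_le (T x : ℝ) : truncPos (T + 1) x ≤ truncPos T x + 1 := by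
  unfold truncPos; grind

omit [IsProbabilityMeasure P] in
/-- The factor `e^{ε x̃}`, where `x̃` is the positive part of `x` truncated at `T`, costs little
against the measure `e^{γ x} P(X ∈ dx)`, but not nothing. Without truncation the cost is infinite,
and raising `T` by one multiplies it by at most `e^ε`, so some `T` has cost between `1 + δ / 2` and
`1 + δ`. -/
theorem exists_truncation (hX : Measurable X)
    (hm : Integrable (fun ω => Real.exp (γ * X ω)) P)
    (hinf : ∀ ε : ℝ, 0 < ε → ¬ Integrable (fun ω => Real.exp ((γ + ε) * X ω)) P)
    {δ ε : ℝ} (hδ : 0 < δ) (hε : 0 < ε) (hεδ : ε * (1 + δ) ≤ δ / 2) :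
    ∃ T : ℝ, 0 ≤ T ∧
      ∫ ω, Real.exp (γ * X ω) * Real.exp (ε * truncPos T (X ω)) ∂P ≤
        (1 + δ) * ∫ ω, Real.exp (γ * X ω) ∂P ∧
      (1 + δ / 2) * ∫ ω, Real.exp (γ * X ω) ∂P ≤
        ∫ ω, Real.exp (γ * X ω) * Real.exp (ε * truncPos T (X ω)) ∂P := by
  set m := ∫ ω, Real.exp (γ * X ω) ∂P with hmdef
  have hm0 : 0 ≤ m := integral_nonneg fun _ => (Real.exp_pos _).le
  set h : ℕ → ℝ := fun n =>
    ∫ ω, Real.exp (γ * X ω) * Real.exp (ε * truncPos n (X ω)) ∂P with hh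
  have hmeas : ∀ T : ℝ, Measurable fun ω =>
      Real.exp (γ * X ω) * Real.exp (ε * truncPos T (X ω)) := fun T => by
    have := (continuous_truncPos T).measurable
    fun_prop
  have hint : ∀ T : ℝ, Integrable (fun ω =>
      Real.exp (γ * X ω) * Real.exp (ε * truncPos T (X ω))) P := by
    intro T
    refine (hm.mul_const (Real.exp (ε * T))).mono' (hmeas T).aestronglyMeasurable
      (Eventually.of_forall fun ω => ?_)
    rw [Real.norm_of_nonneg (by positivity)]
    have := truncPos_le T (X ω)
    gcongr
  have hex : ∃ n, (1 + δ) * m < h n := by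
    by_contra hcon
    push Not at hcon
    refine hinf ε hε ?_
    refine ⟨(by fun_prop : Measurable fun ω => Real.exp ((γ + ε) * X ω)).aestronglyMeasurable, ?_⟩
    rw [hasFiniteIntegral_iff_ofReal (Eventually.of_forall fun ω => (Real.exp_pos _).le)]
    calc ∫⁻ ω, ENNReal.ofReal (Real.exp ((γ + ε) * X ω)) ∂P
        ≤ ∫⁻ ω, liminf (fun n : ℕ => ENNReal.ofReal
            (Real.exp (γ * X ω) * Real.exp (ε * truncPos n (X ω)))) atTop ∂P := by
          refine lintegral_mono fun ω => le_liminf_of_le (by isBoundedDefault) ?_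
          filter_upwards [eventually_ge_atTop ⌈max (X ω) 0⌉₊] with n hn
          refine ENNReal.ofReal_le_ofReal ?_
          rw [← Real.exp_add]
          refine Real.exp_le_exp.2 ?_
          have : truncPos n (X ω) = max (X ω) 0 := min_eq_left ((Nat.ceil_le).1 hn)
          rw [this]
          nlinarith [le_max_left (X ω) 0]
      _ ≤ liminf (fun n : ℕ => ∫⁻ ω, ENNReal.ofReal
            (Real.exp (γ * X ω) * Real.exp (ε * truncPos n (X ω))) ∂P) atTop :=
          lintegral_liminf_le fun n => (hmeas n).ennreal_ofReal
      _ ≤ ENNReal.ofReal ((1 + δ) * m) := by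
          refine liminf_le_of_le (by isBoundedDefault) fun b hb => ?_
          obtain ⟨n, hn⟩ := hb.exists
          refine hn.trans ?_
          rw [← ofReal_integral_eq_lintegral_ofReal (hint n)
            (Eventually.of_forall fun ω => by positivity)]
          exact ENNReal.ofReal_le_ofReal (hcon n)
      _ < ⊤ := ENNReal.ofReal_lt_top
  classical
  set n := Nat.find hex with hn
  have hn1 : (1 + δ) * m < h n := Nat.find_spec hex
  have hn0 : n ≠ 0 := by
    intro h0
    rw [h0] at hn1
    have : h 0 = m := by
      simp only [hh, hmdef]
      refine integral_congr_ae (Eventually.of_forall fun ω => ?_)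
      have : truncPos ((0 : ℕ) : ℝ) (X ω) = 0 := by
        unfold truncPos; simp
      simp only [this, mul_zero, Real.exp_zero, mul_one]
    rw [this] at hn1
    nlinarith
  obtain ⟨k, hk⟩ := Nat.exists_eq_succ_of_ne_zero hn0
  have hk1 : h k ≤ (1 + δ) * m := not_lt.1 (Nat.find_min hex (by omega))
  refine ⟨k, by positivity, hk1, ?_⟩
  have hle : h n ≤ Real.exp ε * h k := by
    simp only [hh]
    rw [← integral_const_mul]
    refine integral_mono (hint n) ((hint k).const_mul _) fun ω => ?_
    simp only
    have h1 := truncPos_succ_le k (X ω)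
    have h3 : ((n : ℕ) : ℝ) = k + 1 := by rw [hk]; push_cast; ring
    have h4 : ε * truncPos n (X ω) ≤ ε + ε * truncPos k (X ω) := by rw [h3]; nlinarith
    calc Real.exp (γ * X ω) * Real.exp (ε * truncPos n (X ω))
        ≤ Real.exp (γ * X ω) * Real.exp (ε + ε * truncPos k (X ω)) := by gcongr
      _ = _ := by rw [Real.exp_add]; ring
  have h2 : Real.exp (-ε) * h n ≤ h k := by
    calc Real.exp (-ε) * h n ≤ Real.exp (-ε) * (Real.exp ε * h k) := by gcongr
      _ = h k := by rw [← mul_assoc, ← Real.exp_add]; simp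
  have h3 : 1 - ε ≤ Real.exp (-ε) := by linarith [Real.add_one_le_exp (-ε)]
  calc (1 + δ / 2) * m ≤ (1 - ε) * ((1 + δ) * m) := by nlinarith
    _ ≤ Real.exp (-ε) * ((1 + δ) * m) := by gcongr
    _ ≤ Real.exp (-ε) * h n := by gcongr
    _ ≤ h k := h2

/-- The lower limit of `P (X + Y > x) / P (X > x)` is at most `2 E e^{γ X}`. The expectations of
the weight `e^{γ x} x̃ e^{ε x̃}` of `X` and of `X + Y` are compared, with `x̃` the truncated positive
part of `x`. As `x̃` is subadditive, the latter is at most `2 E e^{γ X} (1 + δ)` times the former,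
while a tail ratio above `2 E e^{γ X} + κ` would make it larger: the part of the expectations below
`x₀` is bounded, and the expectation of the weight grows without bound as `ε → 0`. -/
theorem not_eventually_tail_add_ge (hγ : 0 < γ) (hX : Measurable X) (hY : Measurable Y)
    (hXY : IndepFun X Y P) (hid : IdentDistrib Y X P P)
    (hm : Integrable (fun ω => Real.exp (γ * X ω)) P)
    (hinf : ∀ ε : ℝ, 0 < ε → ¬ Integrable (fun ω => Real.exp ((γ + ε) * X ω)) P)
    {κ : ℝ} (hκ : 0 < κ) :
    ¬ ∀ᶠ x in atTop, (2 * (∫ ω, Real.exp (γ * X ω) ∂P) + κ) * P.real {ω | x < X ω} ≤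
      P.real {ω | x < X ω + Y ω} := by
  intro hev
  set m := ∫ ω, Real.exp (γ * X ω) ∂P with hmdef
  have hm0 : 0 < m := integral_exp_pos hm
  obtain ⟨x₁, hx₁⟩ := eventually_atTop.1 hev
  set x₀ := max x₁ 0
  have hx₀ : 0 ≤ x₀ := le_max_right _ _
  have htail : ∀ x, x₀ ≤ x → (2 * m + κ) * P.real {ω | x < X ω} ≤ P.real {ω | x < X ω + Y ω} :=
    fun x hx => hx₁ x ((le_max_left _ _).trans hx)
  set δ := κ / (4 * m) with hδdef
  have hδ : 0 < δ := by positivity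
  set W := Real.exp (γ * x₀) * (x₀ * Real.exp x₀) with hW
  have hW0 : 0 ≤ W := by positivity
  -- the parameter `ε` is small enough for the expected weight to exceed the bound obtained below
  obtain ⟨ε, hε, hε1, hε2, hε3⟩ : ∃ ε : ℝ, 0 < ε ∧ ε ≤ 1 ∧ ε * (1 + δ) ≤ δ / 2 ∧
      ε * ((2 * m + κ) * W + 1) ≤ κ / 2 * (m * (δ / 2)) := by
    refine ⟨min 1 (min (δ / 2 / (1 + δ)) (κ / 2 * (m * (δ / 2)) / ((2 * m + κ) * W + 1))),
      by positivity, min_le_left _ _, ?_, ?_⟩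
    · rw [← le_div_iff₀ (by positivity)]
      exact (min_le_right _ _).trans (min_le_left _ _)
    · rw [← le_div_iff₀ (by positivity)]
      exact (min_le_right _ _).trans (min_le_right _ _)
  obtain ⟨T, hT, hT1, hT2⟩ := exists_truncation hX hm hinf hδ hε hε2
  have hYg : ∀ g : ℝ → ℝ, Measurable g → ∫ ω, g (Y ω) ∂P = ∫ ω, g (X ω) ∂P := fun g hg =>
    (hid.comp hg).integral_eq
  have htm := (continuous_truncPos T).measurable
  have htc := continuous_truncPos T
  set u : ℝ → ℝ := fun x => Real.exp (γ * x) * Real.exp (ε * truncPos T x) with hu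
  set w : ℝ → ℝ := fun x => Real.exp (γ * x) * (truncPos T x * Real.exp (ε * truncPos T x)) with hw
  have hum : Measurable u := by fun_prop
  have hwm : Measurable w := by fun_prop
  have hwc : Continuous w := by fun_prop
  have hwmono : Monotone w := by
    intro x y hxy
    have h1 := truncPos_mono T hxy
    have h2 := truncPos_nonneg hT x
    have h3 := truncPos_nonneg hT y
    simp only [hw]
    gcongr
  have hw0 : ∀ x, 0 ≤ w x := fun x => by
    have := truncPos_nonneg hT x
    positivity
  have huX : Integrable (fun ω => u (X ω)) P := by
    refine (hm.mul_const (Real.exp (ε * T))).mono' (hum.comp hX).aestronglyMeasurable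
      (Eventually.of_forall fun ω => ?_)
    rw [Real.norm_of_nonneg (by positivity)]
    have := truncPos_le T (X ω)
    simp only [hu]
    gcongr
  have hwX : Integrable (fun ω => w (X ω)) P := by
    refine (hm.mul_const (T * Real.exp (ε * T))).mono' (hwm.comp hX).aestronglyMeasurable
      (Eventually.of_forall fun ω => ?_)
    rw [Real.norm_of_nonneg (hw0 _)]
    have := truncPos_le T (X ω)
    have := truncPos_nonneg hT (X ω)
    simp only [hw]
    gcongr
  have huY : Integrable (fun ω => u (Y ω)) P := (hid.comp hum).integrable_iff.2 huX
  have hwY : Integrable (fun ω => w (Y ω)) P := (hid.comp hwm).integrable_iff.2 hwX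
  have i1 : Integrable (fun ω => w (X ω) * u (Y ω)) P :=
    (hXY.comp hwm hum).integrable_mul hwX huY
  have i2 : Integrable (fun ω => u (X ω) * w (Y ω)) P :=
    (hXY.comp hum hwm).integrable_mul huX hwY
  have hsub : ∀ x y, w (x + y) ≤ w x * u y + u x * w y := by
    intro x y
    have h1 := truncPos_add_le hT x y
    have h2 := truncPos_nonneg hT x
    have h3 := truncPos_nonneg hT y
    have h4 := truncPos_nonneg hT (x + y)
    calc w (x + y) ≤ Real.exp (γ * (x + y)) * ((truncPos T x + truncPos T y) *
          Real.exp (ε * (truncPos T x + truncPos T y))) := by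
          simp only [hw]
          gcongr
      _ = _ := by
          simp only [hw, hu, mul_add, Real.exp_add]
          ring
  have hwadd : Integrable (fun ω => w (X ω + Y ω)) P := by
    refine (i1.add i2).mono' (hwm.comp (hX.add hY)).aestronglyMeasurable
      (Eventually.of_forall fun ω => ?_)
    rw [Real.norm_of_nonneg (hw0 _)]
    exact hsub _ _
  set Ew := ∫ ω, w (X ω) ∂P with hEw
  set h := ∫ ω, u (X ω) ∂P with hh
  have hEw0 : 0 ≤ Ew := integral_nonneg fun ω => hw0 _
  have hup : ∫ ω, w (X ω + Y ω) ∂P ≤ 2 * (Ew * h) := by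
    calc ∫ ω, w (X ω + Y ω) ∂P ≤ ∫ ω, (w (X ω) * u (Y ω) + u (X ω) * w (Y ω)) ∂P :=
          integral_mono hwadd (i1.add i2) fun ω => hsub _ _
      _ = Ew * h + h * Ew := by
          rw [integral_add i1 i2]
          have e1 := (hXY.comp hwm hum).integral_mul_eq_mul_integral
            (hwm.comp hX).aestronglyMeasurable (hum.comp hY).aestronglyMeasurable
          have e2 := (hXY.comp hum hwm).integral_mul_eq_mul_integral
            (hum.comp hX).aestronglyMeasurable (hwm.comp hY).aestronglyMeasurable
          simp only [Pi.mul_apply, Function.comp_apply, hYg u hum, hYg w hwm] at e1 e2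
          rw [e1, e2]
      _ = _ := by ring
  -- the tail inequality holds beyond `x₀` only, so `w` is replaced by `(w - w x₀)⁺`
  have hlow : (2 * m + κ) * (Ew - W) ≤ ∫ ω, w (X ω + Y ω) ∂P := by
    set φ : ℝ → ℝ := fun x => max (w x - w x₀) 0 with hφ
    have hφi : ∀ {Z : Ω → ℝ}, Measurable Z → Integrable (fun ω => w (Z ω)) P →
        Integrable (fun ω => φ (Z ω)) P := by
      intro Z hZ hi
      refine hi.mono' ((by fun_prop : Measurable φ).comp hZ).aestronglyMeasurable
        (Eventually.of_forall fun ω => ?_)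
      rw [Real.norm_of_nonneg (le_max_right _ _)]
      exact max_le (by linarith [hw0 x₀]) (hw0 _)
    have hdom := integral_comp_le_of_tail_le (P := P) (X := X) (X' := fun ω => X ω + Y ω) hX
      (hX.add hY) (c := 2 * m + κ) (x₀ := x₀) (by positivity) htail (φ := φ) (by fun_prop)
      (fun x y hxy => max_le_max (sub_le_sub_right (hwmono hxy) _) le_rfl)
      (fun x hx => max_eq_right (sub_nonpos.2 (hwmono hx))) (hφi hX hwX)
      (hφi (hX.add hY) hwadd)
    have hwW : w x₀ ≤ W := by
      have e1 : truncPos T x₀ ≤ x₀ := by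
        unfold truncPos
        rw [max_eq_left hx₀]
        exact min_le_left _ _
      have e2 := truncPos_nonneg hT x₀
      simp only [hw, hW]
      gcongr
      nlinarith
    have e3 : Ew - W ≤ ∫ ω, φ (X ω) ∂P := by
      have : Ew - W = ∫ ω, (w (X ω) - W) ∂P := by
        rw [integral_sub hwX (integrable_const _)]; simp [hEw]
      rw [this]
      refine integral_mono (hwX.sub (integrable_const _)) (hφi hX hwX) fun ω => ?_
      exact le_trans (by linarith) (le_max_left _ _)
    have e4 : ∫ ω, φ (X ω + Y ω) ∂P ≤ ∫ ω, w (X ω + Y ω) ∂P := by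
      refine integral_mono (hφi (hX.add hY) hwadd) hwadd fun ω => ?_
      exact max_le (by linarith [hw0 x₀]) (hw0 _)
    calc (2 * m + κ) * (Ew - W) ≤ (2 * m + κ) * ∫ ω, φ (X ω) ∂P := by gcongr
      _ ≤ _ := hdom.trans e4
  -- `e^z - 1 ≤ z e^z` turns the cost of the truncated factor into a lower bound for `Ew`
  have hEwlow : m * (δ / 2) ≤ ε * Ew := by
    have e1 : h - m ≤ ε * Ew := by
      rw [hh, hmdef, hEw, ← integral_sub huX hm, ← integral_const_mul]
      refine integral_mono (huX.sub hm) (hwX.const_mul ε) fun ω => ?_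
      simp only [hu, hw]
      set z := ε * truncPos T (X ω) with hz
      have e2 : Real.exp z - 1 ≤ z * Real.exp z := by
        have := Real.add_one_le_exp (-z)
        have e3 : Real.exp (-z) * Real.exp z = 1 := by rw [← Real.exp_add]; simp
        nlinarith [Real.exp_pos z]
      calc Real.exp (γ * X ω) * Real.exp z - Real.exp (γ * X ω)
          = Real.exp (γ * X ω) * (Real.exp z - 1) := by ring
        _ ≤ Real.exp (γ * X ω) * (z * Real.exp z) := by gcongr
        _ = _ := by rw [hz]; ring
    linarith
  have hfin : κ / 2 * Ew ≤ (2 * m + κ) * W := by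
    have e1 : 2 * (Ew * h) ≤ 2 * (Ew * ((1 + δ) * m)) := by gcongr
    have e2 : δ * m = κ / 4 := by rw [hδdef]; field_simp
    have e3 : 2 * (Ew * ((1 + δ) * m)) = Ew * (2 * m + κ / 2) := by
      have : (1 + δ) * m = m + κ / 4 := by rw [add_mul, e2, one_mul]
      rw [this]; ring
    nlinarith [hlow.trans hup]
  have e5 : κ / 2 * (m * (δ / 2)) ≤ ε * ((2 * m + κ) * W) := by
    calc κ / 2 * (m * (δ / 2)) ≤ κ / 2 * (ε * Ew) := by gcongr
      _ = ε * (κ / 2 * Ew) := by ring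
      _ ≤ _ := by gcongr
  nlinarith

end FossKorshunov

/-! ### Consequences of convolution equivalence -/

section Convolution

variable {Ω : Type*} [MeasurableSpace Ω] {P : Measure Ω} [IsProbabilityMeasure P] {γ : ℝ}
  {G : ℝ → ℝ}

/-- A tail bound near infinity extends to the whole line. -/
theorem RegVarTail.exists_forall_le (hG : RegVarTail γ G) {F : ℝ → ℝ} {C : ℝ}
    (hF : ∀ x, F x ≤ 1) (hC : 0 ≤ C) (h : ∀ᶠ x in atTop, F x ≤ C * G x) :
    ∃ C' : ℝ, 0 < C' ∧ ∀ x, F x ≤ C' * G x := by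
  obtain ⟨x₀, hx₀⟩ := eventually_atTop.1 h
  have h0 := hG.pos x₀
  refine ⟨C + 1 / G x₀, by positivity, fun x => ?_⟩
  have hx := hG.pos x
  rcases le_total x₀ x with hxx | hxx
  · refine (hx₀ x hxx).trans ?_
    have : 0 ≤ 1 / G x₀ := by positivity
    nlinarith
  · have h1 : 1 ≤ 1 / G x₀ * G x := by
      rw [div_mul_eq_mul_div, one_mul, le_div_iff₀ h0, one_mul]; exact hG.anti hxx
    nlinarith [hF x]

/-- Exponential moments above the tail index are infinite. -/
theorem RegVarTail.not_integrable_exp (hG : RegVarTail γ G) (hγ : 0 < γ) {X : Ω → ℝ}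
    (hX : ∀ x, P.real {ω | x < Real.exp (X ω)} = G x) {ε : ℝ} (hε : 0 < ε) :
    ¬ Integrable (fun ω => Real.exp ((γ + ε) * X ω)) P := by
  intro hi
  set M := ∫ ω, Real.exp ((γ + ε) * X ω) ∂P with hM
  have hM0 : 0 ≤ M := integral_nonneg fun ω => (Real.exp_pos _).le
  have h1 := hG.eventually_rpow_neg_le hγ (β := γ + ε) (by linarith)
    (η := 1 / (2 * (M + 1))) (by positivity)
  obtain ⟨x, hx, hx0⟩ := (h1.and (eventually_gt_atTop 0)).exists
  have h2 : x ^ (γ + ε) * G x ≤ M := by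
    rw [← hX x]
    refine le_trans ?_ (mul_meas_ge_le_integral_of_nonneg
      (Eventually.of_forall fun ω => (Real.exp_pos _).le) hi (x ^ (γ + ε)))
    have : 0 ≤ x ^ (γ + ε) := by positivity
    refine mul_le_mul_of_nonneg_left (measureReal_mono fun ω hω => ?_) this
    simp only [Set.mem_ofPred_eq] at hω ⊢
    rw [mul_comm, Real.exp_mul]
    gcongr
  have h3 : 1 ≤ 1 / (2 * (M + 1)) * (x ^ (γ + ε) * G x) := by
    have : x ^ (-(γ + ε)) * x ^ (γ + ε) = 1 := by rw [← Real.rpow_add hx0]; simp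
    calc 1 = x ^ (-(γ + ε)) * x ^ (γ + ε) := this.symm
      _ ≤ (1 / (2 * (M + 1)) * G x) * x ^ (γ + ε) := by gcongr
      _ = _ := by ring
  have h4 : 1 / (2 * (M + 1)) * (x ^ (γ + ε) * G x) ≤ 1 / (2 * (M + 1)) * M := by gcongr
  have h5 : 1 / (2 * (M + 1)) * M < 1 := by
    rw [div_mul_eq_mul_div, div_lt_one (by positivity)]; linarith
  linarith

/-- A multiplier bounded by `K` changes the tail by its truncated moment of order `γ`. -/
theorem RegVarTail.tendsto_tail_mul_trunc (hG : RegVarTail γ G) {A B : Ω → ℝ} (hA : Measurable A)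
    (hB : Measurable B) (hB0 : ∀ ω, 0 < B ω) (hAB : IndepFun A B P)
    (hAG : ∀ x, P.real {ω | x < A ω} = G x) {K : ℝ} (hK : 0 < K) :
    Tendsto (fun x => P.real {ω | x < A ω * B ω ∧ B ω ≤ K} / G x) atTop
      (𝓝 (∫ ω in {ω | B ω ≤ K}, B ω ^ γ ∂P)) := by
  have hD : MeasurableSet {p : ℝ × ℝ | p.2 ≤ K} := measurableSet_le measurable_snd measurable_const
  have hBK : MeasurableSet {ω | B ω ≤ K} := measurableSet_le hB measurable_const
  have hrep : ∀ x, P.real {ω | x < A ω * B ω ∧ B ω ≤ K} =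
      ∫ ω, {ω | B ω ≤ K}.indicator (fun ω => G (x / B ω)) ω ∂P := by
    intro x
    have hD : MeasurableSet {p : ℝ × ℝ | x < p.1 * p.2 ∧ p.2 ≤ K} := by measurability
    have := measureReal_of_indepFun hAB hA hB hD
    refine Eq.trans this (integral_congr_ae (Eventually.of_forall fun ω => ?_))
    simp only [Set.mem_ofPred_eq]
    by_cases h : B ω ≤ K
    · rw [Set.indicator_of_mem (by exact h), ← hAG]
      simp only [h, and_true, div_lt_iff₀ (hB0 ω)]
    · rw [Set.indicator_of_notMem (by exact h)]
      simp [h]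
  simp_rw [hrep, ← integral_div]
  rw [← integral_indicator hBK]
  obtain ⟨C, hC, hCK⟩ := hG.exists_eventually_le (inv_pos.2 hK)
  refine tendsto_integral_filter_of_dominated_convergence (fun _ => C) ?_ ?_
    (integrable_const C) ?_
  · refine Eventually.of_forall fun x => ?_
    have : Measurable G := hG.anti.measurable
    exact (((this.comp (measurable_const.div hB)).indicator hBK).div_const _).aestronglyMeasurable
  · filter_upwards [hCK, eventually_ge_atTop 0] with x hx hx0
    refine Eventually.of_forall fun ω => ?_
    have h0 := hG.pos x
    by_cases h : B ω ≤ K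
    · rw [Set.indicator_of_mem (by exact h),
        Real.norm_of_nonneg (div_nonneg (hG.pos _).le (hG.pos _).le), div_le_iff₀ h0]
      refine le_trans (hG.anti ?_) hx
      rw [inv_mul_eq_div]
      have := hB0 ω
      gcongr
    · rw [Set.indicator_of_notMem (by exact h)]
      simpa using hC.le
  · refine Eventually.of_forall fun ω => ?_
    by_cases h : B ω ≤ K
    · simp only [Set.indicator_of_mem (show ω ∈ {ω | B ω ≤ K} from h)]
      have := hG.ratio (B ω)⁻¹ (inv_pos.2 (hB0 ω))
      rw [Real.inv_rpow (hB0 ω).le, Real.rpow_neg (hB0 ω).le, inv_inv] at this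
      simpa only [inv_mul_eq_div] using this
    · simp only [Set.indicator_of_notMem (show ω ∉ {ω | B ω ≤ K} from h)]
      simp

variable {X Y : Ω → ℝ}

/-- Under convolution equivalence, the product of two independent copies exceeds a high level with
both factors large only with negligible probability; moreover the moment of order `γ` is finite.
If `c` is the limit of the ratio, the contribution of both factors above `K` has the limit
`c - 2 E[e^{γ X}; e^X ≤ K]`, which decreases to `c - 2 E e^{γ X}` as `K → ∞` and is nonnegative; by
`not_eventually_tail_add_ge` it decreases to zero. -/
theorem convolutionRatio_consequences (hG : RegVarTail γ G) (hγ : 0 < γ) (hX : Measurable X)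
    (hY : Measurable Y) (hXY : IndepFun X Y P) (hid : IdentDistrib Y X P P)
    (hXG : ∀ x, P.real {ω | x < Real.exp (X ω)} = G x) (hconv : ConvolutionRatio P X Y) :
    Integrable (fun ω => Real.exp (γ * X ω)) P ∧
    (∃ C : ℝ, 0 < C ∧ ∀ x, P.real {ω | x < Real.exp (X ω) * Real.exp (Y ω)} ≤ C * G x) ∧
    ∀ η : ℝ, 0 < η → ∃ K : ℝ, 1 ≤ K ∧ ∀ᶠ x in atTop,
      P.real {ω | x < Real.exp (X ω) * Real.exp (Y ω) ∧ K < Real.exp (X ω) ∧ K < Real.exp (Y ω)} ≤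
        η * G x := by
  obtain ⟨c, hc, hlim⟩ := hconv
  set A : Ω → ℝ := fun ω => Real.exp (X ω) with hAdef
  set B : Ω → ℝ := fun ω => Real.exp (Y ω) with hBdef
  have hA : Measurable A := by fun_prop
  have hB : Measurable B := by fun_prop
  have hA0 : ∀ ω, 0 < A ω := fun ω => Real.exp_pos _
  have hB0 : ∀ ω, 0 < B ω := fun ω => Real.exp_pos _
  have hAB : IndepFun A B P := hXY.comp Real.measurable_exp Real.measurable_exp
  have hidAB : IdentDistrib B A P P := hid.comp Real.measurable_exp
  have hBG : ∀ x, P.real {ω | x < B ω} = G x := fun x => by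
    rw [← hXG x]
    have := hidAB.measure_mem_eq (s := Set.Ioi x) measurableSet_Ioi
    exact congrArg ENNReal.toReal this
  have hprod : Tendsto (fun x => P.real {ω | x < A ω * B ω} / G x) atTop (𝓝 c) := by
    refine (hlim.comp Real.tendsto_log_atTop).congr' ?_
    filter_upwards [eventually_gt_atTop 0] with x hx
    simp only [Function.comp_apply]
    congr 2
    · ext ω
      simp only [Set.mem_ofPred_eq, hAdef, hBdef, ← Real.exp_add]
      exact Real.log_lt_iff_lt_exp hx
    · rw [← hXG x]
      congr 1
      ext ω
      exact Real.log_lt_iff_lt_exp hx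
  set e : ℝ → ℝ := fun K => ∫ ω in {ω | A ω ≤ K}, A ω ^ γ ∂P with he
  have heB : ∀ K, ∫ ω in {ω | B ω ≤ K}, B ω ^ γ ∂P = e K := fun K => by
    simp only [he]
    rw [← integral_indicator (measurableSet_le hB measurable_const),
      ← integral_indicator (measurableSet_le hA measurable_const)]
    have hg : Measurable ((Set.Iic K).indicator fun a : ℝ => a ^ γ) :=
      Measurable.indicator (by fun_prop) measurableSet_Iic
    exact (hidAB.comp hg).integral_eq
  -- for `x > K²` the two factors are not both at most `K` on the event `x < A B`
  have hthird : ∀ K, 0 < K → Tendsto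
      (fun x => P.real {ω | x < A ω * B ω ∧ K < A ω ∧ K < B ω} / G x) atTop (𝓝 (c - 2 * e K)) := by
    intro K hK
    have h1 := hG.tendsto_tail_mul_trunc hA hB hB0 hAB hXG hK
    have h2 := hG.tendsto_tail_mul_trunc hB hA hA0 hAB.symm hBG hK
    rw [heB] at h1
    have h3 := (hprod.sub h1).sub h2
    have e1 : c - e K - ∫ ω in {ω | A ω ≤ K}, A ω ^ γ ∂P = c - 2 * e K := by simp only [he]; ring
    rw [e1] at h3
    refine h3.congr' ?_
    filter_upwards [eventually_gt_atTop (K * K)] with x hx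
    rw [← sub_div, ← sub_div]
    congr 1
    have m1 : MeasurableSet {ω | x < A ω * B ω ∧ B ω ≤ K} := by measurability
    have m2 : MeasurableSet {ω | x < B ω * A ω ∧ A ω ≤ K} := by measurability
    have m3 : MeasurableSet {ω | x < A ω * B ω ∧ K < A ω ∧ K < B ω} := by measurability
    have hU : {ω | x < A ω * B ω} = ({ω | x < A ω * B ω ∧ B ω ≤ K} ∪
        {ω | x < B ω * A ω ∧ A ω ≤ K}) ∪ {ω | x < A ω * B ω ∧ K < A ω ∧ K < B ω} := by
      ext ω
      simp only [Set.mem_ofPred_eq, Set.mem_union, mul_comm (B ω)]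
      grind
    have d1 : Disjoint {ω | x < A ω * B ω ∧ B ω ≤ K} {ω | x < B ω * A ω ∧ A ω ≤ K} := by
      rw [Set.disjoint_left]
      rintro ω ⟨ha, hb⟩ ⟨-, hd⟩
      have : A ω * B ω ≤ K * K := mul_le_mul hd hb (hB0 ω).le hK.le
      linarith
    have d2 : Disjoint ({ω | x < A ω * B ω ∧ B ω ≤ K} ∪ {ω | x < B ω * A ω ∧ A ω ≤ K})
        {ω | x < A ω * B ω ∧ K < A ω ∧ K < B ω} := by
      rw [Set.disjoint_left]
      rintro ω (⟨-, hb⟩ | ⟨-, hb⟩) ⟨-, h1, h2⟩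
      · exact absurd h2 (not_lt.2 hb)
      · exact absurd h1 (not_lt.2 hb)
    rw [hU, measureReal_union d2 m3, measureReal_union d1 m2]
    ring
  have hle : ∀ K, 0 < K → e K ≤ c / 2 := fun K hK => by
    have := ge_of_tendsto' (hthird K hK)
      (fun x => div_nonneg measureReal_nonneg (hG.pos x).le)
    linarith
  have hAγ : ∀ ω, A ω ^ γ = Real.exp (γ * X ω) := fun ω => by
    simp only [hAdef]; rw [← Real.exp_mul, mul_comm]
  have hunion : (⋃ n : ℕ, {ω | A ω ≤ (n : ℝ) + 1}) = Set.univ := by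
    refine Set.eq_univ_of_forall fun ω => Set.mem_iUnion.2 ?_
    obtain ⟨n, hn⟩ := exists_nat_ge (A ω)
    exact ⟨n, show A ω ≤ (n : ℝ) + 1 by linarith⟩
  have hmono : Monotone fun n : ℕ => {ω | A ω ≤ (n : ℝ) + 1} := by
    intro a b hab ω hω
    have hω' : A ω ≤ (a : ℝ) + 1 := hω
    have : (a : ℝ) ≤ b := by exact_mod_cast hab
    exact show A ω ≤ (b : ℝ) + 1 by linarith
  have hm : Integrable (fun ω => A ω ^ γ) P := by
    refine ⟨(by fun_prop : Measurable fun ω => A ω ^ γ).aestronglyMeasurable, ?_⟩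
    rw [hasFiniteIntegral_iff_ofReal (Eventually.of_forall fun ω => by have := hA0 ω; positivity)]
    refine lt_of_le_of_lt ?_ (ENNReal.ofReal_lt_top (r := c / 2))
    have h1 := setLIntegral_iUnion_of_directed (μ := P) (fun ω => ENNReal.ofReal (A ω ^ γ))
      (s := fun n : ℕ => {ω | A ω ≤ (n : ℝ) + 1}) hmono.directed_le
    rw [hunion, setLIntegral_univ] at h1
    rw [h1]
    refine iSup_le fun n => ?_
    rw [← ofReal_integral_eq_lintegral_ofReal]
    · exact ENNReal.ofReal_le_ofReal (hle _ (by positivity))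
    · refine Integrable.of_bound (C := ((n : ℝ) + 1) ^ γ)
        (by fun_prop : Measurable fun ω => A ω ^ γ).aestronglyMeasurable ?_
      refine (ae_restrict_iff' (measurableSet_le hA measurable_const)).2
        (Eventually.of_forall fun ω hω => ?_)
      have := hA0 ω
      rw [Real.norm_of_nonneg (by positivity)]
      exact Real.rpow_le_rpow this.le hω hγ.le
    · exact Eventually.of_forall fun ω => by have := hA0 ω; positivity
  have hm' : Integrable (fun ω => Real.exp (γ * X ω)) P := by simpa only [hAγ] using hm
  set m := ∫ ω, Real.exp (γ * X ω) ∂P with hmdef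
  have helim : Tendsto (fun n : ℕ => e ((n : ℝ) + 1)) atTop (𝓝 m) := by
    have h1 := tendsto_setIntegral_of_monotone (μ := P) (f := fun ω => A ω ^ γ)
      (s := fun n : ℕ => {ω | A ω ≤ (n : ℝ) + 1})
      (fun n => measurableSet_le hA measurable_const) hmono hm.integrableOn
    rw [hunion, setIntegral_univ] at h1
    simpa only [he, hmdef, hAγ] using h1
  have hcm : c ≤ 2 * m := by
    by_contra hcon
    push Not at hcon
    refine not_eventually_tail_add_ge hγ hX hY hXY hid hm'
      (fun ε hε => hG.not_integrable_exp hγ hXG hε) (κ := (c - 2 * m) / 2) (by linarith) ?_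
    have hpos : ∀ x, 0 < P.real {ω | x < X ω} := fun x => by
      have := hG.pos (Real.exp x)
      rw [← hXG] at this
      simpa only [hAdef, Real.exp_lt_exp] using this
    filter_upwards [hlim.eventually_const_le
      (show 2 * m + (c - 2 * m) / 2 < c by linarith)] with x hx
    rwa [le_div_iff₀ (hpos x)] at hx
  refine ⟨hm', ?_, fun η hη => ?_⟩
  · refine hG.exists_forall_le (F := fun x => P.real {ω | x < A ω * B ω}) (C := c + 1)
      (fun x => measureReal_le_one) (by linarith) ?_
    filter_upwards [hprod.eventually_le_const (show c < c + 1 by linarith)] with x hx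
    rwa [div_le_iff₀ (hG.pos x)] at hx
  · have h1 : Tendsto (fun n : ℕ => c - 2 * e ((n : ℝ) + 1)) atTop (𝓝 (c - 2 * m)) :=
      tendsto_const_nhds.sub (helim.const_mul 2)
    obtain ⟨n, hn⟩ := (h1.eventually_lt_const (show c - 2 * m < η by linarith)).exists
    refine ⟨(n : ℝ) + 1, by linarith [(n.cast_nonneg : (0 : ℝ) ≤ n)], ?_⟩
    filter_upwards [(hthird ((n : ℝ) + 1) (by positivity)).eventually_le_const hn] with x hx
    rwa [div_le_iff₀ (hG.pos x)] at hx

end Convolution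

/-! ### Products with an independent factor of infinite moment -/

section ProductTail

variable {Ω : Type*} [MeasurableSpace Ω] {P : Measure Ω} [IsProbabilityMeasure P] {γ : ℝ}
  {G G₁ : ℝ → ℝ} {R e : Ω → ℝ}

/-- If `E e^γ = ∞`, an independent factor `e` makes the tail of `R` negligible. -/
theorem RegVarTail.eventually_le_mul_tail (hG : RegVarTail γ G) (hγ : 0 < γ) (hR : Measurable R)
    (he : Measurable e) (he0 : ∀ ω, 0 < e ω) (hind : IndepFun R e P)
    (hRG : ∀ x, P.real {ω | x < R ω} = G x)
    (hinf : ∫⁻ ω, ENNReal.ofReal (e ω ^ γ) ∂P = ⊤) {η : ℝ} (hη : 0 < η) :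
    ∀ᶠ x in atTop, G x ≤ η * P.real {ω | x < R ω * e ω} := by
  obtain ⟨K, hK, hKe⟩ : ∃ K : ℝ, 0 < K ∧ 1 / η < ∫ ω in {ω | e ω ≤ K}, e ω ^ γ ∂P := by
    by_contra hcon
    push Not at hcon
    have hunion : (⋃ n : ℕ, {ω | e ω ≤ (n : ℝ) + 1}) = Set.univ := by
      refine Set.eq_univ_of_forall fun ω => Set.mem_iUnion.2 ?_
      obtain ⟨n, hn⟩ := exists_nat_ge (e ω)
      exact ⟨n, show e ω ≤ (n : ℝ) + 1 by linarith⟩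
    have hmono : Monotone fun n : ℕ => {ω | e ω ≤ (n : ℝ) + 1} := by
      intro a b hab ω hω
      have hω' : e ω ≤ (a : ℝ) + 1 := hω
      have : (a : ℝ) ≤ b := by exact_mod_cast hab
      exact show e ω ≤ (b : ℝ) + 1 by linarith
    have h1 := setLIntegral_iUnion_of_directed (μ := P) (fun ω => ENNReal.ofReal (e ω ^ γ))
      (s := fun n : ℕ => {ω | e ω ≤ (n : ℝ) + 1}) hmono.directed_le
    rw [hunion, setLIntegral_univ, hinf] at h1
    refine absurd h1.symm (ne_of_lt (lt_of_le_of_lt ?_ (ENNReal.ofReal_lt_top (r := 1 / η))))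
    refine iSup_le fun n => ?_
    rw [← ofReal_integral_eq_lintegral_ofReal]
    · exact ENNReal.ofReal_le_ofReal (hcon _ (by positivity))
    · refine Integrable.of_bound (C := ((n : ℝ) + 1) ^ γ)
        (by fun_prop : Measurable fun ω => e ω ^ γ).aestronglyMeasurable ?_
      refine (ae_restrict_iff' (measurableSet_le he measurable_const)).2
        (Eventually.of_forall fun ω hω => ?_)
      have := he0 ω
      rw [Real.norm_of_nonneg (by positivity)]
      exact Real.rpow_le_rpow this.le hω hγ.le
    · exact Eventually.of_forall fun ω => by have := he0 ω; positivity
  filter_upwards [(hG.tendsto_tail_mul_trunc hR he he0 hind hRG hK).eventually_const_lt hKe]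
    with x hx
  rw [lt_div_iff₀ (hG.pos x)] at hx
  have h2 : P.real {ω | x < R ω * e ω ∧ e ω ≤ K} ≤ P.real {ω | x < R ω * e ω} :=
    measureReal_mono fun ω hω => hω.1
  calc G x = η * (1 / η * G x) := by field_simp
    _ ≤ _ := by gcongr; exact hx.le.trans h2

/-- With one of two factors bounded, the scaling of the tail of the product is that of the tail of
the other factor. -/
theorem RegVarTail.eventually_tail_mul_trunc_le (hG : RegVarTail γ G) {A B : Ω → ℝ}
    (hA : Measurable A) (hB : Measurable B) (hB0 : ∀ ω, 0 < B ω) (hAB : IndepFun A B P)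
    (hAG : ∀ x, P.real {ω | x < A ω} = G x) {c C : ℝ} (hc : 0 < c) (hC : c ^ (-γ) < C) :
    ∃ K₀ : ℝ, 0 < K₀ ∧ ∀ x b, 0 < x → 0 < b → K₀ ≤ x / b →
      P.real {ω | c * x < A ω * B ω ∧ B ω ≤ b} ≤ C * P.real {ω | x < A ω * B ω ∧ B ω ≤ b} := by
  obtain ⟨z, hz⟩ := eventually_atTop.1 (hG.eventually_le hc hC)
  refine ⟨max z 1, by positivity, fun x b hx hb hxb => ?_⟩
  have hD : MeasurableSet {p : ℝ × ℝ | c * x < p.1 * p.2 ∧ p.2 ≤ b} := by measurability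
  have hD' : MeasurableSet {p : ℝ × ℝ | x < p.1 * p.2 ∧ p.2 ≤ b} := by measurability
  refine measureReal_le_measureReal_of_indepFun hAB hAB hA hA hB hD hD' fun ω => ?_
  simp only [Set.mem_ofPred_eq]
  by_cases h : B ω ≤ b
  · simp only [h, and_true, ← div_lt_iff₀ (hB0 ω), hAG, mul_div_assoc]
    refine hz _ ((le_max_left z 1).trans (hxb.trans ?_))
    have := hB0 ω
    gcongr
  · simp [h]

/-- The product of independent factors with regularly varying tails of index `γ`, one of them with
`E e^γ = ∞`, has a regularly varying tail of index `γ`. The event that the product exceeds `x` is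
split into `e ≤ K`, where the tail of `R` scales, `R ≤ x / K`, where the tail of `e` scales, and
`R > x / K`, which is negligible against the tail of the product. -/
theorem RegVarTail.mul (hG : RegVarTail γ G) (hG₁ : RegVarTail γ G₁) (hγ : 0 < γ)
    (hR : Measurable R) (hR0 : ∀ ω, 0 < R ω) (he : Measurable e) (he0 : ∀ ω, 0 < e ω)
    (hind : IndepFun R e P) (hRG : ∀ x, P.real {ω | x < R ω} = G x)
    (heG : ∀ x, P.real {ω | x < e ω} = G₁ x)
    (hinf : ∫⁻ ω, ENNReal.ofReal (e ω ^ γ) ∂P = ⊤) :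
    RegVarTail γ fun x => P.real {ω | x < R ω * e ω} := by
  set H : ℝ → ℝ := fun x => P.real {ω | x < R ω * e ω} with hH
  have hanti : Antitone H := fun x y hxy => measureReal_mono fun ω hω => lt_of_le_of_lt hxy hω
  have hpos : ∀ x, 0 < H x := fun x => by
    have h1 : P.real ({ω | max x 0 < R ω} ∩ {ω | 1 < e ω}) = G (max x 0) * G₁ 1 := by
      rw [← hRG, ← heG, measureReal_def, measureReal_def, measureReal_def, ← ENNReal.toReal_mul]
      congr 1
      exact hind.measure_inter_preimage_eq_mul _ _ measurableSet_Ioi measurableSet_Ioi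
    refine lt_of_lt_of_le (mul_pos (hG.pos (max x 0)) (hG₁.pos 1)) (h1 ▸ measureReal_mono ?_)
    rintro ω ⟨ha, hb⟩
    have ha' : max x 0 < R ω := ha
    have hb' : 1 < e ω := hb
    have : R ω ≤ R ω * e ω := le_mul_of_one_le_right (hR0 ω).le hb'.le
    exact ((le_max_left x 0).trans_lt ha').trans_le this
  -- the upper bound for `c` implies the lower bound, by the upper bound for `c⁻¹`
  have hup : ∀ c : ℝ, 0 < c → ∀ C, c ^ (-γ) < C → ∀ᶠ x in atTop, H (c * x) ≤ C * H x := by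
    intro c hc C hC
    obtain ⟨C', hC'1, hC'2⟩ := exists_between hC
    have hC'0 : 0 < C' := lt_of_le_of_lt (by positivity) hC'1
    obtain ⟨K₁, hK₁, H₁⟩ := hG.eventually_tail_mul_trunc_le hR he he0 hind hRG hc hC'1
    obtain ⟨K, hK, H₂⟩ := hG₁.eventually_tail_mul_trunc_le he hR hR0 hind.symm heG hc hC'1
    obtain ⟨D, hD, HD⟩ := hG.exists_eventually_le (inv_pos.2 hK)
    filter_upwards [HD, hG.eventually_le_mul_tail hγ hR he he0 hind hRG hinf
      (η := (C - C') / D) (by have := sub_pos.2 hC'2; positivity),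
      eventually_ge_atTop (K₁ * K), eventually_gt_atTop 0] with x hx1 hx2 hx3 hx0
    have s1 := H₁ x K hx0 hK (by rwa [le_div_iff₀ hK])
    have s2 := H₂ x (x / K) hx0 (by positivity) (by rw [div_div_cancel₀ hx0.ne'])
    have hdis : P.real {ω | x < R ω * e ω ∧ e ω ≤ K} + P.real {ω | x < e ω * R ω ∧ R ω ≤ x / K} ≤
        H x := by
      rw [← measureReal_union]
      · refine measureReal_mono ?_
        rintro ω (⟨h1, -⟩ | ⟨h1, -⟩)
        · exact h1
        · exact show x < R ω * e ω by rwa [mul_comm]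
      · rw [Set.disjoint_left]
        rintro ω ⟨h1, h2⟩ ⟨-, h3⟩
        have : R ω * e ω ≤ x / K * K := mul_le_mul h3 h2 (he0 ω).le (by positivity)
        rw [div_mul_cancel₀ _ hK.ne'] at this
        linarith
      · measurability
    have hcov : H (c * x) ≤ P.real {ω | c * x < R ω * e ω ∧ e ω ≤ K} +
        P.real {ω | c * x < e ω * R ω ∧ R ω ≤ x / K} + P.real {ω | K⁻¹ * x < R ω} := by
      refine le_trans (measureReal_mono ?_)
        ((measureReal_union_le _ _).trans (add_le_add_left (measureReal_union_le _ _) _))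
      intro ω hω
      have hω' : c * x < R ω * e ω := hω
      simp only [Set.mem_union, Set.mem_ofPred_eq, mul_comm (e ω), inv_mul_eq_div]
      by_cases h : R ω ≤ x / K
      · exact Or.inl (Or.inr ⟨hω', h⟩)
      · exact Or.inr (not_le.1 h)
    rw [hRG] at hcov
    have hHx : 0 < H x := hpos x
    calc H (c * x) ≤ C' * P.real {ω | x < R ω * e ω ∧ e ω ≤ K} +
          C' * P.real {ω | x < e ω * R ω ∧ R ω ≤ x / K} + D * ((C - C') / D * H x) := by
          refine hcov.trans (add_le_add (add_le_add s1 s2) (hx1.trans ?_))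
          gcongr
      _ = C' * (P.real {ω | x < R ω * e ω ∧ e ω ≤ K} +
          P.real {ω | x < e ω * R ω ∧ R ω ≤ x / K}) + (C - C') * H x := by field_simp
      _ ≤ C' * H x + (C - C') * H x := by gcongr
      _ = C * H x := by ring
  refine ⟨hanti, hpos, fun x => measureReal_le_one, fun c hc => ?_⟩
  refine tendsto_order.2 ⟨fun a ha => ?_, fun a ha => ?_⟩
  · rcases le_or_gt a 0 with ha0 | ha0
    · exact Eventually.of_forall fun x => ha0.trans_lt (div_pos (hpos _) (hpos _))
    · obtain ⟨a', ha'1, ha'2⟩ := exists_between ha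
      have ha'0 : 0 < a' := ha0.trans ha'1
      have h1 : (c⁻¹) ^ (-γ) < a'⁻¹ := by
        rw [Real.inv_rpow hc.le]
        exact inv_strictAnti₀ ha'0 ha'2
      have h2 := (tendsto_id.const_mul_atTop hc).eventually (hup c⁻¹ (inv_pos.2 hc) _ h1)
      filter_upwards [h2] with x hx
      simp only [id, ← mul_assoc, inv_mul_cancel₀ hc.ne', one_mul] at hx
      rw [lt_div_iff₀ (hpos x)]
      rw [inv_mul_eq_div, le_div_iff₀ ha'0] at hx
      nlinarith [hpos x]
  · obtain ⟨a', ha'1, ha'2⟩ := exists_between ha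
    filter_upwards [hup c hc a' ha'1] with x hx
    rw [div_lt_iff₀ (hpos x)]
    nlinarith [hpos x]

end ProductTail

/-! ### Independent families of sources -/

section SourceField

/-- The σ-algebra generated by the variables `ξ p`, `p ∈ A`. -/
@[reducible] def generatedBy {Ω I : Type*} (ξ : I → Ω → ℝ) (A : Set I) : MeasurableSpace Ω :=
  ⨆ p ∈ A, MeasurableSpace.comap (ξ p) inferInstance

/-- An iid family `ξ` together with a σ-algebra `mW` that is independent of it. Independence is
recorded in the only form in which it is used: disjoint parts of the family are independent, and
`mW` may be joined to one of them. -/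
structure SourceField {Ω I : Type*} (mW : MeasurableSpace Ω) {mΩ : MeasurableSpace Ω}
    (P : Measure Ω) (ξ : I → Ω → ℝ) : Prop where
  measurable : ∀ p, Measurable (ξ p)
  ident : ∀ p q, IdentDistrib (ξ p) (ξ q) P P
  le : mW ≤ mΩ
  indep : ∀ A : Set I, Indep (generatedBy ξ A) (generatedBy ξ Aᶜ ⊔ mW) P

/-- The product of the factors `e^{ξ p}`, `p ∈ s`, written as the exponential of a sum. -/
noncomputable def expSum {Ω I : Type*} (ξ : I → Ω → ℝ) (s : Finset I) (ω : Ω) : ℝ :=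
  Real.exp (∑ p ∈ s, ξ p ω)

theorem expSum_pos {Ω I : Type*} (ξ : I → Ω → ℝ) (s : Finset I) (ω : Ω) : 0 < expSum ξ s ω :=
  Real.exp_pos _

theorem measurable_generatedBy {Ω I : Type*} {ξ : I → Ω → ℝ} {A : Set I} {p : I} (hp : p ∈ A) :
    Measurable[generatedBy ξ A] (ξ p) :=
  Measurable.of_comap_le (le_iSup₂ (f := fun p (_ : p ∈ A) =>
    MeasurableSpace.comap (ξ p) (inferInstance : MeasurableSpace ℝ)) p hp)

theorem measurable_sum_generatedBy {Ω I : Type*} {ξ : I → Ω → ℝ} {A : Set I} {s : Finset I}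
    (hs : ∀ p ∈ s, p ∈ A) (c : I → ℝ) : Measurable[generatedBy ξ A] fun ω => ∑ p ∈ s, c p * ξ p ω :=
  Finset.measurable_fun_sum _ fun p hp => (measurable_generatedBy (hs p hp)).const_mul _

theorem measurable_expSum_generatedBy {Ω I : Type*} {ξ : I → Ω → ℝ} {A : Set I} {s : Finset I}
    (hs : ∀ p ∈ s, p ∈ A) : Measurable[generatedBy ξ A] (expSum ξ s) := by
  have := measurable_sum_generatedBy (ξ := ξ) hs fun _ => 1
  simp only [one_mul] at this
  exact Real.measurable_exp.comp this

namespace SourceField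

variable {Ω I : Type*} {mW mΩ : MeasurableSpace Ω} {P : Measure Ω} [IsProbabilityMeasure P]
  {ξ : I → Ω → ℝ}

omit [IsProbabilityMeasure P] in
theorem generatedBy_le (h : SourceField mW P ξ) (A : Set I) : generatedBy ξ A ≤ mΩ :=
  iSup₂_le fun p _ => (h.measurable p).comap_le

omit [IsProbabilityMeasure P] in
theorem indepFun (h : SourceField mW P ξ) {E F : Type*} [MeasurableSpace E] [MeasurableSpace F]
    {A : Set I} {X : Ω → E} {Y : Ω → F} (hX : Measurable[generatedBy ξ A] X)
    (hY : Measurable[generatedBy ξ Aᶜ ⊔ mW] Y) : IndepFun X Y P := by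
  rw [IndepFun_iff_Indep]
  exact indep_of_indep_of_le (h.indep A) hX.comap_le hY.comap_le

theorem indepFun_left (h : SourceField mW P ξ) {E F : Type*} [MeasurableSpace E]
    [MeasurableSpace F]
    {A : Set I} {X : Ω → E} {Y : Ω → F} (hX : Measurable[generatedBy ξ A] X)
    (hY : Measurable[generatedBy ξ Aᶜ] Y) : IndepFun X Y P :=
  h.indepFun hX (hY.mono le_sup_left le_rfl)

theorem measurable_expSum (h : SourceField mW P ξ) (s : Finset I) : Measurable (expSum ξ s) :=
  (measurable_expSum_generatedBy (A := Set.univ) fun p _ => Set.mem_univ p).mono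
    (h.generatedBy_le _) le_rfl

theorem expSum_indepFun (h : SourceField mW P ξ) {s t : Finset I} (hst : Disjoint s t) :
    IndepFun (expSum ξ s) (expSum ξ t) P :=
  h.indepFun_left (A := s) (measurable_expSum_generatedBy fun _ hp => hp)
    (measurable_expSum_generatedBy fun _ hp hps => Finset.disjoint_left.1 hst hps hp)

theorem expSum_insert [DecidableEq I] {s : Finset I} {p : I} (hp : p ∉ s) (ω : Ω) :
    expSum ξ (insert p s) ω = expSum ξ s ω * expSum ξ {p} ω := by
  simp only [expSum, Finset.sum_insert hp, Finset.sum_singleton]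
  rw [← Real.exp_add, add_comm]

theorem expSum_empty (ω : Ω) : expSum ξ ∅ ω = 1 := by simp [expSum]

theorem expSum_singleton (p : I) (ω : Ω) : expSum ξ {p} ω = Real.exp (ξ p ω) := by simp [expSum]

/-- The law of a finite product depends on the number of factors only. -/
theorem identDistrib_expSum (h : SourceField mW P ξ) {s t : Finset I} (hst : s.card = t.card) :
    IdentDistrib (expSum ξ s) (expSum ξ t) P P := by
  classical
  induction s using Finset.induction_on generalizing t with
  | empty =>
    rw [Finset.card_empty, eq_comm, Finset.card_eq_zero] at hst
    subst hst
    exact IdentDistrib.refl (h.measurable_expSum _).aemeasurable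
  | insert p s hp ih =>
    rw [Finset.card_insert_of_notMem hp] at hst
    obtain ⟨q, t', hq, rfl, hcard⟩ := Finset.card_eq_succ.1 hst.symm
    have h1 := (ih hcard.symm).prodMk ((h.ident p q).comp Real.measurable_exp)
      (by
        have := h.expSum_indepFun (Finset.disjoint_singleton_right.2 hp)
        rw [funext (expSum_singleton (ξ := ξ) p)] at this
        exact this)
      (by
        have := h.expSum_indepFun (Finset.disjoint_singleton_right.2 hq)
        rw [funext (expSum_singleton (ξ := ξ) q)] at this
        exact this)
    have h2 := h1.comp (measurable_fst.mul measurable_snd : Measurable fun z : ℝ × ℝ => z.1 * z.2)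
    convert h2 using 1
    · ext ω; simp [expSum_insert hp, expSum_singleton]
    · ext ω; simp [expSum_insert hq, expSum_singleton]

theorem expSum_tail_eq (h : SourceField mW P ξ) {s t : Finset I} (hst : s.card = t.card) (x : ℝ) :
    P.real {ω | x < expSum ξ s ω} = P.real {ω | x < expSum ξ t ω} :=
  congrArg ENNReal.toReal ((h.identDistrib_expSum hst).measure_mem_eq (s := Set.Ioi x)
    measurableSet_Ioi)

end SourceField

end SourceField

/-! ### Exponential moments of weighted series -/

section ExponentialMoments

namespace SourceField

variable {Ω I : Type*} {mW mΩ : MeasurableSpace Ω} {P : Measure Ω} [IsProbabilityMeasure P]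
  {ξ : I → Ω → ℝ}

theorem measurable_tsum_generatedBy [Countable I] {A : Set I} {c : I → ℝ}
    (hc : ∀ p, p ∉ A → c p = 0) : Measurable[generatedBy ξ A] fun ω => ∑' p, c p * ξ p ω := by
  let := generatedBy ξ A
  refine Measurable.tsum fun p => ?_
  by_cases hp : p ∈ A
  · exact (measurable_generatedBy hp).const_mul _
  · simp only [hc p hp, zero_mul]
    exact measurable_const

/-- Convexity of the exponential between `0` and `θ max x 0`. -/
theorem exp_mul_le_one_add {r θ x y : ℝ} (hr0 : 0 ≤ r) (hr1 : r ≤ 1) (hy : y = r * θ)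
    (hθ : 0 ≤ θ) :
    Real.exp (y * x) ≤ 1 + r * Real.exp (θ * max x 0) := by
  have h1 : y * x ≤ r * (θ * max x 0) + (1 - r) * 0 := by
    rw [hy]
    have := mul_le_mul_of_nonneg_left (le_max_left x 0) (mul_nonneg hr0 hθ)
    linarith
  have h2 := convexOn_exp.2 (Set.mem_univ (θ * max x 0)) (Set.mem_univ 0) hr0
    (sub_nonneg.2 hr1) (by ring)
  simp only [smul_eq_mul, Real.exp_zero] at h2
  calc Real.exp (y * x) ≤ Real.exp (r * (θ * max x 0) + (1 - r) * 0) := Real.exp_le_exp.2 h1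
    _ ≤ r * Real.exp (θ * max x 0) + (1 - r) * 1 := h2
    _ ≤ _ := by linarith

theorem integrable_exp_pos_part {X : Ω → ℝ} (hX : Measurable X) {θ : ℝ}
    (h : Integrable (fun ω => Real.exp (θ * X ω)) P) :
    Integrable (fun ω => Real.exp (θ * max (X ω) 0)) P := by
  refine (h.add (integrable_const 1)).mono' (by fun_prop) (Eventually.of_forall fun ω => ?_)
  rw [Real.norm_of_nonneg (Real.exp_pos _).le]
  simp only [Pi.add_apply]
  rcases le_total (X ω) 0 with hx | hx
  · rw [max_eq_right hx]
    simp [(Real.exp_pos _).le]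
  · rw [max_eq_left hx]; linarith

theorem integrable_exp_sum (h : SourceField mW P ξ) {θ l M : ℝ} (hθ : 0 < θ)
    (hint : ∀ p, Integrable (fun ω => Real.exp (θ * ξ p ω)) P)
    (hM : ∀ p, ∫ ω, Real.exp (θ * max (ξ p ω) 0) ∂P = M) (hl : 0 ≤ l) {c : I → ℝ}
    (hc : ∀ p, 0 ≤ c p) (hcθ : ∀ p, l * c p ≤ θ) (s : Finset I) :
    Integrable (fun ω => Real.exp (l * ∑ p ∈ s, c p * ξ p ω)) P ∧
      ∫ ω, Real.exp (l * ∑ p ∈ s, c p * ξ p ω) ∂P ≤ Real.exp (∑ p ∈ s, l * c p / θ * M) := by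
  classical
  induction s using Finset.induction_on with
  | empty => simp
  | insert p s hp ih =>
    have hpm := h.measurable p
    have hr0 : 0 ≤ l * c p / θ := div_nonneg (mul_nonneg hl (hc p)) hθ.le
    have hb : ∀ ω, Real.exp (l * c p * ξ p ω) ≤
        1 + l * c p / θ * Real.exp (θ * max (ξ p ω) 0) := fun ω =>
      exp_mul_le_one_add hr0 ((div_le_one hθ).2 (hcθ p)) (by field_simp) hθ.le
    have hbi : Integrable (fun ω => 1 + l * c p / θ * Real.exp (θ * max (ξ p ω) 0)) P :=
      (integrable_const 1).add ((integrable_exp_pos_part hpm (hint p)).const_mul _)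
    have i1 : Integrable (fun ω => Real.exp (l * c p * ξ p ω)) P := by
      refine hbi.mono' (by fun_prop) (Eventually.of_forall fun ω => ?_)
      rw [Real.norm_of_nonneg (Real.exp_pos _).le]
      exact hb ω
    have e1 : ∫ ω, Real.exp (l * c p * ξ p ω) ∂P ≤ Real.exp (l * c p / θ * M) := by
      calc _ ≤ ∫ ω, (1 + l * c p / θ * Real.exp (θ * max (ξ p ω) 0)) ∂P :=
            integral_mono i1 hbi hb
        _ = 1 + l * c p / θ * M := by
          rw [integral_add (integrable_const 1)
            ((integrable_exp_pos_part hpm (hint p)).const_mul _), integral_const_mul, hM]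
          simp
        _ ≤ _ := by rw [add_comm]; exact Real.add_one_le_exp _
    have hind : IndepFun (fun ω => Real.exp (l * ∑ q ∈ s, c q * ξ q ω))
        (fun ω => Real.exp (l * c p * ξ p ω)) P := by
      refine h.indepFun_left (A := s) ?_ ?_
      · exact Real.measurable_exp.comp
          ((measurable_sum_generatedBy (fun _ hq => hq) c).const_mul l)
      · exact Real.measurable_exp.comp ((measurable_generatedBy (by simpa using hp)).const_mul _)
    have hsplit : ∀ ω, Real.exp (l * ∑ q ∈ insert p s, c q * ξ q ω) =
        Real.exp (l * ∑ q ∈ s, c q * ξ q ω) * Real.exp (l * c p * ξ p ω) := fun ω => by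
      rw [← Real.exp_add, Finset.sum_insert hp]
      ring_nf
    simp only [hsplit]
    refine ⟨hind.integrable_mul ih.1 i1, ?_⟩
    have e2 := hind.integral_mul_eq_mul_integral ih.1.aestronglyMeasurable i1.aestronglyMeasurable
    simp only [Pi.mul_apply] at e2
    rw [e2, Finset.sum_insert hp, add_comm, Real.exp_add]
    have : 0 ≤ ∫ ω, Real.exp (l * c p * ξ p ω) ∂P := integral_nonneg fun _ => (Real.exp_pos _).le
    gcongr
    exact ih.2

/-- Exponential moments of a weighted series of independent variables: by convexity each factor
contributes at most `1 + O(c p)`. -/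
theorem integrable_exp_tsum [Countable I] [Nonempty I] (h : SourceField mW P ξ) {θ l : ℝ}
    (hθ : 0 < θ) (hint : ∀ p, Integrable (fun ω => Real.exp (θ * ξ p ω)) P) (hl : 0 ≤ l) {c : I → ℝ}
    (hc : ∀ p, 0 ≤ c p) (hcθ : ∀ p, l * c p ≤ θ) (hcs : Summable c)
    (hsum : ∀ᵐ ω ∂P, Summable fun p => c p * ξ p ω) :
    Integrable (fun ω => Real.exp (l * ∑' p, c p * ξ p ω)) P := by
  obtain ⟨p₀⟩ := ‹Nonempty I›
  set M := ∫ ω, Real.exp (θ * max (ξ p₀ ω) 0) ∂P with hMdef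
  have hM0 : 0 ≤ M := integral_nonneg fun _ => (Real.exp_pos _).le
  have hM : ∀ p, ∫ ω, Real.exp (θ * max (ξ p ω) 0) ∂P = M := fun p =>
    ((h.ident p p₀).comp (by fun_prop : Measurable fun x => Real.exp (θ * max x 0))).integral_eq
  have hfin := h.integrable_exp_sum hθ hint hM hl hc hcθ
  have hmeas : Measurable fun ω => ∑' p, c p * ξ p ω :=
    (measurable_tsum_generatedBy (A := Set.univ) fun p hp => absurd (Set.mem_univ p) hp).mono
      (h.generatedBy_le _) le_rfl
  have hmeas' : ∀ s : Finset I, Measurable fun ω => ∑ p ∈ s, c p * ξ p ω := fun s =>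
    Finset.measurable_fun_sum _ fun p _ => (h.measurable p).const_mul _
  refine ⟨(Real.measurable_exp.comp (hmeas.const_mul l)).aestronglyMeasurable, ?_⟩
  rw [hasFiniteIntegral_iff_ofReal (Eventually.of_forall fun ω => (Real.exp_pos _).le)]
  obtain ⟨F, hF⟩ := exists_seq_tendsto (atTop : Filter (Finset I))
  calc ∫⁻ ω, ENNReal.ofReal (Real.exp (l * ∑' p, c p * ξ p ω)) ∂P
      = ∫⁻ ω, liminf (fun n => ENNReal.ofReal
          (Real.exp (l * ∑ p ∈ F n, c p * ξ p ω))) atTop ∂P := by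
        refine lintegral_congr_ae ?_
        filter_upwards [hsum] with ω hω
        refine (Tendsto.liminf_eq ?_).symm
        refine ENNReal.tendsto_ofReal ((Real.continuous_exp.tendsto _).comp ?_)
        exact (hω.hasSum.comp hF).const_mul l
    _ ≤ liminf (fun n => ∫⁻ ω, ENNReal.ofReal
          (Real.exp (l * ∑ p ∈ F n, c p * ξ p ω)) ∂P) atTop :=
        lintegral_liminf_le fun n =>
          (Real.measurable_exp.comp ((hmeas' (F n)).const_mul l)).ennreal_ofReal
    _ ≤ ENNReal.ofReal (Real.exp (l / θ * M * ∑' p, c p)) := by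
        refine liminf_le_of_le (by isBoundedDefault) fun b hb => ?_
        obtain ⟨n, hn⟩ := hb.exists
        refine hn.trans ?_
        rw [← ofReal_integral_eq_lintegral_ofReal (hfin (F n)).1
          (Eventually.of_forall fun ω => (Real.exp_pos _).le)]
        refine ENNReal.ofReal_le_ofReal ((hfin (F n)).2.trans (Real.exp_le_exp.2 ?_))
        have e1 : ∑ p ∈ F n, l * c p / θ * M = l / θ * M * ∑ p ∈ F n, c p := by
          rw [Finset.mul_sum]
          refine Finset.sum_congr rfl fun p _ => by ring
        rw [e1]
        have : 0 ≤ l / θ * M := by positivity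
        exact mul_le_mul_of_nonneg_left (hcs.sum_le_tsum _ fun p _ => hc p) this
    _ < ⊤ := ENNReal.ofReal_lt_top

end SourceField

end ExponentialMoments

/-! ### Large products of sources -/

section ExplainingExceedances

namespace SourceField

variable {Ω I : Type*} {mW mΩ : MeasurableSpace Ω} {P : Measure Ω} [IsProbabilityMeasure P]
  {ξ : I → Ω → ℝ} {γ : ℝ} {G : ℝ → ℝ}

theorem regVarTail_expSum (h : SourceField mW P ξ) (hG : RegVarTail γ G) (hγ : 0 < γ)
    (hξG : ∀ p x, P.real {ω | x < expSum ξ {p} ω} = G x)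
    (hinf : ∀ p, ∫⁻ ω, ENNReal.ofReal (expSum ξ {p} ω ^ γ) ∂P = ⊤) {s : Finset I}
    (hs : s.Nonempty) : RegVarTail γ fun x => P.real {ω | x < expSum ξ s ω} := by
  classical
  induction s using Finset.induction_on with
  | empty => exact absurd hs Finset.not_nonempty_empty
  | insert p s hp ih =>
    rcases s.eq_empty_or_nonempty with rfl | hs'
    · simpa only [insert_empty_eq, hξG] using hG
    · simp only [expSum_insert hp]
      exact (ih hs').mul hG hγ (h.measurable_expSum s) (expSum_pos ξ s) (h.measurable_expSum {p})
        (expSum_pos ξ {p}) (h.expSum_indepFun (Finset.disjoint_singleton_right.2 hp))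
        (fun _ => rfl) (hξG p) (hinf p)

/-- If `E e^{γ ξ} = ∞`, the tail of a product with fewer factors is negligible. -/
theorem eventually_tail_expSum_le (h : SourceField mW P ξ) (hG : RegVarTail γ G) (hγ : 0 < γ)
    (hξG : ∀ p x, P.real {ω | x < expSum ξ {p} ω} = G x)
    (hinf : ∀ p, ∫⁻ ω, ENNReal.ofReal (expSum ξ {p} ω ^ γ) ∂P = ⊤) {s t : Finset I}
    (hs : s.Nonempty) (hst : s.card < t.card) {η : ℝ} (hη : 0 < η) :
    ∀ᶠ x in atTop, P.real {ω | x < expSum ξ s ω} ≤ η * P.real {ω | x < expSum ξ t ω} := by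
  classical
  obtain ⟨k, hk⟩ := Nat.exists_eq_add_of_lt hst
  induction k generalizing t η with
  | zero =>
    obtain ⟨p, t', hp, rfl, ht'⟩ := Finset.card_eq_succ.1 (show t.card = s.card + 1 by omega)
    have h1 := (h.regVarTail_expSum hG hγ hξG hinf hs).eventually_le_mul_tail hγ
      (h.measurable_expSum t') (h.measurable_expSum {p}) (expSum_pos ξ {p})
      (h.expSum_indepFun (Finset.disjoint_singleton_right.2 hp))
      (fun x => h.expSum_tail_eq ht' x) (hinf p) hη
    simpa only [expSum_insert hp] using h1
  | succ k ih =>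
    obtain ⟨p, t', hp, rfl, ht'⟩ := Finset.card_eq_succ.1
      (show t.card = (s.card + k + 1) + 1 by omega)
    have hne : t'.Nonempty := Finset.card_pos.1 (by omega)
    have h1 := (h.regVarTail_expSum hG hγ hξG hinf hne).eventually_le_mul_tail hγ
      (h.measurable_expSum t') (h.measurable_expSum {p}) (expSum_pos ξ {p})
      (h.expSum_indepFun (Finset.disjoint_singleton_right.2 hp))
      (fun x => rfl) (hinf p) one_pos
    filter_upwards [ih (t := t') (by omega) hη ht', h1] with x hx hx1
    simp only [expSum_insert hp]
    rw [one_mul] at hx1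
    exact hx.trans (by gcongr)

/-- If `E e^{γ ξ} = ∞`, a product with fewer factors stays negligible after multiplication by an
independent variable with a moment of order above `γ`. -/
theorem eventually_tail_expSum_mul_le (h : SourceField mW P ξ) (hG : RegVarTail γ G) (hγ : 0 < γ)
    (hξG : ∀ p x, P.real {ω | x < expSum ξ {p} ω} = G x)
    (hinf : ∀ p, ∫⁻ ω, ENNReal.ofReal (expSum ξ {p} ω ^ γ) ∂P = ⊤) {s t : Finset I}
    (hst : s.card < t.card) {U : Ω → ℝ} {β : ℝ} (hβ : γ < β)
    (hU : Measurable U) (hind : IndepFun (expSum ξ s) U P)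
    (hUβ : Integrable (fun ω => |U ω| ^ β) P) {η : ℝ} (hη : 0 < η) :
    ∀ᶠ x in atTop, P.real {ω | x < expSum ξ s ω * U ω} ≤ η * P.real {ω | x < expSum ξ t ω} := by
  have ht : t.Nonempty := Finset.card_pos.1 (by omega)
  have hGt := h.regVarTail_expSum hG hγ hξG hinf ht
  rcases s.eq_empty_or_nonempty with rfl | hs
  · simp only [expSum_empty, one_mul]
    set M := ∫ ω, |U ω| ^ β ∂P with hM
    have hM0 : 0 ≤ M := integral_nonneg fun ω => by positivity
    filter_upwards [hGt.eventually_rpow_neg_le hγ hβ (η := η / (M + 1)) (by positivity),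
      eventually_gt_atTop 0] with x hx hx0
    have h1 : x ^ β * P.real {ω | x < U ω} ≤ M := by
      refine le_trans ?_ (mul_meas_ge_le_integral_of_nonneg
        (Eventually.of_forall fun ω => by positivity) hUβ (x ^ β))
      refine mul_le_mul_of_nonneg_left (measureReal_mono fun ω hω => ?_) (by positivity)
      have hω' : x < U ω := hω
      exact Real.rpow_le_rpow hx0.le (hω'.le.trans (le_abs_self _)) (by linarith)
    have h2 : x ^ (-β) * x ^ β = 1 := by rw [← Real.rpow_add hx0]; simp
    have h0 := (hGt.pos x).le
    calc P.real {ω | x < U ω} = x ^ (-β) * (x ^ β * P.real {ω | x < U ω}) := by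
          rw [← mul_assoc, h2, one_mul]
      _ ≤ (η / (M + 1) * P.real {ω | x < expSum ξ t ω}) * M := by gcongr
      _ = η * P.real {ω | x < expSum ξ t ω} * (M / (M + 1)) := by ring
      _ ≤ η * P.real {ω | x < expSum ξ t ω} * 1 := by
          gcongr
          rw [div_le_one (by positivity)]; linarith
      _ = _ := mul_one _
  · obtain ⟨C, hC, HC⟩ := breiman_le (h.regVarTail_expSum hG hγ hξG hinf hs) hβ (hγ.trans hβ)
      (h.measurable_expSum s) hU (fun ω => (expSum_pos ξ s ω).le) hind (C₀ := 1)
      (fun x => by rw [one_mul]) zero_le_one hUβ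
    filter_upwards [HC, h.eventually_tail_expSum_le hG hγ hξG hinf hs hst (η := η / C)
      (by positivity)] with x hx1 hx2
    refine hx1.trans ?_
    calc C * P.real {ω | x < expSum ξ s ω} ≤ C * (η / C * P.real {ω | x < expSum ξ t ω}) := by
          gcongr
      _ = _ := by field_simp

/-- If `E e^{γ ξ} = ∞`, two distinct products with the same number of factors are not large at the
same time: the smaller one is below their geometric mean, which contains only the common factors with
full weight. The remaining factors enter as square roots and have moments of order above `γ`. -/
theorem eventually_pair_expSum_le (h : SourceField mW P ξ) (hG : RegVarTail γ G) (hγ : 0 < γ)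
    (hξG : ∀ p x, P.real {ω | x < expSum ξ {p} ω} = G x)
    (hinf : ∀ p, ∫⁻ ω, ENNReal.ofReal (expSum ξ {p} ω ^ γ) ∂P = ⊤)
    (hmom : ∀ p, Integrable (fun ω => Real.exp (3 / 4 * γ * ξ p ω)) P) {s t : Finset I}
    (hst : s.card = t.card) (hne : s ≠ t) {η : ℝ} (hη : 0 < η) :
    ∀ᶠ x in atTop, P.real {ω | x < expSum ξ s ω ∧ x < expSum ξ t ω} ≤
      η * P.real {ω | x < expSum ξ s ω} := by
  classical
  set D := symmDiff s t with hD
  set U : Ω → ℝ := fun ω => Real.exp (∑ p ∈ D, 1 / 2 * ξ p ω) with hU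
  have hcard : (s ∩ t).card < s.card := by
    refine Finset.card_lt_card (Finset.ssubset_iff_subset_ne.2 ⟨Finset.inter_subset_left, ?_⟩)
    intro heq
    exact hne (Finset.eq_of_subset_of_card_le (Finset.inter_eq_left.1 heq) hst.ge)
  have hUm : Measurable[generatedBy ξ ((↑(s ∩ t) : Set I)ᶜ)] U := by
    refine Real.measurable_exp.comp (measurable_sum_generatedBy (fun p hp => ?_) fun _ => 1 / 2)
    simp only [hD, Finset.mem_symmDiff] at hp
    simp only [Finset.coe_inter, Set.mem_compl_iff, Set.mem_inter_iff, Finset.mem_coe]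
    tauto
  have hind : IndepFun (expSum ξ (s ∩ t)) U P :=
    h.indepFun_left (A := ↑(s ∩ t)) (measurable_expSum_generatedBy fun _ hp => hp) hUm
  have hp₀ : ∃ p₀ : I, True := by
    obtain ⟨p, -⟩ : s.Nonempty := Finset.card_pos.1 (by omega)
    exact ⟨p, trivial⟩
  obtain ⟨p₀, -⟩ := hp₀
  have hUi : Integrable (fun ω => |U ω| ^ (3 / 2 * γ)) P := by
    have h1 := (h.integrable_exp_sum (θ := 3 / 4 * γ) (l := 3 / 2 * γ)
      (M := ∫ ω, Real.exp (3 / 4 * γ * max (ξ p₀ ω) 0) ∂P) (by positivity) hmom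
      (fun p => ((h.ident p p₀).comp
        (by fun_prop : Measurable fun x => Real.exp (3 / 4 * γ * max x 0))).integral_eq)
      (by positivity) (c := fun _ => 1 / 2) (fun _ => by norm_num)
      (fun _ => by linarith) D).1
    refine h1.congr (Eventually.of_forall fun ω => ?_)
    simp only [hU]
    rw [abs_of_pos (Real.exp_pos _), ← Real.exp_mul, mul_comm]
  filter_upwards [h.eventually_tail_expSum_mul_le hG hγ hξG hinf hcard (β := 3 / 2 * γ)
    (by linarith) (hUm.mono (h.generatedBy_le _) le_rfl) hind hUi hη] with x hx
  refine le_trans (measureReal_mono ?_) hx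
  rintro ω ⟨h1, h2⟩
  have hsum : ∑ p ∈ s, ξ p ω + ∑ p ∈ t, ξ p ω =
      2 * (∑ p ∈ s ∩ t, ξ p ω + ∑ p ∈ D, 1 / 2 * ξ p ω) := by
    have e1 := Finset.sum_inter_add_sum_sdiff s t fun p => ξ p ω
    have e2 := Finset.sum_inter_add_sum_sdiff t s fun p => ξ p ω
    have e3 : ∑ p ∈ D, ξ p ω = ∑ p ∈ s \ t, ξ p ω + ∑ p ∈ t \ s, ξ p ω :=
      Finset.sum_union disjoint_sdiff_sdiff
    rw [Finset.inter_comm] at e2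
    rw [← Finset.mul_sum, e3]
    linarith
  have h3 : expSum ξ s ω * expSum ξ t ω = (expSum ξ (s ∩ t) ω * U ω) ^ 2 := by
    simp only [expSum, hU]
    rw [← Real.exp_add, ← Real.exp_add, ← Real.exp_nat_mul, hsum]
    norm_num
  simp only [Set.mem_ofPred_eq]
  by_contra hcon
  push Not at hcon
  have h4 : 0 < expSum ξ (s ∩ t) ω * U ω := mul_pos (expSum_pos _ _ _) (Real.exp_pos _)
  have h5 : (expSum ξ (s ∩ t) ω * U ω) ^ 2 ≤ x ^ 2 := by gcongr
  have hx0 : 0 < x := h4.trans_le hcon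
  have h6 : x * x < expSum ξ s ω * expSum ξ t ω := mul_lt_mul'' h1 h2 hx0.le hx0.le
  rw [h3] at h6
  nlinarith

/-- Under convolution equivalence, a large finite product contains a large factor. By induction: the
tail of the product over `s` is dominated by that of a single factor `q`, which replaces it in the
bound for two factors that are both large. -/
theorem exists_large_factor [Nontrivial I] (h : SourceField mW P ξ) (hG : RegVarTail γ G)
    (hγ : 0 < γ) (hξG : ∀ p x, P.real {ω | x < expSum ξ {p} ω} = G x)
    (hconv : ∀ p q, p ≠ q → ConvolutionRatio P (ξ p) (ξ q)) (s : Finset I) :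
    (∃ C : ℝ, 0 < C ∧ ∀ x, P.real {ω | x < expSum ξ s ω} ≤ C * G x) ∧
    ∀ η : ℝ, 0 < η → ∃ y : ℝ, 0 < y ∧ ∀ᶠ x in atTop,
      P.real {ω | x < expSum ξ s ω ∧ ∀ p ∈ s, expSum ξ {p} ω ≤ y * x} ≤ η * G x := by
  classical
  induction s using Finset.induction_on with
  | empty =>
    have hev : ∀ᶠ x : ℝ in atTop, ∀ ω, ¬ x < expSum ξ ∅ ω := by
      filter_upwards [eventually_ge_atTop 1] with x hx ω
      rw [expSum_empty]
      exact not_lt.2 hx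
    refine ⟨hG.exists_forall_le (F := fun x => P.real {ω | x < expSum ξ ∅ ω}) (C := 0)
      (fun x => measureReal_le_one) le_rfl ?_, fun η hη => ⟨1, one_pos, ?_⟩⟩
    · filter_upwards [hev] with x hx
      simp [hx]
    · filter_upwards [hev] with x hx
      have := (hG.pos x).le
      simp only [hx, false_and]
      simp only [Set.ofPred_false, measureReal_empty]
      positivity
  | insert p s hp ih =>
    obtain ⟨⟨C, hC, hCs⟩, hbig⟩ := ih
    obtain ⟨q, hq⟩ := exists_ne p
    have hRe := h.expSum_indepFun (Finset.disjoint_singleton_right.2 hp)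
    have hqp : IndepFun (expSum ξ {q}) (expSum ξ {p}) P :=
      h.expSum_indepFun (by simpa using hq)
    have hξqp : IndepFun (ξ q) (ξ p) P :=
      h.indepFun_left (A := {q}) (measurable_generatedBy (by simp))
        (measurable_generatedBy (by simpa using hq.symm))
    have hcons := convolutionRatio_consequences hG hγ (h.measurable q) (h.measurable p) hξqp
      (h.ident p q) (fun x => by simpa only [expSum_singleton] using hξG q x) (hconv q p hq)
    simp only [← expSum_singleton (ξ := ξ)] at hcons
    obtain ⟨-, ⟨C₂, hC₂, hprod⟩, htrip⟩ := hcons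
    have hms := h.measurable_expSum s
    have hmp := h.measurable_expSum {p}
    have hmq := h.measurable_expSum {q}
    constructor
    · refine ⟨C * C₂, by positivity, fun x => ?_⟩
      have hD : MeasurableSet {z : ℝ × ℝ | x < z.1 * z.2} := by measurability
      have := measureReal_le_measureReal_of_indepFun hRe hqp hms hmq hmp hD hD (c := C)
        (fun ω => by
          have he := expSum_pos ξ {p} ω
          simp only [Set.mem_ofPred_eq, ← div_lt_iff₀ he, hξG]
          exact hCs _)
      simp only [expSum_insert hp]
      refine this.trans ?_
      rw [mul_assoc]
      gcongr
      exact hprod x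
    · intro η hη
      obtain ⟨K, hK, htripK⟩ := htrip (η / (2 * C)) (by positivity)
      have hK0 : 0 < K := one_pos.trans_le hK
      obtain ⟨D, hD, hDG⟩ := hG.exists_eventually_le (inv_pos.2 hK0)
      obtain ⟨y', hy', hbig'⟩ := hbig (η / (2 * D)) (by positivity)
      -- `K⁻¹` excludes a large last factor, `y' / K` passes the hypothesis to the product over `s`
      refine ⟨min (y' / K) K⁻¹, by positivity, ?_⟩
      have hbK := (tendsto_id.const_mul_atTop (inv_pos.2 hK0)).eventually hbig'
      filter_upwards [htripK, hDG, hbK, eventually_gt_atTop 0] with x h1 h2 h3 hx0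
      have hboth : P.real {ω | x < expSum ξ s ω * expSum ξ {p} ω ∧ K < expSum ξ s ω ∧
          K < expSum ξ {p} ω} ≤ C * P.real {ω | x < expSum ξ {q} ω * expSum ξ {p} ω ∧
          K < expSum ξ {q} ω ∧ K < expSum ξ {p} ω} := by
        have hD : MeasurableSet {z : ℝ × ℝ | x < z.1 * z.2 ∧ K < z.1 ∧ K < z.2} := by
          measurability
        refine measureReal_le_measureReal_of_indepFun hRe hqp hms hmq hmp hD hD fun ω => ?_
        have he := expSum_pos ξ {p} ω
        simp only [Set.mem_ofPred_eq, ← div_lt_iff₀ he]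
        by_cases hKe : K < expSum ξ {p} ω
        · simp only [hKe, and_true, ← max_lt_iff, hξG]
          exact hCs _
        · simp [hKe]
      have hcov : {ω | x < expSum ξ (insert p s) ω ∧ ∀ r ∈ insert p s, expSum ξ {r} ω ≤
          min (y' / K) K⁻¹ * x} ⊆
          {ω | x < expSum ξ s ω * expSum ξ {p} ω ∧ K < expSum ξ s ω ∧ K < expSum ξ {p} ω} ∪
          {ω | id (K⁻¹ * id x) < expSum ξ s ω ∧
            ∀ r ∈ s, expSum ξ {r} ω ≤ y' * id (K⁻¹ * id x)} := by
        rintro ω ⟨ha, hb⟩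
        rw [expSum_insert hp] at ha
        have hepos := expSum_pos ξ {p} ω
        have hspos := expSum_pos ξ s ω
        by_cases hKe : K < expSum ξ {p} ω
        · by_cases hKs : K < expSum ξ s ω
          · exact Or.inl ⟨ha, hKs, hKe⟩
          · exfalso
            have h4 := hb p (Finset.mem_insert_self p s)
            have h5 : expSum ξ {p} ω ≤ K⁻¹ * x :=
              h4.trans (mul_le_mul_of_nonneg_right (min_le_right _ _) hx0.le)
            have h6 : expSum ξ s ω * expSum ξ {p} ω ≤ K * (K⁻¹ * x) :=
              mul_le_mul (not_lt.1 hKs) h5 hepos.le hK0.le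
            rw [← mul_assoc, mul_inv_cancel₀ hK0.ne', one_mul] at h6
            linarith
        · right
          refine ⟨?_, fun r hr => ?_⟩
          · simp only [id]
            rw [inv_mul_eq_div, div_lt_iff₀ hK0]
            exact ha.trans_le (mul_le_mul_of_nonneg_left (not_lt.1 hKe) hspos.le)
          · refine (hb r (Finset.mem_insert_of_mem hr)).trans ?_
            simp only [id]
            rw [← mul_assoc]
            exact mul_le_mul_of_nonneg_right (min_le_left _ _) hx0.le
      have hGx := (hG.pos x).le
      calc _ ≤ _ := (measureReal_mono hcov).trans (measureReal_union_le _ _)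
        _ ≤ C * (η / (2 * C) * G x) + η / (2 * D) * (D * G x) := by
          refine add_le_add (hboth.trans (by gcongr)) (h3.trans ?_)
          simp only [id]
          gcongr
        _ = η * G x := by field_simp; ring

/-- The large factor persists after multiplication by an independent variable with a moment of
order above `γ`. -/
theorem exists_large_factor_mul [Nontrivial I] (h : SourceField mW P ξ) (hG : RegVarTail γ G)
    (hγ : 0 < γ) (hξG : ∀ p x, P.real {ω | x < expSum ξ {p} ω} = G x)
    (hconv : ∀ p q, p ≠ q → ConvolutionRatio P (ξ p) (ξ q)) (s : Finset I) {U : Ω → ℝ} {β : ℝ}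
    (hβ : γ < β) (hU : Measurable U) (hind : IndepFun (expSum ξ s) U P)
    (hUβ : Integrable (fun ω => |U ω| ^ β) P) {η : ℝ} (hη : 0 < η) :
    ∃ y : ℝ, 0 < y ∧ ∀ᶠ x in atTop,
      P.real {ω | x < expSum ξ s ω * U ω ∧ ∀ p ∈ s, expSum ξ {p} ω ≤ y * x} ≤ η * G x := by
  obtain ⟨⟨C, hC, hCs⟩, hbig⟩ := h.exists_large_factor hG hγ hξG hconv s
  obtain ⟨K, hK, hKx⟩ := breiman_trunc hG hβ (hγ.trans hβ) (h.measurable_expSum s) hU hind hCs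
    hC.le hUβ (half_pos hη)
  have hK0 : 0 < K := one_pos.trans_le hK
  obtain ⟨D, hD, hDG⟩ := hG.exists_eventually_le (inv_pos.2 hK0)
  obtain ⟨y', hy', hbig'⟩ := hbig (η / (2 * D)) (by positivity)
  refine ⟨y' / K, by positivity, ?_⟩
  have hbK := (tendsto_id.const_mul_atTop (inv_pos.2 hK0)).eventually hbig'
  filter_upwards [hKx, hDG, hbK] with x h1 h2 h3
  have hcov : {ω | x < expSum ξ s ω * U ω ∧ ∀ p ∈ s, expSum ξ {p} ω ≤ y' / K * x} ⊆
      {ω | x < expSum ξ s ω * U ω ∧ K < U ω} ∪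
      {ω | id (K⁻¹ * id x) < expSum ξ s ω ∧
        ∀ r ∈ s, expSum ξ {r} ω ≤ y' * id (K⁻¹ * id x)} := by
    rintro ω ⟨ha, hb⟩
    by_cases hKU : K < U ω
    · exact Or.inl ⟨ha, hKU⟩
    · right
      refine ⟨?_, fun r hr => ?_⟩
      · simp only [id]
        rw [inv_mul_eq_div, div_lt_iff₀ hK0]
        exact ha.trans_le (mul_le_mul_of_nonneg_left (not_lt.1 hKU) (expSum_pos ξ s ω).le)
      · refine (hb r hr).trans (le_of_eq ?_)
        simp only [id]
        ring
  calc _ ≤ _ := (measureReal_mono hcov).trans (measureReal_union_le _ _)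
    _ ≤ η / 2 * G x + η / (2 * D) * (D * G x) := by
      refine add_le_add h1 (h3.trans ?_)
      simp only [id]
      gcongr
    _ = η * G x := by field_simp; ring

end SourceField

end ExplainingExceedances

/-! ### Linear models -/

section LinearModel

/-- The weights `c` off the finite set `s`. -/
def offPart {I : Type*} [DecidableEq I] (s : Finset I) (c : I → ℝ) (p : I) : ℝ :=
  if p ∈ s then 0 else c p

/-- The vector with coordinates `exp (∑ b q p ξ p) W q`. -/
noncomputable def linearValue {Ω I ι : Type*} (ξ : I → Ω → ℝ) (b : ι → I → ℝ) (W : ι → Ω → ℝ)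
    (ω : Ω) (q : ι) : ℝ :=
  Real.exp (∑' p, b q p * ξ p ω) * W q ω

/-- The cofactor of the product `expSum ξ s` in the coordinates of `linearValue` that contain this
product with full weight; the other coordinates are set to zero. -/
noncomputable def cofactor {Ω I ι : Type*} [DecidableEq I] (ξ : I → Ω → ℝ) (b : ι → I → ℝ)
    (W : ι → Ω → ℝ) (Λ : ι → Finset I) (s : Finset I) (ω : Ω) (q : ι) : ℝ :=
  if s ⊆ Λ q then Real.exp (∑' p, offPart s (b q) p * ξ p ω) * W q ω else 0

/-- The assumptions on the vectors `linearValue ξ b W`: weights in `[0, 1]`, equal to `1` exactly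
on `Λ q`, over an iid family `ξ`, and multipliers `W q` independent of `ξ` with a moment of order
`β > γ`. -/
structure LinearModel {Ω I ι : Type*} (mW : MeasurableSpace Ω) {mΩ : MeasurableSpace Ω}
    (P : Measure Ω) (ξ : I → Ω → ℝ) (γ β : ℝ) (b : ι → I → ℝ) (W : ι → Ω → ℝ)
    (Λ : ι → Finset I) : Prop where
  field : SourceField mW P ξ
  nonneg : ∀ q p, 0 ≤ b q p
  le_one : ∀ q p, b q p ≤ 1
  summable_b : ∀ q, Summable (b q)
  mem_iff : ∀ q p, p ∈ Λ q ↔ b q p = 1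
  measurable_W : ∀ q, Measurable[mW] (W q)
  index_pos : 0 < γ
  index_lt : γ < β
  moment : ∀ q, Integrable (fun ω => |W q ω| ^ β) P
  summable : ∀ q, ∀ᵐ ω ∂P, Summable fun p => b q p * ξ p ω

theorem integrable_abs_rpow_of_le {Ω : Type*} [MeasurableSpace Ω] {P : Measure Ω}
    [IsFiniteMeasure P] {X : Ω → ℝ} (hX : Measurable X) {l l' : ℝ} (hl : 0 ≤ l) (hll : l ≤ l')
    (h : Integrable (fun ω => |X ω| ^ l') P) : Integrable (fun ω => |X ω| ^ l) P := by
  refine ((integrable_const (1 : ℝ)).add h).mono' (by fun_prop) (Eventually.of_forall fun ω => ?_)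
  rw [Real.norm_of_nonneg (by positivity)]
  simp only [Pi.add_apply]
  rcases le_total |X ω| 1 with h1 | h1
  · have : |X ω| ^ l ≤ 1 := Real.rpow_le_one (abs_nonneg _) h1 hl
    have : 0 ≤ |X ω| ^ l' := by positivity
    linarith
  · have : |X ω| ^ l ≤ |X ω| ^ l' := Real.rpow_le_rpow_of_exponent_le h1 hll
    linarith

theorem integrable_norm_rpow_of_forall {Ω ι : Type*} [MeasurableSpace Ω] [Fintype ι]
    {P : Measure Ω} {U : Ω → ι → ℝ} (hU : Measurable U) {l : ℝ} (hl : 0 < l)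
    (h : ∀ q, Integrable (fun ω => |U ω q| ^ l) P) : Integrable (fun ω => ‖U ω‖ ^ l) P := by
  have hsum : Integrable (fun ω => ∑ q, |U ω q| ^ l) P := integrable_finsetSum _ fun q _ => h q
  refine hsum.mono' (hU.norm.pow_const l).aestronglyMeasurable (Eventually.of_forall fun ω => ?_)
  rw [Real.norm_of_nonneg (by positivity)]
  rcases isEmpty_or_nonempty ι with hι | hι
  · have : ‖U ω‖ = 0 := by rw [Subsingleton.elim (U ω) 0, norm_zero]
    simp [this, hl.ne']
  · obtain ⟨q, hq⟩ := Finite.exists_max fun q => ‖U ω q‖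
    have h1 : ‖U ω‖ ≤ |U ω q| := (pi_norm_le_iff_of_nonneg (norm_nonneg _)).2 hq
    calc ‖U ω‖ ^ l ≤ |U ω q| ^ l := by gcongr
      _ ≤ _ := Finset.single_le_sum (f := fun q => |U ω q| ^ l) (fun q _ => by positivity)
        (Finset.mem_univ q)

theorem measureReal_le_of_ae_imp {Ω : Type*} [MeasurableSpace Ω] {P : Measure Ω}
    [IsFiniteMeasure P] {A B : Set Ω} (h : ∀ᵐ ω ∂P, ω ∈ A → ω ∈ B) : P.real A ≤ P.real B :=
  ENNReal.toReal_mono (measure_ne_top _ _) (measure_mono_ae h)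

namespace LinearModel

variable {Ω I ι : Type*} {mW mΩ : MeasurableSpace Ω} {P : Measure Ω} [IsProbabilityMeasure P]
  {ξ : I → Ω → ℝ} {γ β : ℝ} {b : ι → I → ℝ} {W : ι → Ω → ℝ} {Λ : ι → Finset I} {G : ℝ → ℝ}
  [DecidableEq I]

theorem summable_offPart (s : Finset I) {f c : I → ℝ} (h : Summable fun p => c p * f p) :
    Summable fun p => offPart s c p * f p := by
  have h1 : Summable fun p => if p ∈ s then c p * f p else 0 :=
    summable_of_ne_finset_zero (s := s) fun p hp => if_neg hp
  refine (h.sub h1).congr fun p => ?_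
  by_cases hp : p ∈ s <;> simp [offPart, hp]

theorem tsum_eq_sum_add_offPart (s : Finset I) {f c : I → ℝ} (h : Summable fun p => c p * f p) :
    ∑' p, c p * f p = ∑ p ∈ s, c p * f p + ∑' p, offPart s c p * f p := by
  have h1 : Summable fun p => if p ∈ s then c p * f p else 0 :=
    summable_of_ne_finset_zero (s := s) fun p hp => if_neg hp
  have h2 : ∑' p, (if p ∈ s then c p * f p else 0) = ∑ p ∈ s, c p * f p := by
    rw [tsum_eq_sum (s := s) fun p hp => if_neg hp]
    exact Finset.sum_congr rfl fun p hp => if_pos hp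
  rw [← h2, ← h1.tsum_add (summable_offPart s h)]
  refine tsum_congr fun p => ?_
  by_cases hp : p ∈ s <;> simp [offPart, hp]

theorem summable_offPart_weight (s : Finset I) {c : I → ℝ} (h : Summable c) :
    Summable (offPart s c) := by
  simpa using summable_offPart s (f := fun _ => 1) (by simpa using h)

theorem offPart_nonneg (s : Finset I) {c : I → ℝ} (hc : ∀ p, 0 ≤ c p) (p : I) :
    0 ≤ offPart s c p := by
  unfold offPart; split_ifs <;> simp [hc]

theorem offPart_le (s : Finset I) {c : I → ℝ} (hc : ∀ p, 0 ≤ c p) (p : I) :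
    offPart s c p ≤ c p := by
  unfold offPart; split_ifs <;> simp [hc]

omit [IsProbabilityMeasure P] in
theorem linearValue_eq (h : LinearModel mW P ξ γ β b W Λ) {s : Finset I} {q : ι} (hs : s ⊆ Λ q) :
    ∀ᵐ ω ∂P, linearValue ξ b W ω q = expSum ξ s ω * cofactor ξ b W Λ s ω q := by
  filter_upwards [h.summable q] with ω hω
  rw [linearValue, cofactor, if_pos hs, expSum, ← mul_assoc, ← Real.exp_add,
    tsum_eq_sum_add_offPart s hω]
  congr 3
  refine Finset.sum_congr rfl fun p hp => ?_
  rw [(h.mem_iff q p).1 (hs hp), one_mul]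

omit [IsProbabilityMeasure P] in
theorem measurable_cofactor_sup [Countable I] (h : LinearModel mW P ξ γ β b W Λ) (s : Finset I)
    (q : ι) : Measurable[generatedBy ξ (↑s)ᶜ ⊔ mW] fun ω => cofactor ξ b W Λ s ω q := by
  unfold cofactor
  split_ifs
  · have h1 : Measurable[generatedBy ξ ((↑s : Set I)ᶜ)]
        fun ω => ∑' p, offPart s (b q) p * ξ p ω :=
      SourceField.measurable_tsum_generatedBy fun p hp => by
        have hp' : p ∈ s := by simpa using hp
        simp [offPart, hp']
    have h2 : Measurable[generatedBy ξ ((↑s : Set I)ᶜ) ⊔ mW]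
        fun ω => ∑' p, offPart s (b q) p * ξ p ω := h1.mono le_sup_left le_rfl
    have h3 : Measurable[generatedBy ξ ((↑s : Set I)ᶜ) ⊔ mW] (W q) :=
      (h.measurable_W q).mono le_sup_right le_rfl
    exact (Real.measurable_exp.comp h2).mul h3
  · exact measurable_const

omit [DecidableEq I] in
theorem sup_le (h : LinearModel mW P ξ γ β b W Λ) (A : Set I) : generatedBy ξ A ⊔ mW ≤ mΩ :=
  _root_.sup_le (h.field.generatedBy_le A) h.field.le

theorem measurable_cofactor_apply [Countable I] (h : LinearModel mW P ξ γ β b W Λ) (s : Finset I)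
    (q : ι) : Measurable fun ω => cofactor ξ b W Λ s ω q :=
  (h.measurable_cofactor_sup s q).mono (h.sup_le _) le_rfl

theorem measurable_cofactor [Countable I] (h : LinearModel mW P ξ γ β b W Λ) (s : Finset I) :
    Measurable (cofactor ξ b W Λ s) :=
  measurable_pi_lambda _ fun q => h.measurable_cofactor_apply s q

omit [DecidableEq I] in
theorem measurable_linearValue [Countable I] (h : LinearModel mW P ξ γ β b W Λ) :
    Measurable (linearValue ξ b W) := by
  refine measurable_pi_lambda _ fun q => ?_
  have h1 : Measurable fun ω => ∑' p, b q p * ξ p ω :=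
    (SourceField.measurable_tsum_generatedBy (A := Set.univ)
      fun p hp => absurd (Set.mem_univ p) hp).mono (h.field.generatedBy_le _) le_rfl
  exact (Real.measurable_exp.comp h1).mul ((h.measurable_W q).mono h.field.le le_rfl)

theorem indepFun_cofactor [Countable I] (h : LinearModel mW P ξ γ β b W Λ) (s : Finset I) :
    IndepFun (expSum ξ s) (cofactor ξ b W Λ s) P := by
  refine h.field.indepFun (A := s) (measurable_expSum_generatedBy fun _ hp => hp) ?_
  let := generatedBy ξ (↑s)ᶜ ⊔ mW
  exact measurable_pi_lambda _ fun q => h.measurable_cofactor_sup s q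

theorem integrable_rpow_cofactor [Countable I] (h : LinearModel mW P ξ γ β b W Λ)
    {s : Finset I} {q : ι} {l : ℝ} (hl : 0 ≤ l) (hlβ : l ≤ β)
    (hi : Integrable (fun ω => Real.exp (l * ∑' p, offPart s (b q) p * ξ p ω)) P) :
    Integrable (fun ω => |cofactor ξ b W Λ s ω q| ^ l) P := by
  by_cases hs : s ⊆ Λ q
  · have hW : Integrable (fun ω => |W q ω| ^ l) P :=
      integrable_abs_rpow_of_le ((h.measurable_W q).mono h.field.le le_rfl) hl hlβ (h.moment q)
    have hind : IndepFun (fun ω => Real.exp (l * ∑' p, offPart s (b q) p * ξ p ω))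
        (fun ω => |W q ω| ^ l) P := by
      refine h.field.indepFun (A := Set.univ) ?_ ?_
      · refine Real.measurable_exp.comp (Measurable.const_mul ?_ l)
        exact SourceField.measurable_tsum_generatedBy fun p hp => absurd (Set.mem_univ p) hp
      · refine Measurable.mono ?_ (le_sup_right (a := generatedBy ξ Set.univᶜ)) le_rfl
        exact (by fun_prop : Measurable fun x : ℝ => |x| ^ l).comp (h.measurable_W q)
    refine (hind.integrable_mul hi hW).congr (Eventually.of_forall fun ω => ?_)
    simp only [Pi.mul_apply, cofactor, if_pos hs]
    rw [abs_mul, abs_of_pos (Real.exp_pos _), Real.mul_rpow (Real.exp_pos _).le (abs_nonneg _),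
      ← Real.exp_mul, mul_comm l]
  · have hl' : (fun ω => |cofactor ξ b W Λ s ω q| ^ l) = fun _ => |(0 : ℝ)| ^ l := by
      funext ω; rw [cofactor, if_neg hs]
    rw [hl']
    exact integrable_const _

omit [IsProbabilityMeasure P] in
/-- Off the set of full weights, the weights stay away from `1`. -/
theorem exists_weight_gap (h : LinearModel mW P ξ γ β b W Λ) (q : ι) :
    ∃ c : ℝ, 1 / 2 ≤ c ∧ c < 1 ∧ ∀ p, offPart (Λ q) (b q) p ≤ c := by
  have hfin : {p | ¬ b q p ≤ 1 / 2}.Finite :=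
    (h.summable_b q).tendsto_cofinite_zero.eventually_le_const (by norm_num : (0 : ℝ) < 1 / 2)
  set F := insert (1 / 2 : ℝ) ((hfin.toFinset.filter fun p => p ∉ Λ q).image (b q)) with hF
  have hne : F.Nonempty := Finset.insert_nonempty _ _
  refine ⟨F.max' hne, Finset.le_max' _ _ (Finset.mem_insert_self _ _), ?_, fun p => ?_⟩
  · have := F.max'_mem hne
    rcases Finset.mem_insert.1 this with h1 | h1
    · rw [h1]; norm_num
    · obtain ⟨p, hp, hpe⟩ := Finset.mem_image.1 h1
      rw [← hpe]
      exact lt_of_le_of_ne (h.le_one q p) fun h2 =>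
        (Finset.mem_filter.1 hp).2 ((h.mem_iff q p).2 h2)
  · have h12 : (1 / 2 : ℝ) ≤ F.max' hne := Finset.le_max' _ _ (Finset.mem_insert_self _ _)
    unfold offPart
    split_ifs with hp
    · linarith
    · by_cases hb : b q p ≤ 1 / 2
      · exact hb.trans h12
      · refine Finset.le_max' _ _ (Finset.mem_insert_of_mem (Finset.mem_image_of_mem _ ?_))
        exact Finset.mem_filter.2 ⟨hfin.mem_toFinset.2 hb, hp⟩

/-- The cofactor of the product over all full weights has a moment of order above `γ`. -/
theorem exists_moment_cofactor [Countable I] [Nonempty I] (h : LinearModel mW P ξ γ β b W Λ)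
    (hint : ∀ θ, 0 < θ → θ < γ → ∀ p, Integrable (fun ω => Real.exp (θ * ξ p ω)) P) (q : ι) :
    ∃ l, γ < l ∧ Integrable (fun ω => |cofactor ξ b W Λ (Λ q) ω q| ^ l) P := by
  obtain ⟨c, hc, hc1, hle⟩ := h.exists_weight_gap q
  have hγ := h.index_pos
  -- with `l ≤ γ (2 - c)` the largest weight off `Λ q` satisfies `l c ≤ γ - γ (1 - c)² < γ`
  have hl : γ < min β (γ * (2 - c)) := lt_min h.index_lt (by nlinarith)
  have hl0 : 0 < min β (γ * (2 - c)) := hγ.trans hl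
  refine ⟨_, hl, h.integrable_rpow_cofactor hl0.le (min_le_left _ _) ?_⟩
  have hθ : min β (γ * (2 - c)) * c < γ := by
    have h1 : min β (γ * (2 - c)) * c ≤ γ * (2 - c) * c := by
      gcongr; exact min_le_right _ _
    have h2 : γ * (2 - c) * c = γ - γ * (1 - c) ^ 2 := by ring
    have h3 : 0 < γ * (1 - c) ^ 2 := by have := sub_pos.2 hc1; positivity
    linarith
  have hθ0 : 0 < min β (γ * (2 - c)) * c := by positivity
  refine h.field.integrable_exp_tsum hθ0 (hint _ hθ0 hθ) hl0.le
    (offPart_nonneg _ (h.nonneg q)) (fun p => ?_) (summable_offPart_weight _ (h.summable_b q)) ?_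
  · have := hle p
    gcongr
  · filter_upwards [h.summable q] with ω hω using summable_offPart _ hω

theorem integrable_exp_of_tail {ξ₀ : Ω → ℝ} (hξ : Measurable ξ₀) (hG : RegVarTail γ G)
    (hξG : ∀ x, P.real {ω | x < Real.exp (ξ₀ ω)} = G x) {θ : ℝ} (hθ : 0 < θ) (hθγ : θ < γ) :
    Integrable (fun ω => Real.exp (θ * ξ₀ ω)) P := by
  obtain ⟨C, hC, hCG⟩ := hG.exists_le_rpow_neg (θ := (θ + γ) / 2) (by linarith) (by linarith)
  have h1 := lintegral_rpow_lt_top_of_tail (P := P) (Y := fun ω => Real.exp (ξ₀ ω))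
    (Real.measurable_exp.comp hξ) (fun ω => (Real.exp_pos _).le) hθ
    (θ' := (θ + γ) / 2) (by linarith) hC.le (fun x hx => by rw [hξG]; exact hCG x hx)
  refine ⟨by fun_prop, ?_⟩
  rw [hasFiniteIntegral_iff_ofReal (Eventually.of_forall fun ω => (Real.exp_pos _).le)]
  refine lt_of_eq_of_lt (lintegral_congr fun ω => ?_) h1
  rw [← Real.exp_mul, mul_comm]

variable [Fintype ι]

/-- If `E e^{γ ξ} = ∞`, the sources are the products over the largest sets of full weights; products
over smaller sets have negligible tails. -/
theorem bigSource_of_infinite_moment [Countable I] [Nonempty I]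
    (h : LinearModel mW P ξ γ β b W Λ) (hG : RegVarTail γ G)
    (hξG : ∀ p x, P.real {ω | x < expSum ξ {p} ω} = G x)
    (hinf : ∀ p, ∫⁻ ω, ENNReal.ofReal (expSum ξ {p} ω ^ γ) ∂P = ⊤)
    {t₀ : Finset I} (ht₀ : t₀.Nonempty) (hmax : ∀ q, (Λ q).card ≤ t₀.card) :
    BigSource P γ (fun x => P.real {ω | x < expSum ξ t₀ ω}) (linearValue ξ b W)
      ((Finset.univ.image Λ).filter fun s => s.card = t₀.card) (fun q s => s ⊆ Λ q) (expSum ξ)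
      (cofactor ξ b W Λ) := by
  have hγ := h.index_pos
  have hF := h.field
  have hint : ∀ θ, 0 < θ → θ < γ → ∀ p, Integrable (fun ω => Real.exp (θ * ξ p ω)) P :=
    fun θ hθ hθγ p => integrable_exp_of_tail (hF.measurable p) hG
      (fun x => by simpa only [SourceField.expSum_singleton] using hξG p x) hθ hθγ
  have hcard : ∀ s ∈ (Finset.univ.image Λ).filter fun s => s.card = t₀.card, s.card = t₀.card :=
    fun s hs => (Finset.mem_filter.1 hs).2
  have hGt := hF.regVarTail_expSum hG hγ hξG hinf ht₀
  refine
    { tail := hGt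
      index_pos := hγ
      measurable_V := h.measurable_linearValue
      measurable_R := hF.measurable_expSum
      measurable_U := h.measurable_cofactor
      source_tail := fun s hs x => hF.expSum_tail_eq (hcard s hs) x
      indep := fun s _ => h.indepFun_cofactor s
      factor := fun s _ q hq => h.linearValue_eq hq
      zero := fun s _ q hq ω => if_neg hq
      big := fun q η hη => ?_
      pair := fun s hs s' hs' hne η hη => ?_
      moment := fun s hs => ?_ }
  · obtain ⟨l, hl, hli⟩ := h.exists_moment_cofactor hint q
    have hV := h.linearValue_eq (Finset.Subset.refl (Λ q))
    have hU := h.measurable_cofactor_apply (Λ q) q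
    have hUabs : Measurable fun ω => |cofactor ξ b W Λ (Λ q) ω q| := hU.abs
    have hind : IndepFun (expSum ξ (Λ q)) (fun ω => |cofactor ξ b W Λ (Λ q) ω q|) P :=
      (h.indepFun_cofactor (Λ q)).comp measurable_id
        ((measurable_pi_apply q).abs : Measurable fun v : ι → ℝ => |v q|)
    have hli' : Integrable (fun ω => |(|cofactor ξ b W Λ (Λ q) ω q|)| ^ l) P := by
      simpa only [abs_abs] using hli
    rcases (hmax q).lt_or_eq with hlt | heq
    · refine ⟨1, one_pos, ?_⟩
      filter_upwards [hF.eventually_tail_expSum_mul_le hG hγ hξG hinf hlt hl hUabs hind hli' hη]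
        with x hx
      refine le_trans (measureReal_le_of_ae_imp ?_) hx
      filter_upwards [hV] with ω hω hmem
      have h1 := hmem.1
      rw [hω, abs_mul, abs_of_pos (expSum_pos ξ _ ω)] at h1
      exact h1
    · obtain ⟨K, hK, hKx⟩ := breiman_trunc (hF.regVarTail_expSum hG hγ hξG hinf ht₀) hl
        (hγ.trans hl) (hF.measurable_expSum (Λ q)) hUabs hind (C₀ := 1)
        (fun x => by rw [one_mul]; exact (hF.expSum_tail_eq heq x).le) zero_le_one hli' hη
      have hK0 : 0 < K := one_pos.trans_le hK
      refine ⟨K⁻¹, inv_pos.2 hK0, ?_⟩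
      filter_upwards [hKx] with x hx
      refine le_trans (measureReal_le_of_ae_imp ?_) hx
      filter_upwards [hV] with ω hω hmem
      obtain ⟨h1, h2⟩ := hmem
      rw [hω, abs_mul, abs_of_pos (expSum_pos ξ _ ω)] at h1
      refine ⟨h1, ?_⟩
      by_contra hcon
      have h3 := h2 (Λ q) (Finset.mem_filter.2
        ⟨Finset.mem_image_of_mem _ (Finset.mem_univ q), heq⟩) (Finset.Subset.refl _)
      rw [inv_mul_eq_div, le_div_iff₀ hK0] at h3
      have h4 := mul_le_mul_of_nonneg_left (not_lt.1 hcon) (expSum_pos ξ (Λ q) ω).le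
      linarith
  · have h1 := hF.eventually_pair_expSum_le hG hγ hξG hinf
      (fun p => hint _ (by positivity) (by linarith) p) ((hcard s hs).trans (hcard s' hs').symm)
      hne hη
    filter_upwards [h1] with x hx
    rwa [hF.expSum_tail_eq (hcard s hs)] at hx
  · refine integrable_norm_rpow_of_forall (h.measurable_cofactor s) hγ fun q => ?_
    by_cases hs' : s ⊆ Λ q
    · have : s = Λ q := Finset.eq_of_subset_of_card_le hs' (by rw [hcard s hs]; exact hmax q)
      subst this
      obtain ⟨l, hl, hli⟩ := h.exists_moment_cofactor hint q
      exact integrable_abs_rpow_of_le (h.measurable_cofactor_apply _ q) hγ.le hl.le hli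
    · have : (fun ω => |cofactor ξ b W Λ s ω q| ^ γ) = fun _ => |(0 : ℝ)| ^ γ := by
        funext ω; rw [cofactor, if_neg hs']
      rw [this]
      exact integrable_const _

/-- Under convolution equivalence, the sources are the single factors with full weight: a large
product has a single large factor, and `E e^{γ ξ} < ∞` leaves the cofactors with a moment of order
`γ`. -/
theorem bigSource_of_convolutionRatio [Countable I] [Nontrivial I]
    (h : LinearModel mW P ξ γ β b W Λ) (hG : RegVarTail γ G)
    (hξG : ∀ p x, P.real {ω | x < expSum ξ {p} ω} = G x)
    (hconv : ∀ p q, p ≠ q → ConvolutionRatio P (ξ p) (ξ q)) :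
    BigSource P γ G (linearValue ξ b W) ((Finset.univ.biUnion Λ).image fun p => {p})
      (fun q s => s ⊆ Λ q) (expSum ξ) (cofactor ξ b W Λ) := by
  have hγ := h.index_pos
  have hF := h.field
  have hξG' : ∀ p x, P.real {ω | x < Real.exp (ξ p ω)} = G x := fun p x => by
    simpa only [SourceField.expSum_singleton] using hξG p x
  have hint : ∀ θ, 0 < θ → θ < γ → ∀ p, Integrable (fun ω => Real.exp (θ * ξ p ω)) P :=
    fun θ hθ hθγ p => integrable_exp_of_tail (hF.measurable p) hG (hξG' p) hθ hθγ
  have hint' : ∀ p, Integrable (fun ω => Real.exp (γ * ξ p ω)) P := fun p => by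
    obtain ⟨q, hq⟩ := exists_ne p
    exact (convolutionRatio_consequences hG hγ (hF.measurable p) (hF.measurable q)
      (hF.indepFun_left (A := {p}) (measurable_generatedBy (by simp))
        (measurable_generatedBy (by simpa using hq))) (hF.ident q p) (hξG' p)
      (hconv p q hq.symm)).1
  refine
    { tail := hG
      index_pos := hγ
      measurable_V := h.measurable_linearValue
      measurable_R := hF.measurable_expSum
      measurable_U := h.measurable_cofactor
      source_tail := fun s hs x => ?_
      indep := fun s _ => h.indepFun_cofactor s
      factor := fun s _ q hq => h.linearValue_eq hq
      zero := fun s _ q hq ω => if_neg hq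
      big := fun q η hη => ?_
      pair := fun s hs s' hs' hne η hη => ?_
      moment := fun s hs => ?_ }
  · obtain ⟨p, -, rfl⟩ := Finset.mem_image.1 hs
    exact hξG p x
  · obtain ⟨l, hl, hli⟩ := h.exists_moment_cofactor hint q
    have hV := h.linearValue_eq (Finset.Subset.refl (Λ q))
    have hU := h.measurable_cofactor_apply (Λ q) q
    have hUabs : Measurable fun ω => |cofactor ξ b W Λ (Λ q) ω q| := hU.abs
    have hind : IndepFun (expSum ξ (Λ q)) (fun ω => |cofactor ξ b W Λ (Λ q) ω q|) P :=
      (h.indepFun_cofactor (Λ q)).comp measurable_id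
        ((measurable_pi_apply q).abs : Measurable fun v : ι → ℝ => |v q|)
    have hli' : Integrable (fun ω => |(|cofactor ξ b W Λ (Λ q) ω q|)| ^ l) P := by
      simpa only [abs_abs] using hli
    obtain ⟨y, hy, hyx⟩ := hF.exists_large_factor_mul hG hγ hξG hconv (Λ q) hl hUabs hind hli' hη
    refine ⟨y, hy, ?_⟩
    filter_upwards [hyx] with x hx
    refine le_trans (measureReal_le_of_ae_imp ?_) hx
    filter_upwards [hV] with ω hω hmem
    obtain ⟨h1, h2⟩ := hmem
    rw [hω, abs_mul, abs_of_pos (expSum_pos ξ _ ω)] at h1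
    refine ⟨h1, fun p hp => h2 {p} (Finset.mem_image_of_mem _
      (Finset.mem_biUnion.2 ⟨q, Finset.mem_univ q, hp⟩)) (Finset.singleton_subset_iff.2 hp)⟩
  · obtain ⟨p, -, rfl⟩ := Finset.mem_image.1 hs
    obtain ⟨p', -, rfl⟩ := Finset.mem_image.1 hs'
    have hpp : p' ≠ p := fun he => hne (by rw [he])
    have hind : IndepFun (expSum ξ {p}) (expSum ξ {p'}) P :=
      hF.expSum_indepFun (by simpa using hpp.symm)
    filter_upwards [(hG.tendsto_zero hγ).eventually_le_const hη] with x hx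
    have h1 : P.real ({ω | x < expSum ξ {p} ω} ∩ {ω | x < expSum ξ {p'} ω}) = G x * G x := by
      have e1 : G x * G x = P.real {ω | x < expSum ξ {p} ω} * P.real {ω | x < expSum ξ {p'} ω} := by
        rw [hξG, hξG]
      rw [e1, measureReal_def, measureReal_def, measureReal_def, ← ENNReal.toReal_mul]
      congr 1
      exact hind.measure_inter_preimage_eq_mul _ _ measurableSet_Ioi measurableSet_Ioi
    calc _ = G x * G x := h1
      _ ≤ η * G x := by have := (hG.pos x).le; gcongr
  · refine integrable_norm_rpow_of_forall (h.measurable_cofactor s) hγ fun q => ?_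
    refine h.integrable_rpow_cofactor hγ.le h.index_lt.le ?_
    refine hF.integrable_exp_tsum hγ hint' hγ.le (offPart_nonneg _ (h.nonneg q)) (fun p => ?_)
      (summable_offPart_weight _ (h.summable_b q)) ?_
    · have := (offPart_le s (h.nonneg q) p).trans (h.le_one q p)
      nlinarith
    · filter_upwards [h.summable q] with ω hω using summable_offPart _ hω

end LinearModel

end LinearModel

/-! ### Regular variation and spectral tail processes of linear models -/

section ModelLimits

namespace LinearModel

variable {Ω I ι : Type*} {mW mΩ : MeasurableSpace Ω} {P : Measure Ω} [IsProbabilityMeasure P]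
  {ξ : I → Ω → ℝ} {γ β : ℝ} {b : ι → I → ℝ} {W : ι → Ω → ℝ} {Λ : ι → Finset I} {G : ℝ → ℝ}
  [DecidableEq I]

omit [IsProbabilityMeasure P] [DecidableEq I] in
theorem comp (h : LinearModel mW P ξ γ β b W Λ) {ι' : Type*} (f : ι' → ι) :
    LinearModel mW P ξ γ β (fun q => b (f q)) (fun q => W (f q)) (fun q => Λ (f q)) where
  field := h.field
  nonneg q := h.nonneg (f q)
  le_one q := h.le_one (f q)
  summable_b q := h.summable_b (f q)
  mem_iff q := h.mem_iff (f q)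
  measurable_W q := h.measurable_W (f q)
  index_pos := h.index_pos
  index_lt := h.index_lt
  moment q := h.moment (f q)
  summable q := h.summable (f q)

theorem cofactor_ne_zero_iff {s : Finset I} {q : ι} (hs : s ⊆ Λ q) (ω : Ω) :
    cofactor ξ b W Λ s ω q ≠ 0 ↔ W q ω ≠ 0 := by
  rw [cofactor, if_pos hs]
  simp [(Real.exp_pos _).ne']

theorem integral_gauge_pos [Fintype ι] [Countable I] (h : LinearModel mW P ξ γ β b W Λ)
    {N : (ι → ℝ) → ℝ} (hN : IsGauge N) {s : Finset I}
    (hm : Integrable (fun ω => ‖cofactor ξ b W Λ s ω‖ ^ γ) P) {q : ι} (hs : s ⊆ Λ q)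
    (hW : ¬ ∀ᵐ ω ∂P, W q ω = 0) (hNq : ∀ v, |v q| ≤ N v) :
    0 < ∫ ω, N (cofactor ξ b W Λ s ω) ^ γ ∂P := by
  have hγ := h.index_pos
  have hnn : ∀ ω, 0 ≤ N (cofactor ξ b W Λ s ω) ^ γ := fun ω => Real.rpow_nonneg (hN.nonneg _) _
  have hi : Integrable (fun ω => N (cofactor ξ b W Λ s ω) ^ γ) P := by
    refine hm.mono' ((hN.lipschitz.continuous.measurable.comp
      (h.measurable_cofactor s)).pow_const γ).aestronglyMeasurable (Eventually.of_forall fun ω => ?_)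
    rw [Real.norm_of_nonneg (hnn ω)]
    exact Real.rpow_le_rpow (hN.nonneg _) (hN.le_norm _) hγ.le
  refine lt_of_le_of_ne (integral_nonneg hnn) fun h0 => hW ?_
  rw [eq_comm, integral_eq_zero_iff_of_nonneg hnn hi] at h0
  filter_upwards [h0] with ω hω
  by_contra hne
  have h1 : 0 < N (cofactor ξ b W Λ s ω) :=
    (abs_pos.2 ((cofactor_ne_zero_iff hs ω).2 hne)).trans_le (hNq _)
  exact (Real.rpow_pos_of_pos h1 γ).ne' hω

/-- A vector `linearValue ξ b W` is regularly varying, with normalization by a gauge that controls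
a coordinate with the largest number of full weights. -/
theorem vagueRegVar [Fintype ι] [Countable I] [Nontrivial I] (h : LinearModel mW P ξ γ β b W Λ)
    (hG : RegVarTail γ G) (hξG : ∀ p x, P.real {ω | x < expSum ξ {p} ω} = G x)
    (halt : (∀ p, ∫⁻ ω, ENNReal.ofReal (expSum ξ {p} ω ^ γ) ∂P = ⊤) ∨
      ∀ p q, p ≠ q → ConvolutionRatio P (ξ p) (ξ q))
    {N : (ι → ℝ) → ℝ} (hN : IsGauge N) {q₀ : ι} (hΛ : (Λ q₀).Nonempty)
    (hmax : ∀ q, (Λ q).card ≤ (Λ q₀).card) (hW : ¬ ∀ᵐ ω ∂P, W q₀ ω = 0)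
    (hNq : ∀ v, |v q₀| ≤ N v) {r : ℝ → ℝ}
    (hr : ∀ x, r x = P.real {ω | x < N (linearValue ξ b W ω)}) :
    VagueRegVar P γ (linearValue ξ b W) r := by
  have hpos : ∀ {G' : ℝ → ℝ} {S : Finset (Finset I)}, BigSource P γ G' (linearValue ξ b W) S
      (fun q s => s ⊆ Λ q) (expSum ξ) (cofactor ξ b W Λ) → (∃ s ∈ S, s ⊆ Λ q₀) →
      VagueRegVar P γ (linearValue ξ b W) r := by
    rintro G' S hB ⟨s, hs, hsq⟩
    refine hB.vagueRegVar hN ?_ hr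
    refine Finset.sum_pos' (fun s' _ => integral_nonneg fun ω => Real.rpow_nonneg (hN.nonneg _) _)
      ⟨s, hs, ?_⟩
    exact h.integral_gauge_pos hN (hB.moment s hs) hsq hW hNq
  rcases halt with hinf | hconv
  · exact hpos (h.bigSource_of_infinite_moment hG hξG hinf hΛ hmax)
      ⟨Λ q₀, Finset.mem_filter.2 ⟨Finset.mem_image_of_mem _ (Finset.mem_univ _), rfl⟩,
        Finset.Subset.refl _⟩
  · obtain ⟨p, hp⟩ := hΛ
    exact hpos (h.bigSource_of_convolutionRatio hG hξG hconv)
      ⟨{p}, Finset.mem_image_of_mem _ (Finset.mem_biUnion.2 ⟨q₀, Finset.mem_univ _, hp⟩),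
        Finset.singleton_subset_iff.2 hp⟩

end LinearModel

end ModelLimits

section ModelSpectral

namespace LinearModel

variable {Ω I : Type*} {mW mΩ : MeasurableSpace Ω} {P : Measure Ω} [IsProbabilityMeasure P]
  {ξ : I → Ω → ℝ} {γ β : ℝ} {b : ℕ → I → ℝ} {W : ℕ → Ω → ℝ} {Λ : ℕ → Finset I} {G : ℝ → ℝ}
  [DecidableEq I] [Countable I] {Y : ℤ → Ω → ℝ}

omit [IsProbabilityMeasure P] [Countable I] in
theorem integral_abs_cofactor_pos {s : Finset I}
    (hm : Integrable (fun ω => |cofactor ξ b W Λ s ω 0| ^ γ) P) (hs : s ⊆ Λ 0)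
    (hW : ¬ ∀ᵐ ω ∂P, W 0 ω = 0) : 0 < ∫ ω, |cofactor ξ b W Λ s ω 0| ^ γ ∂P := by
  refine lt_of_le_of_ne (integral_nonneg fun ω => by positivity) fun h0 => hW ?_
  rw [eq_comm, integral_eq_zero_iff_of_nonneg (fun ω => by positivity) hm] at h0
  filter_upwards [h0] with ω hω
  by_contra hne
  have h1 : 0 < |cofactor ξ b W Λ s ω 0| := abs_pos.2 ((cofactor_ne_zero_iff hs ω).2 hne)
  exact (Real.rpow_pos_of_pos h1 γ).ne' hω

omit [IsProbabilityMeasure P] [Countable I] in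
theorem integrable_abs_cofactor_of_bigSource {S : Finset (Finset I)}
    {I' : Fin (0 + 1) → Finset I → Prop}
    {V : Ω → Fin (0 + 1) → ℝ} (hU : ∀ s, Measurable (cofactor ξ b W Λ s))
    (hB : BigSource P γ G V S I' (expSum ξ) (fun s ω t => cofactor ξ b W Λ s ω t)) {s : Finset I}
    (hs : s ∈ S) : Integrable (fun ω => |cofactor ξ b W Λ s ω 0| ^ γ) P := by
  refine (hB.moment s hs).mono' ?_ (Eventually.of_forall fun ω => ?_)
  · exact (((measurable_pi_apply 0).comp (hU s)).abs.pow_const γ).aestronglyMeasurable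
  · rw [Real.norm_of_nonneg (by positivity)]
    have hγ := hB.index_pos
    have := norm_le_pi_norm (fun t : Fin (0 + 1) => cofactor ξ b W Λ s ω t) 0
    exact Real.rpow_le_rpow (abs_nonneg _) this hγ.le

theorem measurableSet_forall_le {B : ℕ → Set ℝ} (hB : ∀ t, MeasurableSet (B t)) (n : ℕ) :
    MeasurableSet {θ : ℕ → ℝ | ∀ t : ℕ, t ≤ n → θ t ∈ B t} := by
  have : {θ : ℕ → ℝ | ∀ t : ℕ, t ≤ n → θ t ∈ B t} =
      ⋂ (t : ℕ) (_ : t ≤ n), (fun θ : ℕ → ℝ => θ t) ⁻¹' B t := by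
    ext θ; simp
  rw [this]
  exact MeasurableSet.iInter fun t => MeasurableSet.iInter fun _ => measurable_pi_apply t (hB t)

/-- If `E e^{γ ξ} = ∞` and the sets of full weights at different times have the same size, the
spectral tail law comes from the single source at time zero. -/
theorem isSpectralTailLaw_of_infinite_moment [Nonempty I] (h : LinearModel mW P ξ γ β b W Λ)
    (hG : RegVarTail γ G) (hξG : ∀ p x, P.real {ω | x < expSum ξ {p} ω} = G x)
    (hinf : ∀ p, ∫⁻ ω, ENNReal.ofReal (expSum ξ {p} ω ^ γ) ∂P = ⊤)
    (hY : ∀ (t : ℕ) ω, Y t ω = linearValue ξ b W ω t) (hΛ : (Λ 0).Nonempty)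
    (hcard : ∀ t, (Λ t).card = (Λ 0).card) (hW : ¬ ∀ᵐ ω ∂P, W 0 ω = 0) :
    IsSpectralTailLaw P γ Y (spectralLaw γ P {Λ 0} (cofactor ξ b W Λ)) ∧
      Integrable (fun ω => |cofactor ξ b W Λ (Λ 0) ω 0| ^ γ) P := by
  have hB : ∀ k : ℕ, BigSource P γ (fun x => P.real {ω | x < expSum ξ (Λ 0) ω})
      (fun ω (t : Fin (k + 1)) => Y ((t : ℕ) : ℤ) ω)
      ((Finset.univ.image fun t : Fin (k + 1) => Λ t).filter fun s => s.card = (Λ 0).card)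
      (fun t s => s ⊆ Λ t) (expSum ξ) (fun s ω t => cofactor ξ b W Λ s ω t) := by
    intro k
    have := (h.comp fun t : Fin (k + 1) => (t : ℕ)).bigSource_of_infinite_moment hG hξG hinf hΛ
      (fun t => (hcard t).le)
    simp only [hY]
    exact this
  have hm : Integrable (fun ω => |cofactor ξ b W Λ (Λ 0) ω 0| ^ γ) P :=
    integrable_abs_cofactor_of_bigSource h.measurable_cofactor (hB 0)
      (Finset.mem_filter.2 ⟨Finset.mem_image.2 ⟨0, Finset.mem_univ _, rfl⟩, rfl⟩)
  refine ⟨isSpectralTailLaw_spectralLaw (I := fun t s => s ⊆ Λ t) hB h.measurable_cofactor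
    (fun k s => ?_) ?_, hm⟩
  · rw [Finset.mem_singleton, Finset.mem_filter]
    constructor
    · rintro rfl
      exact ⟨⟨Finset.mem_image.2 ⟨0, Finset.mem_univ _, rfl⟩, rfl⟩, Finset.Subset.refl _⟩
    · rintro ⟨⟨-, h1⟩, h2⟩
      exact Finset.eq_of_subset_of_card_le h2 h1.ge
  · rw [Finset.sum_singleton]
    exact integral_abs_cofactor_pos hm (Finset.Subset.refl _) hW

/-- Under convolution equivalence, the spectral tail law comes from the sources with full weight at
time zero. -/
theorem isSpectralTailLaw_of_convolutionRatio [Nontrivial I] (h : LinearModel mW P ξ γ β b W Λ)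
    (hG : RegVarTail γ G) (hξG : ∀ p x, P.real {ω | x < expSum ξ {p} ω} = G x)
    (hconv : ∀ p q, p ≠ q → ConvolutionRatio P (ξ p) (ξ q))
    (hY : ∀ (t : ℕ) ω, Y t ω = linearValue ξ b W ω t) (hΛ : (Λ 0).Nonempty)
    (hW : ¬ ∀ᵐ ω ∂P, W 0 ω = 0) :
    IsSpectralTailLaw P γ Y
      (spectralLaw γ P ((Λ 0).image fun p => {p}) (cofactor ξ b W Λ)) ∧
      ∀ p ∈ Λ 0, Integrable (fun ω => |cofactor ξ b W Λ {p} ω 0| ^ γ) P := by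
  have hB : ∀ k : ℕ, BigSource P γ G (fun ω (t : Fin (k + 1)) => Y ((t : ℕ) : ℤ) ω)
      ((Finset.univ.biUnion fun t : Fin (k + 1) => Λ t).image fun p => {p})
      (fun t s => s ⊆ Λ t) (expSum ξ) (fun s ω t => cofactor ξ b W Λ s ω t) := by
    intro k
    have := (h.comp fun t : Fin (k + 1) => (t : ℕ)).bigSource_of_convolutionRatio hG hξG hconv
    simp only [hY]
    exact this
  have hmem : ∀ k : ℕ, ∀ p ∈ Λ 0,
      {p} ∈ (Finset.univ.biUnion fun t : Fin (k + 1) => Λ t).image fun p => ({p} : Finset I) :=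
    fun k p hp => Finset.mem_image_of_mem _ (Finset.mem_biUnion.2 ⟨0, Finset.mem_univ _, hp⟩)
  have hm : ∀ p ∈ Λ 0, Integrable (fun ω => |cofactor ξ b W Λ {p} ω 0| ^ γ) P := fun p hp =>
    integrable_abs_cofactor_of_bigSource h.measurable_cofactor (hB 0) (hmem 0 p hp)
  refine ⟨isSpectralTailLaw_spectralLaw (I := fun t s => s ⊆ Λ t) hB h.measurable_cofactor
    (fun k s => ?_) ?_, hm⟩
  · constructor
    · intro hs
      obtain ⟨p, hp, rfl⟩ := Finset.mem_image.1 hs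
      exact ⟨hmem k p hp, Finset.singleton_subset_iff.2 hp⟩
    · rintro ⟨h1, h2⟩
      obtain ⟨p, -, rfl⟩ := Finset.mem_image.1 h1
      exact Finset.mem_image_of_mem _ (Finset.singleton_subset_iff.1 h2)
  · refine Finset.sum_pos (fun s hs => ?_) (hΛ.image _)
    obtain ⟨p, hp, rfl⟩ := Finset.mem_image.1 hs
    exact integral_abs_cofactor_pos (hm p hp) (Finset.singleton_subset_iff.2 hp) hW

theorem div_abs_eq_iff {u ε : ℝ} (hε : |ε| = 1) : u / |u| = ε ↔ 0 < ε * u := by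
  have hε0 : ε * ε = 1 := by rw [← abs_mul_abs_self, hε, one_mul]
  rcases eq_or_ne u 0 with rfl | hu
  · simp only [abs_zero, div_zero, mul_zero, lt_irrefl, iff_false]
    rintro rfl
    simp at hε
  · have hu' : 0 < |u| := abs_pos.2 hu
    rw [div_eq_iff hu'.ne']
    constructor
    · intro h
      have h1 : ε * u = |u| := by
        calc ε * u = ε * (ε * |u|) := by rw [← h]
          _ = |u| := by rw [← mul_assoc, hε0, one_mul]
      rwa [h1]
    · intro h
      have h1 : ε * u = |u| := by rw [← abs_of_pos h, abs_mul, hε, one_mul]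
      rw [← h1, ← mul_assoc, hε0, one_mul]

/-- If `E e^{γ ξ} = ∞`, the spectral tail process vanishes after time zero, where it is the sign of
the multiplier under the change of measure with density proportional to `|W 0|^γ`. -/
theorem spectral_of_infinite_moment [Nonempty I] (h : LinearModel mW P ξ γ β b W Λ)
    (hG : RegVarTail γ G) (hξG : ∀ p x, P.real {ω | x < expSum ξ {p} ω} = G x)
    (hinf : ∀ p, ∫⁻ ω, ENNReal.ofReal (expSum ξ {p} ω ^ γ) ∂P = ⊤)
    (hY : ∀ (t : ℕ) ω, Y t ω = linearValue ξ b W ω t) (hΛ : (Λ 0).Nonempty)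
    (hcard : ∀ t, (Λ t).card = (Λ 0).card) (hne : ∀ t, 1 ≤ t → Λ t ≠ Λ 0)
    (hW : ¬ ∀ᵐ ω ∂P, W 0 ω = 0) {ν : Measure (ℕ → ℝ)} (hν : IsSpectralTailLaw P γ Y ν) :
    (∀ t : ℕ, 1 ≤ t → ∀ᵐ θ ∂ν, θ t = 0) ∧
      ∀ ε : ℝ, |ε| = 1 → ν.real {θ | θ 0 = ε} =
        (∫ ω, (max (ε * W 0 ω) 0) ^ γ ∂P) / ∫ ω, |W 0 ω| ^ γ ∂P := by
  have hγ := h.index_pos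
  obtain ⟨hlaw, hm⟩ := h.isSpectralTailLaw_of_infinite_moment hG hξG hinf hY hΛ hcard hW
  have hpos := integral_abs_cofactor_pos hm (Finset.Subset.refl _) hW
  have hU := h.measurable_cofactor
  have hreal : ∀ (n : ℕ) {B : ℕ → Set ℝ}, (∀ t, MeasurableSet (B t)) →
      ν.real {θ | ∀ t : ℕ, t ≤ n → θ t ∈ B t} =
        (∫ ω, |cofactor ξ b W Λ (Λ 0) ω 0| ^ γ ∂P)⁻¹ *
          ∫ ω in {ω | ∀ t : ℕ, t ≤ n → cofactor ξ b W Λ (Λ 0) ω t /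
            |cofactor ξ b W Λ (Λ 0) ω 0| ∈ B t}, |cofactor ξ b W Λ (Λ 0) ω 0| ^ γ ∂P := by
    intro n B hB
    rw [hlaw.real_setOf_eq_spectralLaw hγ hU hν n hB,
      spectralLaw_real hU (by simpa using hm) (measurableSet_forall_le hB n)]
    simp only [Finset.sum_singleton]
    rfl
  have := hν.isProbabilityMeasure
  refine ⟨fun t ht => ?_, fun ε hε => ?_⟩
  · have hB : ∀ u : ℕ, MeasurableSet (if u = t then ({0} : Set ℝ) else Set.univ) := fun u => by
      split_ifs
      · exact measurableSet_singleton 0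
      · exact MeasurableSet.univ
    have h1 := hreal t hB
    -- the sets of full weights have equal size, so `Λ 0 ⊆ Λ t` would force equality
    have h0 : ∀ ω, cofactor ξ b W Λ (Λ 0) ω t = 0 := fun ω => if_neg fun hsub =>
      hne t ht (Finset.eq_of_subset_of_card_le hsub (hcard t).le).symm
    have h2 : {ω | ∀ u : ℕ, u ≤ t → cofactor ξ b W Λ (Λ 0) ω u /
        |cofactor ξ b W Λ (Λ 0) ω 0| ∈ (if u = t then ({0} : Set ℝ) else Set.univ)} = Set.univ := by
      refine Set.eq_univ_of_forall fun ω u _ => ?_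
      split_ifs with hut
      · subst hut
        simp [h0]
      · exact Set.mem_univ _
    rw [h2, setIntegral_univ, inv_mul_cancel₀ hpos.ne'] at h1
    have h3 : ν {θ | ∀ u : ℕ, u ≤ t → θ u ∈ (if u = t then ({0} : Set ℝ) else Set.univ)} = 1 := by
      rwa [measureReal_def, ENNReal.toReal_eq_one_iff] at h1
    have h4 := (mem_ae_iff_prob_eq_one (measurableSet_forall_le hB t)).2 h3
    filter_upwards [h4] with θ hθ
    have := hθ t le_rfl
    simpa using this
  · have h1 := hreal 0 (B := fun _ => {ε}) fun _ => measurableSet_singleton ε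
    simp only [Nat.le_zero, forall_eq, Set.mem_singleton_iff, div_abs_eq_iff hε] at h1
    rw [h1]
    -- the volatility part `E` of the cofactor is independent of `W 0` and cancels from the ratio
    set E : Ω → ℝ := fun ω => Real.exp (∑' p, offPart (Λ 0) (b 0) p * ξ p ω) with hE
    have hcof : ∀ ω, cofactor ξ b W Λ (Λ 0) ω 0 = E ω * W 0 ω := fun ω =>
      if_pos (Finset.Subset.refl _)
    have hE0 : ∀ ω, 0 < E ω := fun ω => Real.exp_pos _
    have hEm : Measurable[generatedBy ξ Set.univ] E :=
      Real.measurable_exp.comp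
        (SourceField.measurable_tsum_generatedBy fun p hp => absurd (Set.mem_univ p) hp)
    have hEm' : Measurable E := hEm.mono (h.field.generatedBy_le _) le_rfl
    have hWm : Measurable (W 0) := (h.measurable_W 0).mono h.field.le le_rfl
    have hind : IndepFun E (W 0) P := h.field.indepFun hEm
      ((h.measurable_W 0).mono le_sup_right le_rfl)
    have hprod : ∀ f : ℝ → ℝ, Measurable f →
        ∫ ω, E ω ^ γ * f (W 0 ω) ∂P = (∫ ω, E ω ^ γ ∂P) * ∫ ω, f (W 0 ω) ∂P := fun f hf =>
      (hind.comp (by fun_prop : Measurable fun x : ℝ => x ^ γ) hf).integral_mul_eq_mul_integral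
        (hEm'.pow_const γ).aestronglyMeasurable (hf.comp hWm).aestronglyMeasurable
    have e1 : ∫ ω, |cofactor ξ b W Λ (Λ 0) ω 0| ^ γ ∂P =
        (∫ ω, E ω ^ γ ∂P) * ∫ ω, |W 0 ω| ^ γ ∂P := by
      rw [← hprod (fun w => |w| ^ γ) (by fun_prop)]
      refine integral_congr_ae (Eventually.of_forall fun ω => ?_)
      simp only [hcof]
      rw [abs_mul, abs_of_pos (hE0 ω), Real.mul_rpow (hE0 ω).le (abs_nonneg _)]
    have hset : MeasurableSet {ω | 0 < ε * cofactor ξ b W Λ (Λ 0) ω 0} :=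
      measurableSet_lt measurable_const (((measurable_pi_apply 0).comp (hU (Λ 0))).const_mul ε)
    have e2 : ∫ ω in {ω | 0 < ε * cofactor ξ b W Λ (Λ 0) ω 0},
        |cofactor ξ b W Λ (Λ 0) ω 0| ^ γ ∂P =
        (∫ ω, E ω ^ γ ∂P) * ∫ ω, (max (ε * W 0 ω) 0) ^ γ ∂P := by
      rw [← hprod (fun w => (max (ε * w) 0) ^ γ) (by fun_prop), ← integral_indicator hset]
      refine integral_congr_ae (Eventually.of_forall fun ω => ?_)
      beta_reduce
      have h5 : ε * cofactor ξ b W Λ (Λ 0) ω 0 = E ω * (ε * W 0 ω) := by rw [hcof]; ring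
      by_cases hlt : 0 < ε * W 0 ω
      · have h6 : |W 0 ω| = ε * W 0 ω := by rw [← abs_of_pos hlt, abs_mul, hε, one_mul]
        have h7 : 0 < ε * cofactor ξ b W Λ (Λ 0) ω 0 := by rw [h5]; exact mul_pos (hE0 ω) hlt
        rw [Set.indicator_of_mem (by exact h7), hcof, max_eq_left hlt.le, abs_mul,
          abs_of_pos (hE0 ω), h6, Real.mul_rpow (hE0 ω).le hlt.le]
      · have h7 : ¬ 0 < ε * cofactor ξ b W Λ (Λ 0) ω 0 := fun hc => by
          rw [h5] at hc
          exact hlt ((mul_pos_iff_of_pos_left (hE0 ω)).1 hc)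
        rw [Set.indicator_of_notMem (by exact h7),
          max_eq_right (not_lt.1 hlt), Real.zero_rpow hγ.ne', mul_zero]
    rw [e1] at hpos
    have hEpos : (∫ ω, E ω ^ γ ∂P) ≠ 0 := fun h0 => by rw [h0, zero_mul] at hpos; exact hpos.false
    rw [e1, e2, mul_inv, mul_mul_mul_comm, inv_mul_cancel₀ hEpos, one_mul, inv_mul_eq_div]

/-- Under convolution equivalence, the spectral tail law is the mixture over the sources with full
weight at time zero. The cofactor may be replaced by the process itself, since the two differ by an
independent positive factor with a finite moment of order `γ`. -/
theorem spectral_of_convolutionRatio [Nontrivial I] (h : LinearModel mW P ξ γ β b W Λ)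
    (hG : RegVarTail γ G) (hξG : ∀ p x, P.real {ω | x < expSum ξ {p} ω} = G x)
    (hconv : ∀ p q, p ≠ q → ConvolutionRatio P (ξ p) (ξ q))
    (hY : ∀ (t : ℕ) ω, Y t ω = linearValue ξ b W ω t) (hΛ : (Λ 0).Nonempty)
    (hW : ¬ ∀ᵐ ω ∂P, W 0 ω = 0) {ν : Measure (ℕ → ℝ)} (hν : IsSpectralTailLaw P γ Y ν)
    (n : ℕ) {B : ℕ → Set ℝ} (hB : ∀ t, MeasurableSet (B t)) :
    ν.real {θ | ∀ t : ℕ, t ≤ n → θ t ∈ B t} =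
      ∑ p ∈ Λ 0, 1 / ((Λ 0).card : ℝ) *
        ((∫ ω in {ω | ∀ t : ℕ, t ≤ n → (if p ∈ Λ t then Y t ω / |Y 0 ω| else 0) ∈ B t},
          |Y 0 ω| ^ γ ∂P) / ∫ ω, |Y 0 ω| ^ γ ∂P) := by
  have hγ := h.index_pos
  have hF := h.field
  have hU := h.measurable_cofactor
  obtain ⟨hlaw, hm⟩ := h.isSpectralTailLaw_of_convolutionRatio hG hξG hconv hY hΛ hW
  have hpos : ∀ p ∈ Λ 0, 0 < ∫ ω, |cofactor ξ b W Λ {p} ω 0| ^ γ ∂P := fun p hp =>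
    integral_abs_cofactor_pos (hm p hp) (Finset.singleton_subset_iff.2 hp) hW
  rw [hlaw.real_setOf_eq_spectralLaw hγ hU hν n hB,
    spectralLaw_real hU (fun s hs => by
      obtain ⟨p, hp, rfl⟩ := Finset.mem_image.1 hs
      exact hm p hp) (measurableSet_forall_le hB n)]
  have hinj : Set.InjOn (fun p : I => ({p} : Finset I)) (Λ 0) := fun p _ q _ hpq =>
    Finset.singleton_injective hpq
  rw [Finset.sum_image hinj, Finset.sum_image hinj]
  have hξG' : ∀ p x, P.real {ω | x < Real.exp (ξ p ω)} = G x := fun p x => by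
    simpa only [SourceField.expSum_singleton] using hξG p x
  obtain ⟨p₀, hp₀⟩ := hΛ
  set m := ∫ ω, expSum ξ {p₀} ω ^ γ ∂P with hmdef
  have hmp : ∀ p, ∫ ω, expSum ξ {p} ω ^ γ ∂P = m := fun p =>
    ((hF.identDistrib_expSum (s := {p}) (t := {p₀}) (by simp)).comp
      (by fun_prop : Measurable fun x : ℝ => x ^ γ)).integral_eq
  have hm0 : 0 < m := by
    obtain ⟨q, hq⟩ := exists_ne p₀
    have hi := (convolutionRatio_consequences hG hγ (hF.measurable p₀) (hF.measurable q)
      (hF.indepFun_left (A := {p₀}) (measurable_generatedBy (by simp))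
        (measurable_generatedBy (by simpa using hq))) (hF.ident q p₀) (hξG' p₀)
      (hconv p₀ q hq.symm)).1
    have e : ∀ ω, expSum ξ {p₀} ω ^ γ = Real.exp (γ * ξ p₀ ω) := fun ω => by
      rw [SourceField.expSum_singleton, ← Real.exp_mul, mul_comm]
    simp only [hmdef, e]
    exact integral_exp_pos hi
  -- a full weight factor is independent of its cofactor and cancels from the ratios
  have hkey : ∀ p ∈ Λ 0, ∀ B : ℕ → Set ℝ, (∀ t, MeasurableSet (B t)) →
      ∫ ω in {ω | ∀ t : ℕ, t ≤ n → (if p ∈ Λ t then Y t ω / |Y 0 ω| else 0) ∈ B t},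
        |Y 0 ω| ^ γ ∂P =
      m * ∫ ω in {ω | ∀ t : ℕ, t ≤ n → cofactor ξ b W Λ {p} ω t /
        |cofactor ξ b W Λ {p} ω 0| ∈ B t}, |cofactor ξ b W Λ {p} ω 0| ^ γ ∂P := by
    intro p hp B hB
    have hYm : ∀ t : ℕ, Measurable fun ω => Y t ω := fun t => by
      have := (measurable_pi_apply t).comp h.measurable_linearValue
      simp only [hY]
      exact this
    have hY0m : Measurable fun ω => Y 0 ω := hYm 0
    have hset1 : MeasurableSet
        {ω | ∀ t : ℕ, t ≤ n → (if p ∈ Λ t then Y t ω / |Y 0 ω| else 0) ∈ B t} := by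
      have hmeas : Measurable fun ω (t : ℕ) => if p ∈ Λ t then Y t ω / |Y 0 ω| else 0 := by
        refine measurable_pi_lambda _ fun t => ?_
        split_ifs
        · exact (hYm t).div hY0m.abs
        · exact measurable_const
      exact hmeas (measurableSet_forall_le hB n)
    set D : Set (ℕ → ℝ) := {u | ∀ t : ℕ, t ≤ n → u t / |u 0| ∈ B t} with hD
    have hDm : MeasurableSet D := by
      have hmeas : Measurable fun (u : ℕ → ℝ) (t : ℕ) => u t / |u 0| := by fun_prop
      exact hmeas (measurableSet_forall_le hB n)
    have hφ : Measurable (D.indicator fun u : ℕ → ℝ => |u 0| ^ γ) :=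
      Measurable.indicator (by fun_prop) hDm
    have hset2 : MeasurableSet {ω | ∀ t : ℕ, t ≤ n → cofactor ξ b W Λ {p} ω t /
        |cofactor ξ b W Λ {p} ω 0| ∈ B t} := hU {p} hDm
    have hind := ((h.indepFun_cofactor {p}).comp
      (by fun_prop : Measurable fun x : ℝ => x ^ γ) hφ).integral_mul_eq_mul_integral
        ((hF.measurable_expSum {p}).pow_const γ).aestronglyMeasurable
        (hφ.comp (hU {p})).aestronglyMeasurable
    simp only [Pi.mul_apply, Function.comp_apply, hmp] at hind
    rw [← integral_indicator hset1, ← integral_indicator hset2]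
    refine Eq.trans (integral_congr_ae ?_) hind
    have hae : ∀ᵐ ω ∂P, ∀ t : ℕ, p ∈ Λ t →
        Y t ω = expSum ξ {p} ω * cofactor ξ b W Λ {p} ω t := by
      rw [ae_all_iff]
      intro t
      by_cases hpt : p ∈ Λ t
      · filter_upwards [h.linearValue_eq (Finset.singleton_subset_iff.2 hpt)] with ω hω _
        rw [hY, hω]
      · exact Eventually.of_forall fun ω hc => absurd hc hpt
    filter_upwards [hae] with ω hω
    have hR := expSum_pos ξ {p} ω
    have hY0 : Y 0 ω = expSum ξ {p} ω * cofactor ξ b W Λ {p} ω 0 := hω 0 hp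
    have hratio : ∀ t : ℕ, (if p ∈ Λ t then Y t ω / |Y 0 ω| else 0) =
        cofactor ξ b W Λ {p} ω t / |cofactor ξ b W Λ {p} ω 0| := by
      intro t
      split_ifs with hpt
      · rw [hω t hpt, hY0, abs_mul, abs_of_pos hR, mul_div_mul_left _ _ hR.ne']
      · have : cofactor ξ b W Λ {p} ω t = 0 :=
          if_neg fun hc => hpt (Finset.singleton_subset_iff.1 hc)
        rw [this, zero_div]
    by_cases hmem : cofactor ξ b W Λ {p} ω ∈ D
    · have hmem' : ∀ t : ℕ, t ≤ n → (if p ∈ Λ t then Y t ω / |Y 0 ω| else 0) ∈ B t := fun t ht => by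
        rw [hratio]; exact hmem t ht
      rw [Set.indicator_of_mem (by exact hmem'), Set.indicator_of_mem hmem, hY0, abs_mul,
        abs_of_pos hR, Real.mul_rpow hR.le (abs_nonneg _)]
    · have hmem' : ¬ ∀ t : ℕ, t ≤ n → (if p ∈ Λ t then Y t ω / |Y 0 ω| else 0) ∈ B t :=
        fun hc => hmem fun t ht => by rw [← hratio]; exact hc t ht
      rw [Set.indicator_of_notMem (by exact hmem'), Set.indicator_of_notMem hmem, mul_zero]
  have hfull : ∀ p ∈ Λ 0, ∫ ω, |Y 0 ω| ^ γ ∂P = m * ∫ ω, |cofactor ξ b W Λ {p} ω 0| ^ γ ∂P := by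
    intro p hp
    simpa using hkey p hp (fun _ => Set.univ) fun _ => MeasurableSet.univ
  set c := ∫ ω, |Y 0 ω| ^ γ ∂P with hc
  have hcp : ∀ p ∈ Λ 0, ∫ ω, |cofactor ξ b W Λ {p} ω 0| ^ γ ∂P = c / m := fun p hp => by
    rw [hfull p hp]; field_simp
  have hc0 : 0 < c := by rw [hfull p₀ hp₀]; exact mul_pos hm0 (hpos p₀ hp₀)
  have hn : (0 : ℝ) < (Λ 0).card := by exact_mod_cast Finset.card_pos.2 ⟨p₀, hp₀⟩
  rw [Finset.sum_congr rfl hcp, Finset.sum_const, nsmul_eq_mul, Finset.mul_sum]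
  refine Finset.sum_congr rfl fun p hp => ?_
  rw [hkey p hp B hB]
  simp only [Set.mem_ofPred_eq]
  field_simp

end LinearModel

end ModelSpectral

/-! ### Invariance under equality in law -/

section TransferByLaw

variable {Ω Ω' : Type*} [MeasurableSpace Ω] [MeasurableSpace Ω'] {P : Measure Ω} {P' : Measure Ω'}
  {γ : ℝ}

theorem setIntegral_eq_of_identDistrib {E : Type*} [MeasurableSpace E] {X : Ω → E} {X' : Ω' → E}
    (h : IdentDistrib X' X P' P) (hX : Measurable X) (hX' : Measurable X') {D : Set E}
    (hD : MeasurableSet D) {g : E → ℝ} (hg : Measurable g) :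
    ∫ ω in {ω | X' ω ∈ D}, g (X' ω) ∂P' = ∫ ω in {ω | X ω ∈ D}, g (X ω) ∂P := by
  have h1 : MeasurableSet {ω | X' ω ∈ D} := hX' hD
  have h2 : MeasurableSet {ω | X ω ∈ D} := hX hD
  rw [← integral_indicator h1, ← integral_indicator h2]
  exact (h.comp (hg.indicator hD)).integral_eq

theorem measureReal_eq_of_identDistrib {E : Type*} [MeasurableSpace E] {X : Ω → E} {X' : Ω' → E}
    (h : IdentDistrib X' X P' P) {D : Set E} (hD : MeasurableSet D) :
    P'.real {ω | X' ω ∈ D} = P.real {ω | X ω ∈ D} :=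
  congrArg ENNReal.toReal (h.measure_mem_eq hD)

theorem VagueRegVar.of_identDistrib {ι : Type*} [Countable ι] {V : Ω → ι → ℝ} {V' : Ω' → ι → ℝ}
    {r : ℝ → ℝ} (h : VagueRegVar P' γ V' r) (hV : IdentDistrib V' V P' P) :
    VagueRegVar P γ V r := by
  obtain ⟨μ, h1, h2, h3, h4, h5⟩ := h
  refine ⟨μ, h1, h2, h3, h4, fun f hf => (h5 f hf).congr fun x => ?_⟩
  have hm : Measurable fun (v : ι → ℝ) => f fun q => ((x⁻¹ * v q : ℝ) : EReal) := by
    have : Measurable fun (v : ι → ℝ) (q : ι) => ((x⁻¹ * v q : ℝ) : EReal) := by fun_prop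
    exact f.continuous.measurable.comp this
  congr 1
  exact (hV.comp hm).integral_eq

theorem IsSpectralTailLaw.of_identDistrib {Y : ℤ → Ω → ℝ} {Y' : ℤ → Ω' → ℝ}
    {ν : Measure (ℕ → ℝ)} (h : IsSpectralTailLaw P' γ Y' ν) (hm : ∀ t, Measurable (Y t))
    (hm' : ∀ t, Measurable (Y' t))
    (hY : IdentDistrib (fun ω (t : ℤ) => Y' t ω) (fun ω (t : ℤ) => Y t ω) P' P) :
    IsSpectralTailLaw P γ Y ν := by
  refine ⟨h.isProbabilityMeasure, fun k f => (h.tendsto k f).congr fun x => ?_⟩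
  have hD : MeasurableSet {y : ℤ → ℝ | x < |y 0|} := by measurability
  have hg : Measurable fun y : ℤ → ℝ => f fun t : Fin (k + 1) => x⁻¹ * y ((t : ℕ) : ℤ) := by
    have : Measurable fun (y : ℤ → ℝ) (t : Fin (k + 1)) => x⁻¹ * y ((t : ℕ) : ℤ) := by fun_prop
    exact f.continuous.measurable.comp this
  have h1 := setIntegral_eq_of_identDistrib hY (measurable_pi_lambda _ hm)
    (measurable_pi_lambda _ hm') hD hg
  have h2 : P' {ω | x < |Y' 0 ω|} = P {ω | x < |Y 0 ω|} := hY.measure_mem_eq hD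
  rw [ProbabilityTheory.cond, ProbabilityTheory.cond, integral_smul_measure, integral_smul_measure,
    h2]
  exact congrArg _ h1

end TransferByLaw

/-! ### Stationary sequences with the law of a linear model -/

section StationaryModel

theorem isGauge_norm_comp {ι κ : Type*} [Fintype ι] [Fintype κ] (f : κ → ι) :
    IsGauge fun v : ι → ℝ => ‖fun k => v (f k)‖ where
  nonneg _ := norm_nonneg _
  lipschitz := LipschitzWith.of_dist_le_mul fun v w => by
    rw [NNReal.coe_one, one_mul]
    refine (dist_norm_norm_le _ _).trans ?_
    rw [dist_eq_norm]
    exact (pi_norm_le_iff_of_nonneg (norm_nonneg _)).2 fun k => norm_le_pi_norm (v - w) (f k)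
  homogeneous r hr v := by
    have : (fun k => r * v (f k)) = r • fun k => v (f k) := rfl
    rw [this, norm_smul, Real.norm_of_nonneg hr]

theorem card_eq_of_shift {Λ Λ' : Finset (ℤ × ℤ)} {t : ℤ}
    (h : ∀ p : ℤ × ℤ, p ∈ Λ' ↔ (p.1, p.2 - t) ∈ Λ) : Λ'.card = Λ.card := by
  refine Finset.card_nbij' (fun p => (p.1, p.2 - t)) (fun p => (p.1, p.2 + t)) ?_ ?_ ?_ ?_
  · exact fun p hp => (h p).1 hp
  · intro p hp
    refine (h _).2 ?_
    simpa using hp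
  · intro p _
    simp
  · intro p _
    simp

/-- A nonempty finite set is not invariant under a nontrivial shift. -/
theorem ne_of_shift {Λ Λ' : Finset (ℤ × ℤ)} {t : ℤ} (ht : 1 ≤ t)
    (h : ∀ p : ℤ × ℤ, p ∈ Λ' ↔ (p.1, p.2 - t) ∈ Λ) (hne : Λ.Nonempty) : Λ' ≠ Λ := by
  rintro rfl
  obtain ⟨p, hp, hmax⟩ := Λ'.exists_max_image (fun p => p.2) hne
  have h1 := hmax (p.1, p.2 + t) ((h _).2 (by simpa using hp))
  simp only at h1
  omega

namespace LinearModel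

variable {Ω Ω' : Type*} [MeasurableSpace Ω] {mW mΩ' : MeasurableSpace Ω'} {P : Measure Ω}
  {P' : Measure Ω'} [IsProbabilityMeasure P'] {ξ : ℤ × ℤ → Ω' → ℝ} {γ β : ℝ} {d : ℕ}
  {b : ℤ × Fin d → ℤ × ℤ → ℝ} {W : ℤ × Fin d → Ω' → ℝ} {Λ : ℤ × Fin d → Finset (ℤ × ℤ)}
  {G : ℝ → ℝ}

/-- A stationary sequence with the law of a linear model whose weights are shifted in time is
regularly varying. -/
theorem isRegVarSeq_of_identDistrib (h : LinearModel mW P' ξ γ β b W Λ) (hG : RegVarTail γ G)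
    (hξG : ∀ p x, P'.real {ω | x < expSum ξ {p} ω} = G x)
    (halt : (∀ p, ∫⁻ ω, ENNReal.ofReal (expSum ξ {p} ω ^ γ) ∂P' = ⊤) ∨
      ∀ p q, p ≠ q → ConvolutionRatio P' (ξ p) (ξ q))
    (hshift : ∀ t k p, p ∈ Λ (t, k) ↔ (p.1, p.2 - t) ∈ Λ (0, k))
    (hΛ : ∃ k, (Λ (0, k)).Nonempty) (hW : ∀ k, ¬ ∀ᵐ ω ∂P', W (0, k) ω = 0)
    {Y : ℤ → Ω → Fin d → ℝ} (hst : StrictlyStationary P Y)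
    (hY : IdentDistrib (linearValue ξ b W) (fun ω (q : ℤ × Fin d) => Y q.1 ω q.2) P' P) :
    IsRegVarSeq P γ Y := by
  refine ⟨h.index_pos, hst, fun n => ?_⟩
  obtain ⟨k₁, hk₁⟩ := hΛ
  obtain ⟨k₀, -, hk₀⟩ := Finset.univ.exists_max_image (fun k => (Λ (0, k)).card)
    ⟨k₁, Finset.mem_univ _⟩
  have hk₀ne : (Λ (0, k₀)).Nonempty :=
    Finset.card_pos.1 ((Finset.card_pos.2 hk₁).trans_le (hk₀ k₁ (Finset.mem_univ _)))
  set f : Fin (n + 1) × Fin d → ℤ × Fin d := fun q => (((q.1 : ℕ) : ℤ), q.2) with hf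
  have hf0 : ∀ k, f (0, k) = (0, k) := fun k => by simp [hf]
  have hnorm : Measurable fun v : ℤ × Fin d → ℝ => ‖fun k => v (0, k)‖ := by
    have : Measurable fun (v : ℤ × Fin d → ℝ) (k : Fin d) => v (0, k) := by fun_prop
    exact this.norm
  have hvec : Measurable fun (v : ℤ × Fin d → ℝ) (q : Fin (n + 1) × Fin d) => v (f q) := by fun_prop
  refine VagueRegVar.of_identDistrib ?_ (hY.comp hvec)
  refine (h.comp f).vagueRegVar hG hξG halt 
    (isGauge_norm_comp fun k : Fin d => ((0 : Fin (n + 1)), k)) (q₀ := (0, k₀)) ?_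
    (fun q => ?_) ?_ (fun v => norm_le_pi_norm (fun k => v (0, k)) k₀)
    (fun x => ?_)
  · simp only [hf0]; exact hk₀ne
  · simp only [hf0]
    rw [card_eq_of_shift (hshift (((q.1 : ℕ) : ℤ)) q.2)]
    exact hk₀ q.2 (Finset.mem_univ _)
  · simp only [hf0]; exact hW k₀
  · have hD : MeasurableSet {v : ℤ × Fin d → ℝ | x < ‖fun k => v (0, k)‖} :=
      measurableSet_lt measurable_const hnorm
    have h1 := measureReal_eq_of_identDistrib hY hD
    refine Eq.trans h1.symm ?_
    congr 1

end LinearModel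

namespace LinearModel

variable {Ω Ω' : Type*} [MeasurableSpace Ω] {mW mΩ' : MeasurableSpace Ω'} {P : Measure Ω}
  {P' : Measure Ω'} [IsProbabilityMeasure P'] {ξ : ℤ × ℤ → Ω' → ℝ} {γ β : ℝ}
  {b : ℤ × Fin 1 → ℤ × ℤ → ℝ} {W : ℤ × Fin 1 → Ω' → ℝ} {Λ : ℤ × Fin 1 → Finset (ℤ × ℤ)}
  {G : ℝ → ℝ}

/-- The spectral tail process of a real sequence with the law of a linear model whose weights are
shifted in time. -/
theorem spectral_of_identDistrib (h : LinearModel mW P' ξ γ β b W Λ) (hG : RegVarTail γ G)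
    (hξG : ∀ p x, P'.real {ω | x < expSum ξ {p} ω} = G x)
    (halt : (∀ p, ∫⁻ ω, ENNReal.ofReal (expSum ξ {p} ω ^ γ) ∂P' = ⊤) ∨
      ∀ p q, p ≠ q → ConvolutionRatio P' (ξ p) (ξ q))
    (hshift : ∀ t k p, p ∈ Λ (t, k) ↔ (p.1, p.2 - t) ∈ Λ (0, k))
    (hΛ : (Λ (0, 0)).Nonempty) (hW : ¬ ∀ᵐ ω ∂P', W (0, 0) ω = 0)
    {Y : ℤ → Ω → ℝ} (hYm : ∀ t, Measurable (Y t))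
    (hY : IdentDistrib (linearValue ξ b W) (fun ω (q : ℤ × Fin 1) => Y q.1 ω) P' P) :
    (∃ ν, IsSpectralTailLaw P γ Y ν) ∧
    ∀ ν, IsSpectralTailLaw P γ Y ν →
      ((∀ p, ∫⁻ ω, ENNReal.ofReal (expSum ξ {p} ω ^ γ) ∂P' = ⊤) →
        (∀ t : ℕ, 1 ≤ t → ∀ᵐ θ ∂ν, θ t = 0) ∧
        ∀ ε : ℝ, |ε| = 1 → ν.real {θ | θ 0 = ε} =
          (∫ ω, (max (ε * W (0, 0) ω) 0) ^ γ ∂P') / ∫ ω, |W (0, 0) ω| ^ γ ∂P') ∧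
      ((∀ p q, p ≠ q → ConvolutionRatio P' (ξ p) (ξ q)) →
        ∀ (n : ℕ) (B : ℕ → Set ℝ), (∀ t, MeasurableSet (B t)) →
          ν.real {θ | ∀ t : ℕ, t ≤ n → θ t ∈ B t} =
            spectralMixture P γ (fun t => (Λ (t, 0) : Set (ℤ × ℤ))) Y n B) := by
  set Y' : ℤ → Ω' → ℝ := fun t ω => linearValue ξ b W ω (t, 0) with hY'
  set f : ℕ → ℤ × Fin 1 := fun t => ((t : ℤ), 0) with hf
  have hf0 : f 0 = (0, 0) := by simp [hf]
  have hm' : ∀ t, Measurable (Y' t) := fun t =>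
    (measurable_pi_apply (t, (0 : Fin 1))).comp h.measurable_linearValue
  have hpath : Measurable fun (v : ℤ × Fin 1 → ℝ) (t : ℤ) => v (t, 0) := by fun_prop
  have hid : IdentDistrib (fun ω (t : ℤ) => Y' t ω) (fun ω (t : ℤ) => Y t ω) P' P := hY.comp hpath
  have hc := h.comp f
  have hYf : ∀ (t : ℕ) ω, Y' t ω =
      linearValue ξ (fun t => b (f t)) (fun t => W (f t)) ω t := fun t ω => rfl
  have hΛf : (Λ (f 0)).Nonempty := by rw [hf0]; exact hΛ
  have hWf : ¬ ∀ᵐ ω ∂P', W (f 0) ω = 0 := by rw [hf0]; exact hW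
  have hcard : ∀ t, (Λ (f t)).card = (Λ (f 0)).card := fun t => by
    rw [hf0]; exact card_eq_of_shift (hshift t 0)
  have hne : ∀ t, 1 ≤ t → Λ (f t) ≠ Λ (f 0) := fun t ht => by
    rw [hf0]; exact ne_of_shift (by exact_mod_cast ht) (hshift t 0) hΛ
  refine ⟨?_, fun ν hν => ?_⟩
  · rcases halt with hinf | hconv
    · exact ⟨_, (hc.isSpectralTailLaw_of_infinite_moment hG hξG hinf hYf hΛf hcard
        hWf).1.of_identDistrib hYm hm' hid⟩
    · exact ⟨_, (hc.isSpectralTailLaw_of_convolutionRatio hG hξG hconv hYf hΛf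
        hWf).1.of_identDistrib hYm hm' hid⟩
  have hν' : IsSpectralTailLaw P' γ Y' ν := hν.of_identDistrib hm' hYm hid.symm
  refine ⟨fun hinf => ?_, fun hconv n B hB => ?_⟩
  · have := hc.spectral_of_infinite_moment hG hξG hinf hYf hΛf hcard hne hWf hν'
    rwa [hf0] at this
  · rw [hc.spectral_of_convolutionRatio hG hξG hconv hYf hΛf hWf hν' n hB, spectralMixture,
      finsum_mem_coe_finset, Set.ncard_coe_finset, hf0]
    have hpow : Measurable fun y : ℤ → ℝ => |y 0| ^ γ := by fun_prop
    have hmY : Measurable fun ω (t : ℤ) => Y t ω := measurable_pi_lambda _ hYm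
    have hmY' : Measurable fun ω (t : ℤ) => Y' t ω := measurable_pi_lambda _ hm'
    have e0 : ∫ ω, |Y' 0 ω| ^ γ ∂P' = ∫ ω, |Y 0 ω| ^ γ ∂P := (hid.comp hpow).integral_eq
    refine Finset.sum_congr rfl fun p _ => ?_
    have hD : MeasurableSet {y : ℤ → ℝ | ∀ t : ℕ, t ≤ n →
        (if p ∈ Λ (f t) then y t / |y 0| else 0) ∈ B t} := by
      have hmeas : Measurable fun (y : ℤ → ℝ) (t : ℕ) =>
          if p ∈ Λ (f t) then y t / |y 0| else 0 := by
        refine measurable_pi_lambda _ fun t => ?_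
        split_ifs
        · fun_prop
        · exact measurable_const
      exact hmeas (measurableSet_forall_le hB n)
    have e1 := setIntegral_eq_of_identDistrib hid hmY hmY' hD hpow
    have e2 : {ω | ∀ t : ℕ, t ≤ n → (Λ ((t : ℤ), 0) : Set (ℤ × ℤ)).indicator
        (fun _ => Y (t : ℤ) ω / |Y 0 ω|) p ∈ B t} =
        {ω | (fun t : ℤ => Y t ω) ∈ {y : ℤ → ℝ | ∀ t : ℕ, t ≤ n →
        (if p ∈ Λ (f t) then y t / |y 0| else 0) ∈ B t}} := by
      ext ω
      refine forall_congr' fun t => forall_congr' fun _ => ?_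
      by_cases hp : p ∈ Λ ((t : ℤ), 0)
      · rw [Set.indicator_of_mem (by exact hp), if_pos (by exact hp)]
      · rw [Set.indicator_of_notMem (by exact hp), if_neg (by exact hp)]
    rw [e2, ← e1, ← e0]
    rfl

end LinearModel

end StationaryModel

/-! ### Independent copies of the fields -/

section IndependentFields

variable {Ω I : Type*} {mΩ : MeasurableSpace Ω} {P : Measure Ω} [IsProbabilityMeasure P]

omit [IsProbabilityMeasure P] in
/-- Jointly independent fields `η` and `Z` give a source field `κ η` with the σ-algebra generated by
`Z`. -/
theorem sourceField_of_iIndepFun {η Z : I → Ω → ℝ} (hη : ∀ p, Measurable (η p))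
    (hZ : ∀ p, Measurable (Z p)) (hid : ∀ p q, IdentDistrib (η p) (η q) P P)
    (hind : iIndepFun (Sum.elim η Z) P) (κ : ℝ) :
    SourceField (generatedBy Z Set.univ) P (fun p ω => κ * η p ω) where
  measurable p := (hη p).const_mul κ
  ident p q := (hid p q).const_mul κ
  le := iSup₂_le fun p _ => (hZ p).comap_le
  indep A := by
    set m : I ⊕ I → MeasurableSpace Ω := fun i =>
      MeasurableSpace.comap (Sum.elim η Z i) (inferInstance : MeasurableSpace ℝ) with hm
    have hle : ∀ i, m i ≤ mΩ := by
      rintro (p | p)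
      · exact (hη p).comap_le
      · exact (hZ p).comap_le
    have hdis : Disjoint (Sum.inl '' A : Set (I ⊕ I)) (Sum.inl '' Aᶜ ∪ Set.range Sum.inr) := by
      rw [Set.disjoint_left]
      rintro _ ⟨p, hp, rfl⟩ (⟨q, hq, hqe⟩ | ⟨q, hqe⟩)
      · exact hq (Sum.inl_injective hqe ▸ hp)
      · simp at hqe
    have hgen : ∀ (B : Set I) (T : Set (I ⊕ I)), (∀ p ∈ B, Sum.inl p ∈ T) →
        generatedBy (fun p ω => κ * η p ω) B ≤ ⨆ i ∈ T, m i := by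
      intro B T hBT
      refine iSup₂_le fun p hp => le_trans ?_ (le_iSup₂ (f := fun i (_ : i ∈ T) => m i) _ (hBT p hp))
      have : Measurable[MeasurableSpace.comap (η p) inferInstance] (η p) := comap_measurable _
      exact (this.const_mul κ).comap_le
    refine indep_of_indep_of_le (indep_iSup_of_disjoint hle hind.iIndep hdis)
      (hgen _ _ fun p hp => Set.mem_image_of_mem _ hp)
      (sup_le (hgen _ _ fun p hp => Or.inl (Set.mem_image_of_mem _ hp)) ?_)
    exact iSup₂_le fun p _ => le_iSup₂ (f := fun i
      (_ : i ∈ (Sum.inl '' Aᶜ ∪ Set.range Sum.inr : Set (I ⊕ I))) => m i) (Sum.inr p)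
      (Or.inr ⟨p, rfl⟩)

/-- Two families of random variables have jointly independent copies on another space. -/
theorem exists_independent_copies {Ω : Type*} {I : Type} {mΩ : MeasurableSpace Ω} {P : Measure Ω}
    [IsProbabilityMeasure P] {η Z : I → Ω → ℝ} (hη : ∀ p, Measurable (η p))
    (hZ : ∀ p, Measurable (Z p)) :
    ∃ (Ω' : Type) (_ : MeasurableSpace Ω') (P' : Measure Ω') (η' Z' : I → Ω' → ℝ),
      IsProbabilityMeasure P' ∧ (∀ p, Measurable (η' p)) ∧ (∀ p, Measurable (Z' p)) ∧
      iIndepFun (Sum.elim η' Z') P' ∧ (∀ p, IdentDistrib (η' p) (η p) P' P) ∧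
      ∀ p, IdentDistrib (Z' p) (Z p) P' P := by
  have hprob : ∀ i : I ⊕ I, IsProbabilityMeasure (P.map (Sum.elim η Z i)) := by
    rintro (p | p)
    · exact Measure.isProbabilityMeasure_map (hη p).aemeasurable
    · exact Measure.isProbabilityMeasure_map (hZ p).aemeasurable
  obtain ⟨Ω', mΩ', P', X, hX, hlaw, hind, hP'⟩ :=
    exists_hasLaw_indepFun (fun _ : I ⊕ I => ℝ) fun i => P.map (Sum.elim η Z i)
  refine ⟨Ω', mΩ', P', fun p => X (Sum.inl p), fun p => X (Sum.inr p), hP', fun p => hX _,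
    fun p => hX _, ?_, fun p => ⟨(hX _).aemeasurable, (hη p).aemeasurable, (hlaw _).map_eq⟩,
    fun p => ⟨(hX _).aemeasurable, (hZ p).aemeasurable, (hlaw _).map_eq⟩⟩
  have : (Sum.elim (fun p => X (Sum.inl p)) fun p => X (Sum.inr p)) = X := by
    funext i; rcases i with p | p <;> rfl
  rwa [this]

end IndependentFields

/-! ### Multiples of the noise -/

section TailOfPowers

variable {Ω : Type*} [MeasurableSpace Ω] {P : Measure Ω} [IsProbabilityMeasure P] {α : ℝ}
  {X : Ω → ℝ}

/-- The bound `x ^ (-α) * L x > 0` holds for large `x` only; positivity elsewhere follows from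
monotonicity. -/
theorem regVarTail_of_slowlyVarying {L : ℝ → ℝ} (hL : SlowlyVarying L)
    (h : ∀ x : ℝ, 0 < x → P.real {ω | x < Real.exp (X ω)} = x ^ (-α) * L x) :
    RegVarTail α fun x => P.real {ω | x < Real.exp (X ω)} := by
  have hanti : Antitone fun x => P.real {ω | x < Real.exp (X ω)} := fun x y hxy =>
    measureReal_mono fun ω hω => lt_of_le_of_lt hxy hω
  refine ⟨hanti, fun x => ?_, fun x => measureReal_le_one, fun c hc => ?_⟩
  · obtain ⟨z, hz1, hz2⟩ := (hL.1.and (eventually_gt_atTop (max x 0))).exists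
    have hz0 : 0 < z := (le_max_right x 0).trans_lt hz2
    refine lt_of_lt_of_le ?_ (hanti ((le_max_left x 0).trans hz2.le))
    simp only [h z hz0]
    positivity
  · have h1 := (hL.2 c hc).const_mul (c ^ (-α))
    rw [mul_one] at h1
    refine h1.congr' ?_
    filter_upwards [eventually_gt_atTop 0, hL.1] with x hx hLx
    rw [h x hx, h (c * x) (mul_pos hc hx), Real.mul_rpow hc.le hx.le]
    have : x ^ (-α) ≠ 0 := (Real.rpow_pos_of_pos hx _).ne'
    field_simp

/-- Multiplication of the noise by `κ` divides the tail index by `κ`. -/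
theorem RegVarTail.exp_const_mul (h : RegVarTail α fun x => P.real {ω | x < Real.exp (X ω)})
    {κ : ℝ} (hκ : 0 < κ) : RegVarTail (α / κ) fun x => P.real {ω | x < Real.exp (κ * X ω)} := by
  have key : ∀ x : ℝ, 0 < x → P.real {ω | x < Real.exp (κ * X ω)} =
      P.real {ω | x ^ κ⁻¹ < Real.exp (X ω)} := fun x hx => by
    congr 1
    ext ω
    simp only [Set.mem_ofPred_eq]
    rw [Real.rpow_inv_lt_iff_of_pos hx.le (Real.exp_pos _).le hκ, ← Real.exp_mul, mul_comm]
  have hanti : Antitone fun x => P.real {ω | x < Real.exp (κ * X ω)} := fun x y hxy =>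
    measureReal_mono fun ω hω => lt_of_le_of_lt hxy hω
  refine ⟨hanti, fun x => ?_, fun x => measureReal_le_one, fun c hc => ?_⟩
  · refine lt_of_lt_of_le ?_ (hanti (le_max_left x 1))
    simp only [key _ (lt_of_lt_of_le one_pos (le_max_right x 1))]
    exact h.pos _
  · have h1 := (h.ratio (c ^ κ⁻¹) (by positivity)).comp (tendsto_rpow_atTop (inv_pos.2 hκ))
    rw [← Real.rpow_mul hc.le] at h1
    have e : κ⁻¹ * -α = -(α / κ) := by field_simp
    rw [e] at h1
    refine h1.congr' ?_
    filter_upwards [eventually_gt_atTop 0] with x hx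
    simp only [Function.comp_apply]
    rw [key x hx, key (c * x) (mul_pos hc hx), Real.mul_rpow hc.le hx.le]

omit [IsProbabilityMeasure P] in
theorem ConvolutionRatio.of_identDistrib_const_mul {Ω' : Type*} [MeasurableSpace Ω']
    {P' : Measure Ω'} {Y : Ω → ℝ} {X' Y' : Ω' → ℝ} (h : ConvolutionRatio P X Y)
    (hX : IdentDistrib X' X P' P) (hY : IdentDistrib Y' Y P' P) (hXY : IndepFun X Y P)
    (hXY' : IndepFun X' Y' P') [IsProbabilityMeasure P'] {κ : ℝ} (hκ : 0 < κ) :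
    ConvolutionRatio P' (fun ω => κ * X' ω) fun ω => κ * Y' ω := by
  obtain ⟨c, hc, hlim⟩ := h
  refine ⟨c, hc, (hlim.comp (tendsto_id.atTop_div_const hκ)).congr fun x => ?_⟩
  have hD : MeasurableSet {z : ℝ × ℝ | x / κ < z.1 + z.2} := by measurability
  have h1 := measureReal_eq_of_identDistrib (hX.prodMk hY hXY' hXY) hD
  have h2 := measureReal_eq_of_identDistrib hX (D := Set.Ioi (x / κ)) measurableSet_Ioi
  simp only [Function.comp_apply, id]
  simp only [Set.mem_ofPred_eq, Set.mem_Ioi, div_lt_iff₀' hκ, mul_add] at h1 h2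
  simp only [div_lt_iff₀' hκ, mul_add]
  rw [h1, h2]

end TailOfPowers

/-! ### The stochastic volatility model -/

section StochasticVolatility

/-- The volatility field as a function of the noise field. -/
noncomputable def volatilityMap (ψ : ℤ × ℤ → ℝ) (x : ℤ × ℤ → ℝ) (q : ℤ × ℤ) : ℝ :=
  Real.exp (∑' p : ℤ × ℤ, ψ p * x (q.1 - p.1, q.2 - p.2))

theorem measurable_volatilityMap (ψ : ℤ × ℤ → ℝ) : Measurable (volatilityMap ψ) := by
  refine measurable_pi_lambda _ fun q => Real.measurable_exp.comp (Measurable.tsum fun p => ?_)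
  fun_prop

/-- The law of the process is determined by the laws of the noise fields. -/
theorem identDistrib_svProcess {Ω Ω' : Type*} [MeasurableSpace Ω] [MeasurableSpace Ω']
    {P : Measure Ω} {P' : Measure Ω'} [IsProbabilityMeasure P] [IsProbabilityMeasure P']
    (ψ : ℤ × ℤ → ℝ) {η Z : ℤ × ℤ → Ω → ℝ} {η' Z' : ℤ × ℤ → Ω' → ℝ}
    (hη : iIndepFun η P) (hη' : iIndepFun η' P') (hηid : ∀ p, IdentDistrib (η' p) (η p) P' P)
    (hZ : iIndepFun Z P) (hZ' : iIndepFun Z' P') (hZid : ∀ p, IdentDistrib (Z' p) (Z p) P' P)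
    (hZσ : IndepFun (fun ω (p : ℤ × ℤ) => Z p ω)
      (fun ω (p : ℤ × ℤ) => volatility ψ η p.1 p.2 ω) P)
    (hZσ' : IndepFun (fun ω (p : ℤ × ℤ) => Z' p ω)
      (fun ω (p : ℤ × ℤ) => volatility ψ η' p.1 p.2 ω) P') :
    IdentDistrib (fun ω (p : ℤ × ℤ) => svProcess ψ η' Z' p.1 p.2 ω)
      (fun ω (p : ℤ × ℤ) => svProcess ψ η Z p.1 p.2 ω) P' P := by
  have h1 := IdentDistrib.pi hηid hη' hη
  have h2 := IdentDistrib.pi hZid hZ' hZ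
  have h3 : IdentDistrib (fun ω (p : ℤ × ℤ) => volatility ψ η' p.1 p.2 ω)
      (fun ω (p : ℤ × ℤ) => volatility ψ η p.1 p.2 ω) P' P := h1.comp (measurable_volatilityMap ψ)
  have hm : Measurable fun (z : (ℤ × ℤ → ℝ) × (ℤ × ℤ → ℝ)) (p : ℤ × ℤ) => z.2 p * z.1 p := by
    fun_prop
  exact (h2.prodMk h3 hZσ' hZσ).comp hm

theorem volatility_shift {Ω : Type*} (ψ : ℤ × ℤ → ℝ) (η : ℤ × ℤ → Ω → ℝ) (s i t : ℤ) (ω : Ω) :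
    volatility ψ (fun p => η (p.1, p.2 + s)) i t ω = volatility ψ η i (t + s) ω := by
  simp only [volatility]
  congr 1
  refine tsum_congr fun p => ?_
  rw [show t - p.2 + s = t + s - p.2 by ring]

/-- The standing assumptions on the stochastic volatility model, with the tail of `e^η` stated as
`RegVarTail`. -/
structure SVModel {Ω : Type*} [MeasurableSpace Ω] (P : Measure Ω) (α δ : ℝ) (ψ : ℤ × ℤ → ℝ)
    (η Z : ℤ × ℤ → Ω → ℝ) : Prop where
  index_pos : 0 < α
  delta_pos : 0 < δ
  psi_nonneg : ∀ p, 0 ≤ ψ p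
  psi_le : ∀ p, ψ p ≤ 1
  psi_max : ∃ p, ψ p = 1
  psi_sum : Summable ψ
  measurable_noise : ∀ p, Measurable (η p)
  indep_noise : iIndepFun η P
  ident_noise : ∀ p, IdentDistrib (η p) (η (0, 0)) P P
  measurable_mult : ∀ p, Measurable (Z p)
  indep_mult : iIndepFun Z P
  ident_mult : ∀ p, IdentDistrib (Z p) (Z (0, 0)) P P
  summable : ∀ i t : ℤ, ∀ᵐ ω ∂P, Summable fun p : ℤ × ℤ => |ψ p * η (i - p.1, t - p.2) ω|
  indep_vol : IndepFun (fun ω (p : ℤ × ℤ) => Z p ω)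
    (fun ω (p : ℤ × ℤ) => volatility ψ η p.1 p.2 ω) P
  tail : RegVarTail α fun x => P.real {ω | x < Real.exp (η (0, 0) ω)}
  mult_ne : ¬ ∀ᵐ ω ∂P, Z (0, 0) ω = 0
  mult_mom : Integrable (fun ω => |Z (0, 0) ω| ^ (α + δ)) P
  dichotomy : InfiniteExpMoment P α (η (0, 0)) ∨ ConvolutionRatio P (η (0, 0)) (η (0, 1))

/-- A function `w` of a row of a field for which `w (σ z)` is `w z` times the exponential of a
series in the noise variables with weights `a t`, where `σ` is the volatility row at time `t`.
Coordinates and products of two coordinates are of this kind. -/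
structure RowProduct (ψ : ℤ × ℤ → ℝ) (a : ℤ → ℤ × ℤ → ℝ) (w : (ℤ → ℝ) → ℝ) : Prop where
  measurable : Measurable w
  nonneg : ∀ t p, 0 ≤ a t p
  summable : ∀ t, Summable (a t)
  shift : ∀ t p, a t p = a 0 (p.1, p.2 - t)
  summable_mul : ∀ t (x : ℤ × ℤ → ℝ),
    (∀ i : ℤ, Summable fun p : ℤ × ℤ => |ψ p * x (i - p.1, t - p.2)|) →
    Summable fun p => a t p * x p
  eq_exp_mul : ∀ t (x : ℤ × ℤ → ℝ) (z : ℤ → ℝ),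
    (∀ i : ℤ, Summable fun p : ℤ × ℤ => |ψ p * x (i - p.1, t - p.2)|) →
    w (fun i => volatilityMap ψ x (i, t) * z i) = Real.exp (∑' p, a t p * x p) * w z

namespace SVModel

variable {Ω : Type*} [MeasurableSpace Ω] {P : Measure Ω} [IsProbabilityMeasure P]
  {α δ : ℝ} {ψ : ℤ × ℤ → ℝ} {η Z : ℤ × ℤ → Ω → ℝ}

omit [IsProbabilityMeasure P] in
theorem measurable_coordinate (h : SVModel P α δ ψ η Z) (i t : ℤ) :
    Measurable (svProcess ψ η Z i t) := by
  refine Measurable.mul ?_ (h.measurable_mult (i, t))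
  refine Real.measurable_exp.comp (Measurable.tsum fun p => ?_)
  exact (h.measurable_noise _).const_mul _

theorem shift_injective (s : ℤ) :
    Function.Injective fun p : ℤ × ℤ => (p.1, p.2 + s) := fun p q hpq => by
  simp only [Prod.mk.injEq, add_left_inj] at hpq
  exact Prod.ext hpq.1 hpq.2

theorem identDistrib_shift (h : SVModel P α δ ψ η Z) (s : ℤ) :
    IdentDistrib (fun ω (p : ℤ × ℤ) => svProcess ψ η Z p.1 (p.2 + s) ω)
      (fun ω (p : ℤ × ℤ) => svProcess ψ η Z p.1 p.2 ω) P P := by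
  have hsh : Measurable fun (v : ℤ × ℤ → ℝ) (p : ℤ × ℤ) => v (p.1, p.2 + s) := by fun_prop
  have h1 := identDistrib_svProcess ψ (η' := fun p => η (p.1, p.2 + s))
    (Z' := fun p => Z (p.1, p.2 + s)) h.indep_noise (h.indep_noise.precomp (shift_injective s))
    (fun p => (h.ident_noise _).trans (h.ident_noise p).symm) h.indep_mult
    (h.indep_mult.precomp (shift_injective s))
    (fun p => (h.ident_mult _).trans (h.ident_mult p).symm) h.indep_vol
    (by
      simp only [volatility_shift]
      exact h.indep_vol.comp hsh hsh)
  simpa only [svProcess, volatility_shift] using h1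

theorem strictlyStationary (h : SVModel P α δ ψ η Z) {d : ℕ} {w : Fin d → (ℤ → ℝ) → ℝ}
    (hw : ∀ k, Measurable (w k)) :
    StrictlyStationary P fun t ω (k : Fin d) => w k fun i => svProcess ψ η Z i t ω := by
  intro s
  have hm : Measurable fun (v : ℤ × ℤ → ℝ) (t : ℤ) (k : Fin d) => w k fun i => v (i, t) := by
    refine measurable_pi_lambda _ fun t => measurable_pi_lambda _ fun k => (hw k).comp ?_
    fun_prop
  exact (h.identDistrib_shift s).comp hm

theorem row_injective (t : ℤ) : Function.Injective fun i : ℤ => (i, t) := fun i j hij => by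
  simpa using hij

/-- The stochastic volatility model has the law of a linear model in which the multipliers are
independent of the whole noise field, not only of the volatilities. The noise is multiplied by the
largest weight `κ` and the weights are divided by it, which turns the tail index `α` into `α / κ`
and makes the maximal weights equal to one. -/
theorem exists_linearModel (h : SVModel P α δ ψ η Z) {κ : ℝ} (hκ : 0 < κ) {d : ℕ}
    {a : Fin d → ℤ → ℤ × ℤ → ℝ} {w : Fin d → (ℤ → ℝ) → ℝ} (ha : ∀ k, RowProduct ψ (a k) (w k))
    (haκ : ∀ k p, a k 0 p ≤ κ)
    (hmom : ∀ k, Integrable (fun ω => |w k fun i => Z (i, 0) ω| ^ ((α + δ) / κ)) P) :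
    ∃ (Ω' : Type) (mW : MeasurableSpace Ω') (_ : MeasurableSpace Ω') (P' : Measure Ω')
      (ξ : ℤ × ℤ → Ω' → ℝ) (W : ℤ × Fin d → Ω' → ℝ) (Λ : ℤ × Fin d → Finset (ℤ × ℤ)) (G : ℝ → ℝ),
      IsProbabilityMeasure P' ∧
      LinearModel mW P' ξ (α / κ) ((α + δ) / κ) (fun q p => a q.2 q.1 p / κ) W Λ ∧
      RegVarTail (α / κ) G ∧ (∀ p x, P'.real {ω | x < expSum ξ {p} ω} = G x) ∧
      (InfiniteExpMoment P α (η (0, 0)) →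
        ∀ p, ∫⁻ ω, ENNReal.ofReal (expSum ξ {p} ω ^ (α / κ)) ∂P' = ⊤) ∧
      (ConvolutionRatio P (η (0, 0)) (η (0, 1)) →
        ∀ p q, p ≠ q → ConvolutionRatio P' (ξ p) (ξ q)) ∧
      (∀ q p, p ∈ Λ q ↔ a q.2 q.1 p = κ) ∧
      (∀ k, IdentDistrib (W (0, k)) (fun ω => w k fun i => Z (i, 0) ω) P' P) ∧
      IdentDistrib (linearValue ξ (fun q p => a q.2 q.1 p / κ) W)
        (fun ω (q : ℤ × Fin d) => w q.2 fun i => svProcess ψ η Z i q.1 ω) P' P := by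
  obtain ⟨Ω', mΩ', P', η', Z', hP', hη'm, hZ'm, hind, hηid, hZid⟩ :=
    exists_independent_copies (P := P) h.measurable_noise h.measurable_mult
  have hη'ind : iIndepFun η' P' := hind.precomp (g := Sum.inl) Sum.inl_injective
  have hZ'ind : iIndepFun Z' P' := hind.precomp (g := Sum.inr) Sum.inr_injective
  have hη'id : ∀ p q, IdentDistrib (η' p) (η' q) P' P' := fun p q =>
    (hηid p).trans ((h.ident_noise p).trans ((h.ident_noise q).symm.trans (hηid q).symm))
  have hη'0 : ∀ p, IdentDistrib (η' p) (η (0, 0)) P' P := fun p => (hηid p).trans (h.ident_noise p)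
  have hF := sourceField_of_iIndepFun hη'm hZ'm hη'id hind κ
  have hF1 := sourceField_of_iIndepFun hη'm hZ'm hη'id hind 1
  have hZσ' : IndepFun (fun ω (p : ℤ × ℤ) => Z' p ω)
      (fun ω (p : ℤ × ℤ) => volatility ψ η' p.1 p.2 ω) P' := by
    have h1 : IndepFun (fun ω (p : ℤ × ℤ) => 1 * η' p ω) (fun ω (p : ℤ × ℤ) => Z' p ω) P' := by
      refine hF1.indepFun (A := Set.univ) ?_ ?_
      · let := generatedBy (fun p ω => 1 * η' p ω) Set.univ
        exact measurable_pi_lambda _ fun p =>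
          measurable_generatedBy (ξ := fun p ω => 1 * η' p ω) (Set.mem_univ p)
      · refine Measurable.mono ?_ le_sup_right le_rfl
        let := generatedBy Z' Set.univ
        exact measurable_pi_lambda _ fun p => measurable_generatedBy (Set.mem_univ p)
    simp only [one_mul] at h1
    exact (h1.comp (measurable_volatilityMap ψ) measurable_id).symm
  have hsv := identDistrib_svProcess ψ h.indep_noise hη'ind hηid h.indep_mult hZ'ind hZid
    h.indep_vol hZσ'
  have hsum : ∀ᵐ ω ∂P', ∀ i t : ℤ, Summable fun p : ℤ × ℤ => |ψ p * η' (i - p.1, t - p.2) ω| := by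
    rw [ae_all_iff]
    intro i
    rw [ae_all_iff]
    intro t
    have hm : MeasurableSet {x : ℤ × ℤ → ℝ | Summable fun p => |ψ p * x (i - p.1, t - p.2)|} :=
      measurableSet_exists_tendsto (f := fun (s : Finset (ℤ × ℤ)) (x : ℤ × ℤ → ℝ) =>
        ∑ p ∈ s, |ψ p * x (i - p.1, t - p.2)|) (l := atTop) fun s => by fun_prop
    exact (IdentDistrib.pi hηid hη'ind h.indep_noise).symm.ae_snd hm (h.summable i t)
  have hrow : ∀ t, IdentDistrib (fun ω (i : ℤ) => Z' (i, t) ω) (fun ω (i : ℤ) => Z (i, 0) ω) P' P :=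
    fun t => IdentDistrib.pi (X := fun i => Z' (i, t)) (Y := fun i => Z (i, 0))
      (fun i => (hZid _).trans ((h.ident_mult _).trans (h.ident_mult _).symm))
      (hZ'ind.precomp (row_injective t)) (h.indep_mult.precomp (row_injective 0))
  set W : ℤ × Fin d → Ω' → ℝ := fun q ω => w q.2 fun i => Z' (i, q.1) ω with hW
  have hsumb : ∀ q : ℤ × Fin d, Summable fun p => a q.2 q.1 p / κ := fun q =>
    ((ha q.2).summable q.1).div_const κ
  have hfin : ∀ q : ℤ × Fin d, {p | a q.2 q.1 p = κ}.Finite := fun q => by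
    have h1 := (hsumb q).tendsto_cofinite_zero.eventually_lt_const one_pos
    refine (Filter.eventually_cofinite.1 h1).subset fun p hp => ?_
    have hp' : a q.2 q.1 p = κ := hp
    simp [hp', hκ.ne']
  have hξeq : ∀ (q : ℤ × Fin d) p ω, a q.2 q.1 p / κ * (κ * η' p ω) = a q.2 q.1 p * η' p ω :=
    fun q p ω => by field_simp
  have htail : ∀ p x, P'.real {ω | x < expSum (fun p ω => κ * η' p ω) {p} ω} =
      P.real {ω | x < Real.exp (κ * η (0, 0) ω)} := fun p x => by
    simp only [SourceField.expSum_singleton]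
    have := (hη'0 p).comp (by fun_prop : Measurable fun y : ℝ => Real.exp (κ * y))
    exact measureReal_eq_of_identDistrib this (D := Set.Ioi x) measurableSet_Ioi
  have hα := h.index_pos
  refine ⟨Ω', generatedBy Z' Set.univ, mΩ', P', fun p ω => κ * η' p ω, W,
    fun q => (hfin q).toFinset, fun x => P.real {ω | x < Real.exp (κ * η (0, 0) ω)}, hP', ?_,
    h.tail.exp_const_mul hκ, htail, fun hinf p => ?_, fun hconv p q hpq => ?_, ?_, ?_, ?_⟩
  · exact
      { field := hF
        nonneg := fun q p => div_nonneg ((ha q.2).nonneg _ _) hκ.le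
        le_one := fun q p => by
          rw [div_le_one hκ, (ha q.2).shift]
          exact haκ _ _
        summable_b := hsumb
        mem_iff := fun q p => by
          rw [Set.Finite.mem_toFinset, div_eq_one_iff_eq hκ.ne']
          rfl
        measurable_W := fun q => by
          let := generatedBy Z' Set.univ
          exact (ha q.2).measurable.comp (measurable_pi_lambda _ fun i =>
            measurable_generatedBy (ξ := Z') (Set.mem_univ (i, q.1)))
        index_pos := by positivity
        index_lt := by
          have := h.delta_pos
          gcongr
          linarith
        moment := fun q => by
          have h1 := (hrow q.1).comp (((ha q.2).measurable.abs).pow_const ((α + δ) / κ))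
          exact h1.integrable_iff.2 (hmom q.2)
        summable := fun q => by
          filter_upwards [hsum] with ω hω
          simp only [hξeq]
          exact (ha q.2).summable_mul q.1 (fun p => η' p ω) fun i => hω i q.1 }
  · rw [InfiniteExpMoment] at hinf
    rw [← hinf]
    have h1 := ((hη'0 p).comp (by fun_prop :
      Measurable fun y : ℝ => ENNReal.ofReal (Real.exp (α * y)))).lintegral_eq
    refine Eq.trans (lintegral_congr fun ω => ?_) h1
    simp only [SourceField.expSum_singleton, Function.comp_apply]
    rw [← Real.exp_mul]
    congr 2
    field_simp
  · exact hconv.of_identDistrib_const_mul (hη'0 p) ((hηid q).trans ((h.ident_noise q).trans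
      (h.ident_noise (0, 1)).symm)) (h.indep_noise.indepFun (by simp)) (hη'ind.indepFun hpq) hκ
  · intro q p
    rw [Set.Finite.mem_toFinset]
    rfl
  · exact fun k => (hrow 0).comp (ha k).measurable
  · have hm : Measurable fun (v : ℤ × ℤ → ℝ) (q : ℤ × Fin d) => w q.2 fun i => v (i, q.1) := by
      refine measurable_pi_lambda _ fun q => (ha q.2).measurable.comp ?_
      fun_prop
    refine IdentDistrib.trans (IdentDistrib.symm (IdentDistrib.of_ae_eq ?_ ?_)) (hsv.comp hm)
    · exact (hsv.comp hm).aemeasurable_fst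
    · filter_upwards [hsum] with ω hω
      funext q
      have h1 := (ha q.2).eq_exp_mul q.1 (fun p => η' p ω) (fun i => Z' (i, q.1) ω)
        fun i => hω i q.1
      simp only [linearValue, hξeq, Function.comp_apply]
      exact h1

theorem isRegVarSeq (h : SVModel P α δ ψ η Z) {κ : ℝ} (hκ : 0 < κ) {d : ℕ}
    {a : Fin d → ℤ → ℤ × ℤ → ℝ} {w : Fin d → (ℤ → ℝ) → ℝ} (ha : ∀ k, RowProduct ψ (a k) (w k))
    (haκ : ∀ k p, a k 0 p ≤ κ) (hmax : ∃ k p, a k 0 p = κ)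
    (hmom : ∀ k, Integrable (fun ω => |w k fun i => Z (i, 0) ω| ^ ((α + δ) / κ)) P)
    (hne : ∀ k, ¬ ∀ᵐ ω ∂P, (w k fun i => Z (i, 0) ω) = 0) :
    IsRegVarSeq P (α / κ) fun t ω (k : Fin d) => w k fun i => svProcess ψ η Z i t ω := by
  obtain ⟨Ω', mW, mΩ', P', ξ, W, Λ, G, hP', hLM, hG, hξG, hinf, hconv, hΛ, hW, hY⟩ :=
    h.exists_linearModel hκ ha haκ hmom
  refine hLM.isRegVarSeq_of_identDistrib hG hξG (h.dichotomy.imp hinf hconv) (fun t k p => ?_)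
    ?_ (fun k hk => hne k ?_) (h.strictlyStationary fun k => (ha k).measurable) hY
  · rw [hΛ, hΛ, (ha k).shift]
  · obtain ⟨k, p, hp⟩ := hmax
    exact ⟨k, p, (hΛ _ _).2 hp⟩
  · exact (hW k).ae_snd (p := fun x => x = 0) (measurableSet_singleton 0) hk

theorem spectral (h : SVModel P α δ ψ η Z) {κ : ℝ} (hκ : 0 < κ)
    {a : ℤ → ℤ × ℤ → ℝ} {w : (ℤ → ℝ) → ℝ} (ha : RowProduct ψ a w)
    (haκ : ∀ p, a 0 p ≤ κ) (hmax : ∃ p, a 0 p = κ)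
    (hmom : Integrable (fun ω => |w fun i => Z (i, 0) ω| ^ ((α + δ) / κ)) P)
    (hne : ¬ ∀ᵐ ω ∂P, (w fun i => Z (i, 0) ω) = 0) :
    (∃ ν, IsSpectralTailLaw P (α / κ) (fun t ω => w fun i => svProcess ψ η Z i t ω) ν) ∧
    ∀ ν, IsSpectralTailLaw P (α / κ) (fun t ω => w fun i => svProcess ψ η Z i t ω) ν →
      (InfiniteExpMoment P α (η (0, 0)) →
        (∀ t : ℕ, 1 ≤ t → ∀ᵐ θ ∂ν, θ t = 0) ∧
        ∀ ε : ℝ, |ε| = 1 → ν.real {θ | θ 0 = ε} =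
          (∫ ω, (max (ε * w fun i => Z (i, 0) ω) 0) ^ (α / κ) ∂P) /
            ∫ ω, |w fun i => Z (i, 0) ω| ^ (α / κ) ∂P) ∧
      (ConvolutionRatio P (η (0, 0)) (η (0, 1)) →
        ∀ (n : ℕ) (B : ℕ → Set ℝ), (∀ t, MeasurableSet (B t)) →
          ν.real {θ | ∀ t : ℕ, t ≤ n → θ t ∈ B t} =
            spectralMixture P (α / κ) (fun t => {p | a t p = κ})
              (fun t ω => w fun i => svProcess ψ η Z i t ω) n B) := by
  obtain ⟨Ω', mW, mΩ', P', ξ, W, Λ, G, hP', hLM, hG, hξG, hinf, hconv, hΛ, hW, hY⟩ :=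
    h.exists_linearModel (d := 1) (a := fun _ => a) (w := fun _ => w) hκ (fun _ => ha)
      (fun _ => haκ) fun _ => hmom
  have hYm : ∀ t, Measurable fun ω => w fun i => svProcess ψ η Z i t ω := fun t =>
    ha.measurable.comp (measurable_pi_lambda _ fun i => h.measurable_coordinate i t)
  obtain ⟨h1, h2⟩ := hLM.spectral_of_identDistrib hG hξG (h.dichotomy.imp hinf hconv)
    (fun t k p => by rw [hΛ, hΛ]; simp only; rw [ha.shift])
    (by obtain ⟨p, hp⟩ := hmax; exact ⟨p, (hΛ _ _).2 hp⟩)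
    (fun hk => hne ((hW 0).ae_snd (p := fun x => x = 0) (measurableSet_singleton 0) hk)) hYm hY
  refine ⟨h1, fun ν hν => ⟨fun hA => ?_, fun hB n B hBm => ?_⟩⟩
  · obtain ⟨h3, h4⟩ := (h2 ν hν).1 (hinf hA)
    refine ⟨h3, fun ε hε => ?_⟩
    rw [h4 ε hε]
    congr 1
    · exact ((hW 0).comp (by fun_prop : Measurable fun x : ℝ => (max (ε * x) 0) ^ (α / κ))).integral_eq
    · exact ((hW 0).comp (by fun_prop : Measurable fun x : ℝ => |x| ^ (α / κ))).integral_eq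
  · have hset : (fun t => (Λ (t, 0) : Set (ℤ × ℤ))) = fun t => {p | a t p = κ} := by
      funext t
      ext p
      exact hΛ (t, 0) p
    rw [(h2 ν hν).2 (hconv hB) n B hBm, hset]

end SVModel

end StochasticVolatility

/-! ### Coordinates and products of coordinates -/

section RowProducts

variable {ψ : ℤ × ℤ → ℝ}

/-- The reflection of the lattice about half of `(i, t)`. -/
def latticeReflection (i t : ℤ) : ℤ × ℤ ≃ ℤ × ℤ :=
  (Equiv.subLeft i).prodCongr (Equiv.subLeft t)

theorem latticeReflection_apply (i t : ℤ) (p : ℤ × ℤ) :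
    latticeReflection i t p = (i - p.1, t - p.2) := rfl

theorem summable_reflection (hψ : Summable ψ) (i t : ℤ) :
    Summable fun p : ℤ × ℤ => ψ (i - p.1, t - p.2) :=
  (latticeReflection i t).summable_iff.2 hψ

theorem hasSum_reflection_mul {x : ℤ × ℤ → ℝ} {i t : ℤ}
    (h : Summable fun p : ℤ × ℤ => |ψ p * x (i - p.1, t - p.2)|) :
    HasSum (fun p : ℤ × ℤ => ψ (i - p.1, t - p.2) * x p)
      (∑' p : ℤ × ℤ, ψ p * x (i - p.1, t - p.2)) := by
  have h1 := (latticeReflection i t).hasSum_iff.2 h.of_abs.hasSum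
  refine h1.congr_fun fun p => ?_
  simp [latticeReflection_apply]

/-- A coordinate `i` of the row has the weights of the moving average, reflected about `(i, t)`. -/
theorem rowProduct_coordinate (hψ0 : ∀ p, 0 ≤ ψ p) (hψ : Summable ψ) (i : ℤ) :
    RowProduct ψ (fun t p => ψ (i - p.1, t - p.2)) fun y => y i where
  measurable := measurable_pi_apply i
  nonneg t p := hψ0 _
  summable t := summable_reflection hψ i t
  shift t p := by
    rw [show t - p.2 = 0 - (p.2 - t) by ring]
  summable_mul t x hx := (hasSum_reflection_mul (hx i)).summable
  eq_exp_mul t x z hx := by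
    rw [(hasSum_reflection_mul (hx i)).tsum_eq]
    rfl

/-- The weights of a product are the sums of the weights. -/
theorem RowProduct.mul {a b : ℤ → ℤ × ℤ → ℝ} {v w : (ℤ → ℝ) → ℝ} (hv : RowProduct ψ a v)
    (hw : RowProduct ψ b w) : RowProduct ψ (fun t p => a t p + b t p) fun y => v y * w y where
  measurable := hv.measurable.mul hw.measurable
  nonneg t p := add_nonneg (hv.nonneg t p) (hw.nonneg t p)
  summable t := (hv.summable t).add (hw.summable t)
  shift t p := by rw [hv.shift, hw.shift]
  summable_mul t x hx := by
    simp only [add_mul]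
    exact (hv.summable_mul t x hx).add (hw.summable_mul t x hx)
  eq_exp_mul t x z hx := by
    simp only [add_mul]
    rw [(hv.summable_mul t x hx).tsum_add (hw.summable_mul t x hx), Real.exp_add,
      hv.eq_exp_mul t x z hx, hw.eq_exp_mul t x z hx]
    ring

end RowProducts

/-! ### The maximal weights of a product -/

section MaximalWeights

variable {ψ : ℤ × ℤ → ℝ}

/-- A family that tends to zero and has a positive member attains its supremum. -/
theorem exists_eq_iSup_of_tendsto_zero {I : Type*} {f : I → ℝ} (hf : Tendsto f cofinite (𝓝 0))
    {q : I} (hq : 0 < f q) : ∃ p, (∀ r, f r ≤ f p) ∧ ⨆ r, f r = f p := by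
  have hfin : {r | f q ≤ f r}.Finite := by
    refine (Filter.eventually_cofinite.1 (hf.eventually_lt_const hq)).subset fun r hr => ?_
    exact not_lt.2 hr
  obtain ⟨p, hp, hmax⟩ := hfin.exists_maximalFor f _ ⟨q, le_refl (f q)⟩
  have hle : ∀ r, f r ≤ f p := fun r => by
    by_contra hlt
    have hlt' := not_le.1 hlt
    exact hlt (hmax (show f q ≤ f r from le_trans hp hlt'.le) hlt'.le)
  have : Nonempty I := ⟨q⟩
  exact ⟨p, hle, le_antisymm (ciSup_le hle) (le_ciSup ⟨f p, by rintro _ ⟨r, rfl⟩; exact hle r⟩ p)⟩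

/-- The supremum `psiPair ψ i j` is attained by the weights of the product of the coordinates `i` and
`j` at time zero. It is at least one, as one of the two summands may be placed at a maximum of
`ψ`. -/
theorem psiPair_attained (hψ0 : ∀ p, 0 ≤ ψ p) (hψ : Summable ψ) (hmax : ∃ p, ψ p = 1) (i j : ℤ) :
    ∃ p : ℤ × ℤ, (∀ r : ℤ × ℤ, ψ (i - r.1, 0 - r.2) + ψ (j - r.1, 0 - r.2) ≤ psiPair ψ i j) ∧
      ψ (i - p.1, 0 - p.2) + ψ (j - p.1, 0 - p.2) = psiPair ψ i j ∧ 1 ≤ psiPair ψ i j := by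
  set f : ℤ × ℤ → ℝ := fun r => ψ (i - r.1, 0 - r.2) + ψ (j - r.1, 0 - r.2) with hf
  have hsum : Summable f := (summable_reflection hψ i 0).add (summable_reflection hψ j 0)
  obtain ⟨p₀, hp₀⟩ := hmax
  have h1 : 1 ≤ f (latticeReflection i 0 p₀) := by
    have : f (latticeReflection i 0 p₀) = ψ p₀ + ψ (j - (i - p₀.1), 0 - (0 - p₀.2)) := by
      simp [hf, latticeReflection_apply]
    rw [this, hp₀]
    linarith [hψ0 (j - (i - p₀.1), 0 - (0 - p₀.2))]
  obtain ⟨p, hle, hp⟩ := exists_eq_iSup_of_tendsto_zero hsum.tendsto_cofinite_zero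
    (one_pos.trans_le h1)
  have hpair : psiPair ψ i j = ⨆ r, f r := by
    rw [psiPair]
    refine Equiv.iSup_congr (latticeReflection j 0) fun r => ?_
    simp only [hf, latticeReflection_apply, sub_sub_cancel, zero_sub, neg_neg]
    rw [add_comm, show r.1 + i - j = i - (j - r.1) by ring]
  rw [hpair, hp]
  exact ⟨p, hle, rfl, h1.trans (hle _)⟩

theorem two_le_psiPair_self (hψ0 : ∀ p, 0 ≤ ψ p) (hψ : Summable ψ) (hmax : ∃ p, ψ p = 1) (i : ℤ) :
    2 ≤ psiPair ψ i i := by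
  obtain ⟨p, hle, -, -⟩ := psiPair_attained hψ0 hψ hmax i i
  obtain ⟨p₀, hp₀⟩ := hmax
  have h1 := hle (latticeReflection i 0 p₀)
  simp only [latticeReflection_apply, sub_sub_cancel, hp₀] at h1
  linarith

end MaximalWeights

/-! ### Multipliers of products of coordinates -/

namespace SVModel

variable {Ω : Type*} [MeasurableSpace Ω] {P : Measure Ω} [IsProbabilityMeasure P]
  {α δ : ℝ} {ψ : ℤ × ℤ → ℝ} {η Z : ℤ × ℤ → Ω → ℝ}

theorem integrable_mult_rpow (h : SVModel P α δ ψ η Z) (p : ℤ × ℤ) {β : ℝ} (hβ : 0 ≤ β)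
    (hβα : β ≤ α + δ) : Integrable (fun ω => |Z p ω| ^ β) P := by
  have h0 : Integrable (fun ω => |Z p ω| ^ (α + δ)) P :=
    ((h.ident_mult p).comp (by fun_prop : Measurable fun x : ℝ => |x| ^ (α + δ))).integrable_iff.2
      h.mult_mom
  exact integrable_abs_rpow_of_le (h.measurable_mult p) hβ hβα h0

omit [IsProbabilityMeasure P] in
theorem mult_ne_zero (h : SVModel P α δ ψ η Z) (p : ℤ × ℤ) : ¬ ∀ᵐ ω ∂P, Z p ω = 0 := fun hp =>
  h.mult_ne ((h.ident_mult p).ae_snd (p := fun x => x = 0) (measurableSet_singleton 0) hp)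

/-- The multiplier of a product of two coordinates has a moment of order above the tail index of the
product. For `i ≠ j` the two factors are independent; for `i = j` the multiplier is a square, but then
`psiPair ψ i i ≥ 2`. -/
theorem integrable_mult_mul_rpow (h : SVModel P α δ ψ η Z) (i j : ℤ) {κ : ℝ}
    (hκ : psiPair ψ i j ≤ κ) :
    Integrable (fun ω => |Z (i, 0) ω * Z (j, 0) ω| ^ ((α + δ) / κ)) P := by
  have hα := h.index_pos
  have hδ := h.delta_pos
  obtain ⟨-, -, -, h1⟩ := psiPair_attained h.psi_nonneg h.psi_sum h.psi_max i j
  have hκ1 : 1 ≤ κ := h1.trans hκ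
  have hκ0 : 0 < κ := one_pos.trans_le hκ1
  simp only [abs_mul]
  by_cases hij : i = j
  · subst hij
    have h2 : 2 ≤ κ := (two_le_psiPair_self h.psi_nonneg h.psi_sum h.psi_max i).trans hκ
    have hle : 2 * ((α + δ) / κ) ≤ α + δ := by
      rw [← mul_div_assoc, div_le_iff₀ hκ0]
      nlinarith
    refine (h.integrable_mult_rpow (i, 0) (by positivity) hle).congr (ae_of_all _ fun ω => ?_)
    beta_reduce
    rw [Real.rpow_mul (abs_nonneg _), Real.rpow_two, sq]
  · have hle : (α + δ) / κ ≤ α + δ := div_le_self (by positivity) hκ1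
    have hm : Measurable fun x : ℝ => |x| ^ ((α + δ) / κ) := by fun_prop
    have hind := (h.indep_mult.indepFun (by simpa using hij : ((i, 0) : ℤ × ℤ) ≠ (j, 0))).comp hm hm
    refine (hind.integrable_mul (h.integrable_mult_rpow (i, 0) (by positivity) hle)
      (h.integrable_mult_rpow (j, 0) (by positivity) hle)).congr (ae_of_all _ fun ω => ?_)
    simp only [Pi.mul_apply, Function.comp_apply]
    rw [Real.mul_rpow (abs_nonneg _) (abs_nonneg _)]

theorem mult_mul_ne_zero (h : SVModel P α δ ψ η Z) (i j : ℤ) :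
    ¬ ∀ᵐ ω ∂P, Z (i, 0) ω * Z (j, 0) ω = 0 := by
  intro h0
  by_cases hij : i = j
  · subst hij
    exact h.mult_ne_zero (i, 0) (h0.mono fun ω hω => by simpa using hω)
  · have hind := h.indep_mult.indepFun (by simpa using hij : ((i, 0) : ℤ × ℤ) ≠ (j, 0))
    have hS : MeasurableSet ({0}ᶜ : Set ℝ) := (measurableSet_singleton 0).compl
    have h1 := hind.measure_inter_preimage_eq_mul _ _ hS hS
    have h2 : P (Z (i, 0) ⁻¹' {0}ᶜ ∩ Z (j, 0) ⁻¹' {0}ᶜ) = 0 := by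
      refine measure_mono_null (fun ω hω => ?_) (ae_iff.1 h0)
      exact mul_ne_zero hω.1 hω.2
    rw [h2] at h1
    rcases mul_eq_zero.1 h1.symm with h3 | h3
    · exact h.mult_ne_zero (i, 0) (ae_iff.2 h3)
    · exact h.mult_ne_zero (j, 0) (ae_iff.2 h3)

omit [IsProbabilityMeasure P] in
theorem rowProduct_pair (h : SVModel P α δ ψ η Z) (i j : ℤ) :
    RowProduct ψ (fun t p => ψ (i - p.1, t - p.2) + ψ (j - p.1, t - p.2)) fun y => y i * y j :=
  (rowProduct_coordinate h.psi_nonneg h.psi_sum i).mul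
    (rowProduct_coordinate h.psi_nonneg h.psi_sum j)

end SVModel

theorem proposition4p4
    {Ω : Type*} [MeasurableSpace Ω] (P : Measure Ω) [IsProbabilityMeasure P]
    (α δ : ℝ) (hα : 0 < α) (hδ : 0 < δ)
    (ψ : ℤ × ℤ → ℝ) (η Z : ℤ × ℤ → Ω → ℝ)
    -- the coefficients
    (hψ_nonneg : ∀ p, 0 ≤ ψ p) (hψ_le : ∀ p, ψ p ≤ 1) (hψ_max : ∃ p, ψ p = 1)
    (hψ_sum : Summable ψ)
    -- the iid fields
    (hη_meas : ∀ p, Measurable (η p)) (hη_indep : iIndepFun η P)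
    (hη_ident : ∀ p, IdentDistrib (η p) (η (0, 0)) P P)
    (hZ_meas : ∀ p, Measurable (Z p)) (hZ_indep : iIndepFun Z P)
    (hZ_ident : ∀ p, IdentDistrib (Z p) (Z (0, 0)) P P)
    -- the series that defines the log-volatility converges absolutely
    (hη_sum : ∀ i t : ℤ, ∀ᵐ ω ∂P, Summable fun p : ℤ × ℤ => |ψ p * η (i - p.1, t - p.2) ω|)
    -- the field `Z` is independent of the volatility field
    (hZσ : IndepFun (fun ω (p : ℤ × ℤ) => Z p ω)
      (fun ω (p : ℤ × ℤ) => volatility ψ η p.1 p.2 ω) P)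
    -- `P (e^η > x) = x^{-α} L x` with `L` slowly varying
    (hη_tail : ∃ L : ℝ → ℝ, SlowlyVarying L ∧
      ∀ x : ℝ, 0 < x → P.real {ω | x < Real.exp (η (0, 0) ω)} = x ^ (-α) * L x)
    -- `Z` is not identically zero and has a moment of order `α + δ`
    (hZ_ne : ¬ (∀ᵐ ω ∂P, Z (0, 0) ω = 0))
    (hZ_mom : Integrable (fun ω => |Z (0, 0) ω| ^ (α + δ)) P)
    -- the two alternatives for `η`
    (h_alt : InfiniteExpMoment P α (η (0, 0)) ∨ ConvolutionRatio P (η (0, 0)) (η (0, 1))) :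
    -- (1)
    (∀ i : ℤ,
      IsRegVarSeqReal P α (svProcess ψ η Z i) ∧
      (∃ ν, IsSpectralTailLaw P α (svProcess ψ η Z i) ν) ∧
      ∀ ν, IsSpectralTailLaw P α (svProcess ψ η Z i) ν →
        (InfiniteExpMoment P α (η (0, 0)) →
          (∀ t : ℕ, 1 ≤ t → ∀ᵐ θ ∂ν, θ t = 0) ∧
          ν.real {θ | θ 0 = 1} =
            (∫ ω, (max (Z (0, 0) ω) 0) ^ α ∂P) / ∫ ω, |Z (0, 0) ω| ^ α ∂P ∧
          ν.real {θ | θ 0 = -1} =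
            (∫ ω, (max (-Z (0, 0) ω) 0) ^ α ∂P) / ∫ ω, |Z (0, 0) ω| ^ α ∂P) ∧
        (ConvolutionRatio P (η (0, 0)) (η (0, 1)) →
          ∀ (n : ℕ) (B : ℕ → Set ℝ), (∀ t, MeasurableSet (B t)) →
            ν.real {θ | ∀ t : ℕ, t ≤ n → θ t ∈ B t} =
              spectralMixture P α (maxSet ψ i) (svProcess ψ η Z i) n B)) ∧
    -- (2)
    (∀ i j : ℤ,
      IsRegVarSeqReal P (α / psiPair ψ i j)
        (fun t ω => svProcess ψ η Z i t ω * svProcess ψ η Z j t ω) ∧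
      (∃ ν, IsSpectralTailLaw P (α / psiPair ψ i j)
        (fun t ω => svProcess ψ η Z i t ω * svProcess ψ η Z j t ω) ν) ∧
      ∀ ν, IsSpectralTailLaw P (α / psiPair ψ i j)
          (fun t ω => svProcess ψ η Z i t ω * svProcess ψ η Z j t ω) ν →
        (InfiniteExpMoment P α (η (0, 0)) →
          (∀ t : ℕ, 1 ≤ t → ∀ᵐ θ ∂ν, θ t = 0) ∧
          ν.real {θ | θ 0 = 1} =
            (∫ ω, (max (Z (i, 0) ω * Z (j, 0) ω) 0) ^ (α / psiPair ψ i j) ∂P) /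
              ∫ ω, |Z (i, 0) ω * Z (j, 0) ω| ^ (α / psiPair ψ i j) ∂P ∧
          ν.real {θ | θ 0 = -1} =
            (∫ ω, (max (-(Z (i, 0) ω * Z (j, 0) ω)) 0) ^ (α / psiPair ψ i j) ∂P) /
              ∫ ω, |Z (i, 0) ω * Z (j, 0) ω| ^ (α / psiPair ψ i j) ∂P) ∧
        (ConvolutionRatio P (η (0, 0)) (η (0, 1)) →
          ∀ (n : ℕ) (B : ℕ → Set ℝ), (∀ t, MeasurableSet (B t)) →
            ν.real {θ | ∀ t : ℕ, t ≤ n → θ t ∈ B t} =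
              spectralMixture P (α / psiPair ψ i j) (maxSetPair ψ i j)
                (fun t ω => svProcess ψ η Z i t ω * svProcess ψ η Z j t ω) n B)) ∧
    -- (3)
    (∀ (d : ℕ), 1 ≤ d → ∀ i j : Fin d → ℤ,
      IsRegVarSeq P (α / psiMulti ψ i j)
        (fun t ω (k : Fin d) => svProcess ψ η Z (i k) t ω * svProcess ψ η Z (j k) t ω)) := by
  obtain ⟨L, hL, hLtail⟩ := hη_tail
  have h : SVModel P α δ ψ η Z :=
    { index_pos := hα
      delta_pos := hδ
      psi_nonneg := hψ_nonneg
      psi_le := hψ_le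
      psi_max := hψ_max
      psi_sum := hψ_sum
      measurable_noise := hη_meas
      indep_noise := hη_indep
      ident_noise := hη_ident
      measurable_mult := hZ_meas
      indep_mult := hZ_indep
      ident_mult := hZ_ident
      summable := hη_sum
      indep_vol := hZσ
      tail := regVarTail_of_slowlyVarying hL hLtail
      mult_ne := hZ_ne
      mult_mom := hZ_mom
      dichotomy := h_alt }
  refine ⟨fun i => ?_, fun i j => ?_, fun d hd i j => ?_⟩
  · have hrow := rowProduct_coordinate hψ_nonneg hψ_sum i
    have hmax : ∃ p : ℤ × ℤ, ψ (i - p.1, 0 - p.2) = 1 := by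
      obtain ⟨p, hp⟩ := hψ_max
      exact ⟨latticeReflection i 0 p, by simpa [latticeReflection_apply] using hp⟩
    have hmom : Integrable (fun ω => |Z (i, 0) ω| ^ ((α + δ) / 1)) P :=
      h.integrable_mult_rpow (i, 0) (by positivity) (by rw [div_one])
    have h1 := h.isRegVarSeq (d := 1) one_pos (fun _ => hrow) (fun _ _ => h.psi_le _)
      ⟨0, hmax⟩ (fun _ => hmom) fun _ => h.mult_ne_zero (i, 0)
    have h2 := h.spectral one_pos hrow (fun _ => h.psi_le _) hmax hmom (h.mult_ne_zero (i, 0))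
    rw [div_one] at h1 h2
    refine ⟨h1, h2.1, fun ν hν => ⟨fun hA => ?_, (h2.2 ν hν).2⟩⟩
    obtain ⟨h3, h4⟩ := (h2.2 ν hν).1 hA
    have habs : ∫ ω, |Z (i, 0) ω| ^ α ∂P = ∫ ω, |Z (0, 0) ω| ^ α ∂P :=
      ((hZ_ident (i, 0)).comp (by fun_prop : Measurable fun x : ℝ => |x| ^ α)).integral_eq
    have hpart : ∀ ε : ℝ, ∫ ω, (max (ε * Z (i, 0) ω) 0) ^ α ∂P =
        ∫ ω, (max (ε * Z (0, 0) ω) 0) ^ α ∂P := fun ε =>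
      ((hZ_ident (i, 0)).comp
        (by fun_prop : Measurable fun x : ℝ => (max (ε * x) 0) ^ α)).integral_eq
    have h5 := h4 1 (by simp)
    have h6 := h4 (-1) (by simp)
    rw [habs, hpart] at h5 h6
    simp only [one_mul, neg_one_mul] at h5 h6
    exact ⟨h3, h5, h6⟩
  · obtain ⟨p, hle, hp, h1⟩ := psiPair_attained hψ_nonneg hψ_sum hψ_max i j
    have hκ : 0 < psiPair ψ i j := one_pos.trans_le h1
    have hmom := h.integrable_mult_mul_rpow i j le_rfl
    have h2 := h.spectral hκ (h.rowProduct_pair i j) hle ⟨p, hp⟩ hmom (h.mult_mul_ne_zero i j)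
    refine ⟨h.isRegVarSeq (d := 1) hκ (fun _ => h.rowProduct_pair i j) (fun _ => hle) ⟨0, p, hp⟩
      (fun _ => hmom) fun _ => h.mult_mul_ne_zero i j, h2.1,
      fun ν hν => ⟨fun hA => ?_, (h2.2 ν hν).2⟩⟩
    obtain ⟨h3, h4⟩ := (h2.2 ν hν).1 hA
    have h5 := h4 1 (by simp)
    have h6 := h4 (-1) (by simp)
    simp only [one_mul, neg_one_mul] at h5 h6
    exact ⟨h3, h5, h6⟩
  · have : Nonempty (Fin d) := ⟨⟨0, hd⟩⟩
    have hle : ∀ k, psiPair ψ (i k) (j k) ≤ psiMulti ψ i j := fun k =>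
      le_ciSup (f := fun k => psiPair ψ (i k) (j k)) (Set.finite_range _).bddAbove k
    obtain ⟨k, hk⟩ := exists_eq_ciSup_of_finite (f := fun k => psiPair ψ (i k) (j k))
    obtain ⟨p, -, hp, h1⟩ := psiPair_attained hψ_nonneg hψ_sum hψ_max (i k) (j k)
    exact h.isRegVarSeq (one_pos.trans_le (h1.trans (hle k)))
      (fun k => h.rowProduct_pair (i k) (j k))
      (fun k r => ((psiPair_attained hψ_nonneg hψ_sum hψ_max (i k) (j k)).choose_spec.1 r).trans
        (hle k))
      ⟨k, p, hp.trans hk⟩ (fun k => h.integrable_mult_mul_rpow (i k) (j k) (hle k))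
      fun k => h.mult_mul_ne_zero (i k) (j k)
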